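/- **Conventions.** Manifolds are smooth, finite dimensional, second countable, Hausdorff and oriented, of one fixed dimension $d\ge 0$ (an orientation of a $0$-manifold is a sign at each point), and without boundary unless it is said otherwise; all local diffeomorphisms preserve orientation. An *sse groupoid* $\mathcal X$ is a small category with all morphisms invertible whose objects and morphisms form manifolds $X_0$, $X_1$, all of whose structure maps (source $s$, target $t$, identity, inverse, composition) are local diffeomorphisms, and whose stabilizers $G_x=\mathrm{Mor}(x,x)$ are finite. It is *nonsingular* if all $G_x$ are trivial, and an *ep groupoid* if moreover $s\times t:X_1\to X_0\times X_0$ is proper. Its *orbit space* $|X|$ is the quotient of $X_0$ by the relation $x\sim y\iff \mathrm{Mor}(x,y)\neq\emptyset$; $|X|_H$ is the maximal Hausdorff quotient of $|X|$ (so $|X|_H=|X|$ for an ep groupoid), and $\pi_H:X_0\to|X|_H$, $|\pi|_H:|X|\to|X|_H$ are the projections. A point $p\in|X|$ of an ep groupoid is *smooth* if for all $x\in X_0$ over $p$ each $\gamma\in G_x$ acts trivially near $x$, i.e. $s=t$ near $\gamma$. Functors are smooth on objects and on morphisms; a functor $F:\mathcal X\to\mathcal Y$ induces $|F|:|X|\to|Y|$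 and $|F|_H:|X|_H\to|Y|_H$. A *wnb (weighted nonsingular branched) groupoid* $(\mathcal B,\Lambda)$ is a nonsingular sse groupoid $\mathcal B$ with a function $\Lambda:|B|_H\to(0,\infty)$ such that each $p\in|B|_H$ has an open neighbourhood $N$, finitely many pairwise disjoint open sets $U_1,\dots,U_\ell\subset\pi_H^{-1}(N)$ and numbers $m_1,\dots,m_\ell>0$ with: $|\pi|_H^{-1}(N)$ is the union of the images of the $U_i$ in $|B|$; each $\pi_H:U_i\to\pi_H(U_i)$ is a homeomorphism onto a relatively closed subset of $N$; and $\Lambda(q)=\sum_{i:\,q\in\pi_H(U_i)}m_i$ for all $q\in N$. It is *compact* if $|B|_H$ is compact. The same definition makes sense for manifolds with boundary. A *layered covering* $F:(\mathcal B',\Lambda')\to(\mathcal B,\Lambda)$ of wnb groupoids is a functor that is a local diffeomorphism on objects, with $|F|:|B'|\to|B|$ surjective, $|F|_H$ proper, and $\sum_{q\in|F|_H^{-1}(p)}\Lambda'(q)=\Lambda(p)$ for all $p\in|B|_H$. Two wnb groupoids are *commensurate* if they have a common layered covering. Two compact wnb groupoids $(\mathcal A,\Lambda_A)$, $(\mathcal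 C,\Lambda_C)$ of dimension $d$ are *cobordant* if there is a compact $(d+1)$-dimensional wnb groupoid $(\mathcal W,\Lambda_W)$ with boundary whose oriented boundary groupoid (objects $\partial W_0$, morphisms $\partial W_1$) is $(-\mathcal A)\sqcup\mathcal C$, such that $|A|_H\sqcup|C|_H\to|W|_H$ is an embedding and $\Lambda_W$ restricts to $\Lambda_A$ and $\Lambda_C$. A *resolution* of an ep groupoid $\mathcal X$ is a functor $F:(\mathcal B,\Lambda)\to\mathcal X$ from a wnb groupoid such that $F$ is a local diffeomorphism on objects, the induced map $|F|_H:|B|_H\to|X|$ is proper, and $\sum_{q\in|F|_H^{-1}(p)}\Lambda(q)=1$ for every smooth point $p\in|X|$. **Proposition.** Let $\mathcal X$ be an ep groupoid. Then $\mathcal X$ has a resolution. If $F:(\mathcal A,\Lambda_A)\to\mathcal X$ and $G:(\mathcal C,\Lambda_C)\to\mathcal X$ are any two resolutions of $\mathcal X$, then $(\mathcal A,\Lambda_A)$ and $(\mathcal C,\Lambda_C)$ are commensurate; if moreover $|X|$ is compact, then $(\mathcal A,\Lambda_A)$ and $(\mathcal C,\Lambda_C)$ are compact and cobordant. -/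

import Mathlib

open scoped Manifold ContDiff Topology

universe u

namespace BranchedResolution

/-! ### Oriented manifolds -/

/-- The family `v` of `n` vectors is a positively oriented basis of the vector space `V`, oriented
by `o`. For `n = 0` the orientation `o` is a sign, and the empty basis is positively oriented
exactly if this sign is `+`. -/
def IsPositive {n : ℕ} {V : Type*} [AddCommGroup V] [Module ℝ V]
    (o : Orientation ℝ V (Fin n)) (v : Fin n → V) : Prop :=
  ∃ b : Module.Basis (Fin n) ℝ V, ⇑b = v ∧ b.orientation = o

/-- An oriented smooth `n`-dimensional second countable Hausdorff manifold with model `I`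
(`I = 𝓡 n`: without boundary; `I = 𝓡∂ n`: with boundary). The orientation is a choice of an
orientation of every tangent space that is locally constant in charts. -/
structure OrientedManifold {n : ℕ} {H : Type} [TopologicalSpace H]
    (I : ModelWithCorners ℝ (EuclideanSpace ℝ (Fin n)) H) : Type (u + 1) where
  carrier : Type u
  [topology : TopologicalSpace carrier]
  [charted : ChartedSpace H carrier]
  [smooth : IsManifold I ∞ carrier]
  [hausdorff : T2Space carrier]
  [secondCountable : SecondCountableTopology carrier]
  orient : ∀ x : carrier, Orientation ℝ (TangentSpace I x) (Fin n)
  orient_locallyConstant : ∀ x₀ : carrier, ∃ o₀ : Orientation ℝ (EuclideanSpace ℝ (Fin n)) (Fin n),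
    ∀ᶠ x in 𝓝 x₀, ∀ v : Fin n → TangentSpace I x,
      IsPositive (orient x) v ↔
        IsPositive o₀ (fun i => mfderiv I 𝓘(ℝ, EuclideanSpace ℝ (Fin n)) (extChartAt I x₀) x (v i))

namespace OrientedManifold

variable {n : ℕ} {H : Type} [TopologicalSpace H]
  {I : ModelWithCorners ℝ (EuclideanSpace ℝ (Fin n)) H}

instance : CoeSort (OrientedManifold.{u} I) (Type u) := ⟨carrier⟩

attribute [instance] topology charted smooth hausdorff secondCountable

end OrientedManifold

/-- `f` is an orientation preserving local diffeomorphism. -/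
structure IsOrientedLocalDiffeo {n : ℕ} {H : Type} [TopologicalSpace H]
    {I : ModelWithCorners ℝ (EuclideanSpace ℝ (Fin n)) H}
    (M N : OrientedManifold.{u} I) (f : M → N) : Prop where
  isLocalDiffeomorph : IsLocalDiffeomorph I I ∞ f
  preserves : ∀ (x : M) (v : Fin n → TangentSpace I x),
    IsPositive (M.orient x) v ↔ IsPositive (N.orient (f x)) (fun i => mfderiv I I f x (v i))

/-! ### Groupoids -/

/-- An oriented sse (smooth, stable, étale) groupoid, in the category of oriented manifolds with
model `I`. The composite `comp δ γ` is "`δ` after `γ`".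

The fibre product `{(δ, γ) | src δ = tgt γ}` is étale over `Mor` through its second projection,
because `src` is a local diffeomorphism, and this defines its smooth structure and its orientation.
As `src (comp δ γ) = src γ` and `src` is étale, the composition is an oriented local diffeomorphism
as soon as it is continuous, so continuity is all that `continuous_comp` has to ask for. -/
structure SseGroupoid {n : ℕ} {H : Type} [TopologicalSpace H]
    (I : ModelWithCorners ℝ (EuclideanSpace ℝ (Fin n)) H) : Type (u + 1) where
  Obj : OrientedManifold.{u} I
  Mor : OrientedManifold.{u} I
  src : Mor → Obj
  tgt : Mor → Obj
  one : Obj → Mor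
  inv : Mor → Mor
  comp : (δ γ : Mor) → src δ = tgt γ → Mor
  src_one : ∀ x, src (one x) = x
  tgt_one : ∀ x, tgt (one x) = x
  src_inv : ∀ γ, src (inv γ) = tgt γ
  tgt_inv : ∀ γ, tgt (inv γ) = src γ
  src_comp : ∀ δ γ h, src (comp δ γ h) = src γ
  tgt_comp : ∀ δ γ h, tgt (comp δ γ h) = tgt δ
  one_comp : ∀ γ, comp (one (tgt γ)) γ (src_one _) = γ
  comp_one : ∀ γ, comp γ (one (src γ)) (tgt_one _).symm = γ
  inv_comp : ∀ γ, comp (inv γ) γ (src_inv γ) = one (src γ)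
  comp_inv : ∀ γ, comp γ (inv γ) (tgt_inv γ).symm = one (tgt γ)
  assoc : ∀ (ε δ γ : Mor) (h₁ : src ε = tgt δ) (h₂ : src δ = tgt γ),
    comp (comp ε δ h₁) γ ((src_comp ε δ h₁).trans h₂) =
      comp ε (comp δ γ h₂) (h₁.trans (tgt_comp δ γ h₂).symm)
  src_localDiffeo : IsOrientedLocalDiffeo Mor Obj src
  tgt_localDiffeo : IsOrientedLocalDiffeo Mor Obj tgt
  one_localDiffeo : IsOrientedLocalDiffeo Obj Mor one
  inv_localDiffeo : IsOrientedLocalDiffeo Mor Mor inv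
  continuous_comp :
    Continuous fun p : {p : Mor × Mor // src p.1 = tgt p.2} => comp p.1.1 p.1.2 p.2
  stable : ∀ x : Obj, {γ : Mor | src γ = x ∧ tgt γ = x}.Finite

namespace SseGroupoid

variable {n : ℕ} {H : Type} [TopologicalSpace H]
  {I : ModelWithCorners ℝ (EuclideanSpace ℝ (Fin n)) H}

/-- Objects are equivalent if there is a morphism between them. -/
def setoid (X : SseGroupoid.{u} I) : Setoid X.Obj where
  r x y := ∃ γ : X.Mor, X.src γ = x ∧ X.tgt γ = y
  iseqv :=
    { refl := fun x => ⟨X.one x, X.src_one x, X.tgt_one x⟩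
      symm := by
        rintro x y ⟨γ, h₁, h₂⟩
        exact ⟨X.inv γ, (X.src_inv γ).trans h₂, (X.tgt_inv γ).trans h₁⟩
      trans := by
        rintro x y z ⟨γ, h₁, h₂⟩ ⟨δ, h₃, h₄⟩
        exact ⟨X.comp δ γ (h₃.trans h₂.symm), (X.src_comp _ _ _).trans h₁,
          (X.tgt_comp _ _ _).trans h₄⟩ }

/-- The orbit space `|X|`, with the quotient topology. -/
abbrev Orbit (X : SseGroupoid.{u} I) : Type u := Quotient X.setoid

/-- The projection `π : X₀ → |X|`. -/
def proj (X : SseGroupoid.{u} I) (x : X.Obj) : X.Orbit := Quotient.mk X.setoid x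

/-- The maximal Hausdorff quotient `|X|_H` of the orbit space. -/
abbrev HOrbit (X : SseGroupoid.{u} I) : Type u := T2Quotient X.Orbit

/-- The projection `π_H : X₀ → |X|_H`. -/
def projH (X : SseGroupoid.{u} I) (x : X.Obj) : X.HOrbit := T2Quotient.mk (X.proj x)

/-- All stabilizers are trivial. -/
def IsNonsingular (X : SseGroupoid.{u} I) : Prop :=
  ∀ γ : X.Mor, X.src γ = X.tgt γ → γ = X.one (X.src γ)

/-- The point `p` of the orbit space is smooth: for every object `x` over `p`, every morphism
from `x` to `x` acts trivially near `x`, i.e. all morphisms near it have equal source and target. -/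
def IsSmoothPoint (X : SseGroupoid.{u} I) (p : X.Orbit) : Prop :=
  ∀ x : X.Obj, X.proj x = p → ∀ γ : X.Mor, X.src γ = x → X.tgt γ = x →
    ∀ᶠ γ' in 𝓝 γ, X.src γ' = X.tgt γ'

end SseGroupoid

/-- An (oriented, `d`-dimensional) ep groupoid, i.e. an orbifold groupoid: an sse groupoid without
boundary that is proper. -/
structure EpGroupoid (d : ℕ) extends SseGroupoid.{u} (𝓡 d) where
  proper : IsProperMap fun γ : Mor => (src γ, tgt γ)

/-- The orbit space of an ep groupoid is Hausdorff. -/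
instance EpGroupoid.t2Space_orbit {d : ℕ} (X : EpGroupoid.{u} d) :
    T2Space X.toSseGroupoid.Orbit := by
  have hopen : IsOpenQuotientMap X.proj := by
    refine ⟨Quotient.mk_surjective, continuous_quotient_mk', fun U hU => ?_⟩
    refine isQuotientMap_quotient_mk'.isOpen_preimage.mp ?_
    have : (Quotient.mk X.setoid) ⁻¹' (X.proj '' U) = X.tgt '' (X.src ⁻¹' U) := by
      ext y
      constructor
      · rintro ⟨x, hx, hxy⟩
        obtain ⟨γ, h₁, h₂⟩ := Quotient.exact hxy
        exact ⟨γ, by simpa [h₁] using hx, h₂⟩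
      · rintro ⟨γ, hγ, rfl⟩
        exact ⟨X.src γ, hγ, Quotient.sound ⟨γ, rfl, rfl⟩⟩
    exact this ▸ X.tgt_localDiffeo.isLocalDiffeomorph.isOpenMap _
      (hU.preimage X.src_localDiffeo.isLocalDiffeomorph.contMDiff.continuous)
  rw [t2Space_iff_of_isOpenQuotientMap hopen]
  have : {q : X.Obj × X.Obj | X.proj q.1 = X.proj q.2} =
      Set.range fun γ : X.Mor => (X.src γ, X.tgt γ) := by
    ext ⟨x, y⟩
    constructor
    · intro h
      obtain ⟨γ, h₁, h₂⟩ := Quotient.exact h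
      exact ⟨γ, Prod.ext h₁ h₂⟩
    · rintro ⟨γ, h⟩
      obtain ⟨rfl, rfl⟩ := Prod.ext_iff.mp h
      exact Quotient.sound ⟨γ, rfl, rfl⟩
  rw [this]
  exact X.proper.isClosedMap.isClosed_range

/-! ### Smooth functors -/

/-- A smooth functor; the two groupoids may live in manifolds with different models. -/
structure SmoothFunctor {n n' : ℕ} {H H' : Type} [TopologicalSpace H] [TopologicalSpace H']
    {I : ModelWithCorners ℝ (EuclideanSpace ℝ (Fin n)) H}
    {J : ModelWithCorners ℝ (EuclideanSpace ℝ (Fin n')) H'}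
    (X : SseGroupoid.{u} I) (Y : SseGroupoid.{u} J) where
  obj : X.Obj → Y.Obj
  mor : X.Mor → Y.Mor
  contMDiff_obj : ContMDiff I J ∞ obj
  contMDiff_mor : ContMDiff I J ∞ mor
  src_mor : ∀ γ, Y.src (mor γ) = obj (X.src γ)
  tgt_mor : ∀ γ, Y.tgt (mor γ) = obj (X.tgt γ)
  mor_one : ∀ x, mor (X.one x) = Y.one (obj x)
  mor_comp : ∀ (δ γ : X.Mor) (h : X.src δ = X.tgt γ),
    mor (X.comp δ γ h) =
      Y.comp (mor δ) (mor γ) (by rw [src_mor, tgt_mor, h])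

namespace SmoothFunctor

variable {n n' : ℕ} {H H' : Type} [TopologicalSpace H] [TopologicalSpace H']
  {I : ModelWithCorners ℝ (EuclideanSpace ℝ (Fin n)) H}
  {J : ModelWithCorners ℝ (EuclideanSpace ℝ (Fin n')) H'}
  {X : SseGroupoid.{u} I} {Y : SseGroupoid.{u} J}

/-- The induced map `|F| : |X| → |Y|`. -/
def orbitMap (F : SmoothFunctor X Y) : X.Orbit → Y.Orbit :=
  Quotient.map F.obj fun _ _ ⟨γ, h₁, h₂⟩ =>
    ⟨F.mor γ, (F.src_mor γ).trans (congrArg F.obj h₁), (F.tgt_mor γ).trans (congrArg F.obj h₂)⟩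

theorem continuous_orbitMap (F : SmoothFunctor X Y) : Continuous F.orbitMap :=
  F.contMDiff_obj.continuous.quotient_map' _

/-- For Hausdorff `|Y|`, the map `|X|_H → |Y|` induced by `F`. -/
def orbitMapOfT2 (F : SmoothFunctor X Y) [T2Space Y.Orbit] : X.HOrbit → Y.Orbit :=
  T2Quotient.lift F.continuous_orbitMap

/-- The induced map `|F|_H : |X|_H → |Y|_H`. -/
def hOrbitMap (F : SmoothFunctor X Y) : X.HOrbit → Y.HOrbit :=
  T2Quotient.lift ((T2Quotient.continuous_mk Y.Orbit).comp F.continuous_orbitMap)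

end SmoothFunctor

/-! ### Weighted nonsingular branched groupoids -/

/-- `(N, U, m)` is a local branching structure of the groupoid `B` with weighting function `Λ`
at each point of `N`. -/
structure IsLocalBranching {n : ℕ} {H : Type} [TopologicalSpace H]
    {I : ModelWithCorners ℝ (EuclideanSpace ℝ (Fin n)) H}
    (B : SseGroupoid.{u} I) (Λ : B.HOrbit → ℝ) (N : Set B.HOrbit) {ℓ : ℕ}
    (U : Fin ℓ → Set B.Obj) (m : Fin ℓ → ℝ) : Prop where
  isOpen_nhd : IsOpen N
  isOpen_branch : ∀ i, IsOpen (U i)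
  branch_subset : ∀ i, U i ⊆ B.projH ⁻¹' N
  disjoint : ∀ i j, i ≠ j → Disjoint (U i) (U j)
  weight_pos : ∀ i, 0 < m i
  covering : (T2Quotient.mk : B.Orbit → B.HOrbit) ⁻¹' N = ⋃ i, B.proj '' U i
  regular_embedding : ∀ i, Topology.IsEmbedding ((U i).domRestrict B.projH)
  regular_closed : ∀ i, ∃ C : Set B.HOrbit, IsClosed C ∧ B.projH '' U i = N ∩ C
  weighting : ∀ q ∈ N, Λ q = ∑ i, (B.projH '' U i).indicator (fun _ => m i) q

/-- A weighted nonsingular branched (wnb) groupoid `(B, Λ)`, possibly with boundary, depending on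
the model `I`. -/
structure WnbGroupoid {n : ℕ} {H : Type} [TopologicalSpace H]
    (I : ModelWithCorners ℝ (EuclideanSpace ℝ (Fin n)) H) extends SseGroupoid.{u} I where
  nonsingular : toSseGroupoid.IsNonsingular
  Λ : toSseGroupoid.HOrbit → ℝ
  Λ_pos : ∀ p, 0 < Λ p
  branching : ∀ p : toSseGroupoid.HOrbit,
    ∃ (N : Set toSseGroupoid.HOrbit) (ℓ : ℕ) (U : Fin ℓ → Set Obj) (m : Fin ℓ → ℝ),
      p ∈ N ∧ IsLocalBranching toSseGroupoid Λ N U m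

/-- The functor `F : (B', Λ') → (B, Λ)` is a layered covering. (In `weighting`, the sum over the
fibre of `|F|_H` is stated through `HasSum`; the fibres of a layered covering are finite.) -/
structure IsLayeredCovering {n : ℕ} {H : Type} [TopologicalSpace H]
    {I : ModelWithCorners ℝ (EuclideanSpace ℝ (Fin n)) H}
    (B' B : WnbGroupoid.{u} I) (F : SmoothFunctor B'.toSseGroupoid B.toSseGroupoid) : Prop where
  localDiffeo : IsOrientedLocalDiffeo B'.Obj B.Obj F.obj
  surjective : Function.Surjective F.orbitMap
  proper : IsProperMap F.hOrbitMap
  weighting : ∀ p : B.HOrbit, HasSum (fun q : {q // F.hOrbitMap q = p} => B'.Λ q.1) (B.Λ p)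

/-- The functor `F : (B, Λ) → X` from a wnb groupoid to an ep groupoid is a resolution of `X`. -/
structure IsResolution {d : ℕ} (B : WnbGroupoid.{u} (𝓡 d)) (X : EpGroupoid.{u} d)
    (F : SmoothFunctor B.toSseGroupoid X.toSseGroupoid) : Prop where
  localDiffeo : IsOrientedLocalDiffeo B.Obj X.Obj F.obj
  proper : IsProperMap F.orbitMapOfT2
  weighting : ∀ p : X.Orbit, X.IsSmoothPoint p →
    HasSum (fun q : {q // F.orbitMapOfT2 q = p} => B.Λ q.1) 1

/-- Two wnb groupoids are commensurate if they have a common layered covering. -/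
def Commensurate {n : ℕ} {H : Type} [TopologicalSpace H]
    {I : ModelWithCorners ℝ (EuclideanSpace ℝ (Fin n)) H} (A C : WnbGroupoid.{u} I) : Prop :=
  ∃ (Z : WnbGroupoid.{u} I) (P : SmoothFunctor Z.toSseGroupoid A.toSseGroupoid)
    (Q : SmoothFunctor Z.toSseGroupoid C.toSseGroupoid),
    IsLayeredCovering Z A P ∧ IsLayeredCovering Z C Q

/-! ### Cobordism -/

/-- The tangent vector `ν` of the manifold with boundary `W` at the boundary point `y` points
outwards: in a chart with values in the half space `{z | 0 ≤ z 0}`, its coordinate of index `0`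
is negative. -/
def IsOutward {d : ℕ} (W : OrientedManifold.{u} (𝓡∂ (d + 1))) (y : W)
    (ν : TangentSpace (𝓡∂ (d + 1)) y) : Prop :=
  (show EuclideanSpace ℝ (Fin (d + 1)) from
    mfderiv (𝓡∂ (d + 1)) 𝓘(ℝ, EuclideanSpace ℝ (Fin (d + 1)))
      (extChartAt (𝓡∂ (d + 1)) y) y ν) 0 < 0

/-- The maps `f : M → W` and `g : N → W` identify the disjoint union `(-M) ⊔ N` of oriented
manifolds with the oriented boundary of `W`. The boundary orientation follows the rule that the
outward direction comes first. -/
structure IsOrientedBoundary {d : ℕ} (M N : OrientedManifold.{u} (𝓡 d))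
    (W : OrientedManifold.{u} (𝓡∂ (d + 1))) (f : M → W) (g : N → W) : Prop where
  contMDiff_left : ContMDiff (𝓡 d) (𝓡∂ (d + 1)) ∞ f
  contMDiff_right : ContMDiff (𝓡 d) (𝓡∂ (d + 1)) ∞ g
  immersion_left : ∀ x, Function.Injective (mfderiv (𝓡 d) (𝓡∂ (d + 1)) f x)
  immersion_right : ∀ x, Function.Injective (mfderiv (𝓡 d) (𝓡∂ (d + 1)) g x)
  embedding : Topology.IsEmbedding (Sum.elim f g)
  range_eq : Set.range (Sum.elim f g) = (𝓡∂ (d + 1)).boundary W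
  orient_left : ∀ (x : M) (ν : TangentSpace (𝓡∂ (d + 1)) (f x)), IsOutward W (f x) ν →
    ∀ v : Fin d → TangentSpace (𝓡 d) x, IsPositive (M.orient x) v ↔
      IsPositive (-W.orient (f x)) (Fin.cons ν fun i => mfderiv (𝓡 d) (𝓡∂ (d + 1)) f x (v i))
  orient_right : ∀ (x : N) (ν : TangentSpace (𝓡∂ (d + 1)) (g x)), IsOutward W (g x) ν →
    ∀ v : Fin d → TangentSpace (𝓡 d) x, IsPositive (N.orient x) v ↔
      IsPositive (W.orient (g x)) (Fin.cons ν fun i => mfderiv (𝓡 d) (𝓡∂ (d + 1)) g x (v i))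

/-- Two wnb groupoids without boundary are cobordant: both are compact, and there is a compact
`(d + 1)`-dimensional wnb groupoid `W` with boundary `-(A, Λ_A) ⊔ (C, Λ_C)`. That is, the functors
`j` and `k` identify the objects and the morphisms of the groupoid `(-A) ⊔ C` with the boundaries
of the manifolds of objects and of morphisms of `W`, they embed its Hausdorff orbit space in
that of `W`, and the weights of `A` and `C` are the restrictions of the weight of `W`. -/
def Cobordant {d : ℕ} (A C : WnbGroupoid.{u} (𝓡 d)) : Prop :=
  CompactSpace A.HOrbit ∧ CompactSpace C.HOrbit ∧
  ∃ (W : WnbGroupoid.{u} (𝓡∂ (d + 1)))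
    (j : SmoothFunctor A.toSseGroupoid W.toSseGroupoid)
    (k : SmoothFunctor C.toSseGroupoid W.toSseGroupoid),
    CompactSpace W.HOrbit ∧
    IsOrientedBoundary A.Obj C.Obj W.Obj j.obj k.obj ∧
    IsOrientedBoundary A.Mor C.Mor W.Mor j.mor k.mor ∧
    Topology.IsEmbedding (Sum.elim j.hOrbitMap k.hOrbitMap) ∧
    (∀ q, W.Λ (j.hOrbitMap q) = A.Λ q) ∧ (∀ q, W.Λ (k.hOrbitMap q) = C.Λ q)

end BranchedResolution

section

open Set Filter


namespace BranchedResolution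

/-! ### Local diffeomorphisms and pullback of manifold structures -/

section Pullback

variable {n : ℕ} {H : Type} [TopologicalSpace H]
  {I : ModelWithCorners ℝ (EuclideanSpace ℝ (Fin n)) H}

/-! The proof replaces weighted branched groupoids by a local combinatorial model. Let `Y` be a
proper groupoid. A `Layer` is a nonsingular groupoid étale over `Y`; its fibre over an object `y`
consists of pairs of an object `a` and a morphism `g : F a → y`, modulo the morphisms of the layer
(`Germ`). A layer with `Sheets` has, near every `x`, finitely many local sections that exhaust the
fibres and carry positive weights of total one. These weights need only be intrinsic over a dense
open set of generic points, since sums over sections through nearby generic points determine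
everything else.

Sheets give a weighting function: `Λ q` is `κ / |G_x|` times the total weight of the sections that
pass through `q` over `x` (`IsInduced`). Here `κ` is the order of the subgroup of `G_x` acting
trivially near `x`. It is locally constant because a diffeomorphism of finite order that is the
identity on open sets accumulating at a fixed point is the identity near that point
(`eventually_eq_self_of_frequently`). At smooth points `κ = |G_x|`, so the fibre has total weight
one. The factor `1 / |G_x|` accounts for the action of `G_x` on a slice, which permutes the places
where a section meets an orbit; this yields the local branching structure
(`exists_isLocalBranching`) and properness over `|Y|`.

Layers can be glued. Given layers `L i` over a locally finite family of closed sets `C i` whose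
interiors cover `|Y|`, an object of the glued layer over `y` is one point of the fibre of each layer
active at `y`, and morphisms preserve all components. As the sets are closed, the set of active
indices can only shrink near a point, so the morphisms form an open, étale relation. Sheets of the
gluing are tuples of sheets with the product of their weights; dropping an index that becomes
inactive sums its weights to one (`Gluing.exists_sheets`).

Existence: a slice without its nontrivial morphisms is a layer with `|G_x|` sheets of weight `1 /
|G_x|`; glue countably many pieces built from a locally finite family of slices. Commensurability:
conversely, the branches of any resolution extend to sections, and its weighting function is induced
by sheets (`Layer.exists_weight`). Gluing both resolutions over all of `|X|` gives a weighted fibre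
product, whose two projections are layered coverings because the marginals of a product weight are
its factors. Cobordism: over `X × [0, 1]` glue the first layer on times at most `2/3` with the
second on times at least `1/3`. A `Collar` makes the glued objects and morphisms near the two ends
those of the given resolutions, so that the boundary is `(-A) ⊔ C`. -/

theorem contMDiffAt_of_comp_isLocalDiffeomorph
    {E₁ : Type*} [NormedAddCommGroup E₁] [NormedSpace ℝ E₁] {H₁ : Type*} [TopologicalSpace H₁]
    {J : ModelWithCorners ℝ E₁ H₁} {L : Type*} [TopologicalSpace L] [ChartedSpace H₁ L]
    {E₂ : Type*} [NormedAddCommGroup E₂] [NormedSpace ℝ E₂] {H₂ : Type*} [TopologicalSpace H₂]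
    {K : ModelWithCorners ℝ E₂ H₂}
    {M N : Type*} [TopologicalSpace M] [ChartedSpace H₂ M] [TopologicalSpace N] [ChartedSpace H₂ N]
    {q : M → N} (hq : IsLocalDiffeomorph K K ∞ q) {g : L → M} {x : L} (hg : ContinuousAt g x)
    (h : ContMDiffAt J K ∞ (q ∘ g) x) : ContMDiffAt J K ∞ g x := by
  have hq' := hq (g x)
  have h1 : ContMDiffAt J K ∞ (hq'.localInverse ∘ (q ∘ g)) x :=
    (hq'.localInverse_contMDiffAt).comp x h
  refine h1.congr_of_eventuallyEq ?_
  have := hg.eventually hq'.localInverse_eventuallyEq_left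
  filter_upwards [this] with y hy
  exact hy.symm

theorem isLocalDiffeomorphAt_of_openPartialHomeomorph
    {E₂ : Type*} [NormedAddCommGroup E₂] [NormedSpace ℝ E₂] {H₂ : Type*} [TopologicalSpace H₂]
    {K : ModelWithCorners ℝ E₂ H₂}
    {M N : Type*} [TopologicalSpace M] [ChartedSpace H₂ M] [TopologicalSpace N] [ChartedSpace H₂ N]
    (e : OpenPartialHomeomorph M N) {x : M} (hx : x ∈ e.source)
    (h₁ : ContMDiffOn K K ∞ e e.source) (h₂ : ContMDiffOn K K ∞ e.symm e.target) :
    IsLocalDiffeomorphAt K K ∞ e x :=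
  ⟨{ toPartialEquiv := e.toPartialEquiv
     open_source := e.open_source
     open_target := e.open_target
     contMDiffOn_toFun := h₁
     contMDiffOn_invFun := h₂ }, hx, fun _ _ => rfl⟩

theorem isLocalDiffeomorph_of_comp
    {E₂ : Type*} [NormedAddCommGroup E₂] [NormedSpace ℝ E₂] {H₂ : Type*} [TopologicalSpace H₂]
    {K : ModelWithCorners ℝ E₂ H₂}
    {L M N : Type*} [TopologicalSpace L] [ChartedSpace H₂ L]
    [TopologicalSpace M] [ChartedSpace H₂ M] [TopologicalSpace N] [ChartedSpace H₂ N]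
    {q : M → N} (hq : IsLocalDiffeomorph K K ∞ q) {g : L → M} (hg : Continuous g)
    (h : IsLocalDiffeomorph K K ∞ (q ∘ g)) : IsLocalDiffeomorph K K ∞ g := by
  have hsm : ContMDiff K K ∞ g := fun x =>
    contMDiffAt_of_comp_isLocalDiffeomorph hq hg.continuousAt (h.contMDiff x)
  have hloc : IsLocalHomeomorph g :=
    IsLocalHomeomorph.of_comp h.isLocalHomeomorph hq.isLocalHomeomorph hg
  intro x
  obtain ⟨e, hx, rfl⟩ := hloc x
  refine isLocalDiffeomorphAt_of_openPartialHomeomorph e hx hsm.contMDiffOn ?_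
  intro y hy
  refine ContMDiffAt.contMDiffWithinAt ?_
  refine contMDiffAt_of_comp_isLocalDiffeomorph h
    (e.symm.continuousAt (by simpa using hy)) ?_
  refine (hq.contMDiff y).congr_of_eventuallyEq ?_
  filter_upwards [e.open_target.mem_nhds hy] with z hz
  simp [e.right_inv hz]

theorem IsOrientedLocalDiffeo.isLocalHomeomorph {M N : OrientedManifold.{u} I} {f : M → N}
    (hf : IsOrientedLocalDiffeo M N f) : IsLocalHomeomorph f :=
  hf.isLocalDiffeomorph.isLocalHomeomorph

theorem IsOrientedLocalDiffeo.congr {M N : OrientedManifold.{u} I} {f g : M → N}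
    (hf : IsOrientedLocalDiffeo M N f) (h : ∀ x, f x = g x) : IsOrientedLocalDiffeo M N g :=
  (funext h : f = g) ▸ hf

theorem IsOrientedLocalDiffeo.continuous {M N : OrientedManifold.{u} I} {f : M → N}
    (hf : IsOrientedLocalDiffeo M N f) : Continuous f :=
  hf.isLocalHomeomorph.continuous

theorem IsOrientedLocalDiffeo.contMDiff {M N : OrientedManifold.{u} I} {f : M → N}
    (hf : IsOrientedLocalDiffeo M N f) : ContMDiff I I ∞ f :=
  hf.isLocalDiffeomorph.contMDiff

theorem IsOrientedLocalDiffeo.mdifferentiableAt {M N : OrientedManifold.{u} I} {f : M → N}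
    (hf : IsOrientedLocalDiffeo M N f) (x : M) : MDifferentiableAt I I f x :=
  (hf.contMDiff x).mdifferentiableAt (by simp)

theorem IsOrientedLocalDiffeo.comp {L M N : OrientedManifold.{u} I} {f : M → N} {g : L → M}
    (hf : IsOrientedLocalDiffeo M N f) (hg : IsOrientedLocalDiffeo L M g) :
    IsOrientedLocalDiffeo L N (f ∘ g) where
  isLocalDiffeomorph x := IsLocalDiffeomorphAt.comp (K := I) (P := N) (hg.isLocalDiffeomorph x)
    (hf.isLocalDiffeomorph (g x))
  preserves x v := by
    rw [hg.preserves x v, hf.preserves (g x)]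
    rw [mfderiv_comp x (hf.mdifferentiableAt _) (hg.mdifferentiableAt _)]
    rfl

/-- All structure maps of the groupoids constructed below are continuous lifts of structure maps of
a given groupoid. This lemma makes continuity the only thing to check for them. -/
theorem IsOrientedLocalDiffeo.of_comp {L M N : OrientedManifold.{u} I} {q : M → N} {g : L → M}
    (hq : IsOrientedLocalDiffeo M N q) (hg : Continuous g)
    (h : IsOrientedLocalDiffeo L N (q ∘ g)) : IsOrientedLocalDiffeo L M g := by
  have h1 := isLocalDiffeomorph_of_comp hq.isLocalDiffeomorph hg h.isLocalDiffeomorph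
  refine ⟨h1, fun x v => ?_⟩
  rw [h.preserves x v, hq.preserves (g x),
    mfderiv_comp x (hq.mdifferentiableAt _) ((h1.contMDiff x).mdifferentiableAt (by simp))]
  rfl

/-- The charted space structure on the source of a local homeomorphism. -/
@[reducible] noncomputable def pullbackChartedSpace {E M : Type*} [TopologicalSpace E]
    [TopologicalSpace M] [ChartedSpace H M] {f : E → M} (hf : IsLocalHomeomorph f) :
    ChartedSpace H E where
  atlas := range fun e => (hf.localInverseAt e).symm ≫ₕ chartAt H (f e)
  chartAt e := (hf.localInverseAt e).symm ≫ₕ chartAt H (f e)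
  mem_chart_source e := by simp
  chart_mem_atlas e := ⟨e, rfl⟩

/-- The charts are charts of `M` composed with `f`, and `f` undoes its own local inverses. So the
transition maps are restrictions of transition maps of `M`. -/
theorem isManifold_pullback {E M : Type*} [TopologicalSpace E]
    [TopologicalSpace M] [ChartedSpace H M] [IsManifold I ∞ M] {f : E → M}
    (hf : IsLocalHomeomorph f) :
    letI := pullbackChartedSpace (H := H) hf
    IsManifold I ∞ E := by
  letI := pullbackChartedSpace (H := H) hf
  refine { compatible := ?_ }
  rintro _ _ ⟨e, rfl⟩ ⟨e', rfl⟩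
  set a := hf.localInverseAt e
  set a' := hf.localInverseAt e'
  set c := chartAt H (f e)
  set c' := chartAt H (f e')
  have hG : c.symm ≫ₕ c' ∈ contDiffGroupoid ∞ I :=
    (contDiffGroupoid ∞ I).compatible (chart_mem_atlas H (f e)) (chart_mem_atlas H (f e'))
  set T := (a.symm ≫ₕ c).symm ≫ₕ a'.symm ≫ₕ c' with hT
  have key : ∀ z ∈ a.source, f (a z) = z := fun z hz => hf.apply_localInverseAt_of_mem hz
  have hfa' : ∀ z, a'.symm z = f z := fun z => by
    rw [show (a'.symm : E → M) = f from hf.localInverseAt_symm _]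
  have hsub : T.source ⊆ (c.symm ≫ₕ c').source := by
    intro z hz
    simp only [hT, OpenPartialHomeomorph.trans_source, OpenPartialHomeomorph.symm_source,
      OpenPartialHomeomorph.trans_target, OpenPartialHomeomorph.coe_trans_symm,
      OpenPartialHomeomorph.symm_symm, mem_inter_iff, mem_preimage, Function.comp,
      OpenPartialHomeomorph.symm_target, hfa'] at hz ⊢
    obtain ⟨⟨h1, h2⟩, h3, h4⟩ := hz
    rw [key _ h2] at h4
    exact ⟨h1, h4⟩
  refine (contDiffGroupoid ∞ I).mem_of_eqOnSource
    (closedUnderRestriction' hG T.open_source) ⟨?_, ?_⟩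
  · rw [OpenPartialHomeomorph.restr_source, T.open_source.interior_eq, inter_eq_right.mpr hsub]
  · intro z hz
    simp only [hT, OpenPartialHomeomorph.trans_source, OpenPartialHomeomorph.symm_source,
      OpenPartialHomeomorph.trans_target, OpenPartialHomeomorph.coe_trans_symm,
      OpenPartialHomeomorph.symm_symm, mem_inter_iff, mem_preimage, Function.comp,
      OpenPartialHomeomorph.symm_target, hfa'] at hz
    obtain ⟨⟨h1, h2⟩, h3, h4⟩ := hz
    simp [hT, Function.comp, hfa', key _ h2]

theorem extChartAt_pullback {E M : Type*} [TopologicalSpace E]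
    [TopologicalSpace M] [ChartedSpace H M] {f : E → M} (hf : IsLocalHomeomorph f) (e : E) :
    letI := pullbackChartedSpace (H := H) hf
    (extChartAt I e : E → EuclideanSpace ℝ (Fin n)) = extChartAt I (f e) ∘ f := by
  letI := pullbackChartedSpace (H := H) hf
  ext1 z
  change I (((hf.localInverseAt e).symm ≫ₕ chartAt H (f e)) z) = _
  simp

section

variable {E M : Type*} [TopologicalSpace E]
    [TopologicalSpace M] [ChartedSpace H M] {f : E → M}

theorem isLocalDiffeomorph_pullback [IsManifold I ∞ M] (hf : IsLocalHomeomorph f) :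
    letI := pullbackChartedSpace (H := H) hf
    IsLocalDiffeomorph I I ∞ f := by
  letI := pullbackChartedSpace (H := H) hf
  haveI : IsManifold I ∞ E := isManifold_pullback hf
  have h1 : ContMDiff I I ∞ f := by
    intro e
    rw [contMDiffAt_iff_target]
    refine ⟨hf.continuous.continuousAt, ?_⟩
    rw [← extChartAt_pullback hf e]
    exact contMDiffAt_extChartAt
  intro e
  have hfa' : ((hf.localInverseAt e).symm : E → M) = f := hf.localInverseAt_symm _
  have := isLocalDiffeomorphAt_of_openPartialHomeomorph (K := I) (hf.localInverseAt e).symm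
    (x := e) (by simp) (by rw [hfa']; exact h1.contMDiffOn) ?_
  · rwa [hfa'] at this
  · intro y hy
    simp only [OpenPartialHomeomorph.symm_target, OpenPartialHomeomorph.symm_symm] at hy ⊢
    refine ContMDiffAt.contMDiffWithinAt ?_
    rw [contMDiffAt_iff_target]
    refine ⟨(hf.localInverseAt e).continuousAt hy, ?_⟩
    rw [extChartAt_pullback hf]
    have h2 := contMDiffAt_extChartAt (I := I) (n := ∞) (x := f ((hf.localInverseAt e) y))
    rw [hf.apply_localInverseAt_of_mem hy] at h2 ⊢
    refine h2.congr_of_eventuallyEq ?_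
    filter_upwards [(hf.localInverseAt e).open_source.mem_nhds hy] with z hz
    simp [hf.apply_localInverseAt_of_mem hz]

/-- In the preferred charts at `e` and `f e` the map `f` is the identity. Both tangent spaces are
the same model space, so an orientation of `M` can be copied verbatim. -/
theorem mfderiv_pullback [IsManifold I ∞ M] (hf : IsLocalHomeomorph f) (e : E) :
    letI := pullbackChartedSpace (H := H) hf
    ∀ v : EuclideanSpace ℝ (Fin n), (mfderiv I I f e : EuclideanSpace ℝ (Fin n) →L[ℝ]
      EuclideanSpace ℝ (Fin n)) v = v := by
  letI := pullbackChartedSpace (H := H) hf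
  intro v
  have hd : MDifferentiableAt I I f e :=
    ((isLocalDiffeomorph_pullback (I := I) hf).contMDiff e).mdifferentiableAt (by simp)
  rw [hd.mfderiv]
  have h : (writtenInExtChartAt I I e f) =ᶠ[𝓝[range I] (extChartAt I e e)] id := by
    filter_upwards [extChartAt_target_mem_nhdsWithin (I := I) e] with z hz
    rw [writtenInExtChartAt, ← Function.comp_assoc, ← extChartAt_pullback hf e]
    exact (extChartAt I e).right_inv hz
  have hu : UniqueDiffWithinAt ℝ (range I) (extChartAt I e e) :=
    I.uniqueDiffOn _ (mem_range_self _)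
  have h2 : fderivWithin ℝ (writtenInExtChartAt I I e f) (range I) (extChartAt I e e) =
      ContinuousLinearMap.id ℝ _ := by
    rw [h.fderivWithin_eq (by
      rw [writtenInExtChartAt, ← Function.comp_assoc, ← extChartAt_pullback hf e]
      simp), fderivWithin_id hu]
  exact congrArg (fun L : EuclideanSpace ℝ (Fin n) →L[ℝ] EuclideanSpace ℝ (Fin n) => L v) h2

end

/-- The oriented manifold structure on the source of a local homeomorphism. -/
noncomputable def OrientedManifold.pullback (M : OrientedManifold.{u} I) {E : Type u}
    [TopologicalSpace E] [T2Space E] [SecondCountableTopology E] (f : E → M)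
    (hf : IsLocalHomeomorph f) : OrientedManifold.{u} I :=
  letI := pullbackChartedSpace (H := H) hf
  haveI : IsManifold I ∞ E := isManifold_pullback hf
  { carrier := E
    orient := fun e => M.orient (f e)
    orient_locallyConstant := by
      intro e₀
      obtain ⟨o, ho⟩ := M.orient_locallyConstant (f e₀)
      refine ⟨o, ?_⟩
      filter_upwards [hf.continuous.continuousAt.eventually ho,
        (chartAt H e₀).open_source.mem_nhds (mem_chart_source H e₀)] with e he hs v
      rw [extChartAt_pullback hf e₀]
      have hs' : f e ∈ (chartAt H (f e₀)).source := by
        have := hs.2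
        simpa using this
      have hd : MDifferentiableAt I I f e :=
        ((isLocalDiffeomorph_pullback (I := I) hf).contMDiff e).mdifferentiableAt (by simp)
      have hd2 : MDifferentiableAt I 𝓘(ℝ, EuclideanSpace ℝ (Fin n)) (extChartAt I (f e₀)) (f e) :=
        mdifferentiableAt_extChartAt hs'
      have : ∀ v : EuclideanSpace ℝ (Fin n),
          mfderiv I 𝓘(ℝ, EuclideanSpace ℝ (Fin n)) (extChartAt I (f e₀) ∘ f) e v =
          mfderiv I 𝓘(ℝ, EuclideanSpace ℝ (Fin n)) (extChartAt I (f e₀)) (f e) v := by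
        intro v
        rw [mfderiv_comp e hd2 hd]
        exact congrArg _ (mfderiv_pullback hf e v)
      rw [show (fun i => mfderiv I 𝓘(ℝ, EuclideanSpace ℝ (Fin n))
        (extChartAt I (f e₀) ∘ f) e (v i)) = (fun i => mfderiv I 𝓘(ℝ, EuclideanSpace ℝ (Fin n))
        (extChartAt I (f e₀)) (f e) (v i)) from funext fun i => this (v i)]
      exact he v }

theorem OrientedManifold.isOrientedLocalDiffeo_pullback (M : OrientedManifold.{u} I) {E : Type u}
    [TopologicalSpace E] [T2Space E] [SecondCountableTopology E] (f : E → M)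
    (hf : IsLocalHomeomorph f) : IsOrientedLocalDiffeo (M.pullback f hf) M f where
  isLocalDiffeomorph := isLocalDiffeomorph_pullback hf
  preserves x v := by
    letI := pullbackChartedSpace (H := H) hf
    exact iff_of_eq (congrArg (IsPositive (M.orient (f x)))
      (funext fun i => (mfderiv_pullback (I := I) hf x (v i)).symm))

end Pullback

end BranchedResolution

namespace BranchedResolution

/-! ### Local homeomorphisms and Hausdorff quotients -/

theorem isLocalHomeomorph_of_sections {E B : Type*} [TopologicalSpace E] [TopologicalSpace B]
    {f : E → B} (hf : Continuous f)
    (h : ∀ e, ∃ (s : B → E) (U : Set B), IsOpen U ∧ f e ∈ U ∧ ContinuousOn s U ∧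
      (∀ y ∈ U, f (s y) = y) ∧ ∀ᶠ e' in 𝓝 e, s (f e') = e') : IsLocalHomeomorph f := by
  refine IsLocalHomeomorph.mk f fun e => ?_
  obtain ⟨s, U, hU, heU, hs, hfs, hsf⟩ := h e
  obtain ⟨V, hV, hVo, heV⟩ := eventually_nhds_iff.mp (hsf.and (hf.continuousAt.eventually
    (hU.mem_nhds heU)))
  refine ⟨{ toFun := f, invFun := s, source := V, target := U ∩ s ⁻¹' V, map_source' := ?_,
            map_target' := fun y hy => hy.2, left_inv' := fun e' he' => (hV e' he').1,
            right_inv' := fun y hy => hfs y hy.1, open_source := hVo,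
            open_target := hs.isOpen_inter_preimage hU hVo,
            continuousOn_toFun := hf.continuousOn,
            continuousOn_invFun := hs.mono inter_subset_left }, heV, fun _ _ => rfl⟩
  intro e' he'
  refine ⟨(hV e' he').2, ?_⟩
  rw [mem_preimage, (hV e' he').1]
  exact he'

/-- Local inverses in the form used throughout: a total function, meaningful on `U`, that recovers
every point near `e` from its image. -/
theorem exists_section {E B : Type*} [TopologicalSpace E] [TopologicalSpace B]
    {f : E → B} (hf : IsLocalHomeomorph f) (e : E) :
    ∃ (s : B → E) (U : Set B), IsOpen U ∧ f e ∈ U ∧ ContinuousOn s U ∧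
      (∀ y ∈ U, f (s y) = y) ∧ s (f e) = e ∧ ∀ᶠ e' in 𝓝 e, s (f e') = e' := by
  have hsym : ∀ z, (hf.localInverseAt e).symm z = f z := fun z => by
    rw [show ((hf.localInverseAt e).symm : E → B) = f from hf.localInverseAt_symm _]
  refine ⟨hf.localInverseAt e, (hf.localInverseAt e).source, (hf.localInverseAt e).open_source,
    by simp, (hf.localInverseAt e).continuousOn, fun y hy => hf.apply_localInverseAt_of_mem hy,
    by simp, ?_⟩
  filter_upwards [(hf.localInverseAt e).open_target.mem_nhds (by simp)] with z hz
  rw [← hsym]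
  exact (hf.localInverseAt e).right_inv hz

/-- Uniqueness of lifts in filter form. Most identities between locally defined morphisms below are
proved by checking the limit and the image under an étale map. -/
theorem eventually_eq_of_isLocalHomeomorph {E B Z : Type*} [TopologicalSpace E]
    [TopologicalSpace B] {f : E → B} (hf : IsLocalHomeomorph f) {e : E} {l : Filter Z}
    {a b : Z → E} (ha : Tendsto a l (𝓝 e)) (hb : Tendsto b l (𝓝 e))
    (h : ∀ᶠ z in l, f (a z) = f (b z)) : ∀ᶠ z in l, a z = b z := by
  obtain ⟨s, U, -, -, -, -, -, hs⟩ := exists_section hf e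
  filter_upwards [ha.eventually hs, hb.eventually hs, h] with z h1 h2 h3
  rw [← h1, ← h2, h3]

/-- Points of a space over an open set of a Hausdorff space are separated in the maximal Hausdorff
quotient if they can be separated over that open set. -/
theorem rel_of_t2Quotient_mk_eq {Q T : Type*} [TopologicalSpace Q] [TopologicalSpace T] [T2Space T]
    {τ : Q → T} (hτ : Continuous τ) {O : Set T} {r : Q → Q → Prop} (hr : Equivalence r)
    (hsep : ∀ x y, τ x = τ y → τ x ∈ O → ¬ r x y → ∃ U V : Set Q, IsOpen U ∧ IsOpen V ∧ x ∈ U ∧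
      y ∈ V ∧ Disjoint U V ∧ (∀ a b, τ a = τ b → (τ a ∈ O → r a b) → (a ∈ U ↔ b ∈ U)) ∧
      (∀ a b, τ a = τ b → (τ a ∈ O → r a b) → (a ∈ V ↔ b ∈ V)))
    {x y : Q} (hxy : T2Quotient.mk x = T2Quotient.mk y) (hx : τ x ∈ O) : r x y := by
  -- Identify whole fibres of `τ` outside `O`, and only `r`-related points of a fibre over `O`. The
  -- quotient is Hausdorff: points over different values of `τ` are separated in `T`, the others by
  -- `hsep`. Hence the maximal Hausdorff quotient identifies no more than `s` does.
  let s : Setoid Q :=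
    { r := fun x y => τ x = τ y ∧ (τ x ∈ O → r x y)
      iseqv :=
        { refl := fun x => ⟨rfl, fun _ => hr.refl x⟩
          symm := fun {x y} h => ⟨h.1.symm, fun h' => hr.symm (h.2 (h.1 ▸ h'))⟩
          trans := fun {x y z} h h' => ⟨h.1.trans h'.1, fun h'' =>
            hr.trans (h.2 h'') (h'.2 (h.1 ▸ h''))⟩ } }
  have hsat : ∀ {U : Set Q}, IsOpen U → (∀ a b, s a b → (a ∈ U ↔ b ∈ U)) →
      IsOpen ((Quotient.mk s) '' U) ∧ (Quotient.mk s) ⁻¹' ((Quotient.mk s) '' U) = U := by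
    intro U hU hUs
    have : (Quotient.mk s) ⁻¹' ((Quotient.mk s) '' U) = U := by
      refine Subset.antisymm ?_ (subset_preimage_image _ _)
      rintro a ⟨b, hb, hab⟩
      exact (hUs b a (Quotient.exact hab)).mp hb
    refine ⟨isQuotientMap_quotient_mk'.isOpen_preimage.mp ?_, this⟩
    exact this.symm ▸ hU
  have hT2 : T2Space (Quotient s) := by
    rw [t2Space_iff]
    intro a b
    refine Quotient.inductionOn₂ a b fun a b hab => ?_
    by_cases hτab : τ a = τ b
    · by_cases hO : τ a ∈ O
      · have hrab : ¬ r a b := fun h => hab (Quotient.sound ⟨hτab, fun _ => h⟩)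
        obtain ⟨U, V, hU, hV, haU, hbV, hd, hsU, hsV⟩ := hsep a b hτab hO hrab
        have h1 := hsat hU fun a b h => hsU a b h.1 h.2
        have h2 := hsat hV fun a b h => hsV a b h.1 h.2
        refine ⟨_, _, h1.1, h2.1, mem_image_of_mem _ haU, mem_image_of_mem _ hbV, ?_⟩
        rw [Set.disjoint_left]
        rintro _ ⟨c, hc, rfl⟩ hc'
        have : c ∈ V := by
          rw [← h2.2]
          exact hc'
        exact Set.disjoint_left.mp hd hc this
      · exact absurd (Quotient.sound (show s a b from ⟨hτab, fun h => absurd h hO⟩)) hab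
    · obtain ⟨U, V, hU, hV, haU, hbV, hd⟩ := t2_separation hτab
      have h1 := hsat (hU.preimage hτ) fun a b h => by simp [h.1]
      have h2 := hsat (hV.preimage hτ) fun a b h => by simp [h.1]
      refine ⟨_, _, h1.1, h2.1, mem_image_of_mem _ haU, mem_image_of_mem _ hbV, ?_⟩
      rw [Set.disjoint_left]
      rintro _ ⟨c, hc, rfl⟩ hc'
      have : c ∈ τ ⁻¹' V := by
        rw [← h2.2]
        exact hc'
      exact Set.disjoint_left.mp hd hc this
  exact (T2Quotient.mk_eq.mp hxy s hT2).2 hx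

/-- Disjoint open sets in `K` pull back to open sets over `O` that are saturated for the relation `f
a = f b`. Thus a continuous map to a Hausdorff space descends to the Hausdorff quotient even if it
is only defined over an open set of `T`. -/
theorem eq_of_t2Quotient_mk_eq {Q T K : Type*} [TopologicalSpace Q] [TopologicalSpace T] [T2Space T]
    [TopologicalSpace K] [T2Space K]
    {τ : Q → T} (hτ : Continuous τ) {O : Set T} (hO : IsOpen O) {f : Q → K}
    (hf : ContinuousOn f (τ ⁻¹' O))
    {x y : Q} (hxy : T2Quotient.mk x = T2Quotient.mk y) (hx : τ x ∈ O) : f x = f y := by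
  refine rel_of_t2Quotient_mk_eq (r := fun a b => f a = f b) hτ
    ⟨fun _ => rfl, fun h => h.symm, fun h h' => h.trans h'⟩ ?_ hxy hx
  intro a b hab ha hne
  obtain ⟨U, V, hU, hV, haU, hbV, hd⟩ := t2_separation hne
  refine ⟨_, _, hf.isOpen_inter_preimage (hO.preimage hτ) hU,
    hf.isOpen_inter_preimage (hO.preimage hτ) hV, ⟨ha, haU⟩,
    ⟨by rw [mem_preimage, ← hab]; exact ha, hbV⟩, ?_, ?_, ?_⟩
  · exact (hd.preimage f).mono inter_subset_right inter_subset_right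
  · intro c d hcd h
    simp only [mem_inter_iff, mem_preimage, ← hcd]
    exact and_congr_right fun h' => by rw [h h']
  · intro c d hcd h
    simp only [mem_inter_iff, mem_preimage, ← hcd]
    exact and_congr_right fun h' => by rw [h h']

/-! ### Calculus of morphisms and orbit spaces of groupoids -/

namespace SseGroupoid

variable {n : ℕ} {H : Type} [TopologicalSpace H]
  {I : ModelWithCorners ℝ (EuclideanSpace ℝ (Fin n)) H}

section mul

variable (X : SseGroupoid.{u} I)

open Classical in
/-- The composition of morphisms, with a junk value if they are not composable. -/
noncomputable def mul (δ γ : X.Mor) : X.Mor :=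
  if h : X.src δ = X.tgt γ then X.comp δ γ h else γ

variable {X}

theorem mul_eq {δ γ : X.Mor} (h : X.src δ = X.tgt γ) : X.mul δ γ = X.comp δ γ h := dif_pos h

@[simp] theorem src_mul (δ γ : X.Mor) : X.src (X.mul δ γ) = X.src γ := by
  unfold mul
  split_ifs with h
  · exact X.src_comp _ _ h
  · rfl

theorem tgt_mul {δ γ : X.Mor} (h : X.src δ = X.tgt γ) : X.tgt (X.mul δ γ) = X.tgt δ := by
  rw [mul_eq h, X.tgt_comp]

theorem one_mul {γ : X.Mor} {x : X.Obj} (h : X.tgt γ = x) : X.mul (X.one x) γ = γ := by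
  subst h
  rw [mul_eq (X.src_one _), X.one_comp]

theorem mul_one {γ : X.Mor} {x : X.Obj} (h : X.src γ = x) : X.mul γ (X.one x) = γ := by
  subst h
  rw [mul_eq (X.tgt_one _).symm, X.comp_one]

theorem inv_mul (γ : X.Mor) : X.mul (X.inv γ) γ = X.one (X.src γ) := by
  rw [mul_eq (X.src_inv γ), X.inv_comp]

theorem mul_inv (γ : X.Mor) : X.mul γ (X.inv γ) = X.one (X.tgt γ) := by
  rw [mul_eq (X.tgt_inv γ).symm, X.comp_inv]

theorem mul_assoc {ε δ γ : X.Mor} (h₁ : X.src ε = X.tgt δ) (h₂ : X.src δ = X.tgt γ) :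
    X.mul (X.mul ε δ) γ = X.mul ε (X.mul δ γ) := by
  rw [mul_eq (δ := X.mul ε δ) (by simpa using h₂), mul_eq (δ := ε) (γ := X.mul δ γ)
    (by rw [tgt_mul h₂, h₁])]
  simp only [mul_eq h₁, mul_eq h₂]
  exact X.assoc ε δ γ h₁ h₂

theorem inv_mul_cancel_left {δ γ : X.Mor} (h : X.src δ = X.tgt γ) :
    X.mul (X.inv δ) (X.mul δ γ) = γ := by
  rw [← mul_assoc (X.src_inv δ) h, inv_mul, one_mul h.symm]

theorem mul_inv_cancel_left {δ γ : X.Mor} (h : X.tgt δ = X.tgt γ) :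
    X.mul δ (X.mul (X.inv δ) γ) = γ := by
  rw [← mul_assoc (X.tgt_inv δ).symm (by rw [X.src_inv, h]), mul_inv, one_mul h.symm]

theorem mul_inv_cancel_right {δ γ : X.Mor} (h : X.src δ = X.tgt γ) :
    X.mul (X.mul δ γ) (X.inv γ) = δ := by
  rw [mul_assoc h (X.tgt_inv γ).symm, mul_inv, mul_one h]

theorem inv_mul_cancel_right {δ γ : X.Mor} (h : X.src δ = X.src γ) :
    X.mul (X.mul δ (X.inv γ)) γ = δ := by
  rw [mul_assoc (by rw [X.tgt_inv, h]) (X.src_inv γ), inv_mul, mul_one h]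

theorem mul_left_cancel {δ γ γ' : X.Mor} (h : X.src δ = X.tgt γ) (h' : X.src δ = X.tgt γ')
    (heq : X.mul δ γ = X.mul δ γ') : γ = γ' := by
  rw [← inv_mul_cancel_left h, heq, inv_mul_cancel_left h']

theorem mul_right_cancel {δ δ' γ : X.Mor} (h : X.src δ = X.tgt γ) (h' : X.src δ' = X.tgt γ)
    (heq : X.mul δ γ = X.mul δ' γ) : δ = δ' := by
  rw [← mul_inv_cancel_right h, heq, mul_inv_cancel_right h']

theorem eq_inv_of_mul_eq_one {δ γ : X.Mor} (h : X.src δ = X.tgt γ)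
    (heq : X.mul δ γ = X.one (X.src γ)) : δ = X.inv γ := by
  rw [← mul_inv_cancel_right h, heq, one_mul (X.tgt_inv γ)]

@[simp] theorem inv_inv (γ : X.Mor) : X.inv (X.inv γ) = γ :=
  (eq_inv_of_mul_eq_one (X.tgt_inv γ).symm (by rw [mul_inv, X.src_inv])).symm

theorem mul_inv_rev {δ γ : X.Mor} (h : X.src δ = X.tgt γ) :
    X.inv (X.mul δ γ) = X.mul (X.inv γ) (X.inv δ) := by
  have h1 : X.src (X.inv γ) = X.tgt (X.inv δ) := by rw [X.src_inv, X.tgt_inv, h]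
  refine (eq_inv_of_mul_eq_one ?_ ?_).symm
  · rw [src_mul, X.src_inv, tgt_mul h]
  · rw [mul_assoc h1 (by rw [X.src_inv, tgt_mul h]), inv_mul_cancel_left h, inv_mul, src_mul]

theorem inv_one (x : X.Obj) : X.inv (X.one x) = X.one x :=
  (eq_inv_of_mul_eq_one (by rw [X.src_one, X.tgt_one])
    (by rw [one_mul (X.tgt_one x), X.src_one])).symm

theorem continuous_src (X : SseGroupoid.{u} I) : Continuous X.src := X.src_localDiffeo.continuous
theorem continuous_tgt (X : SseGroupoid.{u} I) : Continuous X.tgt := X.tgt_localDiffeo.continuous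
theorem continuous_inv (X : SseGroupoid.{u} I) : Continuous X.inv := X.inv_localDiffeo.continuous
theorem continuous_one (X : SseGroupoid.{u} I) : Continuous X.one := X.one_localDiffeo.continuous

/-- `mul` is continuous only along composable pairs, so composability is required eventually along
the filter as well as in the limit. -/
theorem tendsto_mul {Z : Type*} {l : Filter Z} {f g : Z → X.Mor} {δ γ : X.Mor}
    (hf : Tendsto f l (𝓝 δ)) (hg : Tendsto g l (𝓝 γ)) (h₀ : X.src δ = X.tgt γ)
    (h : ∀ᶠ z in l, X.src (f z) = X.tgt (g z)) :
    Tendsto (fun z => X.mul (f z) (g z)) l (𝓝 (X.mul δ γ)) := by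
  have hc : ContinuousOn (fun p : X.Mor × X.Mor => X.mul p.1 p.2)
      {p | X.src p.1 = X.tgt p.2} := by
    rw [continuousOn_iff_continuous_domRestrict]
    exact X.continuous_comp.congr fun p => (mul_eq p.2).symm
  have h1 : Tendsto (fun z => (f z, g z)) l (𝓝[{p | X.src p.1 = X.tgt p.2}] (δ, γ)) :=
    tendsto_nhdsWithin_iff.mpr ⟨hf.prodMk_nhds hg, h⟩
  exact (hc (δ, γ) h₀).tendsto.comp h1

end mul

section orbit

variable (X : SseGroupoid.{u} I)

theorem proj_eq_iff {x y : X.Obj} :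
    X.proj x = X.proj y ↔ ∃ γ : X.Mor, X.src γ = x ∧ X.tgt γ = y :=
  ⟨fun h => Quotient.exact h, fun h => Quotient.sound h⟩

theorem proj_src_eq (γ : X.Mor) : X.proj (X.src γ) = X.proj (X.tgt γ) :=
  X.proj_eq_iff.mpr ⟨γ, rfl, rfl⟩

theorem isOpenQuotientMap_proj : IsOpenQuotientMap X.proj := by
  refine ⟨Quotient.mk_surjective, continuous_quotient_mk', fun U hU => ?_⟩
  refine isQuotientMap_quotient_mk'.isOpen_preimage.mp ?_
  have : (Quotient.mk X.setoid) ⁻¹' (X.proj '' U) = X.tgt '' (X.src ⁻¹' U) := by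
    ext y
    constructor
    · rintro ⟨x, hx, hxy⟩
      obtain ⟨γ, h₁, h₂⟩ := Quotient.exact hxy
      exact ⟨γ, by simpa [h₁] using hx, h₂⟩
    · rintro ⟨γ, hγ, rfl⟩
      exact ⟨X.src γ, hγ, Quotient.sound ⟨γ, rfl, rfl⟩⟩
  exact this ▸ X.tgt_localDiffeo.isLocalDiffeomorph.isOpenMap _ (hU.preimage X.continuous_src)

theorem continuous_proj : Continuous X.proj := X.isOpenQuotientMap_proj.continuous

theorem continuous_projH : Continuous X.projH :=
  (T2Quotient.continuous_mk _).comp X.continuous_proj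

theorem projH_surjective : Function.Surjective X.projH :=
  (T2Quotient.surjective_mk _).comp Quotient.mk_surjective

/-- The map `s × t` is proper. -/
def IsProper : Prop := IsProperMap fun γ : X.Mor => (X.src γ, X.tgt γ)

variable {X}

theorem IsProper.t2Space (hX : X.IsProper) : T2Space X.Orbit := by
  rw [t2Space_iff_of_isOpenQuotientMap X.isOpenQuotientMap_proj]
  have : {q : X.Obj × X.Obj | X.proj q.1 = X.proj q.2} =
      Set.range fun γ : X.Mor => (X.src γ, X.tgt γ) := by
    ext ⟨x, y⟩
    constructor
    · intro h
      obtain ⟨γ, h₁, h₂⟩ := Quotient.exact h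
      exact ⟨γ, Prod.ext h₁ h₂⟩
    · rintro ⟨γ, h⟩
      obtain ⟨rfl, rfl⟩ := Prod.ext_iff.mp h
      exact Quotient.sound ⟨γ, rfl, rfl⟩
  rw [this]
  exact hX.isClosedMap.isClosed_range

/-- Near a pair of objects, all morphisms are near one of the morphisms between them. -/
theorem IsProper.eventually_mem (hX : X.IsProper) {x y : X.Obj} {W : Set X.Mor} (hW : IsOpen W)
    (h : ∀ γ, X.src γ = x → X.tgt γ = y → γ ∈ W) :
    ∀ᶠ p in 𝓝 (x, y), ∀ γ, X.src γ = p.1 → X.tgt γ = p.2 → γ ∈ W := by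
  have h1 : IsClosed ((fun γ : X.Mor => (X.src γ, X.tgt γ)) '' Wᶜ) :=
    hX.isClosedMap _ hW.isClosed_compl
  have h2 : (x, y) ∉ (fun γ : X.Mor => (X.src γ, X.tgt γ)) '' Wᶜ := by
    rintro ⟨γ, hγ, h'⟩
    exact hγ (h γ (congrArg Prod.fst h') (congrArg Prod.snd h'))
  filter_upwards [h1.isOpen_compl.mem_nhds h2] with p hp γ h1 h2
  by_contra hγ
  exact hp ⟨γ, hγ, Prod.ext h1 h2⟩

variable (X) in
/-- The order of the stabilizer. -/
noncomputable def order (x : X.Obj) : ℕ := Set.ncard {γ : X.Mor | X.src γ = x ∧ X.tgt γ = x}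

theorem finite_hom (x y : X.Obj) : {γ : X.Mor | X.src γ = x ∧ X.tgt γ = y}.Finite := by
  rcases Set.eq_empty_or_nonempty {γ : X.Mor | X.src γ = x ∧ X.tgt γ = y} with h | ⟨δ, h1, h2⟩
  · rw [h]
    exact finite_empty
  · refine Set.Finite.of_finite_image (f := fun γ => X.mul (X.inv δ) γ) ((X.stable x).subset ?_) ?_
    · rintro _ ⟨γ, ⟨h3, h4⟩, rfl⟩
      refine ⟨by simp [h3], ?_⟩
      rw [tgt_mul (by rw [X.src_inv, h2, h4]), X.tgt_inv, h1]
    · rintro γ ⟨_, h4⟩ γ' ⟨_, h4'⟩ h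
      exact mul_left_cancel (by rw [X.src_inv, h2, h4]) (by rw [X.src_inv, h2, h4']) h

theorem ncard_hom {x y : X.Obj} (δ : X.Mor) (h1 : X.src δ = x) (h2 : X.tgt δ = y) :
    Set.ncard {γ : X.Mor | X.src γ = x ∧ X.tgt γ = y} = X.order x := by
  refine (Set.ncard_congr (fun γ _ => X.mul δ γ) ?_ ?_ ?_).symm
  · rintro γ ⟨h3, h4⟩
    refine ⟨by simp [h3], ?_⟩
    rw [tgt_mul (by rw [h1, h4]), h2]
  · rintro γ γ' ⟨_, h4⟩ ⟨_, h4'⟩ h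
    exact mul_left_cancel (by rw [h1, h4]) (by rw [h1, h4']) h
  · rintro γ ⟨h3, h4⟩
    refine ⟨X.mul (X.inv δ) γ, ⟨by simp [h3], ?_⟩, mul_inv_cancel_left (by rw [h2, h4])⟩
    rw [tgt_mul (by rw [X.src_inv, h2, h4]), X.tgt_inv, h1]

theorem order_pos (x : X.Obj) : 0 < X.order x :=
  (Set.ncard_pos (X.stable x)).mpr ⟨X.one x, X.src_one x, X.tgt_one x⟩

theorem order_eq (δ : X.Mor) : X.order (X.src δ) = X.order (X.tgt δ) := by
  rw [← ncard_hom δ rfl rfl, ← ncard_hom (X.inv δ) (X.src_inv δ) (X.tgt_inv δ)]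
  refine Set.ncard_congr (fun γ _ => X.inv γ) ?_ ?_ ?_
  · rintro γ ⟨h3, h4⟩
    exact ⟨(X.src_inv γ).trans h4, (X.tgt_inv γ).trans h3⟩
  · intro γ γ' _ _ h
    rw [← inv_inv γ, h, inv_inv]
  · rintro γ ⟨h3, h4⟩
    exact ⟨X.inv γ, ⟨(X.src_inv γ).trans h4, (X.tgt_inv γ).trans h3⟩, inv_inv γ⟩

theorem order_congr {x y : X.Obj} (h : X.proj x = X.proj y) : X.order x = X.order y := by
  obtain ⟨γ, rfl, rfl⟩ := X.proj_eq_iff.mp h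
  exact order_eq γ

end orbit

end SseGroupoid

/-! ### Étale equivalence relations over a groupoid -/

section EtaleRel

variable {n : ℕ} {H : Type} [TopologicalSpace H]
  {I : ModelWithCorners ℝ (EuclideanSpace ℝ (Fin n)) H}

open SseGroupoid

/-- A space `N` étale over the objects of the groupoid `Y`, with an open groupoid of morphisms
lying over those of `Y`: `rel a g b` means that `g` lifts to a morphism from `a` to `b`. -/
structure EtaleRel (Y : SseGroupoid.{u} I) where
  N : Type u
  [top : TopologicalSpace N]
  pr : N → Y.Obj
  etale : IsLocalHomeomorph pr
  rel : N → Y.Mor → N → Prop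
  src_eq : ∀ {a g b}, rel a g b → Y.src g = pr a
  tgt_eq : ∀ {a g b}, rel a g b → Y.tgt g = pr b
  refl : ∀ a, rel a (Y.one (pr a)) a
  symm : ∀ {a g b}, rel a g b → rel b (Y.inv g) a
  trans : ∀ {a g b h c}, rel a g b → rel b h c → rel a (Y.mul h g) c
  isOpen : ∀ {a g b}, rel a g b → ∀ᶠ t : N × Y.Mor × N in 𝓝 (a, g, b),
    Y.src t.2.1 = pr t.1 → Y.tgt t.2.1 = pr t.2.2 → rel t.1 t.2.1 t.2.2

attribute [instance] EtaleRel.top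

/-- Pairs `(a, g)` with `g` starting at `pr a` form a space étale over the objects through the
target of `g`: lift the target to a morphism, then lift its source to `N`. The last clause says that
nearby pairs lie on this section. -/
theorem exists_section_pair {Y : SseGroupoid.{u} I} {N : Type*} [TopologicalSpace N]
    {pr : N → Y.Obj} (hpr : IsLocalHomeomorph pr) {a : N} {g : Y.Mor} (h : Y.src g = pr a) :
    ∃ (σ : Y.Obj → N) (γ : Y.Obj → Y.Mor) (U : Set Y.Obj), IsOpen U ∧ Y.tgt g ∈ U ∧
      ContinuousOn σ U ∧ ContinuousOn γ U ∧ σ (Y.tgt g) = a ∧ γ (Y.tgt g) = g ∧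
      (∀ y ∈ U, Y.src (γ y) = pr (σ y) ∧ Y.tgt (γ y) = y) ∧
      ∀ᶠ p : N × Y.Mor in 𝓝 (a, g), Y.src p.2 = pr p.1 →
        p.1 = σ (Y.tgt p.2) ∧ p.2 = γ (Y.tgt p.2) := by
  obtain ⟨s, U, hU, hgU, hs, hsU, hsg, hs'⟩ :=
    exists_section Y.tgt_localDiffeo.isLocalHomeomorph g
  obtain ⟨r, V, hV, haV, hr, hrV, hra, hr'⟩ := exists_section hpr a
  have hc : ContinuousOn (fun y => Y.src (s y)) U := Y.continuous_src.comp_continuousOn hs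
  refine ⟨fun y => r (Y.src (s y)), s, U ∩ (fun y => Y.src (s y)) ⁻¹' V,
    hc.isOpen_inter_preimage hU hV, ⟨hgU, ?_⟩, ?_, hs.mono inter_subset_left, ?_, hsg, ?_, ?_⟩
  · simpa [hsg, h] using haV
  · exact hr.comp (hc.mono inter_subset_left) fun y hy => hy.2
  · simp [hsg, h, hra]
  · rintro y ⟨hy1, hy2⟩
    exact ⟨(hrV _ hy2).symm, hsU y hy1⟩
  · have h1 : ∀ᶠ p : N × Y.Mor in 𝓝 (a, g), s (Y.tgt p.2) = p.2 :=
      (continuous_snd.tendsto (a, g)).eventually hs'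
    have h2 : ∀ᶠ p : N × Y.Mor in 𝓝 (a, g), r (pr p.1) = p.1 :=
      (continuous_fst.tendsto (a, g)).eventually hr'
    filter_upwards [h1, h2] with p h1 h2 h3
    exact ⟨by rw [h1, h3, h2], h1.symm⟩

namespace EtaleRel

variable {Y : SseGroupoid.{u} I} (R : EtaleRel Y)

theorem eventually_rel {R : EtaleRel Y} {a : R.N} {g : Y.Mor} {b : R.N} (h : R.rel a g b)
    {Z : Type*} {l : Filter Z} {a' : Z → R.N} {g' : Z → Y.Mor} {b' : Z → R.N}
    (ha : Tendsto a' l (𝓝 a)) (hg : Tendsto g' l (𝓝 g)) (hb : Tendsto b' l (𝓝 b))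
    (hs : ∀ᶠ z in l, Y.src (g' z) = R.pr (a' z)) (ht : ∀ᶠ z in l, Y.tgt (g' z) = R.pr (b' z)) :
    ∀ᶠ z in l, R.rel (a' z) (g' z) (b' z) := by
  filter_upwards [(ha.prodMk_nhds (hg.prodMk_nhds hb)).eventually (R.isOpen h), hs, ht]
    with z h1 h2 h3 using h1 h2 h3

/-- The space of morphisms of the relation. -/
abbrev RelMor : Type u := {t : R.N × Y.Mor × R.N // R.rel t.1 t.2.1 t.2.2}

/-- Near `(a, g, b)` the ends of a related triple are recovered from the source and the target of
its morphism through local inverses of `pr`, and openness of the relation makes the recovered triple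
related. -/
theorem isLocalHomeomorph_relMor : IsLocalHomeomorph fun t : R.RelMor => t.1.2.1 := by
  refine isLocalHomeomorph_of_sections (by fun_prop) ?_
  rintro ⟨⟨a, g, b⟩, h⟩
  obtain ⟨s, U, hU, haU, hs, hsU, hsa, hs'⟩ := exists_section R.etale a
  obtain ⟨r, V, hV, hbV, hr, hrV, hrb, hr'⟩ := exists_section R.etale b
  have hsrc := R.src_eq h
  have htgt := R.tgt_eq h
  have h1 : Tendsto (fun g' => s (Y.src g')) (𝓝 g) (𝓝 a) := by
    have := (hs.continuousAt (hU.mem_nhds haU)).tendsto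
    rw [hsa, ← hsrc] at this
    exact this.comp (Y.continuous_src.tendsto g)
  have h2 : Tendsto (fun g' => r (Y.tgt g')) (𝓝 g) (𝓝 b) := by
    have := (hr.continuousAt (hV.mem_nhds hbV)).tendsto
    rw [hrb, ← htgt] at this
    exact this.comp (Y.continuous_tgt.tendsto g)
  have hUg : ∀ᶠ g' in 𝓝 g, Y.src g' ∈ U :=
    Y.continuous_src.continuousAt.eventually (hU.mem_nhds (hsrc ▸ haU))
  have hVg : ∀ᶠ g' in 𝓝 g, Y.tgt g' ∈ V :=
    Y.continuous_tgt.continuousAt.eventually (hV.mem_nhds (htgt ▸ hbV))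
  have h3 := eventually_rel h h1 tendsto_id h2
    (by filter_upwards [hUg] with z hz using (hsU _ hz).symm)
    (by filter_upwards [hVg] with z hz using (hrV _ hz).symm)
  obtain ⟨W, hW, hWo, hgW⟩ := eventually_nhds_iff.mp (h3.and (hUg.and hVg))
  classical
  -- Off `W` the lifted triple need not be related, so the section takes the constant value `(a, g,
  -- b)` there.
  refine ⟨fun g' => if hg' : g' ∈ W then ⟨(s (Y.src g'), g', r (Y.tgt g')), (hW g' hg').1⟩
    else ⟨(a, g, b), h⟩, W, hWo, hgW, ?_, ?_, ?_⟩
  · rw [continuousOn_iff_continuous_domRestrict]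
    refine continuous_induced_rng.mpr ?_
    have h4 : Continuous fun g' : W => (s (Y.src g'), (g' : Y.Mor), r (Y.tgt g')) := by
      refine Continuous.prodMk ?_ (Continuous.prodMk continuous_subtype_val ?_)
      · exact hs.comp_continuous (Y.continuous_src.comp continuous_subtype_val)
          fun g' => (hW g' g'.2).2.1
      · exact hr.comp_continuous (Y.continuous_tgt.comp continuous_subtype_val)
          fun g' => (hW g' g'.2).2.2
    convert h4 using 1
    ext1 g'
    simp
  · intro g' hg'
    simp [hg']
  · have c1 : Tendsto (fun t : R.RelMor => t.1.1) (𝓝 ⟨(a, g, b), h⟩) (𝓝 a) :=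
      Continuous.tendsto (by fun_prop : Continuous fun t : R.RelMor => t.1.1) ⟨(a, g, b), h⟩
    have c2 : Tendsto (fun t : R.RelMor => t.1.2.1) (𝓝 ⟨(a, g, b), h⟩) (𝓝 g) :=
      Continuous.tendsto (by fun_prop : Continuous fun t : R.RelMor => t.1.2.1) ⟨(a, g, b), h⟩
    have c3 : Tendsto (fun t : R.RelMor => t.1.2.2) (𝓝 ⟨(a, g, b), h⟩) (𝓝 b) :=
      Continuous.tendsto (by fun_prop : Continuous fun t : R.RelMor => t.1.2.2) ⟨(a, g, b), h⟩
    filter_upwards [c1.eventually hs', c3.eventually hr', c2.eventually (hWo.mem_nhds hgW)]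
      with t e1 e2 e3
    have e1' : s (Y.src t.1.2.1) = t.1.1 := by rw [R.src_eq t.2, e1]
    have e2' : r (Y.tgt t.1.2.1) = t.1.2.2 := by rw [R.tgt_eq t.2, e2]
    rw [dif_pos (show t.1.2.1 ∈ W from e3)]
    exact Subtype.ext (Prod.ext e1' (Prod.ext rfl e2'))

variable [T2Space R.N] [SecondCountableTopology R.N]

instance : SecondCountableTopology R.RelMor :=
  Topology.IsInducing.subtypeVal.secondCountableTopology

/-- The groupoid defined by an étale relation. -/
noncomputable def toSse : SseGroupoid.{u} I where
  Obj := Y.Obj.pullback R.pr R.etale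
  Mor := Y.Mor.pullback (fun t : R.RelMor => t.1.2.1) R.isLocalHomeomorph_relMor
  src t := t.1.1
  tgt t := t.1.2.2
  one a := ⟨(a, Y.one (R.pr a), a), R.refl a⟩
  inv t := ⟨(t.1.2.2, Y.inv t.1.2.1, t.1.1), R.symm t.2⟩
  comp δ γ h := ⟨(γ.1.1, Y.mul δ.1.2.1 γ.1.2.1, δ.1.2.2),
    R.trans γ.2 ((show δ.1.1 = γ.1.2.2 from h) ▸ δ.2)⟩
  src_one _ := rfl
  tgt_one _ := rfl
  src_inv _ := rfl
  tgt_inv _ := rfl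
  src_comp _ _ _ := rfl
  tgt_comp _ _ _ := rfl
  one_comp γ := Subtype.ext (Prod.ext rfl (Prod.ext (one_mul (R.tgt_eq γ.2)) rfl))
  comp_one γ := Subtype.ext (Prod.ext rfl (Prod.ext (mul_one (R.src_eq γ.2)) rfl))
  inv_comp γ := by
    refine Subtype.ext (Prod.ext rfl (Prod.ext ?_ rfl))
    exact (inv_mul γ.1.2.1).trans (congrArg _ (R.src_eq γ.2))
  comp_inv γ := by
    refine Subtype.ext (Prod.ext rfl (Prod.ext ?_ rfl))
    exact (mul_inv γ.1.2.1).trans (congrArg _ (R.tgt_eq γ.2))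
  assoc ε δ γ h₁ h₂ := by
    refine Subtype.ext (Prod.ext rfl (Prod.ext ?_ rfl))
    refine mul_assoc ?_ ?_
    · rw [R.src_eq ε.2, R.tgt_eq δ.2]
      exact congrArg _ h₁
    · rw [R.src_eq δ.2, R.tgt_eq γ.2]
      exact congrArg _ h₂
  -- Source and target lift the source and target of `Y` through `pr`; identity and inverse lift
  -- those of `Y` through the projection to `Y.Mor`.
  src_localDiffeo := by
    refine (Y.Obj.isOrientedLocalDiffeo_pullback R.pr R.etale).of_comp ?_ ?_
    · exact (by fun_prop : Continuous fun t : R.RelMor => t.1.1)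
    · have := Y.src_localDiffeo.comp
        (Y.Mor.isOrientedLocalDiffeo_pullback _ R.isLocalHomeomorph_relMor)
      exact this.congr fun t => R.src_eq (Subtype.prop (p := fun t :
        R.N × Y.Mor × R.N => R.rel t.1 t.2.1 t.2.2) t)
  tgt_localDiffeo := by
    refine (Y.Obj.isOrientedLocalDiffeo_pullback R.pr R.etale).of_comp ?_ ?_
    · exact (by fun_prop : Continuous fun t : R.RelMor => t.1.2.2)
    · have := Y.tgt_localDiffeo.comp
        (Y.Mor.isOrientedLocalDiffeo_pullback _ R.isLocalHomeomorph_relMor)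
      exact this.congr fun t => R.tgt_eq (Subtype.prop (p := fun t :
        R.N × Y.Mor × R.N => R.rel t.1 t.2.1 t.2.2) t)
  one_localDiffeo := by
    refine (Y.Mor.isOrientedLocalDiffeo_pullback _ R.isLocalHomeomorph_relMor).of_comp ?_ ?_
    · refine Continuous.subtype_mk (continuous_id.prodMk (Continuous.prodMk ?_ continuous_id)) _
      exact Y.continuous_one.comp R.etale.continuous
    · exact Y.one_localDiffeo.comp (Y.Obj.isOrientedLocalDiffeo_pullback R.pr R.etale)
  inv_localDiffeo := by
    refine (Y.Mor.isOrientedLocalDiffeo_pullback _ R.isLocalHomeomorph_relMor).of_comp ?_ ?_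
    · have h1 : Continuous fun t : R.RelMor => Y.inv t.1.2.1 :=
        Y.continuous_inv.comp (by fun_prop)
      exact Continuous.subtype_mk ((by fun_prop : Continuous fun t : R.RelMor => t.1.2.2).prodMk
        (h1.prodMk (by fun_prop : Continuous fun t : R.RelMor => t.1.1))) _
    · exact Y.inv_localDiffeo.comp
        (Y.Mor.isOrientedLocalDiffeo_pullback _ R.isLocalHomeomorph_relMor)
  continuous_comp := by
    have h1 : Continuous fun p : {p : R.RelMor × R.RelMor // p.1.1.1 = p.2.1.2.2} =>
        Y.mul p.1.1.1.2.1 p.1.2.1.2.1 := by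
      rw [continuous_iff_continuousAt]
      intro p
      have hp : ∀ p : {p : R.RelMor × R.RelMor // p.1.1.1 = p.2.1.2.2},
          Y.src p.1.1.1.2.1 = Y.tgt p.1.2.1.2.1 := fun p => by
        rw [R.src_eq p.1.1.2, R.tgt_eq p.1.2.2, p.2]
      refine tendsto_mul (Continuous.tendsto (by fun_prop) _)
        (Continuous.tendsto (by fun_prop) _) (hp p) (Eventually.of_forall hp)
    refine Continuous.subtype_mk (Continuous.prodMk ?_ (h1.prodMk ?_)) _
    · exact (by fun_prop : Continuous fun p : {p : R.RelMor × R.RelMor // p.1.1.1 = p.2.1.2.2} =>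
        p.1.2.1.1)
    · exact (by fun_prop : Continuous fun p : {p : R.RelMor × R.RelMor // p.1.1.1 = p.2.1.2.2} =>
        p.1.1.1.2.2)
  stable a := by
    refine Set.Finite.of_finite_image (f := fun t : R.RelMor => t.1.2.1)
      ((Y.stable (R.pr a)).subset ?_) ?_
    · rintro _ ⟨t, ⟨rfl, h⟩, rfl⟩
      exact ⟨R.src_eq t.2, (R.tgt_eq t.2).trans (congrArg _ h)⟩
    · rintro t ⟨h1, h2⟩ t' ⟨h1', h2'⟩ h
      exact Subtype.ext (Prod.ext (h1.trans h1'.symm) (Prod.ext h (h2.trans h2'.symm)))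

/-- The projection of the groupoid of an étale relation to its base. -/
noncomputable def toBase : SmoothFunctor R.toSse Y where
  obj := R.pr
  mor := fun t : R.RelMor => t.1.2.1
  contMDiff_obj := (Y.Obj.isOrientedLocalDiffeo_pullback R.pr R.etale).contMDiff
  contMDiff_mor := (Y.Mor.isOrientedLocalDiffeo_pullback _ R.isLocalHomeomorph_relMor).contMDiff
  src_mor t := R.src_eq t.2
  tgt_mor t := R.tgt_eq t.2
  mor_one _ := rfl
  mor_comp _ _ _ := mul_eq _

theorem toBase_localDiffeo : IsOrientedLocalDiffeo R.toSse.Obj Y.Obj R.toBase.obj :=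
  Y.Obj.isOrientedLocalDiffeo_pullback R.pr R.etale

end EtaleRel

end EtaleRel

end BranchedResolution

namespace BranchedResolution

namespace SseGroupoid

/-! ### Slices of proper groupoids -/

section Slice

variable {n : ℕ} {H : Type} [TopologicalSpace H]
  {I : ModelWithCorners ℝ (EuclideanSpace ℝ (Fin n)) H}

/-- The stabilizer of an object. -/
def stab (X : SseGroupoid.{u} I) (x : X.Obj) : Set X.Mor := {γ | X.src γ = x ∧ X.tgt γ = x}

/-- An open neighbourhood `P` of the object `x` on which the stabilizer of `x` acts, such that all
morphisms between objects of `P` come from this action. -/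
structure Slice (X : SseGroupoid.{u} I) (x : X.Obj) where
  P : Set X.Obj
  isOpen : IsOpen P
  mem : x ∈ P
  sec : X.Mor → X.Obj → X.Mor
  cont : ∀ g ∈ X.stab x, ContinuousOn (sec g) P
  src_sec : ∀ g ∈ X.stab x, ∀ y ∈ P, X.src (sec g y) = y
  tgt_mem : ∀ g ∈ X.stab x, ∀ y ∈ P, X.tgt (sec g y) ∈ P
  sec_self : ∀ g ∈ X.stab x, sec g x = g
  exists_sec : ∀ γ, X.src γ ∈ P → X.tgt γ ∈ P → ∃ g ∈ X.stab x, γ = sec g (X.src γ)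
  sec_mul : ∀ g ∈ X.stab x, ∀ h ∈ X.stab x, ∀ y ∈ P,
    X.mul (sec g (X.tgt (sec h y))) (sec h y) = sec (X.mul g h) y
  sec_inj : ∀ g ∈ X.stab x, ∀ h ∈ X.stab x, ∀ y ∈ P, sec g y = sec h y → g = h

variable {X : SseGroupoid.{u} I}

theorem one_mem_stab (x : X.Obj) : X.one x ∈ X.stab x := ⟨X.src_one x, X.tgt_one x⟩

theorem mul_mem_stab {x : X.Obj} {g h : X.Mor} (hg : g ∈ X.stab x) (hh : h ∈ X.stab x) :
    X.mul g h ∈ X.stab x :=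
  ⟨by rw [src_mul, hh.1], by rw [tgt_mul (hg.1.trans hh.2.symm), hg.2]⟩

/-- Every `g` in the finite stabilizer extends to a local inverse `s g` of the source. By properness
all morphisms with both ends near `x` are near the stabilizer, hence lie on these sections. The
group law holds nearby because a morphism near a stabilizer element is determined by its source. -/
theorem IsProper.exists_slice (hX : X.IsProper) {x : X.Obj} {V : Set X.Obj} (hV : V ∈ 𝓝 x) :
    ∃ S : X.Slice x, S.P ⊆ V := by
  choose s U hU hgU hs hsU hsg hs' using
    fun g : X.Mor => exists_section X.src_localDiffeo.isLocalHomeomorph g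
  have hfin : (X.stab x).Finite := X.stable x
  -- Disjoint neighbourhoods of the stabilizer elements keep different sections apart; they give
  -- `sec_inj`.
  obtain ⟨D, hD, hDd⟩ := hfin.t2_separation
  have hA : ∀ g : X.Mor, ∃ A : Set X.Mor, IsOpen A ∧ g ∈ A ∧ A ⊆ D g ∧
      ∀ γ ∈ A, s g (X.src γ) = γ := by
    intro g
    obtain ⟨A, hA, hAo, hgA⟩ := eventually_nhds_iff.mp
      ((hs' g).and ((hD g).2.mem_nhds (hD g).1))
    exact ⟨A, hAo, hgA, fun γ hγ => (hA γ hγ).2, fun γ hγ => (hA γ hγ).1⟩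
  choose A hAo hgA hAD hAs using hA
  have hev := hX.eventually_mem (x := x) (y := x) (W := ⋃ g ∈ X.stab x, A g)
    (isOpen_biUnion fun g _ => hAo g) fun γ h1 h2 => mem_biUnion (show γ ∈ X.stab x from ⟨h1, h2⟩)
      (hgA γ)
  rw [nhds_prod_eq] at hev
  obtain ⟨Q, hQ, hQA⟩ := mem_prod_self_iff.mp hev
  have htend : ∀ g ∈ X.stab x, Tendsto (s g) (𝓝 x) (𝓝 g) := by
    intro g hg
    have := ((hs g).continuousAt ((hU g).mem_nhds (hgU g))).tendsto
    rwa [hsg, hg.1] at this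
  have htt : ∀ g ∈ X.stab x, Tendsto (fun y => X.tgt (s g y)) (𝓝 x) (𝓝 x) := by
    intro g hg
    have := (X.continuous_tgt.tendsto g).comp (htend g hg)
    rwa [hg.2] at this
  have e1 : ∀ᶠ y in 𝓝 x, ∀ g ∈ X.stab x, y ∈ U g ∧ s g y ∈ A g := by
    refine hfin.eventually_all.mpr fun g hg => ?_
    exact (show ∀ᶠ y in 𝓝 x, y ∈ U g from (hU g).mem_nhds (hg.1 ▸ hgU g)).and ((htend g hg).eventually ((hAo g).mem_nhds (hgA g)))
  -- The product of two sections tends to `mul g h`, so it enters the neighbourhood on which `s (mul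
  -- g h)` inverts the source.
  have e2 : ∀ᶠ y in 𝓝 x, ∀ g ∈ X.stab x, ∀ h ∈ X.stab x, X.tgt (s h y) ∈ U g ∧
      X.mul (s g (X.tgt (s h y))) (s h y) ∈ A (X.mul g h) := by
    refine hfin.eventually_all.mpr fun g hg => hfin.eventually_all.mpr fun h hh => ?_
    have h1 : ∀ᶠ y in 𝓝 x, X.tgt (s h y) ∈ U g :=
      (htt h hh).eventually ((hU g).mem_nhds (hg.1 ▸ hgU g))
    refine h1.and ?_
    have h2 := tendsto_mul ((htend g hg).comp (htt h hh)) (htend h hh) (hg.1.trans hh.2.symm)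
      (by filter_upwards [h1] with y hy using hsU g _ hy)
    exact h2.eventually ((hAo _).mem_nhds (hgA _))
  obtain ⟨Q₂, hQ₂, hQo, hxQ⟩ := eventually_nhds_iff.mp
    ((e1.and e2).and (((show ∀ᶠ y in 𝓝 x, y ∈ Q from hQ)).and (show ∀ᶠ y in 𝓝 x, y ∈ V from hV)))
  have hcont : ∀ g ∈ X.stab x, ContinuousOn (s g) Q₂ := fun g hg =>
    (hs g).mono fun y hy => ((hQ₂ y hy).1.1 g hg).1
  have hsrc : ∀ g ∈ X.stab x, ∀ y ∈ Q₂, X.src (s g y) = y := fun g hg y hy =>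
    hsU g y ((hQ₂ y hy).1.1 g hg).1
  have hmul : ∀ g ∈ X.stab x, ∀ h ∈ X.stab x, ∀ y ∈ Q₂,
      X.mul (s g (X.tgt (s h y))) (s h y) = s (X.mul g h) y := by
    intro g hg h hh y hy
    have := hAs _ _ ((hQ₂ y hy).1.2 g hg h hh).2
    rw [← this, src_mul, hsrc h hh y hy]
  have hsub : {y | y ∈ Q₂ ∧ ∀ g ∈ X.stab x, X.tgt (s g y) ∈ Q₂} ⊆ Q₂ := fun y hy => hy.1
  -- The points all of whose translates stay in `Q₂`: this set is invariant, since a translate of a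
  -- translate is a translate.
  refine ⟨{ P := {y | y ∈ Q₂ ∧ ∀ g ∈ X.stab x, X.tgt (s g y) ∈ Q₂}
            isOpen := ?_
            mem := ⟨hxQ, fun g hg => ?_⟩
            sec := s
            cont := fun g hg => (hcont g hg).mono hsub
            src_sec := fun g hg y hy => hsrc g hg y hy.1
            tgt_mem := fun g hg y hy => ⟨hy.2 g hg, fun h hh => ?_⟩
            sec_self := fun g hg => ?_
            exists_sec := fun γ h1 h2 => ?_
            sec_mul := fun g hg h hh y hy => hmul g hg h hh y hy.1
            sec_inj := fun g hg h hh y hy heq => ?_ }, fun y hy => (hQ₂ y hy.1).2.2⟩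
  · have : {y | y ∈ Q₂ ∧ ∀ g ∈ X.stab x, X.tgt (s g y) ∈ Q₂} =
        Q₂ ∩ ⋂ g ∈ X.stab x, (Q₂ ∩ (fun y => X.tgt (s g y)) ⁻¹' Q₂) := by
      ext y
      simp only [mem_ofPred_eq, mem_inter_iff, mem_iInter, mem_preimage]
      exact ⟨fun h => ⟨h.1, fun g hg => ⟨h.1, h.2 g hg⟩⟩, fun h => ⟨h.1, fun g hg => (h.2 g hg).2⟩⟩
    rw [this]
    refine hQo.inter (hfin.isOpen_biInter fun g hg => ?_)
    exact (X.continuous_tgt.comp_continuousOn (hcont g hg)).isOpen_inter_preimage hQo hQo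
  · have := hsg g
    rw [hg.1] at this
    rwa [this, hg.2]
  · have h3 : X.tgt (s h (X.tgt (s g y))) = X.tgt (s (X.mul h g) y) := by
      rw [← hmul h hh g hg y hy.1, tgt_mul (hsrc h hh _ (hy.2 g hg))]
    rw [h3]
    exact hy.2 _ (mul_mem_stab hh hg)
  · have := hsg g
    rwa [hg.1] at this
  · have h3 : γ ∈ ⋃ g ∈ X.stab x, A g :=
      hQA (show (X.src γ, X.tgt γ) ∈ Q ×ˢ Q from ⟨(hQ₂ _ h1.1).2.1, (hQ₂ _ h2.1).2.1⟩) γ rfl rfl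
    obtain ⟨g, hg, hγ⟩ := mem_iUnion₂.mp h3
    exact ⟨g, hg, (hAs g γ hγ).symm⟩
  · by_contra hne
    refine Set.disjoint_left.mp (hDd hg hh hne) (hAD g ((hQ₂ y hy.1).1.1 g hg).2) ?_
    rw [heq]
    exact hAD h ((hQ₂ y hy.1).1.1 h hh).2

namespace Slice

variable {x : X.Obj} (S : X.Slice x)

theorem sec_one {y : X.Obj} (hy : y ∈ S.P) : S.sec (X.one x) y = X.one y := by
  obtain ⟨k, hk, hyk⟩ := S.exists_sec (X.one y) (by rwa [X.src_one]) (by rwa [X.tgt_one])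
  rw [X.src_one] at hyk
  have := S.sec_mul _ (one_mem_stab x) k hk y hy
  rw [← hyk, X.tgt_one, mul_one (S.src_sec _ (one_mem_stab x) y hy), one_mul hk.2, ← hyk] at this
  exact this

theorem exists_tgt_sec {y z : X.Obj} (hy : y ∈ S.P) (hz : z ∈ S.P) (h : X.proj y = X.proj z) :
    ∃ g ∈ X.stab x, X.tgt (S.sec g y) = z := by
  obtain ⟨γ, rfl, rfl⟩ := X.proj_eq_iff.mp h
  obtain ⟨g, hg, hγ⟩ := S.exists_sec γ hy hz
  exact ⟨g, hg, by rw [← hγ]⟩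

theorem proj_tgt_sec {g : X.Mor} (hg : g ∈ X.stab x) {y : X.Obj} (hy : y ∈ S.P) :
    X.proj (X.tgt (S.sec g y)) = X.proj y := by
  rw [← X.proj_src_eq, S.src_sec g hg y hy]

theorem finite_orbit {y : X.Obj} (hy : y ∈ S.P) : {z | z ∈ S.P ∧ X.proj z = X.proj y}.Finite := by
  have : (X.stab x).Finite := X.stable x
  refine (this.image fun g => X.tgt (S.sec g y)).subset ?_
  rintro z ⟨hz, hzy⟩
  obtain ⟨g, hg, h⟩ := S.exists_tgt_sec hy hz hzy.symm
  exact ⟨g, hg, h⟩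

/-- Orbit-stabilizer count: the morphisms from `y` into `P` correspond to the stabilizer of `x`;
group them by their targets, each of which receives as many morphisms as the stabilizer of `y` has
elements. -/
theorem ncard_orbit_mul_order {y : X.Obj} (hy : y ∈ S.P) :
    Set.ncard {z | z ∈ S.P ∧ X.proj z = X.proj y} * X.order y = X.order x := by
  classical
  have hfin : (X.stab x).Finite := X.stable x
  have hO := S.finite_orbit hy
  have hF : {γ : X.Mor | X.src γ = y ∧ X.tgt γ ∈ S.P} = (fun g => S.sec g y) '' X.stab x := by
    ext γ
    constructor
    · rintro ⟨rfl, h2⟩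
      obtain ⟨g, hg, h⟩ := S.exists_sec γ hy h2
      exact ⟨g, hg, h.symm⟩
    · rintro ⟨g, hg, rfl⟩
      exact ⟨S.src_sec g hg y hy, S.tgt_mem g hg y hy⟩
  have hFfin : {γ : X.Mor | X.src γ = y ∧ X.tgt γ ∈ S.P}.Finite := hF ▸ hfin.image _
  have h1 : Set.ncard {γ : X.Mor | X.src γ = y ∧ X.tgt γ ∈ S.P} = X.order x := by
    rw [hF]
    exact Set.InjOn.ncard_image fun g hg h hh heq => S.sec_inj g hg h hh y hy heq
  rw [← h1, Set.ncard_eq_toFinset_card _ hFfin, Set.ncard_eq_toFinset_card _ hO,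
    Finset.card_eq_sum_card_fiberwise (f := X.tgt) (t := hO.toFinset)]
  · rw [Finset.sum_const_nat (m := X.order y)]
    intro z hz
    simp only [Finite.mem_toFinset, mem_ofPred_eq] at hz
    obtain ⟨δ, hδ, hδ'⟩ := X.proj_eq_iff.mp hz.2.symm
    rw [← ncard_hom δ hδ hδ', ← Set.ncard_coe_finset]
    congr 1
    ext γ
    simp only [Finset.coe_filter, Finite.mem_toFinset, mem_ofPred_eq]
    constructor
    · rintro ⟨h, h'⟩
      exact ⟨h.1, h'⟩
    · rintro ⟨h, h'⟩
      exact ⟨⟨h, h' ▸ hz.1⟩, h'⟩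
  · intro γ hγ
    simp only [Finite.coe_toFinset, mem_ofPred_eq] at hγ ⊢
    exact ⟨hγ.2, by rw [← X.proj_src_eq, hγ.1]⟩

theorem isOpen_proj_image : IsOpen (X.proj '' S.P) := X.isOpenQuotientMap_proj.isOpenMap _ S.isOpen

/-- If the ultrafilter avoids a neighbourhood of every translate of `y`, choose one for each of the
finitely many stabilizer elements. The points of `P` equivalent to points near `y` lie in the union
of these neighbourhoods, and an ultrafilter containing a finite union contains one of its members.
-/
theorem exists_le_nhds {𝒱 : Ultrafilter X.Obj} (hP : S.P ∈ 𝒱) {y : X.Obj} (hy : y ∈ S.P)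
    (h : Tendsto X.proj 𝒱 (𝓝 (X.proj y))) :
    ∃ z ∈ S.P, X.proj z = X.proj y ∧ (𝒱 : Filter X.Obj) ≤ 𝓝 z := by
  by_contra! hcon
  have hfin : (X.stab x).Finite := X.stable x
  have hV : ∀ g : X.Mor, ∃ V : Set X.Obj, g ∈ X.stab x →
      IsOpen V ∧ X.tgt (S.sec g y) ∈ V ∧ V ∉ 𝒱 := by
    intro g
    by_cases hg : g ∈ X.stab x
    · have h1 := hcon _ (S.tgt_mem g hg y hy) (S.proj_tgt_sec hg hy)
      rw [Filter.not_le] at h1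
      obtain ⟨V, hV, hV'⟩ := h1
      obtain ⟨W, hWV, hW, hyW⟩ := mem_nhds_iff.mp hV
      exact ⟨W, fun _ => ⟨hW, hyW, fun h => hV' (mem_of_superset h hWV)⟩⟩
    · exact ⟨∅, fun h => absurd h hg⟩
  choose V hV using hV
  have hW : {v | v ∈ S.P ∧ ∀ g ∈ X.stab x, X.tgt (S.sec g v) ∈ V g} ∈ 𝓝 y := by
    refine Filter.inter_mem (S.isOpen.mem_nhds hy) (hfin.eventually_all.mpr fun g hg => ?_)
    have := (X.continuous_tgt.comp_continuousOn (S.cont g hg)).continuousAt (S.isOpen.mem_nhds hy)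
    exact this.eventually ((hV g hg).1.mem_nhds (hV g hg).2.1)
  have hO := h (X.isOpenQuotientMap_proj.isOpenMap.image_mem_nhds hW)
  have hsub : S.P ∩ X.proj ⁻¹' (X.proj '' {v | v ∈ S.P ∧ ∀ g ∈ X.stab x, X.tgt (S.sec g v) ∈ V g}) ⊆
      ⋃ g ∈ X.stab x, V g := by
    rintro z ⟨hz, v, ⟨hv, hv'⟩, hvz⟩
    obtain ⟨g, hg, rfl⟩ := S.exists_tgt_sec hv hz hvz
    exact mem_biUnion hg (hv' g hg)
  have := mem_of_superset (Filter.inter_mem hP hO) hsub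
  rw [Ultrafilter.mem_coe, Ultrafilter.finite_biUnion_mem_iff hfin] at this
  obtain ⟨g, hg, hg'⟩ := this
  exact (hV g hg).2.2 hg'

end Slice

end Slice

end SseGroupoid

end BranchedResolution

namespace BranchedResolution

open SseGroupoid

/-! ### Layers, germs, frames and weights -/

section Layer

variable {n : ℕ} {H : Type} [TopologicalSpace H]
  {I : ModelWithCorners ℝ (EuclideanSpace ℝ (Fin n)) H}

theorem SmoothFunctor.mor_mul {X Y : SseGroupoid.{u} I} (F : SmoothFunctor X Y) {δ γ : X.Mor}
    (h : X.src δ = X.tgt γ) : F.mor (X.mul δ γ) = Y.mul (F.mor δ) (F.mor γ) := by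
  rw [mul_eq h, F.mor_comp, mul_eq]

theorem SmoothFunctor.mor_inv {X Y : SseGroupoid.{u} I} (F : SmoothFunctor X Y) (γ : X.Mor) :
    F.mor (X.inv γ) = Y.inv (F.mor γ) := by
  refine eq_inv_of_mul_eq_one ?_ ?_
  · rw [F.src_mor, F.tgt_mor, X.src_inv]
  · rw [← F.mor_mul (X.src_inv γ), inv_mul, F.mor_one, F.src_mor]

theorem SseGroupoid.IsNonsingular.hom_unique {X : SseGroupoid.{u} I} (hX : X.IsNonsingular)
    {α β : X.Mor} (h1 : X.src α = X.src β) (h2 : X.tgt α = X.tgt β) : α = β := by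
  have h3 : X.src (X.inv β) = X.tgt α := by rw [X.src_inv, h2]
  have := hX (X.mul (X.inv β) α) (by rw [src_mul, tgt_mul h3, X.tgt_inv, h1])
  rw [src_mul] at this
  have := eq_inv_of_mul_eq_one (δ := X.inv β) h3 this
  rw [← inv_inv β, this, inv_inv]

/-- A nonsingular groupoid, étale over the groupoid `Y`. -/
structure Layer (Y : SseGroupoid.{u} I) where
  grp : SseGroupoid.{u} I
  nonsingular : grp.IsNonsingular
  F : SmoothFunctor grp Y
  etale : IsOrientedLocalDiffeo grp.Obj Y.Obj F.obj

namespace Layer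

variable {Y : SseGroupoid.{u} I} (L : Layer Y)

/-- The morphisms `g : F a → y` and `h : F b → y` define the same point of the fibre of `L`
over `y`. -/
def Germ (a : L.grp.Obj) (g : Y.Mor) (b : L.grp.Obj) (h : Y.Mor) : Prop :=
  Y.src h = L.F.obj b ∧ ∃ α, L.grp.src α = a ∧ L.grp.tgt α = b ∧ g = Y.mul h (L.F.mor α)

namespace Germ

variable {L} {a b c : L.grp.Obj} {g h k : Y.Mor}

theorem src_left (H : L.Germ a g b h) : Y.src g = L.F.obj a := by
  obtain ⟨-, α, rfl, rfl, rfl⟩ := H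
  rw [src_mul, L.F.src_mor]

theorem comp_aux {α : L.grp.Mor} (h1 : Y.src h = L.F.obj b) (h2 : L.grp.tgt α = b) :
    Y.src h = Y.tgt (L.F.mor α) := by rw [h1, L.F.tgt_mor, h2]

theorem tgt_eq (H : L.Germ a g b h) : Y.tgt g = Y.tgt h := by
  obtain ⟨h1, α, h2, h3, rfl⟩ := H
  rw [tgt_mul (comp_aux h1 h3)]

theorem refl (h : Y.src g = L.F.obj a) : L.Germ a g a g := by
  refine ⟨h, L.grp.one a, L.grp.src_one a, L.grp.tgt_one a, ?_⟩
  rw [L.F.mor_one, mul_one h]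

theorem symm (H : L.Germ a g b h) : L.Germ b h a g := by
  refine ⟨H.src_left, ?_⟩
  obtain ⟨h1, α, h2, h3, rfl⟩ := H
  refine ⟨L.grp.inv α, by rw [L.grp.src_inv, h3], by rw [L.grp.tgt_inv, h2], ?_⟩
  rw [L.F.mor_inv, mul_inv_cancel_right (comp_aux h1 h3)]

theorem trans (H : L.Germ a g b h) (H' : L.Germ b h c k) : L.Germ a g c k := by
  refine ⟨H'.1, ?_⟩
  obtain ⟨h1, α, h2, h3, rfl⟩ := H
  obtain ⟨h1', β, h2', h3', rfl⟩ := H'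
  have h4 : L.grp.src β = L.grp.tgt α := by rw [h2', h3]
  refine ⟨L.grp.mul β α, by rw [src_mul, h2], by rw [tgt_mul h4, h3'], ?_⟩
  rw [L.F.mor_mul h4, mul_assoc (comp_aux h1' h3') (by rw [L.F.src_mor, L.F.tgt_mor, h4])]

theorem mul_left (H : L.Germ a g b h) (hk : Y.src k = Y.tgt g) :
    L.Germ a (Y.mul k g) b (Y.mul k h) := by
  have h5 := H.tgt_eq
  obtain ⟨h1, α, h2, h3, rfl⟩ := H
  refine ⟨by rw [src_mul, h1], α, h2, h3, ?_⟩
  rw [mul_assoc (hk.trans h5) (comp_aux h1 h3)]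

theorem proj_eq (H : L.Germ a g b h) : L.grp.proj a = L.grp.proj b := by
  obtain ⟨-, α, rfl, rfl, -⟩ := H
  exact L.grp.proj_src_eq α

theorem of_mor {α : L.grp.Mor} (h1 : L.grp.src α = a) (h2 : L.grp.tgt α = b)
    (h3 : Y.src h = L.F.obj b) : L.Germ a (Y.mul h (L.F.mor α)) b h :=
  ⟨h3, α, h1, h2, rfl⟩

/-- Germ equality is an open condition. Lift `a'` to a morphism near `α`; its image and `h'⁻¹ g'`
have the same source and the same limit, so they agree, and then the targets agree because the layer
is étale over `Y`. -/
theorem eventually (H : L.Germ a g b h) {Z : Type*} {l : Filter Z} {a' b' : Z → L.grp.Obj}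
    {g' h' : Z → Y.Mor} (ha : Tendsto a' l (𝓝 a)) (hg : Tendsto g' l (𝓝 g))
    (hb : Tendsto b' l (𝓝 b)) (hh : Tendsto h' l (𝓝 h))
    (hg' : ∀ᶠ z in l, Y.src (g' z) = L.F.obj (a' z))
    (hh' : ∀ᶠ z in l, Y.src (h' z) = L.F.obj (b' z))
    (ht : ∀ᶠ z in l, Y.tgt (g' z) = Y.tgt (h' z)) :
    ∀ᶠ z in l, L.Germ (a' z) (g' z) (b' z) (h' z) := by
  have h0 := H.tgt_eq
  obtain ⟨h1, α, h2, h3, h4⟩ := H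
  obtain ⟨s, U, hU, haU, hs, hsU, hsa, hs'⟩ :=
    exists_section L.grp.src_localDiffeo.isLocalHomeomorph α
  have ta : Tendsto (fun z => s (a' z)) l (𝓝 α) := by
    have := (hs.continuousAt (hU.mem_nhds haU)).tendsto
    rw [hsa, h2] at this
    exact this.comp ha
  have tF := (L.F.contMDiff_mor.continuous.tendsto α).comp ta
  have tk : Tendsto (fun z => Y.mul (Y.inv (h' z)) (g' z)) l (𝓝 (L.F.mor α)) := by
    have := tendsto_mul ((Y.continuous_inv.tendsto h).comp hh) hg (by rw [Y.src_inv, h0])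
      (by filter_upwards [ht] with z hz
          simp [Y.src_inv, hz])
    rw [h4, inv_mul_cancel_left (comp_aux h1 h3)] at this
    exact this
  have hU' : ∀ᶠ z in l, a' z ∈ U := ha.eventually (hU.mem_nhds (h2 ▸ haU))
  have e1 := eventually_eq_of_isLocalHomeomorph Y.src_localDiffeo.isLocalHomeomorph tF tk (by
    filter_upwards [hU', hg'] with z hz hz'
    simp [L.F.src_mor, hsU _ hz, hz'])
  have tt : Tendsto (fun z => L.grp.tgt (s (a' z))) l (𝓝 b) := by
    have := (L.grp.continuous_tgt.tendsto α).comp ta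
    rwa [h3] at this
  have e2 := eventually_eq_of_isLocalHomeomorph L.etale.isLocalHomeomorph tt hb (by
    filter_upwards [e1, hh', ht] with z hz hz' hz''
    rw [← L.F.tgt_mor, ← hz', show L.F.mor (s (a' z)) = _ from hz, tgt_mul, Y.tgt_inv]
    rw [Y.src_inv, hz''])
  filter_upwards [e1, e2, hU', hh', ht] with z z1 z2 z3 z4 z5
  refine ⟨z4, s (a' z), hsU _ z3, z2, ?_⟩
  rw [show L.F.mor (s (a' z)) = _ from z1, mul_inv_cancel_left z5.symm]

end Germ

theorem Germ.eq_of_self {L : Layer Y} {a : L.grp.Obj} {g h : Y.Mor} (H : L.Germ a g a h) :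
    g = h := by
  obtain ⟨h1, α, h2, h3, rfl⟩ := H
  rw [L.nonsingular α (h2.trans h3.symm), L.F.mor_one, h2, mul_one h1]

/-- Local sections of a layer over a neighbourhood of `x` that exhaust its fibres. -/
structure Frame (x : Y.Obj) where
  P : Set Y.Obj
  isOpen : IsOpen P
  mem : x ∈ P
  S : Type u
  [fintype : Fintype S]
  pt : S → Y.Obj → L.grp.Obj
  mor : S → Y.Obj → Y.Mor
  cont_pt : ∀ s, ContinuousOn (pt s) P
  cont_mor : ∀ s, ContinuousOn (mor s) P
  src_mor : ∀ s, ∀ y ∈ P, Y.src (mor s y) = L.F.obj (pt s y)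
  tgt_mor : ∀ s, ∀ y ∈ P, Y.tgt (mor s y) = y
  cover : ∀ y ∈ P, ∀ a g, Y.src g = L.F.obj a → Y.tgt g = y → ∃ s, L.Germ a g (pt s y) (mor s y)

attribute [instance] Frame.fintype

/-- A weight on a layer, and a dense open set of generic points. -/
structure Weight where
  gen : Set Y.Orbit
  isOpen_gen : IsOpen gen
  dense_gen : Dense gen
  wt : L.grp.Obj → ℝ
  wt_pos : ∀ a, 0 < wt a
  wt_src : ∀ α : L.grp.Mor, wt (L.grp.src α) = wt (L.grp.tgt α)

variable {L}

/-- Weights on the sections of a frame that induce the given weight over generic points. -/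
structure Frame.IsWeight {x : Y.Obj} (T : L.Frame x) (W : L.Weight) (w : T.S → ℝ) : Prop where
  pos : ∀ s, 0 < w s
  wt_eq : ∀ y ∈ T.P, Y.proj y ∈ W.gen → ∀ a g, Y.src g = L.F.obj a → Y.tgt g = y →
    ∑ s, {s | L.Germ a g (T.pt s y) (T.mor s y)}.indicator w s = W.wt a

/-- A frame with weights of total weight one. -/
structure Sheets (W : L.Weight) (x : Y.Obj) extends L.Frame x where
  w : S → ℝ
  isWeight : toFrame.IsWeight W w
  sum_w : ∑ s, w s = 1
  inj : ∀ s, InjOn (fun y => L.grp.projH (pt s y)) P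

/-- A frame is also a frame at other points, over a smaller set. -/
def Frame.restrict {x : Y.Obj} (T : L.Frame x) {y : Y.Obj} {P : Set Y.Obj} (hP : IsOpen P)
    (hPT : P ⊆ T.P) (hy : y ∈ P) : L.Frame y where
  P := P
  isOpen := hP
  mem := hy
  S := T.S
  pt := T.pt
  mor := T.mor
  cont_pt s := (T.cont_pt s).mono hPT
  cont_mor s := (T.cont_mor s).mono hPT
  src_mor s y hy := T.src_mor s y (hPT hy)
  tgt_mor s y hy := T.tgt_mor s y (hPT hy)
  cover y hy := T.cover y (hPT hy)

/-- Sheets at `x` are also sheets at other points. -/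
def Sheets.restrict {W : L.Weight} {x : Y.Obj} (T : Sheets W x) {y : Y.Obj} {P : Set Y.Obj}
    (hP : IsOpen P) (hPT : P ⊆ T.P) (hy : y ∈ P) : Sheets W y where
  toFrame := T.toFrame.restrict hP hPT hy
  w := T.w
  isWeight := ⟨T.isWeight.pos, fun y hy => T.isWeight.wt_eq y (hPT hy)⟩
  sum_w := T.sum_w
  inj s := (T.inj s).mono hPT

theorem Weight.wt_proj (W : L.Weight) {a b : L.grp.Obj} (h : L.grp.proj a = L.grp.proj b) :
    W.wt a = W.wt b := by
  obtain ⟨α, rfl, rfl⟩ := L.grp.proj_eq_iff.mp h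
  exact W.wt_src α

end Layer

/-- Double counting: both sides equal the sum of `w s * w' s' * φ' s' / c' s'` over all related
pairs, because the weights of the partners of an element add up to the common value `c s = c' s'`.
-/
theorem sum_mul_eq_sum_mul_of_rel {S S' : Type*} [Fintype S] [Fintype S'] (r : S → S' → Prop)
    {w c φ : S → ℝ} {w' c' φ' : S' → ℝ} (hc : ∀ s, 0 < c s) (hc' : ∀ s, 0 < c' s)
    (hcc : ∀ s s', r s s' → c s = c' s') (hφ : ∀ s s', r s s' → φ s = φ' s')
    (h1 : ∀ s, ∑ s', {s' | r s s'}.indicator w' s' = c s)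
    (h2 : ∀ s', ∑ s, {s | r s s'}.indicator w s = c' s') :
    ∑ s, w s * φ s = ∑ s', w' s' * φ' s' := by
  classical
  have e1 : ∀ s, w s * φ s =
      ∑ s', if r s s' then w s * w' s' * φ' s' / c' s' else 0 := by
    intro s
    have : w s * φ s = w s * φ s / c s * ∑ s', {s' | r s s'}.indicator w' s' := by
      rw [h1, div_mul_cancel₀ _ (hc s).ne']
    rw [this, Finset.mul_sum]
    refine Finset.sum_congr rfl fun s' _ => ?_
    by_cases h : r s s'
    · rw [indicator_of_mem (show s' ∈ {s' | r s s'} from h), if_pos h, hφ s s' h, hcc s s' h]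
      ring
    · rw [indicator_of_notMem (show s' ∉ {s' | r s s'} from h), if_neg h, mul_zero]
  have e2 : ∀ s', w' s' * φ' s' =
      ∑ s, if r s s' then w s * w' s' * φ' s' / c' s' else 0 := by
    intro s'
    have : w' s' * φ' s' = w' s' * φ' s' / c' s' * ∑ s, {s | r s s'}.indicator w s := by
      rw [h2, div_mul_cancel₀ _ (hc' s').ne']
    rw [this, Finset.mul_sum]
    refine Finset.sum_congr rfl fun s _ => ?_
    by_cases h : r s s'
    · rw [indicator_of_mem (show s ∈ {s | r s s'} from h), if_pos h]
      ring
    · rw [indicator_of_notMem (show s ∉ {s | r s s'} from h), if_neg h, mul_zero]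
  rw [Finset.sum_congr rfl fun s _ => e1 s, Finset.sum_comm,
    Finset.sum_congr rfl fun s _ => e2 s]

namespace Layer

variable {Y : SseGroupoid.{u} I} {L : Layer Y}

/-- Relate sections of the two frames if they pass through the same germ after transport along `η`.
Over a generic point the sections through a germ have total weight `W.wt` of that germ in either
frame, which is what the double counting needs. -/
theorem sum_comparison {W : L.Weight} {x x' : Y.Obj} {T : L.Frame x} {T' : L.Frame x'}
    {w : T.S → ℝ} {w' : T'.S → ℝ} (hw : T.IsWeight W w) (hw' : T'.IsWeight W w')
    {η : Y.Mor} (hy : Y.src η ∈ T.P) (hy' : Y.tgt η ∈ T'.P) (hgen : Y.proj (Y.src η) ∈ W.gen)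
    {φ : T.S → ℝ} {φ' : T'.S → ℝ}
    (hφ : ∀ s s', L.grp.proj (T.pt s (Y.src η)) = L.grp.proj (T'.pt s' (Y.tgt η)) → φ s = φ' s') :
    ∑ s, w s * φ s = ∑ s, w' s * φ' s := by
  have ht : ∀ s, Y.src η = Y.tgt (T.mor s (Y.src η)) := fun s => (T.tgt_mor s _ hy).symm
  refine sum_mul_eq_sum_mul_of_rel (fun s s' => L.Germ (T.pt s (Y.src η))
    (Y.mul η (T.mor s (Y.src η))) (T'.pt s' (Y.tgt η)) (T'.mor s' (Y.tgt η)))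
    (c := fun s => W.wt (T.pt s (Y.src η))) (c' := fun s => W.wt (T'.pt s (Y.tgt η)))
    (fun _ => W.wt_pos _) (fun _ => W.wt_pos _) (fun s s' h => W.wt_proj h.proj_eq)
    (fun s s' h => hφ s s' h.proj_eq) (fun s => ?_) fun s' => ?_
  · refine hw'.wt_eq _ hy' (Y.proj_src_eq η ▸ hgen) _ _ ?_ (tgt_mul (ht s))
    rw [src_mul, T.src_mor s _ hy]
  · have h0 : Y.src (Y.inv η) = Y.tgt (T'.mor s' (Y.tgt η)) := by
      rw [Y.src_inv, T'.tgt_mor s' _ hy']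
    rw [← hw.wt_eq _ hy hgen (T'.pt s' (Y.tgt η)) (Y.mul (Y.inv η) (T'.mor s' (Y.tgt η)))
      (by rw [src_mul, T'.src_mor s' _ hy']) (by rw [tgt_mul h0, Y.tgt_inv])]
    congr 1
    ext s
    congr 1
    ext s
    constructor
    · intro h
      have h4 := h.symm.mul_left (k := Y.inv η) h0
      rwa [inv_mul_cancel_left (ht s)] at h4
    · intro h
      have h4 := h.symm.mul_left (k := η) (ht s)
      rwa [mul_inv_cancel_left (T'.tgt_mor s' _ hy').symm] at h4

end Layer

end Layer

end BranchedResolution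

namespace BranchedResolution

open SseGroupoid

/-! ### Weighting functions induced by sheets -/

section Induced

variable {n : ℕ} {H : Type} [TopologicalSpace H]
  {I : ModelWithCorners ℝ (EuclideanSpace ℝ (Fin n)) H}

namespace SseGroupoid.Slice

variable {X : SseGroupoid.{u} I} {x : X.Obj}

/-- Take the points of `P` whose translates all lie in the smaller neighbourhood. The action `sec`
is kept, so identities already proved for it survive the shrinking. -/
theorem exists_shrink (S : X.Slice x) {V : Set X.Obj} (hV : V ∈ 𝓝 x) :
    ∃ S' : X.Slice x, S'.P ⊆ S.P ∧ S'.P ⊆ V ∧ S'.sec = S.sec := by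
  obtain ⟨V', hV', hVo, hxV⟩ := mem_nhds_iff.mp hV
  have hfin : (X.stab x).Finite := X.stable x
  have hsub : S.P ∩ ⋂ g ∈ X.stab x, (S.P ∩ (fun y => X.tgt (S.sec g y)) ⁻¹' V') ⊆ S.P :=
    inter_subset_left
  have hmem : ∀ y ∈ S.P ∩ ⋂ g ∈ X.stab x, (S.P ∩ (fun y => X.tgt (S.sec g y)) ⁻¹' V'),
      ∀ g ∈ X.stab x, X.tgt (S.sec g y) ∈ V' := fun y hy g hg => (mem_iInter₂.mp hy.2 g hg).2
  refine ⟨{ P := S.P ∩ ⋂ g ∈ X.stab x, (S.P ∩ (fun y => X.tgt (S.sec g y)) ⁻¹' V')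
            isOpen := ?_
            mem := ?_
            sec := S.sec
            cont := fun g hg => (S.cont g hg).mono hsub
            src_sec := fun g hg y hy => S.src_sec g hg y hy.1
            tgt_mem := fun g hg y hy => ⟨S.tgt_mem g hg y hy.1, mem_iInter₂.mpr fun h hh =>
              ⟨S.tgt_mem g hg y hy.1, ?_⟩⟩
            sec_self := S.sec_self
            exists_sec := fun γ h1 h2 => S.exists_sec γ h1.1 h2.1
            sec_mul := fun g hg h hh y hy => S.sec_mul g hg h hh y hy.1
            sec_inj := fun g hg h hh y hy => S.sec_inj g hg h hh y hy.1 }, hsub, ?_, rfl⟩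
  · refine S.isOpen.inter (hfin.isOpen_biInter fun g hg => ?_)
    exact (X.continuous_tgt.comp_continuousOn (S.cont g hg)).isOpen_inter_preimage S.isOpen hVo
  · refine ⟨S.mem, mem_iInter₂.mpr fun g hg => ⟨S.mem, ?_⟩⟩
    rw [mem_preimage, S.sec_self g hg, hg.2]
    exact hxV
  · have h3 : X.tgt (S.sec h (X.tgt (S.sec g y))) = X.tgt (S.sec (X.mul h g) y) := by
      rw [← S.sec_mul h hh g hg y hy.1,
        tgt_mul (S.src_sec h hh _ (S.tgt_mem g hg y hy.1))]
    rw [mem_preimage, h3]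
    exact hmem y hy _ (mul_mem_stab hh hg)
  · intro y hy
    have := hmem y hy _ (one_mem_stab x)
    rw [S.sec_one hy.1, X.tgt_one] at this
    exact hV' this

end SseGroupoid.Slice

namespace Layer

variable {Y : SseGroupoid.{u} I} {L : Layer Y}

theorem Frame.tendsto_pt {x : Y.Obj} (T : L.Frame x) (s : T.S) {y : Y.Obj} (hy : y ∈ T.P) :
    Tendsto (T.pt s) (𝓝 y) (𝓝 (T.pt s y)) :=
  (T.cont_pt s).continuousAt (T.isOpen.mem_nhds hy)

theorem Frame.tendsto_mor {x : Y.Obj} (T : L.Frame x) (s : T.S) {y : Y.Obj} (hy : y ∈ T.P) :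
    Tendsto (T.mor s) (𝓝 y) (𝓝 (T.mor s y)) :=
  (T.cont_mor s).continuousAt (T.isOpen.mem_nhds hy)

theorem Frame.tendsto_projH {x : Y.Obj} (T : L.Frame x) (s : T.S) {y : Y.Obj} (hy : y ∈ T.P) :
    Tendsto (fun y => L.grp.projH (T.pt s y)) (𝓝 y) (𝓝 (L.grp.projH (T.pt s y))) :=
  (L.grp.continuous_projH.tendsto _).comp (T.tendsto_pt s hy)

theorem Frame.eventually_mem {x : Y.Obj} (T : L.Frame x) : ∀ᶠ y in 𝓝 x, y ∈ T.P :=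
  T.isOpen.mem_nhds T.mem

theorem Frame.proj_pt {x : Y.Obj} (T : L.Frame x) (s : T.S) {y : Y.Obj} (hy : y ∈ T.P) :
    Y.proj (L.F.obj (T.pt s y)) = Y.proj y := by
  rw [← T.src_mor s y hy, Y.proj_src_eq, T.tgt_mor s y hy]

theorem Frame.exists_proj_eq {x : Y.Obj} (T : L.Frame x) {y : Y.Obj} (hy : y ∈ T.P)
    {a : L.grp.Obj} (ha : Y.proj (L.F.obj a) = Y.proj y) :
    ∃ s, L.grp.proj a = L.grp.proj (T.pt s y) := by
  obtain ⟨g, h1, h2⟩ := Y.proj_eq_iff.mp ha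
  obtain ⟨s, hs⟩ := T.cover y hy a g h1 h2
  exact ⟨s, hs.proj_eq⟩

theorem Frame.isOpen_image {x : Y.Obj} (T : L.Frame x) (s : T.S) {O : Set Y.Obj} (hO : IsOpen O)
    (hOP : O ⊆ T.P) : IsOpen (T.pt s '' O) := by
  have h0 : IsLocalHomeomorph (Subtype.val : T.P → Y.Obj) :=
    T.isOpen.isOpenEmbedding_subtypeVal.isLocalHomeomorph
  have h1 : IsLocalHomeomorph fun y : T.P => T.mor s y := by
    refine IsLocalHomeomorph.of_comp (g := Y.tgt) ?_ Y.tgt_localDiffeo.isLocalHomeomorph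
      (continuousOn_iff_continuous_domRestrict.mp (T.cont_mor s))
    convert h0 using 1
    ext1 y
    exact T.tgt_mor s y y.2
  have h2 : IsLocalHomeomorph fun y : T.P => T.pt s y := by
    refine IsLocalHomeomorph.of_comp (g := L.F.obj) ?_ L.etale.isLocalHomeomorph
      (continuousOn_iff_continuous_domRestrict.mp (T.cont_pt s))
    convert Y.src_localDiffeo.isLocalHomeomorph.comp h1 using 1
    ext1 y
    exact (T.src_mor s y y.2).symm
  have h3 : T.pt s '' O = (fun y : T.P => T.pt s y) '' (Subtype.val ⁻¹' O) := by
    ext a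
    constructor
    · rintro ⟨y, hy, rfl⟩
      exact ⟨⟨y, hOP hy⟩, hy, rfl⟩
    · rintro ⟨y, hy, rfl⟩
      exact ⟨y, hy, rfl⟩
  rw [h3]
  exact h2.isOpenMap _ (hO.preimage continuous_subtype_val)

theorem Weight.frequently_gen (W : L.Weight) {x : Y.Obj} {p : Y.Obj → Prop}
    (hp : ∀ᶠ y in 𝓝 x, p y) : ∃ y, p y ∧ Y.proj y ∈ W.gen := by
  obtain ⟨V, hV, hVo, hxV⟩ := mem_nhds_iff.mp hp
  obtain ⟨_, ⟨y, hy, rfl⟩, hg⟩ := W.dense_gen.inter_open_nonempty _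
    (Y.isOpenQuotientMap_proj.isOpenMap V hVo) ⟨_, mem_image_of_mem _ hxV⟩
  exact ⟨y, hV hy, hg⟩

/-- The part of the total weight of a frame lying over a point of the Hausdorff quotient is
independent of choices. -/
theorem sum_indicator_eq {W : L.Weight} {x x' : Y.Obj} (hxx : Y.proj x = Y.proj x')
    (T : Sheets W x) (T' : Sheets W x') (q : L.grp.HOrbit) :
    ∑ s, {s | L.grp.projH (T.pt s x) = q}.indicator T.w s =
      ∑ s, {s | L.grp.projH (T'.pt s x') = q}.indicator T'.w s := by
  classical
  obtain ⟨η, rfl, rfl⟩ := Y.proj_eq_iff.mp hxx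
  obtain ⟨e, U, hU, hηU, he, heU, heη, -⟩ :=
    exists_section Y.src_localDiffeo.isLocalHomeomorph η
  have hfin : (insert q (range (fun s => L.grp.projH (T.pt s (Y.src η))) ∪
      range (fun s => L.grp.projH (T'.pt s (Y.tgt η))))).Finite :=
    ((finite_range _).union (finite_range _)).insert q
  obtain ⟨D, hD, hDd⟩ := hfin.t2_separation
  have key : ∀ r ∈ insert q (range (fun s => L.grp.projH (T.pt s (Y.src η))) ∪
      range (fun s => L.grp.projH (T'.pt s (Y.tgt η)))), ∀ r' ∈ D r, (r = q ↔ r' ∈ D q) := by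
    intro r hr r' hr'
    constructor
    · rintro rfl
      exact hr'
    · intro h
      by_contra hne
      exact Set.disjoint_left.mp (hDd hr (mem_insert _ _) hne) hr' h
  have te : Tendsto (fun y => Y.tgt (e y)) (𝓝 (Y.src η)) (𝓝 (Y.tgt η)) := by
    have := (Y.continuous_tgt.tendsto η).comp (heη ▸ (he.continuousAt (hU.mem_nhds hηU)).tendsto)
    exact this
  have e1 : ∀ᶠ y in 𝓝 (Y.src η), ∀ s, L.grp.projH (T.pt s y) ∈ D (L.grp.projH (T.pt s (Y.src η))) :=
    eventually_all.mpr fun s => (T.tendsto_projH s T.mem).eventually ((hD _).2.mem_nhds (hD _).1)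
  have e2 : ∀ᶠ y in 𝓝 (Y.tgt η), ∀ s, L.grp.projH (T'.pt s y) ∈
      D (L.grp.projH (T'.pt s (Y.tgt η))) :=
    eventually_all.mpr fun s =>
      (T'.tendsto_projH s T'.mem).eventually ((hD _).2.mem_nhds (hD _).1)
  -- At a generic `y` near the source of `η`, a section lies in `D q` exactly if its value at the
  -- limit point is `q`. Comparing there with the indicator function of `D q` gives the claim at the
  -- limit.
  obtain ⟨y, ⟨⟨hy1, hy2, hyU⟩, hy3, hy4⟩, hgen⟩ := W.frequently_gen
    ((e1.and ((te.eventually e2).and (hU.mem_nhds hηU))).and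
      (T.eventually_mem.and (te.eventually T'.eventually_mem)))
  have h0 : Y.src (e y) = y := heU y hyU
  have hcomp := sum_comparison T.isWeight T'.isWeight (η := e y) (by rwa [h0]) hy4 (by rwa [h0])
    (φ := fun s => (D q).indicator (fun _ => 1) (L.grp.projH (T.pt s y)))
    (φ' := fun s => (D q).indicator (fun _ => 1) (L.grp.projH (T'.pt s (Y.tgt (e y))))) (by
      intro s s' h
      rw [h0] at h
      exact congrArg (fun c => (D q).indicator (fun _ => (1 : ℝ)) (T2Quotient.mk c)) h)
  have a1 : ∀ s, {s | L.grp.projH (T.pt s (Y.src η)) = q}.indicator T.w s =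
      T.w s * (D q).indicator (fun _ => 1) (L.grp.projH (T.pt s y)) := by
    intro s
    have := key _ (Or.inr (Or.inl ⟨s, rfl⟩)) _ (hy1 s)
    by_cases h : L.grp.projH (T.pt s (Y.src η)) = q
    · rw [indicator_of_mem (by exact h), indicator_of_mem (this.mp h), _root_.mul_one]
    · rw [indicator_of_notMem (by exact h), indicator_of_notMem (fun h' => h (this.mpr h')), mul_zero]
  have a2 : ∀ s, {s | L.grp.projH (T'.pt s (Y.tgt η)) = q}.indicator T'.w s =
      T'.w s * (D q).indicator (fun _ => 1) (L.grp.projH (T'.pt s (Y.tgt (e y)))) := by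
    intro s
    have := key _ (Or.inr (Or.inr ⟨s, rfl⟩)) _ (hy2 s)
    by_cases h : L.grp.projH (T'.pt s (Y.tgt η)) = q
    · rw [indicator_of_mem (by exact h), indicator_of_mem (this.mp h), _root_.mul_one]
    · rw [indicator_of_notMem (by exact h), indicator_of_notMem (fun h' => h (this.mpr h')), mul_zero]
  rw [Finset.sum_congr rfl fun s _ => a1 s, Finset.sum_congr rfl fun s _ => a2 s, hcomp]

variable [T2Space Y.Orbit]

variable (L) in
/-- The projection of the Hausdorff orbit space of a layer to the orbit space of its base. -/
noncomputable def base : L.grp.HOrbit → Y.Orbit := L.F.orbitMapOfT2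

theorem continuous_base : Continuous L.base := T2Quotient.continuous_lift L.F.continuous_orbitMap

@[simp] theorem base_projH (a : L.grp.Obj) : L.base (L.grp.projH a) = Y.proj (L.F.obj a) :=
  T2Quotient.lift_mk L.F.continuous_orbitMap (L.grp.proj a)

theorem Frame.base_pt {x : Y.Obj} (T : L.Frame x) (s : T.S) {y : Y.Obj} (hy : y ∈ T.P) :
    L.base (L.grp.projH (T.pt s y)) = Y.proj y := by
  rw [base_projH, T.proj_pt s hy]

theorem Frame.exists_projH_eq {x : Y.Obj} (T : L.Frame x) {y : Y.Obj} (hy : y ∈ T.P)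
    {q : L.grp.HOrbit} (hq : L.base q = Y.proj y) : ∃ s, L.grp.projH (T.pt s y) = q := by
  obtain ⟨a, rfl⟩ := L.grp.projH_surjective q
  rw [base_projH] at hq
  obtain ⟨s, hs⟩ := T.exists_proj_eq hy hq
  exact ⟨s, congrArg T2Quotient.mk hs.symm⟩

/-- The weighting function on the Hausdorff orbit space is the one induced by a weight. -/
def IsInduced (W : L.Weight) (κ : Y.Orbit → ℝ) (Λ : L.grp.HOrbit → ℝ) : Prop :=
  ∀ x (T : Sheets W x) q, L.base q = Y.proj x →
    Λ q = κ (Y.proj x) / Y.order x * ∑ s, {s | L.grp.projH (T.pt s x) = q}.indicator T.w s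

theorem isInduced_of_exists {W : L.Weight} {κ : Y.Orbit → ℝ} {Λ : L.grp.HOrbit → ℝ}
    (h : ∀ p, ∃ x, Y.proj x = p ∧ ∃ T : Sheets W x, ∀ q, L.base q = p →
      Λ q = κ p / Y.order x * ∑ s, {s | L.grp.projH (T.pt s x) = q}.indicator T.w s) :
    IsInduced W κ Λ := by
  intro x T q hq
  obtain ⟨x', hx', T', hT'⟩ := h (Y.proj x)
  rw [hT' q hq, order_congr hx', sum_indicator_eq hx'.symm T T']

theorem exists_isInduced (W : L.Weight) (hT : ∀ x, Nonempty (Sheets W x)) (κ : Y.Orbit → ℝ) :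
    ∃ Λ, IsInduced W κ Λ := by
  refine ⟨fun q => κ (L.base q) / Y.order (Quotient.out (L.base q)) *
    ∑ s, {s | L.grp.projH ((hT (Quotient.out (L.base q))).some.pt s
      (Quotient.out (L.base q))) = q}.indicator (hT (Quotient.out (L.base q))).some.w s,
    isInduced_of_exists fun p => ⟨Quotient.out p, Quotient.out_eq p,
      (hT (Quotient.out p)).some, fun q hq => ?_⟩⟩
  subst hq
  rfl

namespace IsInduced

variable {W : L.Weight} {κ : Y.Orbit → ℝ} {Λ : L.grp.HOrbit → ℝ}

theorem eq_sum (h : IsInduced W κ Λ) {x y : Y.Obj} (T : Sheets W x) (hy : y ∈ T.P)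
    {q : L.grp.HOrbit} (hq : L.base q = Y.proj y) :
    Λ q = κ (Y.proj y) / Y.order y * ∑ s, {s | L.grp.projH (T.pt s y) = q}.indicator T.w s :=
  h y (T.restrict T.isOpen subset_rfl hy) q hq

theorem pos (h : IsInduced W κ Λ) (hκ : ∀ p, 0 < κ p) (hT : ∀ x, Nonempty (Sheets W x))
    (q : L.grp.HOrbit) : 0 < Λ q := by
  obtain ⟨x, hx⟩ := Y.isOpenQuotientMap_proj.surjective (L.base q)
  obtain ⟨T⟩ := hT x
  obtain ⟨s, hs⟩ := T.exists_projH_eq T.mem hx.symm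
  rw [h x T q hx.symm]
  refine mul_pos (div_pos (hκ _) (Nat.cast_pos.mpr (order_pos x))) ?_
  refine Finset.sum_pos' (fun s _ => indicator_nonneg (fun s _ => (T.isWeight.pos s).le) _)
    ⟨s, Finset.mem_univ _, ?_⟩
  rw [indicator_of_mem (show s ∈ {s | L.grp.projH (T.pt s x) = q} from hs)]
  exact T.isWeight.pos s

/-- Each section meets exactly one point of the fibre, so summing over the fibre collects all
section weights, of total one. At a smooth point, with the order of the effectively trivial subgroup
as `κ`, the value is one. -/
theorem hasSum (h : IsInduced W κ Λ) (hT : ∀ x, Nonempty (Sheets W x)) (x : Y.Obj) :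
    HasSum (fun q : {q // L.base q = Y.proj x} => Λ q.1) (κ (Y.proj x) / Y.order x) := by
  classical
  obtain ⟨T⟩ := hT x
  have h1 : ∀ q : {q // L.base q = Y.proj x}, Λ q.1 = κ (Y.proj x) / Y.order x *
      ∑ s, if q = ⟨L.grp.projH (T.pt s x), T.base_pt s T.mem⟩ then T.w s else 0 := by
    intro q
    rw [h x T q.1 q.2]
    congr 1
    refine Finset.sum_congr rfl fun s _ => ?_
    by_cases hs : L.grp.projH (T.pt s x) = q.1
    · rw [indicator_of_mem (by exact hs), if_pos (Subtype.ext hs.symm)]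
    · rw [indicator_of_notMem (by exact hs), if_neg fun h => hs (congrArg Subtype.val h).symm]
  have h2 : HasSum (fun q : {q // L.base q = Y.proj x} => ∑ s,
      if q = ⟨L.grp.projH (T.pt s x), T.base_pt s T.mem⟩ then T.w s else 0) (∑ s, T.w s) :=
    hasSum_sum fun s _ => hasSum_ite_eq _ _
  have h3 := h2.mul_left (κ (Y.proj x) / Y.order x)
  rw [T.sum_w, _root_.mul_one] at h3
  exact (funext h1 : (fun q : {q // L.base q = Y.proj x} => Λ q.1) = _) ▸ h3

/-- Over a slice, the weighting function is given by the sections. -/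
theorem eq_sum_image (h : IsInduced W κ Λ) {x y : Y.Obj} (T : Sheets W x) (S : Y.Slice x)
    (hST : S.P ⊆ T.P) (hy : y ∈ S.P) {q : L.grp.HOrbit} (hq : L.base q = Y.proj y) :
    Λ q = κ (Y.proj y) / Y.order x *
      ∑ s, ((fun y => L.grp.projH (T.pt s y)) '' S.P).indicator (fun _ => T.w s) q := by
  classical
  have hO := S.finite_orbit hy
  have h1 : ∀ z ∈ hO.toFinset, Λ q = κ (Y.proj y) / Y.order y *
      ∑ s, {s | L.grp.projH (T.pt s z) = q}.indicator T.w s := by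
    intro z hz
    rw [Finite.mem_toFinset] at hz
    rw [h.eq_sum T (hST hz.1) (hq.trans hz.2.symm), hz.2, order_congr hz.2]
  -- Add the formula for `Λ q` over the orbit of `y` in the slice. By injectivity a section meets
  -- `q` over at most one point of the orbit, and the orbit length times `|G_y|` is `|G_x|`, which
  -- turns the factor `1 / |G_y|` into `1 / |G_x|`.
  have h2 := Finset.sum_congr rfl h1
  rw [Finset.sum_const, ← Finset.mul_sum, Finset.sum_comm, nsmul_eq_mul,
    ← Set.ncard_eq_toFinset_card _ hO] at h2
  have h3 : ∀ s, ∑ z ∈ hO.toFinset, {s | L.grp.projH (T.pt s z) = q}.indicator T.w s =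
      ((fun y => L.grp.projH (T.pt s y)) '' S.P).indicator (fun _ => T.w s) q := by
    intro s
    by_cases hs : q ∈ (fun y => L.grp.projH (T.pt s y)) '' S.P
    · obtain ⟨z, hz, hzq⟩ := id hs
      have hzq' : L.grp.projH (T.pt s z) = q := hzq
      rw [indicator_of_mem hs, Finset.sum_eq_single z]
      · rw [indicator_of_mem (by exact hzq)]
      · intro z' hz' hne
        rw [Finite.mem_toFinset] at hz'
        refine indicator_of_notMem (fun hz'' => hne ?_) _
        exact T.inj s (hST hz'.1) (hST hz) (hz''.trans hzq.symm)
      · intro hz'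
        refine absurd ?_ hz'
        rw [Finite.mem_toFinset]
        refine ⟨hz, ?_⟩
        rw [← hq, ← hzq', T.base_pt s (hST hz)]
    · rw [indicator_of_notMem hs]
      refine Finset.sum_eq_zero fun z hz => indicator_of_notMem (fun hz' => hs ?_) _
      rw [Finite.mem_toFinset] at hz
      exact ⟨z, hz.1, hz'⟩
  rw [Finset.sum_congr rfl fun s _ => h3 s] at h2
  have h4 := S.ncard_orbit_mul_order hy
  have h5 : (Y.order y : ℝ) ≠ 0 := Nat.cast_ne_zero.mpr (order_pos y).ne'
  have h6 : (Y.order x : ℝ) ≠ 0 := Nat.cast_ne_zero.mpr (order_pos x).ne'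
  rw [← h4] at h6 ⊢
  push_cast at h6 ⊢
  have h7 : ((Set.ncard {z | z ∈ S.P ∧ Y.proj z = Y.proj y} : ℕ) : ℝ) ≠ 0 := left_ne_zero_of_mul h6
  rw [div_mul_eq_mul_div, eq_div_iff h5] at h2
  rw [div_mul_eq_mul_div, eq_div_iff h6]
  linarith

end IsInduced

/-- Ultrafilters concentrated on a section of a frame over a slice converge as soon as their
projections do. -/
theorem Frame.exists_le_nhds {x : Y.Obj} (T : L.Frame x) (S : Y.Slice x) (hST : S.P ⊆ T.P)
    (s : T.S) {y : Y.Obj} (hy : y ∈ S.P) {𝒰 : Ultrafilter L.grp.HOrbit}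
    (h1 : (fun y => L.grp.projH (T.pt s y)) '' S.P ∈ 𝒰) (h2 : Tendsto L.base 𝒰 (𝓝 (Y.proj y))) :
    ∃ z ∈ S.P, Y.proj z = Y.proj y ∧ (𝒰 : Filter L.grp.HOrbit) ≤ 𝓝 (L.grp.projH (T.pt s z)) := by
  set 𝒱 := Ultrafilter.ofComapInfPrincipal h1
  have hP : S.P ∈ 𝒱 := Ultrafilter.ofComapInfPrincipal_mem h1
  have hm : 𝒱.map (fun y => L.grp.projH (T.pt s y)) = 𝒰 :=
    Ultrafilter.ofComapInfPrincipal_eq_of_map h1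
  have hm' : Tendsto (fun y => L.grp.projH (T.pt s y)) 𝒱 𝒰 := by
    rw [← hm]
    exact tendsto_map
  have h3 : Tendsto Y.proj 𝒱 (𝓝 (Y.proj y)) := by
    refine (h2.comp hm').congr' ?_
    filter_upwards [hP] with z hz using T.base_pt s (hST hz)
  obtain ⟨z, hz, hzy, hle⟩ := S.exists_le_nhds hP hy h3
  refine ⟨z, hz, hzy, ?_⟩
  rw [← hm]
  exact (T.tendsto_projH s (hST hz)).mono_left hle

/-- Over the image of a slice the Hausdorff orbit space is covered by the images of finitely many
sections. An ultrafilter lies on one of them and can be followed back to the slice, where it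
converges to a translate of `x`. -/
theorem isProperMap_base (hY : Y.IsProper) (hT : ∀ x, Nonempty (L.Frame x)) :
    IsProperMap L.base := by
  rw [isProperMap_iff_ultrafilter]
  refine ⟨continuous_base, fun 𝒰 p hp => ?_⟩
  obtain ⟨x, rfl⟩ := Y.isOpenQuotientMap_proj.surjective p
  obtain ⟨T⟩ := hT x
  obtain ⟨S, hST⟩ := hY.exists_slice (T.isOpen.mem_nhds T.mem)
  have h1 : L.base ⁻¹' (Y.proj '' S.P) ∈ 𝒰 := hp (S.isOpen_proj_image.mem_nhds ⟨x, S.mem, rfl⟩)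
  have h2 : L.base ⁻¹' (Y.proj '' S.P) ⊆ ⋃ s, (fun y => L.grp.projH (T.pt s y)) '' S.P := by
    rintro q ⟨y, hy, hyq⟩
    obtain ⟨s, hs⟩ := T.exists_projH_eq (hST hy) hyq.symm
    exact mem_iUnion.mpr ⟨s, y, hy, hs⟩
  have h3 := mem_of_superset h1 h2
  rw [Ultrafilter.mem_coe, ← biUnion_univ, Ultrafilter.finite_biUnion_mem_iff finite_univ] at h3
  obtain ⟨s, -, hs⟩ := h3
  obtain ⟨z, hz, hzy, hle⟩ := T.exists_le_nhds S hST s S.mem hs hp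
  exact ⟨_, (T.base_pt s (hST hz)).trans hzy, hle⟩

omit [T2Space Y.Orbit] in
/-- Sections of a frame through the same point have the same image over small slices. -/
theorem Frame.eventually_pt_eq {x : Y.Obj} (T : L.Frame x) (S : Y.Slice x) {s t : T.S}
    (hst : T.pt s x = T.pt t x) : ∃ g ∈ Y.stab x,
      ∀ᶠ y in 𝓝 x, T.pt t y = T.pt s (Y.tgt (S.sec g y)) := by
  have hs := T.src_mor s x T.mem
  have ht := T.src_mor t x T.mem
  have hs' := T.tgt_mor s x T.mem
  have ht' := T.tgt_mor t x T.mem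
  have h0 : Y.src (T.mor s x) = Y.tgt (Y.inv (T.mor t x)) := by rw [Y.tgt_inv, hs, ht, hst]
  have hg : Y.mul (T.mor s x) (Y.inv (T.mor t x)) ∈ Y.stab x :=
    ⟨by rw [src_mul, Y.src_inv, ht'], by rw [tgt_mul h0, hs']⟩
  refine ⟨_, hg, ?_⟩
  set g := Y.mul (T.mor s x) (Y.inv (T.mor t x)) with hgdef
  have c1 : Tendsto (S.sec g) (𝓝 x) (𝓝 g) := by
    have := ((S.cont g hg).continuousAt (S.isOpen.mem_nhds S.mem)).tendsto
    rwa [S.sec_self g hg] at this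
  have c2 : Tendsto (fun y => Y.tgt (S.sec g y)) (𝓝 x) (𝓝 x) := by
    have := (Y.continuous_tgt.tendsto g).comp c1
    rwa [hg.2] at this
  have c3 : Tendsto (fun y => Y.mul (Y.inv (S.sec g y)) (T.mor s (Y.tgt (S.sec g y)))) (𝓝 x)
      (𝓝 (T.mor t x)) := by
    have := tendsto_mul ((Y.continuous_inv.tendsto g).comp c1) ((T.tendsto_mor s T.mem).comp c2)
      (by rw [Y.src_inv, hg.2, hs']) (by
        filter_upwards [c2.eventually T.eventually_mem] with y hy
        simp only [Function.comp]
        rw [Y.src_inv, T.tgt_mor s _ hy])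
    rwa [hgdef, mul_inv_rev h0, SseGroupoid.inv_inv, SseGroupoid.mul_assoc (by rw [Y.tgt_inv, hs, ht, hst])
      (by rw [Y.src_inv]), inv_mul, SseGroupoid.mul_one (by rw [ht, hs, hst])] at this
  have e0 : ∀ᶠ y in 𝓝 x, y ∈ S.P := S.isOpen.mem_nhds S.mem
  have e1 := eventually_eq_of_isLocalHomeomorph Y.tgt_localDiffeo.isLocalHomeomorph
    (T.tendsto_mor t T.mem) c3 (by
      filter_upwards [T.eventually_mem, c2.eventually T.eventually_mem, e0] with y hy hy' hy''
      rw [T.tgt_mor t y hy, tgt_mul (by rw [Y.src_inv, T.tgt_mor s _ hy']), Y.tgt_inv,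
        S.src_sec g hg y hy''])
  refine eventually_eq_of_isLocalHomeomorph L.etale.isLocalHomeomorph
    (T.tendsto_pt t T.mem) (hst ▸ (T.tendsto_pt s T.mem).comp c2) ?_
  filter_upwards [e1, T.eventually_mem, c2.eventually T.eventually_mem] with y h1 h2 h3
  rw [← T.src_mor t y h2, h1, src_mul, T.src_mor s _ h3]

/-- Over a small slice, two sections with the same value at `x` differ by a stabilizer element, so
they have the same image. Hence there is one branch for each distinct value at `x`; its weight is `κ
/ |G_x|` times the sum of the weights of the sections with that value. -/
theorem exists_isLocalBranching (hY : Y.IsProper) {W : L.Weight}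
    (hT : ∀ x, Nonempty (Sheets W x)) {κ : Y.Orbit → ℝ} (hκ : ∀ p, 0 < κ p)
    (hκ' : IsLocallyConstant κ) {Λ : L.grp.HOrbit → ℝ} (h : IsInduced W κ Λ) (p : L.grp.HOrbit) :
    ∃ (N : Set L.grp.HOrbit) (ℓ : ℕ) (U : Fin ℓ → Set L.grp.Obj) (m : Fin ℓ → ℝ),
      p ∈ N ∧ IsLocalBranching L.grp Λ N U m := by
  classical
  obtain ⟨x, hx⟩ := Y.isOpenQuotientMap_proj.surjective (L.base p)
  obtain ⟨T⟩ := hT x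
  obtain ⟨S₀, hS₀⟩ := hY.exists_slice (T.isOpen.mem_nhds T.mem)
  -- Sections with different values at `x` stay in disjoint open sets; this makes the branches
  -- disjoint.
  obtain ⟨D, hD, hDd⟩ := (finite_range fun s => T.pt s x).t2_separation
  have e1 : ∀ᶠ y in 𝓝 x, ∀ s, T.pt s y ∈ D (T.pt s x) := eventually_all.mpr fun s =>
    (T.tendsto_pt s T.mem).eventually ((hD _).2.mem_nhds (hD _).1)
  have e2 : ∀ᶠ y in 𝓝 x, κ (Y.proj y) = κ (Y.proj x) :=
    (Y.continuous_proj.tendsto x).eventually (hκ'.eventually_eq (Y.proj x))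
  have e3 : ∀ s t, ∃ g ∈ Y.stab x, T.pt s x = T.pt t x →
      ∀ᶠ y in 𝓝 x, T.pt t y = T.pt s (Y.tgt (S₀.sec g y)) := by
    intro s t
    by_cases hst : T.pt s x = T.pt t x
    · obtain ⟨g, hg, h⟩ := T.eventually_pt_eq S₀ hst
      exact ⟨g, hg, fun _ => h⟩
    · exact ⟨_, one_mem_stab x, fun h => absurd h hst⟩
  choose g hg he3 using e3
  have e4 : ∀ᶠ y in 𝓝 x, ∀ s t, T.pt s x = T.pt t x →
      T.pt t y = T.pt s (Y.tgt (S₀.sec (g s t) y)) := by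
    refine eventually_all.mpr fun s => eventually_all.mpr fun t => ?_
    by_cases hst : T.pt s x = T.pt t x
    · filter_upwards [he3 s t hst] with y hy _ using hy
    · exact Eventually.of_forall fun y h => absurd h hst
  -- The smaller slice keeps the sections of `S₀`, in terms of which the coincidences `e4` were
  -- found.
  obtain ⟨S, hSS₀, hSV, hsec⟩ := S₀.exists_shrink ((e1.and (e2.and e4)) : ∀ᶠ y in 𝓝 x, _)
  have hST : S.P ⊆ T.P := hSS₀.trans hS₀
  have himg : ∀ s t, T.pt s x = T.pt t x → T.pt t '' S.P ⊆ T.pt s '' S.P := by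
    rintro s t hst _ ⟨y, hy, rfl⟩
    refine ⟨Y.tgt (S.sec (g s t) y), S.tgt_mem _ (hg s t) y hy, ?_⟩
    rw [hsec]
    exact ((hSV hy).2.2 s t hst).symm
  set V : Finset L.grp.Obj := Finset.univ.image fun s => T.pt s x
  let e := V.equivFin
  let idx : T.S → Fin V.card := fun s =>
    e ⟨T.pt s x, Finset.mem_image_of_mem _ (Finset.mem_univ s)⟩
  have hidx : Function.Surjective idx := by
    intro i
    obtain ⟨s, -, hs⟩ := Finset.mem_image.mp (e.symm i).2
    refine ⟨s, ?_⟩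
    rw [← e.apply_symm_apply i]
    exact congrArg e (Subtype.ext hs)
  have hidx' : ∀ s t, idx s = idx t → T.pt s x = T.pt t x := fun s t hst =>
    congrArg Subtype.val (e.injective hst)
  -- `r i` is a section representing the branch of index `i`.
  choose r hr using hidx
  have hinj : ∀ s, InjOn L.grp.projH (T.pt s '' S.P) := by
    rintro s _ ⟨y, hy, rfl⟩ _ ⟨z, hz, rfl⟩ hyz
    exact congrArg _ (T.inj s (hST hy) (hST hz) hyz)
  have himg2 : ∀ s, L.grp.projH '' (T.pt s '' S.P) = (fun y => L.grp.projH (T.pt s y)) '' S.P :=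
    fun s => image_image _ _ _
  refine ⟨L.base ⁻¹' (Y.proj '' S.P), V.card, fun i => T.pt (r i) '' S.P,
    fun i => κ (Y.proj x) / Y.order x * ∑ s with idx s = i, T.w s, ⟨x, S.mem, hx⟩, ?_⟩
  constructor
  · exact S.isOpen_proj_image.preimage continuous_base
  · exact fun i => T.isOpen_image _ S.isOpen hST
  · rintro i _ ⟨y, hy, rfl⟩
    exact ⟨y, hy, (T.base_pt _ (hST hy)).symm⟩
  · intro i j hij
    have hne : T.pt (r i) x ≠ T.pt (r j) x := by
      intro h
      apply hij
      rw [← hr i, ← hr j]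
      exact congrArg e (Subtype.ext h)
    refine (hDd ⟨_, rfl⟩ ⟨_, rfl⟩ hne).mono ?_ ?_
    · rintro _ ⟨y, hy, rfl⟩
      exact (hSV hy).1 _
    · rintro _ ⟨y, hy, rfl⟩
      exact (hSV hy).1 _
  · intro i
    refine mul_pos (div_pos (hκ _) (Nat.cast_pos.mpr (order_pos x))) ?_
    exact Finset.sum_pos (fun s _ => T.isWeight.pos s)
      ⟨r i, Finset.mem_filter.mpr ⟨Finset.mem_univ _, hr i⟩⟩
  · ext c
    obtain ⟨a, rfl⟩ := L.grp.isOpenQuotientMap_proj.surjective c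
    simp only [mem_preimage, mem_iUnion]
    constructor
    · rintro ⟨y, hy, hya⟩
      have hya' : Y.proj (L.F.obj a) = Y.proj y := (hya.trans (base_projH a)).symm
      obtain ⟨s, hs⟩ := T.exists_proj_eq (hST hy) hya'
      have h2 := himg (r (idx s)) s (hidx' _ _ (hr _)) ⟨y, hy, rfl⟩
      exact ⟨idx s, _, h2, hs.symm⟩
    · rintro ⟨i, _, ⟨y, hy, rfl⟩, hya⟩
      refine ⟨y, hy, ?_⟩
      rw [← hya]
      exact (T.base_pt _ (hST hy)).symm
  · intro i
    refine ⟨Topology.isInducing_iff_nhds.mpr ?_, ?_⟩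
    · rintro ⟨_, y, hy, rfl⟩
      refine le_antisymm ?_ ?_
      · exact (L.grp.continuous_projH.comp continuous_subtype_val).continuousAt.tendsto.le_comap
      · rw [le_iff_ultrafilter]
        intro 𝒰 h𝒰
        have h1 : Tendsto ((T.pt (r i) '' S.P).domRestrict L.grp.projH) 𝒰
            (𝓝 (L.grp.projH (T.pt (r i) y))) := tendsto_iff_comap.mpr h𝒰
        have h2 : (fun y => L.grp.projH (T.pt (r i) y)) '' S.P ∈
            𝒰.map ((T.pt (r i) '' S.P).domRestrict L.grp.projH) := by
          rw [Ultrafilter.mem_map]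
          refine mem_of_superset univ_mem ?_
          rintro ⟨_, z, hz, rfl⟩ -
          exact ⟨z, hz, rfl⟩
        have hP := Ultrafilter.ofComapInfPrincipal_mem h2
        have hm := Ultrafilter.ofComapInfPrincipal_eq_of_map h2
        set 𝒱 := Ultrafilter.ofComapInfPrincipal h2
        have h3 : Tendsto (fun y => L.grp.projH (T.pt (r i) y)) 𝒱
            (𝓝 (L.grp.projH (T.pt (r i) y))) := by
          have : (𝒱.map (fun y => L.grp.projH (T.pt (r i) y)) : Filter _) ≤
            𝓝 (L.grp.projH (T.pt (r i) y)) := by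
              rw [hm]
              exact h1
          exact this
        have h4 : Tendsto Y.proj 𝒱 (𝓝 (Y.proj y)) := by
          have := (continuous_base.tendsto _).comp h3
          rw [T.base_pt _ (hST hy)] at this
          refine this.congr' ?_
          filter_upwards [hP] with z hz using T.base_pt _ (hST hz)
        obtain ⟨z, hz, hzy, hle⟩ := S.exists_le_nhds hP hy h4
        -- The slice only provides convergence to some translate `z` of `y`. The Hausdorff quotient
        -- forces both to have the same image on the section, and injectivity of the section
        -- identifies them.
        have h5 : z = y := T.inj (r i) (hST hz) (hST hy)
          (tendsto_nhds_unique ((T.tendsto_projH (r i) (hST hz)).mono_left hle) h3)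
        subst h5
        suffices hv : Tendsto (Subtype.val : T.pt (r i) '' S.P → L.grp.Obj) 𝒰
            (𝓝 (T.pt (r i) z)) from
          tendsto_id'.mp (Topology.IsInducing.subtypeVal.tendsto_nhds_iff.mpr hv)
        have h6 : Tendsto (T.pt (r i)) 𝒱 (𝓝 (T.pt (r i) z)) :=
          (T.tendsto_pt (r i) (hST hz)).mono_left hle
        intro A hA
        have h7 : T.pt (r i) ⁻¹' A ∩ S.P ∈ 𝒱 := inter_mem (h6 hA) hP
        have h8 : (fun y => L.grp.projH (T.pt (r i) y)) '' (T.pt (r i) ⁻¹' A ∩ S.P) ∈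
            𝒰.map ((T.pt (r i) '' S.P).domRestrict L.grp.projH) := by
          rw [← hm, Ultrafilter.mem_map]
          exact mem_of_superset h7 (subset_preimage_image _ _)
        rw [Ultrafilter.mem_map] at h8
        change Subtype.val ⁻¹' A ∈ 𝒰
        refine mem_of_superset h8 ?_
        rintro ⟨_, v, hv, rfl⟩ ⟨v', ⟨hv'A, hv'⟩, hvv⟩
        have : v' = v := T.inj (r i) (hST hv') (hST hv) hvv
        subst this
        exact hv'A
    · rintro ⟨a, ha⟩ ⟨b, hb⟩ hab
      exact Subtype.ext (hinj _ ha hb hab)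
  · intro i
    refine ⟨closure (L.grp.projH '' (T.pt (r i) '' S.P)), isClosed_closure, ?_⟩
    refine Subset.antisymm (fun q hq => ⟨?_, subset_closure hq⟩) ?_
    · obtain ⟨_, ⟨y, hy, rfl⟩, rfl⟩ := hq
      exact ⟨y, hy, (T.base_pt _ (hST hy)).symm⟩
    · rintro q ⟨⟨y, hy, hyq⟩, hq⟩
      rw [mem_closure_iff_ultrafilter] at hq
      obtain ⟨𝒰, h1, h2⟩ := hq
      rw [himg2] at h1 ⊢
      obtain ⟨z, hz, -, hle⟩ := T.exists_le_nhds S hST (r i) hy h1 (by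
        rw [hyq]
        exact (continuous_base.tendsto q).mono_left h2)
      exact ⟨z, hz, tendsto_nhds_unique (f := id) hle h2⟩
  · rintro q ⟨y, hy, hyq⟩
    -- Group the sections by their branch: within a group the images, hence the indicator functions,
    -- coincide.
    rw [h.eq_sum_image T S hST hy hyq.symm, (hSV hy).2.1, Finset.mul_sum,
      ← Finset.sum_fiberwise Finset.univ idx]
    refine Finset.sum_congr rfl fun i _ => ?_
    have h1 : ∀ s ∈ Finset.univ.filter (fun s => idx s = i),
        κ (Y.proj x) / Y.order x *
          ((fun y => L.grp.projH (T.pt s y)) '' S.P).indicator (fun _ => T.w s) q =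
        (L.grp.projH '' (T.pt (r i) '' S.P)).indicator
          (fun _ => κ (Y.proj x) / Y.order x * T.w s) q := by
      intro s hs
      have hs' : idx s = i := (Finset.mem_filter.mp hs).2
      have h2 : T.pt (r i) x = T.pt s x := hidx' _ _ ((hr i).trans hs'.symm)
      have h3 : T.pt (r i) '' S.P = T.pt s '' S.P :=
        Subset.antisymm (himg _ _ h2.symm) (himg _ _ h2)
      rw [h3, himg2]
      by_cases hq : q ∈ (fun y => L.grp.projH (T.pt s y)) '' S.P
      · rw [indicator_of_mem hq, indicator_of_mem hq]
      · rw [indicator_of_notMem hq, indicator_of_notMem hq, mul_zero]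
    rw [Finset.sum_congr rfl h1]
    by_cases hq : q ∈ L.grp.projH '' (T.pt (r i) '' S.P)
    · simp only [indicator_of_mem hq]
      rw [Finset.mul_sum]
    · simp only [indicator_of_notMem hq]
      exact Finset.sum_const_zero

/-- The wnb groupoid defined by a weighted layer. -/
noncomputable def wnb (hY : Y.IsProper) {W : L.Weight} (hT : ∀ x, Nonempty (Sheets W x))
    {κ : Y.Orbit → ℝ} (hκ : ∀ p, 0 < κ p) (hκ' : IsLocallyConstant κ) {Λ : L.grp.HOrbit → ℝ}
    (h : IsInduced W κ Λ) : WnbGroupoid.{u} I where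
  toSseGroupoid := L.grp
  nonsingular := L.nonsingular
  Λ := Λ
  Λ_pos := h.pos hκ hT
  branching := exists_isLocalBranching hY hT hκ hκ' h

end Layer

end Induced

end BranchedResolution

namespace BranchedResolution

open SseGroupoid

/-! ### Gluing layers over a locally finite closed cover -/

section Gluing

variable {n : ℕ} {H : Type} [TopologicalSpace H]
  {I : ModelWithCorners ℝ (EuclideanSpace ℝ (Fin n)) H}

/-- Layers `L i` over a locally finite family of closed sets `C i` whose interiors cover the orbit
space of `Y`. -/
structure LayerFamily (Y : SseGroupoid.{u} I) where
  ι : Type u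
  L : ι → Layer Y
  W : ∀ i, (L i).Weight
  C : ι → Set Y.Orbit
  isClosed : ∀ i, IsClosed (C i)
  locallyFinite : LocallyFinite C
  exists_interior : ∀ p, ∃ i, p ∈ interior (C i)
  sheets : ∀ i x, Y.proj x ∈ C i → Nonempty (Layer.Sheets (W i) x)

noncomputable instance {Y : SseGroupoid.{u} I} (G : LayerFamily Y) (x : Y.Obj) :
    Fintype {i // Y.proj x ∈ G.C i} :=
  (G.locallyFinite.point_finite (Y.proj x)).fintype

/-- A space `M` over `Y.Obj` whose points have components in the layers of a family: `c i m n g`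
means that `n` is the component of `m` of index `i`, transported along `g`. -/
structure Gluing (Y : SseGroupoid.{u} I) extends LayerFamily Y where
  M : Type u
  [top : TopologicalSpace M]
  [t2 : T2Space M]
  [secondCountable : SecondCountableTopology M]
  pr : M → Y.Obj
  etale : IsLocalHomeomorph pr
  c : ∀ i, M → (L i).grp.Obj → Y.Mor → Prop
  src_eq : ∀ {i m n g}, c i m n g → Y.src g = (L i).F.obj n
  tgt_eq : ∀ {i m n g}, c i m n g → Y.tgt g = pr m
  isOpen : ∀ {i m n g}, c i m n g → ∀ᶠ t : M × (L i).grp.Obj × Y.Mor in 𝓝 (m, n, g),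
    Y.src t.2.2 = (L i).F.obj t.2.1 → Y.tgt t.2.2 = pr t.1 → c i t.1 t.2.1 t.2.2
  germ : ∀ {i m n g n' g'}, c i m n g → (L i).Germ n' g' n g → c i m n' g'
  unique : ∀ {i m n g n' g'}, c i m n g → c i m n' g' → (L i).Germ n g n' g'
  exists_comp : ∀ {i m}, Y.proj (pr m) ∈ C i → ∃ n g, c i m n g
  surj : ∀ (x : Y.Obj) (n : ∀ i : {i // Y.proj x ∈ C i}, (L i).grp.Obj)
    (g : {i // Y.proj x ∈ C i} → Y.Mor),
    (∀ i, Y.src (g i) = (L i).F.obj (n i)) → (∀ i, Y.tgt (g i) = x) →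
    ∃ m η, Y.src η = pr m ∧ Y.tgt η = x ∧ ∀ i : {i // Y.proj x ∈ C i}, c i m (n i) (Y.mul (Y.inv η) (g i))

attribute [instance] Gluing.top Gluing.t2 Gluing.secondCountable

namespace Gluing

variable {Y : SseGroupoid.{u} I} (G : Gluing Y)

variable {G}

theorem eventually_c {i : G.ι} {m : G.M} {n : (G.L i).grp.Obj} {g : Y.Mor} (h : G.c i m n g)
    {Z : Type*} {l : Filter Z} {m' : Z → G.M} {n' : Z → (G.L i).grp.Obj} {g' : Z → Y.Mor}
    (hm : Tendsto m' l (𝓝 m)) (hn : Tendsto n' l (𝓝 n)) (hg : Tendsto g' l (𝓝 g))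
    (hs : ∀ᶠ z in l, Y.src (g' z) = (G.L i).F.obj (n' z))
    (ht : ∀ᶠ z in l, Y.tgt (g' z) = G.pr (m' z)) :
    ∀ᶠ z in l, G.c i (m' z) (n' z) (g' z) := by
  filter_upwards [(hm.prodMk_nhds (hn.prodMk_nhds hg)).eventually (G.isOpen h), hs, ht]
    with z h1 h2 h3 using h1 h2 h3

/-- Near a point with an `i`-component, there are continuous `i`-components. -/
theorem exists_continuous_c {i : G.ι} {m : G.M} {n : (G.L i).grp.Obj} {g : Y.Mor}
    (h : G.c i m n g) : ∃ (n' : G.M → (G.L i).grp.Obj) (g' : G.M → Y.Mor),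
      Tendsto n' (𝓝 m) (𝓝 n) ∧ Tendsto g' (𝓝 m) (𝓝 g) ∧ ∀ᶠ m' in 𝓝 m, G.c i m' (n' m') (g' m') := by
  obtain ⟨σ, γ, U, hU, hgU, hσ, hγ, hσg, hγg, hUst, -⟩ :=
    exists_section_pair (G.L i).etale.isLocalHomeomorph (G.src_eq h)
  rw [G.tgt_eq h] at hgU hσg hγg
  have hpr := G.etale.continuous.tendsto m
  have h1 := (hσ.continuousAt (hU.mem_nhds hgU)).tendsto.comp hpr
  have h2 := (hγ.continuousAt (hU.mem_nhds hgU)).tendsto.comp hpr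
  rw [hσg] at h1
  rw [hγg] at h2
  have h3 : ∀ᶠ m' in 𝓝 m, G.pr m' ∈ U := hpr.eventually (hU.mem_nhds hgU)
  refine ⟨_, _, h1, h2, eventually_c h tendsto_id h1 h2 ?_ ?_⟩
  · filter_upwards [h3] with z hz using (hUst _ hz).1
  · filter_upwards [h3] with z hz using (hUst _ hz).2

variable (G) in
/-- Points are related if they have the same components. -/
noncomputable def etaleRel : EtaleRel Y where
  N := G.M
  pr := G.pr
  etale := G.etale
  rel m η m' := Y.src η = G.pr m ∧ Y.tgt η = G.pr m' ∧
    ∀ i, Y.proj (G.pr m) ∈ G.C i → ∃ n g, G.c i m n g ∧ G.c i m' n (Y.mul η g)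
  src_eq h := h.1
  tgt_eq h := h.2.1
  refl m := by
    refine ⟨Y.src_one _, Y.tgt_one _, fun i hi => ?_⟩
    obtain ⟨n, g, h⟩ := G.exists_comp hi
    exact ⟨n, g, h, by rwa [SseGroupoid.one_mul (G.tgt_eq h)]⟩
  symm {m η m'} h := by
    obtain ⟨h1, h2, h3⟩ := h
    refine ⟨by rw [Y.src_inv, h2], by rw [Y.tgt_inv, h1], fun i hi => ?_⟩
    have h4 : Y.proj (G.pr m) = Y.proj (G.pr m') := by rw [← h1, ← h2, Y.proj_src_eq]
    obtain ⟨n, g, hn, hn'⟩ := h3 i (h4 ▸ hi)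
    refine ⟨n, _, hn', ?_⟩
    rwa [inv_mul_cancel_left (by rw [h1, G.tgt_eq hn])]
  trans {m η m' η' m''} h h' := by
    obtain ⟨h1, h2, h3⟩ := h
    obtain ⟨h1', h2', h3'⟩ := h'
    refine ⟨by rw [src_mul, h1], by rw [tgt_mul (by rw [h1', h2]), h2'], fun i hi => ?_⟩
    have h4 : Y.proj (G.pr m) = Y.proj (G.pr m') := by rw [← h1, ← h2, Y.proj_src_eq]
    obtain ⟨n, g, hn, hn'⟩ := h3 i hi
    obtain ⟨k, f, hk, hk'⟩ := h3' i (h4 ▸ hi)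
    refine ⟨n, g, hn, G.germ hk' ?_⟩
    have := (G.unique hn' hk).mul_left (k := η') (by rw [h1', G.tgt_eq hn'])
    rwa [← SseGroupoid.mul_assoc (by rw [h1', h2]) (by rw [h1, G.tgt_eq hn])] at this
  isOpen {m η m'} h := by
    obtain ⟨h1, h2, h3⟩ := h
    -- Only triples with matching ends matter, so openness is checked within `D`.
    set D : Set (G.M × Y.Mor × G.M) := {t | Y.src t.2.1 = G.pr t.1 ∧ Y.tgt t.2.1 = G.pr t.2.2}
    suffices hD : ∀ᶠ t in 𝓝[D] (m, η, m'), ∀ i, Y.proj (G.pr t.1) ∈ G.C i →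
        ∃ n g, G.c i t.1 n g ∧ G.c i t.2.2 n (Y.mul t.2.1 g) by
      rw [eventually_nhdsWithin_iff] at hD
      filter_upwards [hD] with t ht ht1 ht2 using ⟨ht1, ht2, ht ⟨ht1, ht2⟩⟩
    have hDm : ∀ᶠ t in 𝓝[D] (m, η, m'), t ∈ D := self_mem_nhdsWithin
    have t1 : Tendsto (fun t : G.M × Y.Mor × G.M => t.1) (𝓝[D] (m, η, m')) (𝓝 m) :=
      (continuous_fst.tendsto (m, η, m')).mono_left nhdsWithin_le_nhds
    have t2 : Tendsto (fun t : G.M × Y.Mor × G.M => t.2.1) (𝓝[D] (m, η, m')) (𝓝 η) :=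
      ((continuous_fst.comp continuous_snd).tendsto (m, η, m')).mono_left nhdsWithin_le_nhds
    have t3 : Tendsto (fun t : G.M × Y.Mor × G.M => t.2.2) (𝓝[D] (m, η, m')) (𝓝 m') :=
      ((continuous_snd.comp continuous_snd).tendsto (m, η, m')).mono_left nhdsWithin_le_nhds
    -- The indices active near `m` are among the finitely many active at `m`, because the sets are
    -- closed and locally finite. So finitely many open conditions suffice.
    have hsub := G.locallyFinite.eventually_subset G.isClosed (Y.proj (G.pr m))
    have hsub' := (((Y.continuous_proj.comp G.etale.continuous).tendsto m).comp t1).eventually hsub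
    have hfin := G.locallyFinite.point_finite (Y.proj (G.pr m))
    have hall : ∀ᶠ t in 𝓝[D] (m, η, m'), ∀ i ∈ {i | Y.proj (G.pr m) ∈ G.C i},
        ∃ n g, G.c i t.1 n g ∧ G.c i t.2.2 n (Y.mul t.2.1 g) := by
      refine hfin.eventually_all.mpr fun i hi => ?_
      obtain ⟨n, g, hn, hn'⟩ := h3 i hi
      obtain ⟨n₁, g₁, hn₁, hg₁, hc⟩ := exists_continuous_c hn
      have hc' := t1.eventually hc
      have := eventually_c hn' t3 (hn₁.comp t1) (tendsto_mul t2 (hg₁.comp t1)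
        (by rw [h1, G.tgt_eq hn]) (by
          filter_upwards [hDm, hc'] with t ht ht'
          rw [ht.1]
          exact (G.tgt_eq ht').symm)) (by
          filter_upwards [hc'] with t ht
          rw [src_mul]
          exact G.src_eq ht) (by
          filter_upwards [hDm, hc'] with t ht ht'
          rw [tgt_mul (by rw [ht.1]; exact (G.tgt_eq ht').symm), ht.2])
      filter_upwards [hc', this] with t ht ht' using ⟨_, _, ht, ht'⟩
    filter_upwards [hall, hsub'] with t ht ht' i hi using ht i (ht' hi)

instance : T2Space G.etaleRel.N := G.t2
instance : SecondCountableTopology G.etaleRel.N := G.secondCountable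

/-- At least one layer is active. Its component of `m` is unchanged by `η`, and in a nonsingular
layer an object with two morphisms of the same germ has equal morphisms. -/
theorem eq_one_of_rel {m : G.M} {η : Y.Mor} (h : G.etaleRel.rel m η m) : η = Y.one (G.pr m) := by
  obtain ⟨h1, h2, h3⟩ := h
  obtain ⟨i, hi⟩ := G.exists_interior (Y.proj (G.pr m))
  obtain ⟨n, g, hn, hn'⟩ := h3 i (interior_subset hi)
  have h4 := (G.unique hn hn').eq_of_self
  have h5 : Y.src η = Y.tgt g := by rw [h1, G.tgt_eq hn]
  rw [← mul_inv_cancel_right h5, ← h4, SseGroupoid.mul_inv, G.tgt_eq hn]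

variable (G) in
/-- The layer obtained by gluing. -/
noncomputable def layer : Layer Y where
  grp := G.etaleRel.toSse
  nonsingular := by
    intro (γ : G.etaleRel.RelMor) (h : γ.1.1 = γ.1.2.2)
    obtain ⟨⟨a, g, b⟩, hr⟩ := γ
    obtain rfl : a = b := h
    exact Subtype.ext (Prod.ext rfl (Prod.ext (eq_one_of_rel hr) rfl))
  F := G.etaleRel.toBase
  etale := G.etaleRel.toBase_localDiffeo

/-- Together with `germ_comp`, this identifies the fibre of the glued layer over a point with the
product of the fibres of the active layers: two germs agree once all their active components do. -/
theorem germ_of_forall {m m' : G.M} {η η' : Y.Mor} (h1 : Y.src η = G.pr m)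
    (h2 : Y.src η' = G.pr m') (h3 : Y.tgt η = Y.tgt η')
    (h4 : ∀ i, Y.proj (G.pr m) ∈ G.C i → ∃ n g, Y.tgt g = Y.tgt η ∧
      G.c i m n (Y.mul (Y.inv η) g) ∧ G.c i m' n (Y.mul (Y.inv η') g)) :
    G.layer.Germ m η m' η' := by
  have h5 : Y.src (Y.inv η') = Y.tgt η := by rw [Y.src_inv, h3]
  have hr : G.etaleRel.rel m (Y.mul (Y.inv η') η) m' := by
    refine ⟨by rw [src_mul, h1], by rw [tgt_mul h5, Y.tgt_inv, h2], fun i hi => ?_⟩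
    obtain ⟨n, g, hg, hn, hn'⟩ := h4 i hi
    refine ⟨n, _, hn, ?_⟩
    rwa [SseGroupoid.mul_assoc h5 (by rw [tgt_mul (by rw [Y.src_inv, hg]), Y.tgt_inv]),
      mul_inv_cancel_left hg.symm]
  refine ⟨h2, (⟨(m, Y.mul (Y.inv η') η, m'), hr⟩ : G.etaleRel.RelMor), rfl, rfl, ?_⟩
  exact (mul_inv_cancel_left h3.symm).symm

theorem germ_comp {m m' : G.M} {η η' : Y.Mor} (h : G.layer.Germ m η m' η') {i : G.ι}
    {n n' : (G.L i).grp.Obj} {g g' : Y.Mor} (hn : G.c i m n g) (hn' : G.c i m' n' g')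
    (hi : Y.proj (G.pr m) ∈ G.C i) : (G.L i).Germ n (Y.mul η g) n' (Y.mul η' g') := by
  have h1' : Y.src η' = G.pr m' := h.1
  obtain ⟨-, ⟨⟨a, k, b⟩, hr⟩, h2, h3, h4⟩ := h
  obtain rfl : a = m := h2
  obtain rfl : b = m' := h3
  obtain rfl : η = Y.mul η' k := h4
  obtain ⟨s1, s2, s3⟩ := hr
  obtain ⟨l, f, hl, hl'⟩ := s3 i hi
  have a1 : Y.src k = Y.tgt g := by rw [G.tgt_eq hn]; exact s1
  have a2 : Y.src η' = Y.tgt k := by rw [h1']; exact s2.symm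
  have e1 := (G.unique hn hl).mul_left (k := k) a1
  have e2 := (e1.trans (G.unique hl' hn')).mul_left (k := η') (by rw [a2, tgt_mul a1])
  rwa [← SseGroupoid.mul_assoc a2 a1] at e2

-- The complement is the union of the locally finite family of closed sets of nongeneric points of
-- `C i`.
variable (G) in
theorem isOpen_gen : IsOpen {p | ∀ i, p ∈ G.C i → p ∈ (G.W i).gen} := by
  have h1 : LocallyFinite fun i => G.C i ∩ ((G.W i).gen)ᶜ :=
    G.locallyFinite.subset fun i => inter_subset_left
  have h2 := (h1.isClosed_iUnion fun i =>
    (G.isClosed i).inter (G.W i).isOpen_gen.isClosed_compl).isOpen_compl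
  convert h2 using 1
  ext p
  simp

-- Near a point only the finitely many indices active there matter, and finite intersections of
-- dense open sets are dense.
variable (G) in
theorem dense_gen : Dense {p | ∀ i, p ∈ G.C i → p ∈ (G.W i).gen} := by
  rw [dense_iff_inter_open]
  rintro O hO ⟨p, hp⟩
  have hfin : {i | p ∈ G.C i}.Finite := G.locallyFinite.point_finite p
  obtain ⟨V, hV, hVo, hpV⟩ := mem_nhds_iff.mp
    (inter_mem (hO.mem_nhds hp) (G.locallyFinite.eventually_subset G.isClosed p))
  have hd : ∀ s : Set G.ι, s.Finite → Dense (⋂ i ∈ s, (G.W i).gen) := by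
    intro s hs
    induction s, hs using Set.Finite.induction_on with
    | empty => simp
    | @insert a s _ hs ih =>
      rw [biInter_insert]
      exact (G.W a).dense_gen.inter_of_isOpen_left ih (G.W a).isOpen_gen
  obtain ⟨q, hq, hq'⟩ := (hd _ hfin).inter_open_nonempty V hVo ⟨p, hpV⟩
  refine ⟨q, (hV hq).1, fun i hi => mem_iInter₂.mp hq' i ((hV hq).2 hi)⟩

open Classical in
variable (G) in
/-- The weight of the component of index `i`, if there is one. -/
noncomputable def wtFactor (m : G.M) (i : G.ι) : ℝ :=
  if h : Y.proj (G.pr m) ∈ G.C i then (G.W i).wt (G.exists_comp h).choose else 1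

theorem wtFactor_eq {m : G.M} {i : G.ι} (hi : Y.proj (G.pr m) ∈ G.C i) {n : (G.L i).grp.Obj}
    {g : Y.Mor} (h : G.c i m n g) : G.wtFactor m i = (G.W i).wt n := by
  rw [wtFactor, dif_pos hi]
  exact (G.W i).wt_proj (G.unique (G.exists_comp hi).choose_spec.choose_spec h).proj_eq

theorem wtFactor_of_notMem {m : G.M} {i : G.ι} (hi : Y.proj (G.pr m) ∉ G.C i) :
    G.wtFactor m i = 1 := dif_neg hi

variable (G) in
/-- The product weight. -/
noncomputable def weight : G.layer.Weight where
  gen := {p | ∀ i, p ∈ G.C i → p ∈ (G.W i).gen}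
  isOpen_gen := G.isOpen_gen
  dense_gen := G.dense_gen
  wt m := ∏ᶠ i, G.wtFactor m i
  wt_pos m := by
    refine finprod_induction (p := fun r : ℝ => 0 < r) one_pos (fun _ _ => mul_pos) fun i => ?_
    by_cases hi : Y.proj (G.pr m) ∈ G.C i
    · obtain ⟨n, g, h⟩ := G.exists_comp hi
      rw [wtFactor_eq hi h]
      exact (G.W i).wt_pos n
    · rw [wtFactor_of_notMem hi]
      exact one_pos
  wt_src α := by
    refine finprod_congr fun i => ?_
    obtain ⟨⟨m, η, m'⟩, h1, h2, h3⟩ :=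
      (show {t : G.M × Y.Mor × G.M // G.etaleRel.rel t.1 t.2.1 t.2.2} from α)
    change Y.src η = G.pr m at h1
    change Y.tgt η = G.pr m' at h2
    change G.wtFactor m i = G.wtFactor m' i
    have h4 : Y.proj (G.pr m) = Y.proj (G.pr m') := by rw [← h1, ← h2, Y.proj_src_eq]
    by_cases hi : Y.proj (G.pr m) ∈ G.C i
    · obtain ⟨n, g, hn, hn'⟩ := h3 i hi
      rw [wtFactor_eq hi hn, wtFactor_eq (h4 ▸ hi) hn']
    · rw [wtFactor_of_notMem hi, wtFactor_of_notMem (h4 ▸ hi)]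

/-- Components define a continuous map to the Hausdorff orbit spaces of the layers. -/
theorem projH_comp_eq [T2Space Y.Orbit] {i : G.ι} {m m' : G.M}
    (hm : Y.proj (G.pr m) ∈ interior (G.C i))
    (h : G.layer.grp.projH m = G.layer.grp.projH m') {n n' : (G.L i).grp.Obj} {g g' : Y.Mor}
    (hn : G.c i m n g) (hn' : G.c i m' n' g') :
    (G.L i).grp.projH n = (G.L i).grp.projH n' := by
  classical
  let τ : G.layer.grp.Orbit → Y.Orbit := G.layer.F.orbitMap
  have hτ : ∀ m : G.M, τ (G.layer.grp.proj m) = Y.proj (G.pr m) := fun _ => rfl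
  have hτc : Continuous τ := G.layer.F.continuous_orbitMap
  let O := interior (G.C i)
  -- The orbit of `m` is sent to the class of its `i`-component, which is well defined by
  -- `germ_comp`; away from `O` the value is irrelevant. Local continuous components make this map
  -- continuous over the open set `O`, so it descends to the Hausdorff quotient there.
  have hex : ∀ q : G.layer.grp.Orbit, ∃ r : (G.L i).grp.HOrbit, ∀ (m : G.M) n g,
      G.layer.grp.proj m = q → τ q ∈ O → G.c i m n g → (G.L i).grp.projH n = r := by
    intro q
    obtain ⟨m₀, rfl⟩ := G.layer.grp.isOpenQuotientMap_proj.surjective q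
    by_cases hm₀ : τ (G.layer.grp.proj m₀) ∈ O
    · obtain ⟨n₀, g₀, h₀⟩ := G.exists_comp (m := m₀) (interior_subset hm₀)
      refine ⟨(G.L i).grp.projH n₀, fun m n g hq _ hc => ?_⟩
      obtain ⟨⟨⟨a, k, b⟩, hr⟩, ha, hb⟩ := G.layer.grp.proj_eq_iff.mp hq
      obtain rfl : a = m := ha
      obtain rfl : b = m₀ := hb
      have hg : G.layer.Germ a (Y.mul (Y.one (G.pr b)) k) b (Y.one (G.pr b)) :=
        ⟨Y.src_one _, (⟨(a, k, b), hr⟩ : G.etaleRel.RelMor), rfl, rfl, rfl⟩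
      have hab : Y.proj (G.pr a) = Y.proj (G.pr b) := congrArg τ hq
      have := germ_comp hg hc h₀ (by
        rw [hab]
        exact interior_subset hm₀)
      exact congrArg T2Quotient.mk this.proj_eq
    · exact ⟨(G.L i).grp.projH n, fun m n g _ h => absurd h hm₀⟩
  choose f hf using hex
  have hfc : ContinuousOn f (τ ⁻¹' O) := by
    intro q hq
    obtain ⟨m₀, rfl⟩ := G.layer.grp.isOpenQuotientMap_proj.surjective q
    refine ContinuousAt.continuousWithinAt ?_
    rw [← G.layer.grp.isOpenQuotientMap_proj.continuousAt_comp_iff]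
    obtain ⟨n₀, g₀, h₀⟩ := G.exists_comp (m := m₀) (interior_subset hq)
    obtain ⟨n₁, g₁, hn₁, -, hc⟩ := exists_continuous_c h₀
    have h0 : f (G.layer.grp.proj m₀) = (G.L i).grp.projH n₀ :=
      (hf _ m₀ n₀ g₀ rfl hq h₀).symm
    have h1 : Tendsto (fun m : G.M => (G.L i).grp.projH (n₁ m)) (𝓝 m₀)
        (𝓝 ((f ∘ G.layer.grp.proj) m₀)) := by
      rw [Function.comp, h0]
      exact ((G.L i).grp.continuous_projH.tendsto n₀).comp hn₁
    refine Tendsto.congr' ?_ h1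
    have hO : ∀ᶠ m : G.M in 𝓝 m₀, τ (G.layer.grp.proj m) ∈ O :=
      ((hτc.comp G.layer.grp.continuous_proj).tendsto m₀).eventually
        (isOpen_interior.mem_nhds hq)
    filter_upwards [hc, hO] with m hm hm' using hf _ m _ _ rfl hm' hm
  have hτm' : τ (G.layer.grp.proj m) = τ (G.layer.grp.proj m') := by
    exact (Layer.base_projH (L := G.layer) m).symm.trans
      ((congrArg G.layer.base h).trans (Layer.base_projH (L := G.layer) m'))
  have h1 := eq_of_t2Quotient_mk_eq hτc (isOpen_interior : IsOpen O) hfc h hm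
  rw [hf _ m n g rfl hm hn, hf _ m' n' g' rfl (hτm' ▸ hm) hn']
  exact h1

-- The fibre of the gluing is a product of fibres, so tuples of sections exhaust it. The weights of
-- the tuples through a germ factor into sums over the single components, one for each index active
-- at `x`. An index no longer active at a nearby `y` imposes no condition, and its factor is the
-- total weight one.
open Classical in
theorem exists_sheets [T2Space Y.Orbit] (x : Y.Obj)
    (T : ∀ i : {i // Y.proj x ∈ G.C i}, Layer.Sheets (G.W i) x) :
    ∃ (R : Layer.Sheets G.weight x) (e : R.S ≃ ∀ i, (T i).S),
      (∀ σ, R.w σ = ∏ i, (T i).w (e σ i)) ∧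
      ∀ σ (i : {i // Y.proj x ∈ G.C i}), G.c i (R.pt σ x) ((T i).pt (e σ i) x)
        (Y.mul (Y.inv (R.mor σ x)) ((T i).mor (e σ i) x)) := by
  have hsurj := fun σ : ∀ i, (T i).S => G.surj x (fun i => (T i).pt (σ i) x)
    (fun i => (T i).mor (σ i) x) (fun i => (T i).src_mor (σ i) x (T i).mem)
    (fun i => (T i).tgt_mor (σ i) x (T i).mem)
  choose m η hη hη' hc using hsurj
  have hsec := fun σ => exists_section_pair G.etale (hη σ)
  choose pt mor U hU hxU hpt hmor hptx hmorx hUst _ using hsec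
  simp only [hη'] at hxU hptx hmorx
  -- One index whose set is a neighbourhood of the orbit of `x` is kept for the proof of
  -- injectivity.
  obtain ⟨i₀, hi₀⟩ := G.exists_interior (Y.proj x)
  have e1 : ∀ᶠ y in 𝓝 x, ∀ σ, y ∈ U σ := eventually_all.mpr fun σ => (hU σ).mem_nhds (hxU σ)
  have e2 : ∀ᶠ y in 𝓝 x, ∀ i, y ∈ (T i).P := eventually_all.mpr fun i => (T i).eventually_mem
  have e3 : ∀ᶠ y in 𝓝 x, {i | Y.proj y ∈ G.C i} ⊆ {i | Y.proj x ∈ G.C i} :=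
    (Y.continuous_proj.tendsto x).eventually
      (G.locallyFinite.eventually_subset G.isClosed (Y.proj x))
  have e4 : ∀ᶠ y in 𝓝 x, Y.proj y ∈ interior (G.C i₀) :=
    (Y.continuous_proj.tendsto x).eventually (isOpen_interior.mem_nhds hi₀)
  have e5 : ∀ᶠ y in 𝓝 x, ∀ σ (i : {i // Y.proj x ∈ G.C i}), G.c i (pt σ y) ((T i).pt (σ i) y)
      (Y.mul (Y.inv (mor σ y)) ((T i).mor (σ i) y)) := by
    refine eventually_all.mpr fun σ => eventually_all.mpr fun i => ?_
    have t1 := ((hpt σ).continuousAt ((hU σ).mem_nhds (hxU σ))).tendsto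
    have t2 := ((hmor σ).continuousAt ((hU σ).mem_nhds (hxU σ))).tendsto
    have t3 := (T i).tendsto_pt (σ i) (T i).mem
    have t4 := (T i).tendsto_mor (σ i) (T i).mem
    rw [hptx] at t1
    rw [hmorx] at t2
    have hst : ∀ᶠ y in 𝓝 x, Y.src (Y.inv (mor σ y)) = Y.tgt ((T i).mor (σ i) y) := by
      filter_upwards [e1, e2] with y hy hy'
      rw [Y.src_inv, (hUst σ y (hy σ)).2, (T i).tgt_mor _ y (hy' i)]
    refine eventually_c (hc σ i) t1 t3 (tendsto_mul ((Y.continuous_inv.tendsto _).comp t2) t4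
      ?_ hst) ?_ ?_
    · rw [Y.src_inv, hη', (T i).tgt_mor _ x (T i).mem]
    · filter_upwards [e2] with y hy
      rw [src_mul, (T i).src_mor _ y (hy i)]
    · filter_upwards [e1, hst] with y hy hy'
      rw [tgt_mul (by exact hy')]
      exact (Y.tgt_inv _).trans (hUst σ y (hy σ)).1
  obtain ⟨P, hP, hPo, hxP⟩ := mem_nhds_iff.mp (e1.and (e2.and (e3.and (e4.and e5))))
  have hcP : ∀ y ∈ P, ∀ σ (i : {i // Y.proj x ∈ G.C i}), G.c i (pt σ y) ((T i).pt (σ i) y)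
      (Y.mul (Y.inv (mor σ y)) ((T i).mor (σ i) y)) := fun y hy => (hP hy).2.2.2.2
  have hPT : ∀ y ∈ P, ∀ i, y ∈ (T i).P := fun y hy => (hP hy).2.1
  have hst : ∀ y ∈ P, ∀ σ, Y.src (mor σ y) = G.pr (pt σ y) ∧ Y.tgt (mor σ y) = y :=
    fun y hy σ => hUst σ y ((hP hy).1 σ)
  have hne : ∀ i, Nonempty (T i).S := by
    intro i
    by_contra hem
    have := (T i).sum_w
    rw [not_nonempty_iff] at hem
    simp at this
  -- A germ lies on the tuple `σ` if and only if, for every index active at `y`, its component lies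
  -- on the corresponding section.
  have hgerm : ∀ y ∈ P, ∀ (a : G.M) (g : Y.Mor), Y.src g = G.pr a → Y.tgt g = y → ∀ σ,
      G.layer.Germ a g (pt σ y) (mor σ y) ↔ ∀ i : {i // Y.proj x ∈ G.C i},
        Y.proj y ∈ G.C i → ∀ n k, G.c i a n k →
          (G.L i).Germ n (Y.mul g k) ((T i).pt (σ i) y) ((T i).mor (σ i) y) := by
    intro y hy a g hg hgy σ
    have hay : Y.proj (G.pr a) = Y.proj y := by rw [← hg, Y.proj_src_eq, hgy]
    constructor
    · intro h i hi n k hk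
      have := germ_comp h hk (hcP y hy σ i) (by rwa [hay])
      rwa [SseGroupoid.mul_inv_cancel_left (by rw [(hst y hy σ).2, (T i).tgt_mor _ y (hPT y hy i)])] at this
    · intro h
      refine germ_of_forall hg (hst y hy σ).1 (by rw [hgy, (hst y hy σ).2]) fun i hi => ?_
      have hi' := (hP hy).2.2.1 (show i ∈ {i | Y.proj y ∈ G.C i} from hay ▸ hi)
      obtain ⟨n, k, hk⟩ := G.exists_comp hi
      have h2 : Y.tgt ((T ⟨i, hi'⟩).mor (σ ⟨i, hi'⟩) y) = Y.tgt g := by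
        rw [hgy, (T ⟨i, hi'⟩).tgt_mor _ y (hPT y hy _)]
      refine ⟨_, _, h2, G.germ hk ?_, hcP y hy σ ⟨i, hi'⟩⟩
      have h3 := (h ⟨i, hi'⟩ (hay ▸ hi) n k hk).symm.mul_left (k := Y.inv g) (by
        rw [Y.src_inv, h2])
      rwa [SseGroupoid.inv_mul_cancel_left (by rw [hg, G.tgt_eq hk])] at h3
  let fr : G.layer.Frame x :=
    { P := P
      isOpen := hPo
      mem := hxP
      S := ∀ i, (T i).S
      pt := pt
      mor := mor
      cont_pt := fun σ => (hpt σ).mono fun y hy => (hP hy).1 σ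
      cont_mor := fun σ => (hmor σ).mono fun y hy => (hP hy).1 σ
      src_mor := fun σ y hy => (hst y hy σ).1
      tgt_mor := fun σ y hy => (hst y hy σ).2
      cover := by
        intro y hy (a : G.M) g (hg : _ = G.pr a) hgy
        have hay : Y.proj (G.pr a) = Y.proj y := by rw [← hg, Y.proj_src_eq, hgy]
        have : ∀ i : {i // Y.proj x ∈ G.C i}, ∃ s, Y.proj y ∈ G.C i → ∀ n k, G.c i a n k →
            (G.L i).Germ n (Y.mul g k) ((T i).pt s y) ((T i).mor s y) := by
          intro i
          by_cases hi : Y.proj y ∈ G.C i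
          · obtain ⟨n₀, k₀, hk₀⟩ := G.exists_comp (m := a) (hay.symm ▸ hi)
            have h0 : ∀ {n k}, G.c i a n k → Y.src g = Y.tgt k := fun hk => by
              rw [hg, G.tgt_eq hk]
            obtain ⟨s, hs⟩ := (T i).cover y (hPT y hy i) n₀ (Y.mul g k₀)
              (by rw [src_mul, G.src_eq hk₀]) (by rw [tgt_mul (h0 hk₀), hgy])
            exact ⟨s, fun _ n k hk => ((G.unique hk hk₀).mul_left (h0 hk)).trans hs⟩
          · exact ⟨(hne i).some, fun h => absurd h hi⟩
        choose σ hσ using this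
        exact ⟨σ, (hgerm y hy a g hg hgy σ).mpr hσ⟩ }
  have hsum : ∑ σ : ∀ i, (T i).S, ∏ i, (T i).w (σ i) = 1 := by
    have := (Finset.prod_univ_sum (fun i : {i // Y.proj x ∈ G.C i} =>
      (Finset.univ : Finset (T i).S)) fun i s => (T i).w s).symm
    rw [Fintype.piFinset_univ] at this
    rw [this]
    exact Finset.prod_eq_one fun i _ => (T i).sum_w
  refine ⟨{ toFrame := fr
            w := fun σ : ∀ i, (T i).S => ∏ i, (T i).w (σ i)
            isWeight := ⟨fun σ => Finset.prod_pos fun i _ => (T i).isWeight.pos _, ?_⟩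
            sum_w := hsum
            inj := ?_ }, Equiv.refl _, fun _ => rfl, fun σ i => hcP x hxP σ i⟩
  · intro y hy hgen (a : G.M) g (hg : _ = G.pr a) hgy
    have hay : Y.proj (G.pr a) = Y.proj y := by rw [← hg, Y.proj_src_eq, hgy]
    -- `f i s` is the weight of `s` if `s` passes through the `i`-component of the germ, or if `i`
    -- is inactive at `y`; it is zero otherwise. Summed over `s` it gives `wtFactor a i`.
    let f : ∀ i : {i // Y.proj x ∈ G.C i}, (T i).S → ℝ := fun i s =>
      if Y.proj y ∈ G.C i → ∀ n k, G.c i a n k →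
        (G.L i).Germ n (Y.mul g k) ((T i).pt s y) ((T i).mor s y) then (T i).w s else 0
    have h1 : ∀ σ : ∀ i, (T i).S, {σ | G.layer.Germ a g (fr.pt σ y) (fr.mor σ y)}.indicator
        (fun σ : ∀ i, (T i).S => ∏ i, (T i).w (σ i)) σ = ∏ i, f i (σ i) := by
      intro σ
      by_cases h : G.layer.Germ a g (pt σ y) (mor σ y)
      · rw [indicator_of_mem (by exact h)]
        exact Finset.prod_congr rfl fun i _ => (if_pos ((hgerm y hy a g hg hgy σ).mp h i)).symm
      · rw [indicator_of_notMem (by exact h)]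
        rw [hgerm y hy a g hg hgy σ, not_forall] at h
        obtain ⟨i, hi⟩ := h
        exact (Finset.prod_eq_zero (Finset.mem_univ i) (if_neg hi)).symm
    have h2 : ∀ i, ∑ s, f i s = G.wtFactor a i := by
      intro i
      by_cases hi : Y.proj y ∈ G.C i
      · obtain ⟨n₀, k₀, hk₀⟩ := G.exists_comp (m := a) (hay.symm ▸ hi)
        have h0 : ∀ {n k}, G.c i a n k → Y.src g = Y.tgt k := fun hk => by
          rw [hg, G.tgt_eq hk]
        rw [wtFactor_eq (hay ▸ hi) hk₀, ← (T i).isWeight.wt_eq y (hPT y hy i) (hgen i hi) n₀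
          (Y.mul g k₀) (by rw [src_mul, G.src_eq hk₀]) (by rw [tgt_mul (h0 hk₀), hgy])]
        refine Finset.sum_congr rfl fun s _ => ?_
        by_cases hs : (G.L i).Germ n₀ (Y.mul g k₀) ((T i).pt s y) ((T i).mor s y)
        · rw [indicator_of_mem (by exact hs)]
          exact if_pos fun _ n k hk => ((G.unique hk hk₀).mul_left (h0 hk)).trans hs
        · rw [indicator_of_notMem (by exact hs)]
          exact if_neg fun h => hs (h hi n₀ k₀ hk₀)
      · rw [wtFactor_of_notMem (by rwa [hay]), ← (T i).sum_w]
        exact Finset.sum_congr rfl fun s _ => if_pos fun h => absurd h hi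
    have h3 := (Finset.prod_univ_sum (fun i : {i // Y.proj x ∈ G.C i} =>
      (Finset.univ : Finset (T i).S)) f).symm
    rw [Fintype.piFinset_univ] at h3
    refine (Finset.sum_congr rfl fun σ _ => h1 σ).trans (h3.trans ?_)
    rw [Finset.prod_congr rfl fun i _ => h2 i]
    change _ = ∏ᶠ i, G.wtFactor a i
    have hfin : {i | Y.proj x ∈ G.C i}.Finite := G.locallyFinite.point_finite _
    rw [finprod_eq_prod_of_mulSupport_subset (s := hfin.toFinset) _ ?_]
    · exact (Finset.prod_subtype hfin.toFinset (p := fun i => Y.proj x ∈ G.C i)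
        (fun i => by simp) (fun i => G.wtFactor a i)).symm
    · intro i hi
      rw [Finite.coe_toFinset]
      by_contra h
      exact hi (wtFactor_of_notMem fun h' => h ((hP hy).2.2.1 (hay ▸ h')))
  · intro σ y hy z hz hyz
    -- If a tuple takes equivalent values at `y` and `z`, so does its `i₀`-component, since the
    -- component map of `projH_comp_eq` is defined over the interior of `C i₀`.
    have h1 : Y.proj (G.pr (pt σ y)) = Y.proj y := fr.proj_pt σ hy
    have := projH_comp_eq (i := i₀) (by rw [h1]; exact (hP hy).2.2.2.1) hyz
      (hcP y hy σ ⟨i₀, interior_subset hi₀⟩) (hcP z hz σ ⟨i₀, interior_subset hi₀⟩)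
    exact (T ⟨i₀, interior_subset hi₀⟩).inj _ (hPT y hy _) (hPT z hz _) this

variable (G) in
theorem nonempty_sheets [T2Space Y.Orbit] (x : Y.Obj) :
    Nonempty (Layer.Sheets G.weight x) := by
  obtain ⟨R, -⟩ := exists_sheets (G := G) x fun i => (G.sheets i x i.2).some
  exact ⟨R⟩

end Gluing

end Gluing

end BranchedResolution

namespace BranchedResolution

open SseGroupoid

/-! ### A universal gluing and its functors to the layers -/

section Universal

variable {n : ℕ} {H : Type} [TopologicalSpace H]
  {I : ModelWithCorners ℝ (EuclideanSpace ℝ (Fin n)) H}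

namespace LayerFamily

variable {Y : SseGroupoid.{u} I} (F : LayerFamily Y)

/-- A choice of sheets. -/
noncomputable def sheet (x : Y.Obj) (i : {i // Y.proj x ∈ F.C i}) : Layer.Sheets (F.W i) x :=
  (F.sheets i x i.2).some

theorem exists_nhd (x : Y.Obj) : ∃ V : Set Y.Obj, IsOpen V ∧ x ∈ V ∧
    (∀ y ∈ V, ∀ i, y ∈ (F.sheet x i).P) ∧ ∀ y ∈ V, ∀ i, Y.proj y ∈ F.C i → Y.proj x ∈ F.C i := by
  have e1 : ∀ᶠ y in 𝓝 x, ∀ i, y ∈ (F.sheet x i).P :=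
    eventually_all.mpr fun i => (F.sheet x i).eventually_mem
  have e2 : ∀ᶠ y in 𝓝 x, {i | Y.proj y ∈ F.C i} ⊆ {i | Y.proj x ∈ F.C i} :=
    (Y.continuous_proj.tendsto x).eventually
      (F.locallyFinite.eventually_subset F.isClosed (Y.proj x))
  obtain ⟨V, hV, hVo, hxV⟩ := mem_nhds_iff.mp (e1.and e2)
  exact ⟨V, hVo, hxV, fun y hy => (hV hy).1, fun y hy i hi => (hV hy).2 hi⟩

/-- A neighbourhood over which the chosen sheets are defined. -/
noncomputable def nhd (x : Y.Obj) : Set Y.Obj := (F.exists_nhd x).choose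

theorem isOpen_nhd (x : Y.Obj) : IsOpen (F.nhd x) := (F.exists_nhd x).choose_spec.1
theorem mem_nhd (x : Y.Obj) : x ∈ F.nhd x := (F.exists_nhd x).choose_spec.2.1
theorem nhd_subset {x y : Y.Obj} (hy : y ∈ F.nhd x) (i) : y ∈ (F.sheet x i).P :=
  (F.exists_nhd x).choose_spec.2.2.1 y hy i
theorem mem_of_mem_nhd {x y : Y.Obj} (hy : y ∈ F.nhd x) {i} (hi : Y.proj y ∈ F.C i) :
    Y.proj x ∈ F.C i :=
  (F.exists_nhd x).choose_spec.2.2.2 y hy i hi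

/-- Countability of the centers makes the disjoint union of all domains second countable. -/
theorem exists_centers : ∃ K : Set Y.Obj, K.Countable ∧ ⋃ k ∈ K, F.nhd k = univ :=
  TopologicalSpace.countable_cover_nhds fun x => (F.isOpen_nhd x).mem_nhds (F.mem_nhd x)

/-- A countable set of objects, such that the chosen sheets over these cover everything. -/
noncomputable def centers : Set Y.Obj := F.exists_centers.choose

/-- A center and a tuple of sheets at this center. -/
abbrev SheetTuple : Type u :=
  Σ k : F.centers, ∀ i : {i // Y.proj k.1 ∈ F.C i}, (F.sheet k i).S

/-- The disjoint union of the domains of all tuples of sheets. -/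
abbrev Univ : Type u := Σ j : F.SheetTuple, F.nhd j.1

instance : Countable F.SheetTuple := by
  have : Countable F.centers := F.exists_centers.choose_spec.1.to_subtype
  infer_instance

/-- The gluing of a layer family that uses all tuples of sheets. -/
noncomputable def universal : Gluing Y where
  toLayerFamily := F
  M := F.Univ
  pr m := m.2
  etale := by
    classical
    refine isLocalHomeomorph_of_sections
      (continuous_sigma fun j => continuous_subtype_val) ?_
    rintro ⟨j, y, hy⟩
    refine ⟨fun z => if hz : z ∈ F.nhd j.1 then ⟨j, z, hz⟩ else ⟨j, y, hy⟩, F.nhd j.1,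
      F.isOpen_nhd _, hy, ?_, fun z hz => ?_, ?_⟩
    · rw [continuousOn_iff_continuous_domRestrict]
      refine (continuous_sigmaMk (σ := fun j : F.SheetTuple => F.nhd j.1)
        (i := j)).congr fun z => ?_
      simp
    · beta_reduce
      rw [dif_pos hz]
    · rw [Sigma.nhds_mk, eventually_map]
      exact Eventually.of_forall fun z => by simp
  c i m n g := ∃ hi : Y.proj (m.1.1 : Y.Obj) ∈ F.C i, (F.L i).Germ n g
    ((F.sheet m.1.1 ⟨i, hi⟩).pt (m.1.2 ⟨i, hi⟩) m.2)
    ((F.sheet m.1.1 ⟨i, hi⟩).mor (m.1.2 ⟨i, hi⟩) m.2)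
  src_eq h := h.choose_spec.src_left
  tgt_eq {i m n g} h := by
    obtain ⟨hi, h⟩ := h
    rw [h.tgt_eq, (F.sheet m.1.1 ⟨i, hi⟩).tgt_mor _ _ (F.nhd_subset m.2.2 _)]
  isOpen {i m n g} h := by
    obtain ⟨j, y⟩ := m
    obtain ⟨hi, h⟩ := h
    have ho : Topology.IsOpenEmbedding (Prod.map
        (Sigma.mk (β := fun j : F.SheetTuple => F.nhd j.1) j)
        (id : (F.L i).grp.Obj × Y.Mor → (F.L i).grp.Obj × Y.Mor)) :=
      Topology.IsOpenEmbedding.sigmaMk.prodMap .id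
    have hm := ho.map_nhds_eq (y, n, g)
    simp only [Prod.map, id] at hm
    rw [← hm, eventually_map]
    have hyP := F.nhd_subset y.2 ⟨i, hi⟩
    set T := F.sheet j.1 ⟨i, hi⟩
    set l := 𝓝 (y, n, g) ⊓ 𝓟 {t : F.nhd j.1 × (F.L i).grp.Obj × Y.Mor |
      Y.src t.2.2 = (F.L i).F.obj t.2.1 ∧ Y.tgt t.2.2 = t.1}
    have hl : ∀ᶠ t in l, Y.src t.2.2 = (F.L i).F.obj t.2.1 ∧ Y.tgt t.2.2 = t.1 :=
      mem_inf_of_right (mem_principal_self _)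
    have t1 : Tendsto (fun t : F.nhd j.1 × (F.L i).grp.Obj × Y.Mor => (t.1 : Y.Obj)) l (𝓝 y) :=
      ((continuous_subtype_val.comp continuous_fst).tendsto (y, n, g)).mono_left inf_le_left
    have t2 : Tendsto (fun t : F.nhd j.1 × (F.L i).grp.Obj × Y.Mor => t.2.1) l (𝓝 n) :=
      ((continuous_fst.comp continuous_snd).tendsto (y, n, g)).mono_left inf_le_left
    have t3 : Tendsto (fun t : F.nhd j.1 × (F.L i).grp.Obj × Y.Mor => t.2.2) l (𝓝 g) :=
      ((continuous_snd.comp continuous_snd).tendsto (y, n, g)).mono_left inf_le_left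
    have hP : ∀ t : F.nhd j.1 × (F.L i).grp.Obj × Y.Mor, (t.1 : Y.Obj) ∈ T.P := fun t =>
      F.nhd_subset t.1.2 ⟨i, hi⟩
    have := h.eventually t2 t3 ((T.tendsto_pt _ hyP).comp t1) ((T.tendsto_mor _ hyP).comp t1)
      (hl.mono fun t ht => ht.1)
      (Eventually.of_forall fun t => T.src_mor _ _ (hP t))
      (hl.mono fun t ht => ht.2.trans (T.tgt_mor _ _ (hP t)).symm)
    have h4 := eventually_inf_principal.mp this
    filter_upwards [h4] with t ht h1 h2 using ⟨hi, ht ⟨h1, h2⟩⟩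
  germ h h' := ⟨h.choose, h'.trans h.choose_spec⟩
  unique h h' := h.choose_spec.trans h'.choose_spec.symm
  exists_comp {i m} hi := by
    have hi' := F.mem_of_mem_nhd m.2.2 hi
    exact ⟨_, _, hi', .refl ((F.sheet m.1.1 ⟨i, hi'⟩).src_mor _ _ (F.nhd_subset m.2.2 _))⟩
  surj x n g hs ht := by
    obtain ⟨k, hk, hxk⟩ := mem_iUnion₂.mp (F.exists_centers.choose_spec.2.symm ▸ mem_univ x :
      x ∈ ⋃ k ∈ F.centers, F.nhd k)
    have : ∀ i : {i // Y.proj k ∈ F.C i}, ∃ s, ∀ hi : Y.proj x ∈ F.C i,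
        (F.L i).Germ (n ⟨i, hi⟩) (g ⟨i, hi⟩) ((F.sheet k i).pt s x) ((F.sheet k i).mor s x) := by
      intro i
      by_cases hi : Y.proj x ∈ F.C i
      · obtain ⟨s, hs⟩ := (F.sheet k i).cover x (F.nhd_subset hxk i) _ _ (hs ⟨i, hi⟩) (ht ⟨i, hi⟩)
        exact ⟨s, fun _ => hs⟩
      -- The index is active at the center `k` but not at `x`, so any sheet may be used; one exists
      -- because the weights sum to one.
      · have hne : Nonempty (F.sheet k i).S := by
          by_contra hem
          have := (F.sheet k i).sum_w
          rw [not_nonempty_iff] at hem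
          simp at this
        exact ⟨hne.some, fun h => absurd h hi⟩
    choose σ hσ using this
    refine ⟨⟨⟨⟨k, hk⟩, σ⟩, x, hxk⟩, Y.one x, Y.src_one x, Y.tgt_one x, fun i => ?_⟩
    have hi' := F.mem_of_mem_nhd hxk i.2
    refine ⟨hi', ?_⟩
    rw [SseGroupoid.inv_one, SseGroupoid.one_mul (ht i)]
    exact hσ ⟨i, hi'⟩ i.2

end LayerFamily

/-- A functor from a glued groupoid to one of its layers, given by a continuous choice of
components. -/
theorem Gluing.exists_component {Y : SseGroupoid.{u} I} (G : Gluing Y) (i : G.ι)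
    {φ : G.M → (G.L i).grp.Obj} {ψ : G.M → Y.Mor} (hφ : Continuous φ) (hψ : Continuous ψ)
    (hc : ∀ m, G.c i m (φ m) (ψ m)) (hC : ∀ p, p ∈ G.C i) :
    ∃ P : SmoothFunctor G.layer.grp (G.L i).grp, P.obj = φ ∧
      IsOrientedLocalDiffeo G.layer.grp.Obj (G.L i).grp.Obj P.obj := by
  have hα : ∀ t : G.etaleRel.RelMor, ∃ α : (G.L i).grp.Mor, (G.L i).grp.src α = φ t.1.1 ∧
      (G.L i).grp.tgt α = φ t.1.2.2 ∧
      Y.mul t.1.2.1 (ψ t.1.1) = Y.mul (ψ t.1.2.2) ((G.L i).F.mor α) := by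
    rintro ⟨⟨m, η, m'⟩, h1, h2, h3⟩
    obtain ⟨n, g, hn, hn'⟩ := h3 i (hC _)
    have e1 := (G.unique (hc m) hn).mul_left (k := η) (by rw [h1, G.tgt_eq (hc m)])
    obtain ⟨-, α, a1, a2, a3⟩ := e1.trans (G.unique hn' (hc m'))
    exact ⟨α, a1, a2, a3⟩
  -- A morphism of a nonsingular layer is determined by its ends. So the map on morphisms is forced
  -- by `φ`, functoriality is automatic, and only continuity remains.
  have huniq : ∀ {α β : (G.L i).grp.Mor}, (G.L i).grp.src α = (G.L i).grp.src β →
      (G.L i).grp.tgt α = (G.L i).grp.tgt β → α = β := (G.L i).nonsingular.hom_unique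
  have hobj : IsOrientedLocalDiffeo G.layer.grp.Obj (G.L i).grp.Obj φ := by
    have h1 : IsOrientedLocalDiffeo G.layer.grp.Obj Y.Mor ψ := by
      refine Y.tgt_localDiffeo.of_comp hψ ?_
      exact G.layer.etale.congr fun m => (G.tgt_eq (hc m)).symm
    refine (G.L i).etale.of_comp hφ ?_
    exact (Y.src_localDiffeo.comp h1).congr fun m => G.src_eq (hc m)
  choose A hA1 hA2 hA3 using hα
  have hcont : Continuous A := by
    rw [continuous_iff_continuousAt]
    intro t₀
    obtain ⟨s, U, hU, haU, hs, hsU, hsa, -⟩ :=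
      exists_section (G.L i).grp.src_localDiffeo.isLocalHomeomorph (A t₀)
    have c1 : Continuous fun t : G.etaleRel.RelMor => φ t.1.1 :=
      hφ.comp (continuous_fst.comp continuous_subtype_val)
    have c2 : Continuous fun t : G.etaleRel.RelMor => φ t.1.2.2 :=
      hφ.comp (continuous_snd.comp (continuous_snd.comp continuous_subtype_val))
    have c3 : Continuous fun t : G.etaleRel.RelMor => ψ t.1.1 :=
      hψ.comp (continuous_fst.comp continuous_subtype_val)
    have c4 : Continuous fun t : G.etaleRel.RelMor => ψ t.1.2.2 :=
      hψ.comp (continuous_snd.comp (continuous_snd.comp continuous_subtype_val))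
    have c5 : Continuous fun t : G.etaleRel.RelMor => t.1.2.1 :=
      continuous_fst.comp (continuous_snd.comp continuous_subtype_val)
    rw [hA1] at haU
    have hU' : ∀ᶠ t : G.etaleRel.RelMor in 𝓝 t₀, φ t.1.1 ∈ U :=
      (c1.tendsto t₀).eventually (hU.mem_nhds haU)
    have ts : Tendsto (fun t : G.etaleRel.RelMor => s (φ t.1.1)) (𝓝 t₀) (𝓝 (A t₀)) := by
      have := ((hs.continuousAt (hU.mem_nhds haU)).tendsto).comp (c1.tendsto t₀)
      rwa [← hA1, hsa] at this
    have hk : ∀ t : G.etaleRel.RelMor, Y.src t.1.2.1 = Y.tgt (ψ t.1.1) := fun t => by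
      exact t.2.1.trans (G.tgt_eq (hc t.1.1)).symm
    have hk' : ∀ t : G.etaleRel.RelMor, Y.tgt t.1.2.1 = Y.tgt (ψ t.1.2.2) := fun t => by
      exact t.2.2.1.trans (G.tgt_eq (hc t.1.2.2)).symm
    have hF : ∀ t : G.etaleRel.RelMor, (G.L i).F.mor (A t) =
        Y.mul (Y.inv (ψ t.1.2.2)) (Y.mul t.1.2.1 (ψ t.1.1)) := fun t => by
      rw [hA3, SseGroupoid.inv_mul_cancel_left]
      exact (G.src_eq (hc t.1.2.2)).trans (by rw [(G.L i).F.tgt_mor, hA2])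
    have tF : Tendsto (fun t : G.etaleRel.RelMor => (G.L i).F.mor (A t)) (𝓝 t₀)
        (𝓝 ((G.L i).F.mor (A t₀))) := by
      simp only [hF]
      have e1 := tendsto_mul (c5.tendsto t₀) (c3.tendsto t₀) (hk t₀) (Eventually.of_forall hk)
      have hh : ∀ t : G.etaleRel.RelMor, Y.src (Y.inv (ψ t.1.2.2)) =
          Y.tgt (Y.mul t.1.2.1 (ψ t.1.1)) := fun t => by
        rw [Y.src_inv, tgt_mul (hk t), hk' t]
      exact tendsto_mul ((Y.continuous_inv.comp c4).tendsto t₀) e1 (hh t₀)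
        (Eventually.of_forall hh)
    have e1 := eventually_eq_of_isLocalHomeomorph Y.src_localDiffeo.isLocalHomeomorph
      (((G.L i).F.contMDiff_mor.continuous.tendsto _).comp ts) tF (by
        filter_upwards [hU'] with t ht
        simp only [Function.comp]
        rw [(G.L i).F.src_mor, (G.L i).F.src_mor, hsU _ ht, hA1])
    have e2 := eventually_eq_of_isLocalHomeomorph (G.L i).etale.isLocalHomeomorph
      (((G.L i).grp.continuous_tgt.tendsto _).comp ts) (hA2 t₀ ▸ c2.tendsto t₀) (by
        filter_upwards [e1] with t ht
        simp only [Function.comp] at ht ⊢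
        rw [← (G.L i).F.tgt_mor, ht, (G.L i).F.tgt_mor, hA2])
    -- The local lift of the source map through `A t₀` has the ends of `A t`, so it equals `A t`
    -- near `t₀`.
    refine ts.congr' ?_
    filter_upwards [hU', e2] with t h1 h2
    exact huniq ((hsU _ h1).trans (hA1 t).symm) (h2.trans (hA2 t).symm)
  refine ⟨{ obj := φ
            mor := A
            contMDiff_obj := hobj.contMDiff
            contMDiff_mor := ?_
            src_mor := hA1
            tgt_mor := hA2
            mor_one := fun m => ?_
            mor_comp := fun δ γ h => ?_ }, rfl, hobj⟩
  · have h1 : IsOrientedLocalDiffeo G.layer.grp.Mor (G.L i).grp.Mor A := by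
      refine (G.L i).grp.src_localDiffeo.of_comp hcont ?_
      exact (hobj.comp G.layer.grp.src_localDiffeo).congr fun t => (hA1 t).symm
    exact h1.contMDiff
  · refine huniq ((hA1 _).trans ?_) ((hA2 _).trans ?_)
    · exact ((G.L i).grp.src_one _).symm
    · exact ((G.L i).grp.tgt_one _).symm
  · refine huniq ((hA1 _).trans ?_) ((hA2 _).trans ?_)
    · exact (hA1 γ).symm.trans ((G.L i).grp.src_comp _ _ _).symm
    · exact (hA2 δ).symm.trans ((G.L i).grp.tgt_comp _ _ _).symm

end Universal

end BranchedResolution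

namespace BranchedResolution

open SseGroupoid

/-! ### The effective part of the stabilizers -/

section Effective

theorem tendsto_iterate {M : Type*} [TopologicalSpace M] {f : M → M} {z : M}
    (hf : Tendsto f (𝓝 z) (𝓝 z)) (k : ℕ) : Tendsto f^[k] (𝓝 z) (𝓝 z) := by
  induction k with
  | zero => exact tendsto_id
  | succ k ih => exact ih.comp hf

/-- Averaging over the finite cyclic action: the mean `ψ` of the iterates of `f` satisfies `ψ ∘ f =
ψ` near `z` and has the identity as derivative at `z`. Being locally injective, it forces `f` to be
the identity. -/
theorem eventually_eq_self_of_iterate {E : Type*} [NormedAddCommGroup E] [NormedSpace ℝ E]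
    [CompleteSpace E] {f : E → E} {z : E} (hf : HasStrictFDerivAt f (ContinuousLinearMap.id ℝ E) z)
    (hz : f z = z) {i j : ℕ} (hij : i < j) (h : ∀ᶠ y in 𝓝 z, f^[i] y = f^[j] y) :
    ∀ᶠ y in 𝓝 z, f y = y := by
  have hft : Tendsto f (𝓝 z) (𝓝 z) := by
    have := hf.continuousAt.tendsto
    rwa [hz] at this
  have hit : ∀ k, HasStrictFDerivAt f^[k] (ContinuousLinearMap.id ℝ E) z := fun k => by
    have := hf.iterate hz k
    rwa [show (ContinuousLinearMap.id ℝ E) ^ k = ContinuousLinearMap.id ℝ E from one_pow k] at this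
  have hone : ((ContinuousLinearEquiv.refl ℝ E : E ≃L[ℝ] E) : E →L[ℝ] E) =
    ContinuousLinearMap.id ℝ E := rfl
  obtain ⟨m, rfl⟩ := Nat.exists_eq_add_of_lt hij
  -- Here `j = i + m + 1`; the iterate of order `i` is locally injective and can be cancelled.
  have h1 : ∀ᶠ y in 𝓝 z, f^[m + 1] y = y := by
    have hs : HasStrictFDerivAt f^[i] ((ContinuousLinearEquiv.refl ℝ E : E ≃L[ℝ] E) : E →L[ℝ] E) z :=
      hit i
    have hl := hs.eventually_left_inverse
    filter_upwards [h, hl, (tendsto_iterate hft (m + 1)).eventually hl] with y h1 h2 h3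
    rw [← h3, ← Function.iterate_add_apply, ← add_assoc, ← h1, h2]
  have hn : ((m + 1 : ℕ) : ℝ) ≠ 0 := Nat.cast_ne_zero.mpr (Nat.succ_ne_zero m)
  set ψ : E → E := fun y => ((m + 1 : ℕ) : ℝ)⁻¹ • ∑ k ∈ Finset.range (m + 1), f^[k] y
  have hψ : HasStrictFDerivAt ψ ((ContinuousLinearEquiv.refl ℝ E : E ≃L[ℝ] E) : E →L[ℝ] E) z := by
    have h2 := (HasStrictFDerivAt.fun_sum (u := Finset.range (m + 1))
      fun k _ => hit k).const_smul ((m + 1 : ℕ) : ℝ)⁻¹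
    have h3 : ((m + 1 : ℕ) : ℝ)⁻¹ • ∑ k ∈ Finset.range (m + 1), ContinuousLinearMap.id ℝ E =
        ContinuousLinearMap.id ℝ E := by
      rw [Finset.sum_const, Finset.card_range, ← Nat.cast_smul_eq_nsmul ℝ, smul_smul,
        inv_mul_cancel₀ hn, one_smul]
    rw [h3] at h2
    exact h2
  have hψf : ∀ᶠ y in 𝓝 z, ψ (f y) = ψ y := by
    filter_upwards [h1] with y hy
    change _ • _ = _ • _
    congr 1
    -- Composition with `f` shifts the orbit sum by one place, and the two end terms agree because
    -- `f^[m + 1] y = y`.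
    have e1 := Finset.sum_range_succ' (fun k => f^[k] y) (m + 1)
    rw [Finset.sum_range_succ, hy] at e1
    simp only [Function.iterate_zero, id] at e1
    exact (add_right_cancel e1).symm
  have hl := hψ.eventually_left_inverse
  filter_upwards [hψf, hl, hft.eventually hl] with y h1 h2 h3
  rw [← h3, h1, h2]

/-- In a chart at `x` the derivative of `θ` is the identity at points arbitrarily close to `x`,
hence at `x` by continuity, and the averaging argument applies. The boundaryless model makes the
chart target a neighbourhood in the vector space. -/
theorem eventually_eq_self_of_frequently {d : ℕ} {M : Type*} [TopologicalSpace M]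
    [ChartedSpace (EuclideanSpace ℝ (Fin d)) M] {θ : M → M} {x : M}
    (hθ : ContMDiffAt (𝓡 d) (𝓡 d) ∞ θ x) (hx : θ x = x) {i j : ℕ} (hij : i < j)
    (h : ∀ᶠ y in 𝓝 x, θ^[i] y = θ^[j] y) (hf : ∃ᶠ y in 𝓝 x, ∀ᶠ y' in 𝓝 y, θ y' = y') :
    ∀ᶠ y in 𝓝 x, θ y = y := by
  have hθt : Tendsto θ (𝓝 x) (𝓝 x) := by
    have := hθ.continuousAt.tendsto
    rwa [hx] at this
  set e := extChartAt (𝓡 d) x with he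
  set z := e x with hz
  set f : EuclideanSpace ℝ (Fin d) → EuclideanSpace ℝ (Fin d) := fun w => e (θ (e.symm w))
  have hsm : ContDiffAt ℝ ∞ f z := by
    have := (contMDiffAt_iff.mp hθ).2
    rw [hx, ModelWithCorners.range_eq_univ, contDiffWithinAt_univ] at this
    exact this
  have hsrc : ∀ᶠ y in 𝓝 x, y ∈ e.source := extChartAt_source_mem_nhds x
  have htgt : ∀ᶠ w in 𝓝 z, w ∈ e.target := extChartAt_target_mem_nhds x
  have tsym : Tendsto e.symm (𝓝 z) (𝓝 x) := by
    have := (continuousAt_extChartAt_symm (I := 𝓡 d) x).tendsto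
    rwa [extChartAt_to_inv] at this
  have te : Tendsto e (𝓝 x) (𝓝 z) := (continuousAt_extChartAt (I := 𝓡 d) x).tendsto
  have hfz : f z = z := by
    change e (θ (e.symm (e x))) = e x
    rw [e.left_inv (mem_extChartAt_source x), hx]
  have hft : Tendsto f (𝓝 z) (𝓝 z) := by
    have := hsm.continuousAt.tendsto
    rwa [hfz] at this
  have hiter : ∀ k, ∀ᶠ w in 𝓝 z, f^[k] w = e (θ^[k] (e.symm w)) := by
    intro k
    induction k with
    | zero => filter_upwards [htgt] with w hw using (e.right_inv hw).symm
    | succ k ih =>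
      filter_upwards [hft.eventually ih, (hθt.comp tsym).eventually hsrc] with w h1 h2
      rw [Function.iterate_succ_apply, Function.iterate_succ_apply, h1]
      congr 2
      exact e.left_inv h2
  have hij' : ∀ᶠ w in 𝓝 z, f^[i] w = f^[j] w := by
    filter_upwards [hiter i, hiter j, tsym.eventually h] with w h1 h2 h3
    rw [h1, h2, h3]
  have hder : fderiv ℝ f z = ContinuousLinearMap.id ℝ _ := by
    have hc : ContinuousAt (fderiv ℝ f) z := hsm.continuousAt_fderiv (by simp)
    refine isClosed_singleton.mem_of_frequently_of_tendsto
      (s := {ContinuousLinearMap.id ℝ (EuclideanSpace ℝ (Fin d))})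
      (f := fun y => fderiv ℝ f (e y)) (b := 𝓝 x) ?_ (hc.tendsto.comp te)
    refine (hf.and_eventually hsrc).mono ?_
    rintro y ⟨hy, hys⟩
    rw [mem_singleton_iff, ← fderiv_id (x := e y)]
    refine Filter.EventuallyEq.fderiv_eq ?_
    have t1 : Tendsto e.symm (𝓝 (e y)) (𝓝 y) := by
      have := (continuousAt_extChartAt_symm' (I := 𝓡 d) hys).tendsto
      rwa [show (extChartAt (𝓡 d) x).symm ((extChartAt (𝓡 d) x) y) = y from e.left_inv hys] at this
    have t2 : ∀ᶠ w in 𝓝 (e y), w ∈ e.target :=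
      extChartAt_target_mem_nhds' (e.map_source hys)
    filter_upwards [t1.eventually hy, t2] with w h1 h2
    change e (θ (e.symm w)) = w
    rw [h1, e.right_inv h2]
  have hstrict : HasStrictFDerivAt f (ContinuousLinearMap.id ℝ _) z :=
    hder ▸ hsm.hasStrictFDerivAt (by simp)
  have hfin := eventually_eq_self_of_iterate hstrict hfz hij hij'
  filter_upwards [te.eventually hfin, hsrc, hθt.eventually hsrc] with y h1 h2 h3
  have h4 : e (θ (e.symm (e y))) = e y := h1
  rw [e.left_inv h2] at h4
  exact e.injOn h3 h2 h4

/-- Treat the finitely many conditions one after another: if the current open set meets `R k`,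
replace it by the intersection. Applied to the sets of points moved by stabilizer elements, and to
the sets where two sections have the same germ. -/
theorem exists_isOpen_dichotomy {X ι : Type*} [TopologicalSpace X] {K : Set ι} (hK : K.Finite)
    {R : ι → Set X} {P : Set X} (hP : IsOpen P) (hne : P.Nonempty)
    (hR : ∀ k ∈ K, ∀ O ⊆ P, IsOpen O → IsOpen (O ∩ R k)) :
    ∃ O ⊆ P, IsOpen O ∧ O.Nonempty ∧ ∀ k ∈ K, O ⊆ R k ∨ Disjoint O (R k) := by
  induction K, hK using Set.Finite.induction_on with
  | empty => exact ⟨P, subset_rfl, hP, hne, fun k hk => absurd hk (notMem_empty k)⟩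
  | @insert a s _ _ ih =>
    obtain ⟨O, hOP, hO, hOne, h⟩ := ih fun k hk => hR k (mem_insert_of_mem a hk)
    by_cases hd : (O ∩ R a).Nonempty
    · refine ⟨O ∩ R a, inter_subset_left.trans hOP, hR a (mem_insert a s) O hOP hO, hd,
        fun k hk => ?_⟩
      rcases hk with rfl | hk
      · exact Or.inl inter_subset_right
      · exact (h k hk).imp inter_subset_left.trans fun h => h.mono_left inter_subset_left
    · refine ⟨O, hOP, hO, hOne, fun k hk => ?_⟩
      rcases hk with rfl | hk
      · exact Or.inr (disjoint_iff_inter_eq_empty.mpr (not_nonempty_iff_eq_empty.mp hd))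
      · exact h k hk

namespace SseGroupoid

section

variable {n : ℕ} {H : Type} [TopologicalSpace H]
  {I : ModelWithCorners ℝ (EuclideanSpace ℝ (Fin n)) H} {X : SseGroupoid.{u} I}

variable (X) in
/-- The morphisms near which source and target agree. -/
def inertia : Set X.Mor := {γ | ∀ᶠ γ' in 𝓝 γ, X.src γ' = X.tgt γ'}

theorem isOpen_inertia : IsOpen X.inertia := by
  rw [isOpen_iff_mem_nhds]
  intro γ hγ
  exact eventually_eventually_nhds.mpr hγ

theorem src_eq_tgt_of_mem_inertia {γ : X.Mor} (h : γ ∈ X.inertia) : X.src γ = X.tgt γ :=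
  Eventually.self_of_nhds (p := fun γ' => X.src γ' = X.tgt γ') h

/-- Conjugation preserves the effectively trivial morphisms. -/
theorem conj_mem_inertia {γ δ : X.Mor} (h : γ ∈ X.inertia) (hγ : X.src γ = X.src δ) :
    X.mul δ (X.mul γ (X.inv δ)) ∈ X.inertia := by
  have hγ' : X.tgt γ = X.src δ := (src_eq_tgt_of_mem_inertia h).symm.trans hγ
  have c1 : X.src γ = X.tgt (X.inv δ) := by rw [X.tgt_inv, hγ]
  have c2 : X.src δ = X.tgt (X.mul γ (X.inv δ)) := by rw [tgt_mul c1, hγ']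
  obtain ⟨s, U, hU, hδU, hs, hsU, hsδ, -⟩ := exists_section X.tgt_localDiffeo.isLocalHomeomorph δ
  set ε := X.mul δ (X.mul γ (X.inv δ)) with hε
  have hε1 : X.src ε = X.tgt δ := by rw [hε, src_mul, src_mul, X.src_inv]
  have hε2 : X.tgt ε = X.tgt δ := by rw [hε, tgt_mul c2]
  have ts := (hs.continuousAt (hU.mem_nhds hδU)).tendsto
  rw [hsδ] at ts
  have t1 : Tendsto (fun γ' => s (X.src γ')) (𝓝 ε) (𝓝 δ) :=
    ts.comp (hε1 ▸ X.continuous_src.tendsto ε)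
  have t2 : Tendsto (fun γ' => s (X.tgt γ')) (𝓝 ε) (𝓝 δ) :=
    ts.comp (hε2 ▸ X.continuous_tgt.tendsto ε)
  have u1 : ∀ᶠ γ' in 𝓝 ε, X.src γ' ∈ U :=
    X.continuous_src.continuousAt.eventually (hU.mem_nhds (hε1 ▸ hδU))
  have u2 : ∀ᶠ γ' in 𝓝 ε, X.tgt γ' ∈ U :=
    X.continuous_tgt.continuousAt.eventually (hU.mem_nhds (hε2 ▸ hδU))
  have t3 : Tendsto (fun γ' => X.mul γ' (s (X.src γ'))) (𝓝 ε) (𝓝 (X.mul ε δ)) :=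
    tendsto_mul tendsto_id t1 hε1 (u1.mono fun γ' h => (hsU _ h).symm)
  have t4 : Tendsto (fun γ' => X.mul (X.inv (s (X.tgt γ'))) (X.mul γ' (s (X.src γ')))) (𝓝 ε)
      (𝓝 (X.mul (X.inv δ) (X.mul ε δ))) := by
    refine tendsto_mul ((X.continuous_inv.tendsto δ).comp t2) t3 ?_ ?_
    · rw [X.src_inv, tgt_mul hε1, hε2]
    · filter_upwards [u1, u2] with γ' h1 h2
      rw [tgt_mul (hsU _ h1).symm]
      exact (X.src_inv _).trans (hsU _ h2)
  have hγε : X.mul (X.inv δ) (X.mul ε δ) = γ := by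
    have e1 : X.mul ε δ = X.mul δ γ := by
      rw [hε, mul_assoc c2 (by rw [src_mul, X.src_inv]), mul_assoc c1 (X.src_inv δ), inv_mul,
        mul_one hγ]
    rw [e1, inv_mul_cancel_left hγ'.symm]
  rw [hγε] at t4
  have e1 := eventually_eq_of_isLocalHomeomorph X.src_localDiffeo.isLocalHomeomorph t1 t2 (by
    filter_upwards [t4.eventually h, u1, u2] with γ' h1 h2 h3
    rw [src_mul, src_mul, tgt_mul (by rw [X.src_inv, hsU _ h3, tgt_mul (hsU _ h2).symm]),
      X.tgt_inv] at h1
    exact h1)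
  filter_upwards [e1, u1, u2] with γ' h1 h2 h3
  rw [← hsU _ h2, h1, hsU _ h3]

variable (X) in
/-- The order of the group of elements of the stabilizer that act trivially near `x`. -/
noncomputable def kerOrder (x : X.Obj) : ℕ := Set.ncard (X.stab x ∩ X.inertia)

theorem kerOrder_pos (x : X.Obj) : 0 < X.kerOrder x := by
  refine (Set.ncard_pos ((X.stable x).subset inter_subset_left)).mpr
    ⟨X.one x, one_mem_stab x, ?_⟩
  obtain ⟨s, U, hU, hxU, hs, hsU, hsx, hs'⟩ :=
    exists_section X.one_localDiffeo.isLocalHomeomorph x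
  filter_upwards [hU.mem_nhds hxU] with γ hγ
  rw [← hsU γ hγ, X.src_one, X.tgt_one]

theorem kerOrder_congr {x y : X.Obj} (h : X.proj x = X.proj y) : X.kerOrder x = X.kerOrder y := by
  have key : ∀ δ : X.Mor, X.kerOrder (X.src δ) ≤ X.kerOrder (X.tgt δ) := by
    intro δ
    refine Set.ncard_le_ncard_of_injOn (fun γ => X.mul δ (X.mul γ (X.inv δ))) ?_ ?_
      ((X.stable _).subset inter_subset_left)
    · rintro γ ⟨⟨h1, h2⟩, h3⟩
      have c1 : X.src γ = X.tgt (X.inv δ) := by rw [X.tgt_inv, h1]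
      exact ⟨⟨by rw [src_mul, src_mul, X.src_inv], by rw [tgt_mul (by rw [tgt_mul c1, h2])]⟩,
        conj_mem_inertia h3 h1⟩
    · rintro γ ⟨⟨h1, h2⟩, h3⟩ γ' ⟨⟨h1', h2'⟩, h3'⟩ heq
      have c1 : X.src γ = X.tgt (X.inv δ) := by rw [X.tgt_inv, h1]
      have c1' : X.src γ' = X.tgt (X.inv δ) := by rw [X.tgt_inv, h1']
      have := mul_left_cancel (by rw [tgt_mul c1, h2]) (by rw [tgt_mul c1', h2']) heq
      exact mul_right_cancel c1 c1' this
  obtain ⟨δ, rfl, rfl⟩ := X.proj_eq_iff.mp h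
  refine le_antisymm (key δ) ?_
  have := key (X.inv δ)
  rwa [X.src_inv, X.tgt_inv] at this

theorem kerOrder_eq_order_of_isSmoothPoint {x : X.Obj} (h : X.IsSmoothPoint (X.proj x)) :
    X.kerOrder x = X.order x := by
  have : X.stab x ∩ X.inertia = X.stab x :=
    inter_eq_left.mpr fun γ hγ => h x rfl γ hγ.1 hγ.2
  rw [kerOrder, this]
  rfl

/-- `kerOrder` as a function on the orbit space. -/
noncomputable def kerOrbit (p : X.Orbit) : ℝ :=
  Quotient.lift (fun x => (X.kerOrder x : ℝ))
    (fun _ _ h => congrArg Nat.cast (kerOrder_congr (Quotient.sound h))) p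

@[simp] theorem kerOrbit_proj (x : X.Obj) : kerOrbit (X.proj x) = X.kerOrder x := rfl

theorem kerOrbit_pos (p : X.Orbit) : 0 < kerOrbit p := by
  obtain ⟨x, rfl⟩ := X.isOpenQuotientMap_proj.surjective p
  exact Nat.cast_pos.mpr (kerOrder_pos x)

namespace Slice

variable {x : X.Obj} (S : X.Slice x)

theorem tendsto_sec {g : X.Mor} (hg : g ∈ X.stab x) {y : X.Obj} (hy : y ∈ S.P) :
    Tendsto (S.sec g) (𝓝 y) (𝓝 (S.sec g y)) :=
  (S.cont g hg).continuousAt (S.isOpen.mem_nhds hy)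

theorem eventually_eq_sec {g : X.Mor} (hg : g ∈ X.stab x) {y : X.Obj} (hy : y ∈ S.P) :
    ∀ᶠ γ in 𝓝 (S.sec g y), γ = S.sec g (X.src γ) := by
  have h1 : Tendsto X.src (𝓝 (S.sec g y)) (𝓝 y) := by
    have := X.continuous_src.tendsto (S.sec g y)
    rwa [S.src_sec g hg y hy] at this
  refine eventually_eq_of_isLocalHomeomorph X.src_localDiffeo.isLocalHomeomorph tendsto_id
    ((S.tendsto_sec hg hy).comp h1) ?_
  filter_upwards [h1.eventually (S.isOpen.mem_nhds hy)] with γ hγ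
  exact (S.src_sec g hg _ hγ).symm

theorem sec_mem_inertia_iff {g : X.Mor} (hg : g ∈ X.stab x) {y : X.Obj} (hy : y ∈ S.P) :
    S.sec g y ∈ X.inertia ↔ ∀ᶠ z in 𝓝 y, X.tgt (S.sec g z) = z := by
  constructor
  · intro h
    filter_upwards [(S.tendsto_sec hg hy).eventually h, S.isOpen.mem_nhds hy] with z h1 h2
    rw [← h1, S.src_sec g hg z h2]
  · intro h
    have h1 : Tendsto X.src (𝓝 (S.sec g y)) (𝓝 y) := by
      have := X.continuous_src.tendsto (S.sec g y)
      rwa [S.src_sec g hg y hy] at this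
    filter_upwards [S.eventually_eq_sec hg hy, h1.eventually h] with γ h1 h2
    rw [← h1] at h2
    exact h2.symm

end Slice

/-- Smooth points are dense. -/
theorem IsProper.exists_isSmoothPoint (hX : X.IsProper) {V : Set X.Obj} (hV : IsOpen V)
    (hne : V.Nonempty) : ∃ y ∈ V, X.IsSmoothPoint (X.proj y) := by
  obtain ⟨x, hx⟩ := hne
  obtain ⟨S, hSV⟩ := hX.exists_slice (hV.mem_nhds hx)
  -- On `O` every stabilizer element of `x` moves all points or fixes all points. One that fixes `y`
  -- therefore acts trivially near `y`; conjugation carries this to the whole orbit of `y`.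
  obtain ⟨O, hOP, hO, ⟨y, hy⟩, h⟩ := exists_isOpen_dichotomy (X.stable x)
    (R := fun g => {y | X.tgt (S.sec g y) ≠ y}) S.isOpen ⟨x, S.mem⟩ (by
      intro g hg O hOP hO
      have : ContinuousOn (fun y => (X.tgt (S.sec g y), y)) O :=
        ((X.continuous_tgt.comp_continuousOn (S.cont g hg)).mono hOP).prodMk continuousOn_id
      exact this.isOpen_inter_preimage hO isClosed_diagonal.isOpen_compl)
  refine ⟨y, hSV (hOP hy), fun z hz γ h1 h2 => ?_⟩
  obtain ⟨δ, rfl, hδ⟩ := X.proj_eq_iff.mp hz.symm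
  subst hδ
  have c1 : X.src (X.inv δ) = X.tgt γ := by rw [X.src_inv, h2]
  have c2 : X.src γ = X.tgt δ := h1
  set ε := X.mul (X.inv δ) (X.mul γ δ) with hε
  have hε1 : X.src ε = X.src δ := by rw [hε, src_mul, src_mul]
  have hε2 : X.tgt ε = X.src δ := by rw [hε, tgt_mul (by rw [tgt_mul c2, c1]), X.tgt_inv]
  have hεT : ε ∈ X.inertia := by
    obtain ⟨g, hg, hgε⟩ := S.exists_sec ε (hε1 ▸ hOP hy) (hε2 ▸ hOP hy)
    rw [hε1] at hgε
    rw [hgε, S.sec_mem_inertia_iff hg (hOP hy)]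
    rcases h g hg with h' | h'
    · refine absurd ?_ (h' hy)
      rw [← hgε, hε2]
    · filter_upwards [hO.mem_nhds hy] with w hw
      by_contra hne
      exact Set.disjoint_left.mp h' hw hne
  have := conj_mem_inertia (δ := δ) hεT hε1
  rwa [hε, ← mul_assoc c1 c2, mul_inv_cancel_right (by rw [src_mul, c2]),
    mul_inv_cancel_left h2.symm] at this

end

/-- In dimension `d` without boundary, the set of effectively trivial morphisms is closed. -/
theorem IsProper.isClosed_inertia {d : ℕ} {X : SseGroupoid.{u} (𝓡 d)} (hX : X.IsProper) :
    IsClosed X.inertia := by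
  refine isClosed_of_closure_subset fun g hg => ?_
  have hgst : X.src g = X.tgt g := by
    have : closure X.inertia ⊆ {γ | X.src γ = X.tgt γ} :=
      closure_minimal (fun γ hγ => src_eq_tgt_of_mem_inertia hγ)
        (isClosed_eq X.continuous_src X.continuous_tgt)
    exact this hg
  obtain ⟨x, hx⟩ : ∃ x, X.src g = x := ⟨_, rfl⟩
  have hgx : g ∈ X.stab x := ⟨hx, hgst ▸ hx⟩
  obtain ⟨S, -⟩ := hX.exists_slice (univ_mem : univ ∈ 𝓝 x)
  have hself := S.sec_self g hgx
  set θ : X.Obj → X.Obj := fun y => X.tgt (S.sec g y) with hθ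
  rw [← hself, S.sec_mem_inertia_iff hgx S.mem]
  have hsec : ContMDiffAt (𝓡 d) (𝓡 d) ∞ (S.sec g) x := by
    refine contMDiffAt_of_comp_isLocalDiffeomorph X.src_localDiffeo.isLocalDiffeomorph
      (S.tendsto_sec hgx S.mem) ?_
    refine contMDiffAt_id.congr_of_eventuallyEq ?_
    filter_upwards [S.isOpen.mem_nhds S.mem] with y hy using S.src_sec g hgx y hy
  have hsm : ContMDiffAt (𝓡 d) (𝓡 d) ∞ θ x :=
    (X.tgt_localDiffeo.contMDiff _).comp x hsec
  have hθx : θ x = x := by rw [hθ]; simp only [hself, hgx.2]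
  -- `p k` is the power `g ^ k`; on the slice it acts as the iterate of `θ`. Finiteness of the
  -- stabilizer gives two equal powers, hence two equal iterates.
  let p : ℕ → X.Mor := fun k => (fun γ => X.mul g γ)^[k] (X.one x)
  have hp : ∀ k, p k ∈ X.stab x := by
    intro k
    induction k with
    | zero => exact one_mem_stab x
    | succ k ih =>
      change (fun γ => X.mul g γ)^[k + 1] (X.one x) ∈ _
      rw [Function.iterate_succ_apply']
      exact mul_mem_stab hgx ih
  have hiter : ∀ k, ∀ y ∈ S.P, θ^[k] y = X.tgt (S.sec (p k) y) := by
    intro k y hy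
    induction k with
    | zero => exact (by rw [show p 0 = X.one x from rfl, S.sec_one hy, X.tgt_one]; rfl)
    | succ k ih =>
      rw [Function.iterate_succ_apply', ih]
      have h1 : p (k + 1) = X.mul g (p k) := Function.iterate_succ_apply' _ _ _
      rw [h1, ← S.sec_mul g hgx _ (hp k) y hy,
        tgt_mul (S.src_sec g hgx _ (S.tgt_mem _ (hp k) y hy))]
  obtain ⟨i, j, hij, hpij⟩ : ∃ i j, i < j ∧ p i = p j := by
    have : ¬ Function.Injective p := fun hinj =>
      (Set.infinite_of_injective_forall_mem hinj hp) (X.stable x)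
    simp only [Function.Injective, not_forall] at this
    obtain ⟨i, j, h, hne⟩ := this
    rcases lt_or_gt_of_ne hne with h' | h'
    · exact ⟨i, j, h', h⟩
    · exact ⟨j, i, h', h.symm⟩
  refine eventually_eq_self_of_frequently hsm hθx hij ?_ ?_
  · filter_upwards [S.isOpen.mem_nhds S.mem] with y hy
    rw [hiter i y hy, hiter j y hy, hpij]
  -- Morphisms of `inertia` close to `g` lie on its section, so `θ` is the identity near their
  -- sources, and these accumulate at `x`.
  · rw [mem_closure_iff_frequently] at hg
    have h1 : ∀ᶠ γ in 𝓝 g, γ = S.sec g (X.src γ) := by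
      have := S.eventually_eq_sec hgx S.mem
      rwa [hself] at this
    have h2 : Tendsto X.src (𝓝 g) (𝓝 x) := hx ▸ X.continuous_src.tendsto g
    refine h2.frequently ((hg.and_eventually (h1.and (h2.eventually
      (S.isOpen.mem_nhds S.mem)))).mono ?_)
    rintro γ ⟨h3, h4, h5⟩
    rw [h4] at h3
    exact (S.sec_mem_inertia_iff hgx h5).mp h3

/-- `inertia` is open and closed. So for `y` near `x` the section through `g` lies in it at `y`
exactly if `g` does, and `g ↦ sec g y` matches the two groups. -/
theorem IsProper.isLocallyConstant_kerOrbit {d : ℕ} {X : SseGroupoid.{u} (𝓡 d)}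
    (hX : X.IsProper) : IsLocallyConstant (kerOrbit : X.Orbit → ℝ) := by
  rw [IsLocallyConstant.iff_eventually_eq]
  intro p
  obtain ⟨x, rfl⟩ := X.isOpenQuotientMap_proj.surjective p
  rw [← X.isOpenQuotientMap_proj.map_nhds_eq, eventually_map]
  obtain ⟨S, -⟩ := hX.exists_slice (univ_mem : univ ∈ 𝓝 x)
  have hfin : (X.stab x).Finite := X.stable x
  have h1 : ∀ᶠ y in 𝓝 x, ∀ g ∈ X.stab x, (S.sec g y ∈ X.inertia ↔ g ∈ X.inertia) := by
    refine hfin.eventually_all.mpr fun g hg => ?_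
    have ht := S.tendsto_sec hg S.mem
    rw [S.sec_self g hg] at ht
    by_cases h : g ∈ X.inertia
    · filter_upwards [ht.eventually (isOpen_inertia.mem_nhds h)] with y hy
      exact iff_of_true hy h
    · filter_upwards [ht.eventually (hX.isClosed_inertia.isOpen_compl.mem_nhds h)] with y hy
      exact iff_of_false hy h
  filter_upwards [h1, S.isOpen.mem_nhds S.mem] with y hy hyP
  rw [kerOrbit_proj, kerOrbit_proj, Nat.cast_inj]
  refine (Set.ncard_congr (fun g _ => S.sec g y) ?_ ?_ ?_).symm
  · rintro g ⟨hg, hgT⟩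
    have h2 := (hy g hg).mpr hgT
    have h3 := S.src_sec g hg y hyP
    exact ⟨⟨h3, by rw [← src_eq_tgt_of_mem_inertia h2, h3]⟩, h2⟩
  · rintro g g' ⟨hg, -⟩ ⟨hg', -⟩ h
    exact S.sec_inj g hg g' hg' y hyP h
  · rintro γ ⟨⟨rfl, h2⟩, hγ⟩
    obtain ⟨g, hg, hgγ⟩ := S.exists_sec γ hyP (h2.symm ▸ hyP)
    refine ⟨g, ⟨hg, (hy g hg).mp (hgγ ▸ hγ)⟩, hgγ.symm⟩

end SseGroupoid

end Effective

end BranchedResolution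

namespace BranchedResolution

open SseGroupoid

/-! ### Points over which the Hausdorff quotient makes no identifications -/

section Resolution

variable {n : ℕ} {H : Type} [TopologicalSpace H]
  {I : ModelWithCorners ℝ (EuclideanSpace ℝ (Fin n)) H}

namespace Layer

variable {Y : SseGroupoid.{u} I} {L : Layer Y}

variable (L) in
/-- The points of `|Y|` over which the Hausdorff quotient of the orbit space of `L` makes no
identifications. -/
def separated : Set Y.Orbit :=
  {p | ∀ a b, Y.proj (L.F.obj a) = p → L.grp.projH a = L.grp.projH b → L.grp.proj a = L.grp.proj b}

/-- Over `O` two sections agree everywhere or nowhere, so branches neither merge nor split there.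
Small images of inequivalent sections over a slice are then disjoint open sets, and separation over
`O` passes to the Hausdorff quotient. -/
theorem Frame.image_subset_separated [T2Space Y.Orbit] (hY : Y.IsProper) {x : Y.Obj}
    (T : L.Frame x) {O : Set Y.Obj} (hO : IsOpen O) (hOT : O ⊆ T.P)
    (hdich : ∀ s t, (∀ y ∈ O, L.Germ (T.pt s y) (T.mor s y) (T.pt t y) (T.mor t y)) ∨
      ∀ y ∈ O, ¬ L.Germ (T.pt s y) (T.mor s y) (T.pt t y) (T.mor t y)) :
    Y.proj '' O ⊆ L.separated := by
  intro p hp a b hap hab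
  have hO' : IsOpen (Y.proj '' O) := Y.isOpenQuotientMap_proj.isOpenMap _ hO
  refine rel_of_t2Quotient_mk_eq (τ := L.F.orbitMap) (O := Y.proj '' O) (r := Eq)
    L.F.continuous_orbitMap eq_equivalence ?_ hab (show Y.proj (L.F.obj a) ∈ _ from hap ▸ hp)
  intro c c' hcc hcO hne
  obtain ⟨z, hz, hzc⟩ := hcO
  obtain ⟨a, rfl⟩ := L.grp.isOpenQuotientMap_proj.surjective c
  obtain ⟨b, rfl⟩ := L.grp.isOpenQuotientMap_proj.surjective c'
  obtain ⟨s, hs⟩ := T.exists_proj_eq (hOT hz) (a := a) hzc.symm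
  obtain ⟨t, ht⟩ := T.exists_proj_eq (hOT hz) (a := b) (hcc.symm.trans hzc.symm)
  rw [hs, ht] at hne ⊢
  clear hs ht hcc hzc a b hab hap
  obtain ⟨S₀, hS₀⟩ := hY.exists_slice (hO.mem_nhds hz)
  have hfin : (Y.stab z).Finite := Y.stable z
  have hmt := T.tgt_mor t z (hOT hz)
  have h1 : ∀ h ∈ Y.stab z, ∃ t', L.Germ (T.pt t z) (Y.mul (Y.inv h) (T.mor t z)) (T.pt t' z)
      (T.mor t' z) := fun h hh => T.cover z (hOT hz) _ _
    (by rw [src_mul, T.src_mor t z (hOT hz)])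
    (by rw [tgt_mul (by rw [Y.src_inv, hh.2, hmt]), Y.tgt_inv, hh.1])
  -- Transporting the section `t` by a stabilizer element `h` gives, near `z`, another section `t'`
  -- of the frame.
  have h2 : ∀ᶠ w in 𝓝 z, ∀ h ∈ Y.stab z, ∃ t', L.Germ (T.pt t' z) (T.mor t' z) (T.pt t z)
      (Y.mul (Y.inv h) (T.mor t z)) ∧ L.Germ (T.pt t (Y.tgt (S₀.sec h w)))
      (Y.mul (Y.inv (S₀.sec h w)) (T.mor t (Y.tgt (S₀.sec h w)))) (T.pt t' w) (T.mor t' w) := by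
    refine hfin.eventually_all.mpr fun h hh => ?_
    obtain ⟨t', ht'⟩ := h1 h hh
    have c1 : Tendsto (S₀.sec h) (𝓝 z) (𝓝 h) := by
      have := S₀.tendsto_sec hh S₀.mem
      rwa [S₀.sec_self h hh] at this
    have c2 : Tendsto (fun y => Y.tgt (S₀.sec h y)) (𝓝 z) (𝓝 z) := by
      have := (Y.continuous_tgt.tendsto h).comp c1
      rwa [hh.2] at this
    have hT : ∀ᶠ w in 𝓝 z, w ∈ T.P := T.isOpen.mem_nhds (hOT hz)
    have hcomp : ∀ᶠ w in 𝓝 z, Y.src (Y.inv (S₀.sec h w)) =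
        Y.tgt (T.mor t (Y.tgt (S₀.sec h w))) := by
      filter_upwards [c2.eventually hT] with w hw
      rw [Y.src_inv, T.tgt_mor t _ hw]
    have c3 := tendsto_mul ((Y.continuous_inv.tendsto h).comp c1)
      ((T.tendsto_mor t (hOT hz)).comp c2) (by rw [Y.src_inv, hh.2, hmt]) hcomp
    have := ht'.eventually ((T.tendsto_pt t (hOT hz)).comp c2) c3 (T.tendsto_pt t' (hOT hz))
      (T.tendsto_mor t' (hOT hz)) (by
        filter_upwards [c2.eventually hT] with w hw
        rw [src_mul]
        exact T.src_mor t _ hw) (by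
        filter_upwards [hT] with w hw using T.src_mor t' w hw) (by
        filter_upwards [hT, hcomp, S₀.isOpen.mem_nhds S₀.mem] with w hw hw' hw''
        rw [tgt_mul (by exact hw'), T.tgt_mor t' w hw]
        exact (Y.tgt_inv _).trans (S₀.src_sec h hh w hw''))
    filter_upwards [this] with w hw using ⟨t', ht'.symm, hw⟩
  obtain ⟨S, hSS₀, hSV, hsec⟩ := S₀.exists_shrink h2
  have hSO : S.P ⊆ O := hSS₀.trans hS₀
  have hST : S.P ⊆ T.P := hSO.trans hOT
  have hsub : ∀ r, L.grp.proj '' (T.pt r '' S.P) ⊆ L.F.orbitMap ⁻¹' (Y.proj '' O) := by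
    rintro r _ ⟨_, ⟨w, hw, rfl⟩, rfl⟩
    exact ⟨w, hSO hw, (T.proj_pt r (hST hw)).symm⟩
  have hopen : ∀ r, IsOpen (L.grp.proj '' (T.pt r '' S.P)) := fun r =>
    L.grp.isOpenQuotientMap_proj.isOpenMap _ (T.isOpen_image r S.isOpen hST)
  have hsat : ∀ r, ∀ a b, L.F.orbitMap a = L.F.orbitMap b →
      (L.F.orbitMap a ∈ Y.proj '' O → a = b) → (a ∈ L.grp.proj '' (T.pt r '' S.P) ↔
        b ∈ L.grp.proj '' (T.pt r '' S.P)) := by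
    intro r a b hab h
    constructor
    · intro ha
      rwa [← h (hsub r ha)]
    · intro hb
      rwa [h (hab ▸ hsub r hb)]
  refine ⟨_, _, hopen s, hopen t, ⟨_, ⟨z, S.mem, rfl⟩, rfl⟩, ⟨_, ⟨z, S.mem, rfl⟩, rfl⟩, ?_,
    hsat s, hsat t⟩
  rw [Set.disjoint_left]
  rintro _ ⟨_, ⟨w₁, hw₁, rfl⟩, rfl⟩ ⟨_, ⟨w₂, hw₂, rfl⟩, hw⟩
  apply hne
  obtain ⟨α, hα1, hα2⟩ := L.grp.proj_eq_iff.mp hw.symm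
  have m1 := T.src_mor s w₁ (hST hw₁)
  have m1' := T.tgt_mor s w₁ (hST hw₁)
  have m2 := T.src_mor t w₂ (hST hw₂)
  have m2' := T.tgt_mor t w₂ (hST hw₂)
  have f1 : Y.src (L.F.mor α) = L.F.obj (T.pt s w₁) := by rw [L.F.src_mor, hα1]
  have f2 : Y.tgt (L.F.mor α) = L.F.obj (T.pt t w₂) := by rw [L.F.tgt_mor, hα2]
  have g0 : Y.src (T.mor t w₂) = Y.tgt (L.F.mor α) := by rw [m2, f2]
  set β := Y.mul (T.mor t w₂) (L.F.mor α) with hβ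
  have hβ1 : Y.src β = Y.src (T.mor s w₁) := by rw [hβ, src_mul, f1, m1]
  have hβ2 : Y.tgt β = w₂ := by rw [hβ, tgt_mul g0, m2']
  -- A common orbit of the two images yields a morphism `k` between points of the slice, so it comes
  -- from a stabilizer element `h`. Transport by `h` turns the coincidence into one of `s` with `t'`
  -- over the single point `w₁`.
  set k := Y.mul β (Y.inv (T.mor s w₁)) with hk
  have hk0 : Y.src β = Y.tgt (Y.inv (T.mor s w₁)) := by rw [Y.tgt_inv, hβ1]
  have hk1 : Y.src k = w₁ := by rw [hk, src_mul, Y.src_inv, m1']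
  have hk2 : Y.tgt k = w₂ := by rw [hk, tgt_mul hk0, hβ2]
  have hkm : Y.mul k (T.mor s w₁) = β := inv_mul_cancel_right hβ1
  obtain ⟨h, hh, hkh⟩ := S.exists_sec k (hk1.symm ▸ hw₁) (hk2.symm ▸ hw₂)
  rw [hk1, hsec] at hkh
  obtain ⟨t', ht', ht''⟩ := hSV hw₁ h hh
  rw [← hkh, hk2] at ht''
  have e1 : L.Germ (T.pt s w₁) β (T.pt t w₂) (T.mor t w₂) := .of_mor hα1 hα2 m2
  have e2 := e1.mul_left (k := Y.inv k) (by rw [Y.src_inv, hk2, hβ2])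
  rw [← hkm, inv_mul_cancel_left (by rw [hk1, m1'])] at e2
  have e3 := e2.trans ht''
  -- The dichotomy moves the coincidence from `w₁` to `z`, where `t'` is a transport of `t`; this
  -- contradicts `hne`.
  have e4 : L.Germ (T.pt s z) (T.mor s z) (T.pt t' z) (T.mor t' z) := by
    rcases hdich s t' with h' | h'
    · exact h' z hz
    · exact absurd e3 (h' w₁ (hSO hw₁))
  exact e4.proj_eq.trans ht'.proj_eq

/-- Equality of the germs of two sections is an open condition. Inside any open set the dichotomy
therefore holds, for all pairs of sections at once, on some nonempty open subset. -/
theorem dense_interior_separated [T2Space Y.Orbit] (hY : Y.IsProper)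
    (hT : ∀ x, Nonempty (L.Frame x)) : Dense (interior L.separated) := by
  rw [dense_iff_inter_open]
  rintro V hV ⟨p, hp⟩
  obtain ⟨x, rfl⟩ := Y.isOpenQuotientMap_proj.surjective p
  obtain ⟨T⟩ := hT x
  obtain ⟨O, hOP, hO, ⟨y, hy⟩, h⟩ := exists_isOpen_dichotomy (K := (univ : Set (T.S × T.S)))
    finite_univ (P := T.P ∩ Y.proj ⁻¹' V)
    (R := fun k => {y | L.Germ (T.pt k.1 y) (T.mor k.1 y) (T.pt k.2 y) (T.mor k.2 y)})
    (T.isOpen.inter (hV.preimage Y.continuous_proj)) ⟨x, T.mem, hp⟩ (by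
      rintro ⟨s, t⟩ - O hOP hO
      rw [isOpen_iff_mem_nhds]
      rintro y ⟨hy, hy'⟩
      have hyT := (hOP hy).1
      have hT : ∀ᶠ w in 𝓝 y, w ∈ T.P := T.isOpen.mem_nhds hyT
      have := Germ.eventually hy' (T.tendsto_pt s hyT) (T.tendsto_mor s hyT) (T.tendsto_pt t hyT)
        (T.tendsto_mor t hyT) (hT.mono fun w hw => T.src_mor s w hw)
        (hT.mono fun w hw => T.src_mor t w hw)
        (hT.mono fun w hw => (T.tgt_mor s w hw).trans (T.tgt_mor t w hw).symm)
      filter_upwards [hO.mem_nhds hy, this] with w h1 h2 using ⟨h1, h2⟩)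
  have hsub := T.image_subset_separated hY hO (fun y hy => (hOP hy).1) fun s t => by
    rcases h (s, t) (mem_univ _) with h' | h'
    · exact Or.inl fun y hy => h' hy
    · exact Or.inr fun y hy hy' => Set.disjoint_left.mp h' hy hy'
  exact ⟨Y.proj y, (hOP hy).2, mem_interior.mpr
    ⟨_, hsub, Y.isOpenQuotientMap_proj.isOpenMap _ hO, ⟨y, hy, rfl⟩⟩⟩

end Layer

/-! ### Local branching structures -/

namespace IsLocalBranching

variable {B : SseGroupoid.{u} I} {Λ : B.HOrbit → ℝ} {N : Set B.HOrbit} {ℓ : ℕ}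
  {U : Fin ℓ → Set B.Obj} {m : Fin ℓ → ℝ}

/-- Since a branch is embedded, closeness in the Hausdorff quotient implies closeness of the objects
on that branch. -/
theorem eventually_mem (h : IsLocalBranching B Λ N U m) {i : Fin ℓ} {a : B.Obj} (ha : a ∈ U i)
    {V : Set B.Obj} (hV : V ∈ 𝓝 a) :
    ∀ᶠ q in 𝓝 (B.projH a), ∀ b ∈ U i, B.projH b = q → b ∈ V := by
  have h1 := (h.regular_embedding i).isInducing.nhds_eq_comap ⟨a, ha⟩
  have h2 : Subtype.val ⁻¹' V ∈ 𝓝 (⟨a, ha⟩ : U i) := continuous_subtype_val.continuousAt hV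
  rw [h1] at h2
  obtain ⟨W, hW, hWV⟩ := h2
  filter_upwards [hW] with q hq b hb hbq
  exact hWV (show (⟨b, hb⟩ : U i) ∈ _ from (hbq ▸ hq : B.projH b ∈ W))

theorem eventually_notMem (h : IsLocalBranching B Λ N U m) {i : Fin ℓ} {q : B.HOrbit} (hq : q ∈ N)
    (hqi : q ∉ B.projH '' U i) : ∀ᶠ q' in 𝓝 q, q' ∉ B.projH '' U i := by
  obtain ⟨C, hC, hUC⟩ := h.regular_closed i
  have : q ∉ C := fun hqC => hqi (hUC ▸ ⟨hq, hqC⟩)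
  filter_upwards [hC.isOpen_compl.mem_nhds this] with q' h1 h2
  rw [hUC] at h2
  exact h1 h2.2

theorem exists_proj_eq (h : IsLocalBranching B Λ N U m) {a : B.Obj} (ha : B.projH a ∈ N) :
    ∃ i, ∃ b ∈ U i, B.proj b = B.proj a := by
  have h1 : B.proj a ∈ (T2Quotient.mk : B.Orbit → B.HOrbit) ⁻¹' N := ha
  rw [h.covering] at h1
  obtain ⟨i, b, hb, hba⟩ := mem_iUnion.mp h1
  exact ⟨i, b, hb, hba⟩

theorem injOn (h : IsLocalBranching B Λ N U m) (i : Fin ℓ) : InjOn B.projH (U i) := by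
  intro a ha b hb hab
  exact congrArg Subtype.val ((h.regular_embedding i).injective
    (show (U i).domRestrict B.projH ⟨a, ha⟩ = (U i).domRestrict B.projH ⟨b, hb⟩ from hab))

end IsLocalBranching

namespace Layer

variable {Y : SseGroupoid.{u} I} {L : Layer Y} [T2Space Y.Orbit]

omit [T2Space Y.Orbit] in
-- Orbits are discrete: the orbit of `x` within a slice is finite, and its other points can be
-- avoided.
theorem _root_.BranchedResolution.SseGroupoid.IsProper.eventually_eq_of_proj (hY : Y.IsProper)
    (x : Y.Obj) : ∀ᶠ y in 𝓝 x, Y.proj y = Y.proj x → y = x := by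
  obtain ⟨S, -⟩ := hY.exists_slice (univ_mem : univ ∈ 𝓝 x)
  have h1 := (S.finite_orbit S.mem).subset (sdiff_subset (t := {x}))
  have h2 : x ∉ {z | z ∈ S.P ∧ Y.proj z = Y.proj x} \ {x} := fun h => h.2 rfl
  filter_upwards [h1.isClosed.isOpen_compl.mem_nhds h2, S.isOpen.mem_nhds S.mem] with y hy hyP h
  by_contra hne
  exact hy ⟨⟨hyP, h⟩, hne⟩

/-- The fibre is compact by properness. It is discrete because near each of its points the finitely
many branches contain no further object over the same orbit, orbits being discrete and the layer
étale. -/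
theorem finite_fibre (hY : Y.IsProper) (hp : IsProperMap L.base) {Λ : L.grp.HOrbit → ℝ}
    (hB : ∀ p, ∃ (N : Set L.grp.HOrbit) (ℓ : ℕ) (U : Fin ℓ → Set L.grp.Obj) (m : Fin ℓ → ℝ),
      p ∈ N ∧ IsLocalBranching L.grp Λ N U m) (p : Y.Orbit) : {q | L.base q = p}.Finite := by
  have hc : IsCompact {q | L.base q = p} := hp.isCompact_preimage isCompact_singleton
  have key : ∀ q : L.grp.HOrbit, L.base q = p → {q' | L.base q' = p → q' = q} ∈ 𝓝 q := by
    intro q hq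
    obtain ⟨N, ℓ, U, m, hqN, hbr⟩ := hB q
    have h1 : ∀ᶠ q' in 𝓝 q, ∀ i, q' ∈ L.grp.projH '' U i → L.base q' = p → q' = q := by
      refine eventually_all.mpr fun i => ?_
      by_cases hi : q ∈ L.grp.projH '' U i
      · obtain ⟨a, ha, rfl⟩ := hi
        rw [base_projH] at hq
        subst hq
        have h2 : ∀ᶠ b in 𝓝 a, Y.proj (L.F.obj b) = Y.proj (L.F.obj a) → b = a := by
          obtain ⟨s, U, -, -, -, -, hsa, hs⟩ := exists_section L.etale.isLocalHomeomorph a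
          filter_upwards [hs, (L.etale.continuous.tendsto a).eventually
            (hY.eventually_eq_of_proj (L.F.obj a))] with b h1 h2 h3
          rw [← h1, h2 h3, hsa]
        filter_upwards [hbr.eventually_mem ha h2] with q' hq'
        rintro ⟨b, hb, rfl⟩ hbp
        rw [base_projH] at hbp
        rw [hq' b hb rfl hbp]
      · filter_upwards [hbr.eventually_notMem hqN hi] with q' h1 h2 using absurd h2 h1
    filter_upwards [h1, hbr.isOpen_nhd.mem_nhds hqN] with q' h1 h2 h3
    obtain ⟨a, rfl⟩ := L.grp.projH_surjective q'
    obtain ⟨i, b, hb, hba⟩ := hbr.exists_proj_eq h2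
    exact h1 i ⟨b, hb, congrArg T2Quotient.mk hba⟩ h3
  obtain ⟨t, hcov⟩ := hc.elim_nhds_subcover' (fun q _ => {q' | L.base q' = p → q' = q}) key
  refine (t.finite_toSet.image Subtype.val).subset fun q hq => ?_
  obtain ⟨r, hr, hqr⟩ := mem_iUnion₂.mp (hcov hq)
  exact ⟨r, hr, (hqr hq).symm⟩

end Layer

end Resolution

end BranchedResolution

namespace BranchedResolution

open SseGroupoid

/-! ### Sections through the morphisms out of one object -/

section Resolution

variable {n : ℕ} {H : Type} [TopologicalSpace H]
  {I : ModelWithCorners ℝ (EuclideanSpace ℝ (Fin n)) H}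

namespace Layer

variable {Y : SseGroupoid.{u} I} {L : Layer Y}

/-- Each of the finitely many `g : F a → x` extends to a local section of pairs. Properness of `Y`
shows that a morphism from near `F a` to near `x` is close to one of these `g`, hence lies on its
section. -/
theorem exists_sections (hY : Y.IsProper) (L : Layer Y) (a : L.grp.Obj) (x : Y.Obj) :
    ∃ (σ : {g : Y.Mor | Y.src g = L.F.obj a ∧ Y.tgt g = x} → Y.Obj → L.grp.Obj)
      (γ : {g : Y.Mor | Y.src g = L.F.obj a ∧ Y.tgt g = x} → Y.Obj → Y.Mor) (V : Set Y.Obj),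
      IsOpen V ∧ x ∈ V ∧ (∀ g, ContinuousOn (σ g) V) ∧ (∀ g, ContinuousOn (γ g) V) ∧
      (∀ g, σ g x = a) ∧ (∀ g, γ g x = g) ∧
      (∀ g, ∀ y ∈ V, Y.src (γ g y) = L.F.obj (σ g y) ∧ Y.tgt (γ g y) = y) ∧
      ∀ᶠ p : L.grp.Obj × Y.Obj in 𝓝 a ×ˢ 𝓝 x, ∀ h, Y.src h = L.F.obj p.1 → Y.tgt h = p.2 →
        ∃ g, p.1 = σ g p.2 ∧ h = γ g p.2 := by
  have hfin := Y.finite_hom (L.F.obj a) x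
  have : Finite {g : Y.Mor | Y.src g = L.F.obj a ∧ Y.tgt g = x} := hfin
  have h1 := fun g : {g : Y.Mor | Y.src g = L.F.obj a ∧ Y.tgt g = x} =>
    exists_section_pair L.etale.isLocalHomeomorph (a := a) (g := g.1) g.2.1
  choose σ γ U hU hgU hσ hγ hσx hγx hU' hev using h1
  have hxU : ∀ g, x ∈ U g := fun g => by
    have := hgU g
    rwa [g.2.2] at this
  refine ⟨σ, γ, ⋂ g, U g, isOpen_iInter_of_finite hU, mem_iInter.mpr hxU,
    fun g => (hσ g).mono (iInter_subset _ _), fun g => (hγ g).mono (iInter_subset _ _), fun g => ?_,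
    fun g => ?_, fun g y hy => hU' g y (mem_iInter.mp hy g), ?_⟩
  · have := hσx g
    rwa [g.2.2] at this
  · have := hγx g
    rwa [g.2.2] at this
  · have h2 : ∀ g : {g : Y.Mor | Y.src g = L.F.obj a ∧ Y.tgt g = x}, ∃ A ∈ 𝓝 a, ∃ G ∈ 𝓝 g.1,
        ∀ b ∈ A, ∀ h ∈ G, Y.src h = L.F.obj b → b = σ g (Y.tgt h) ∧ h = γ g (Y.tgt h) := by
      intro g
      have := hev g
      rw [nhds_prod_eq] at this
      obtain ⟨A, hA, G, hG, h⟩ := mem_prod_iff.mp this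
      exact ⟨A, hA, G, hG, fun b hb k hk => @h (b, k) ⟨hb, hk⟩⟩
    choose A hA G hG hAG using h2
    have h3 := hY.eventually_mem (x := L.F.obj a) (y := x) (W := ⋃ g, interior (G g))
      (isOpen_iUnion fun g => isOpen_interior) fun h e1 e2 =>
        mem_iUnion.mpr ⟨⟨h, e1, e2⟩, mem_interior_iff_mem_nhds.mpr (hG ⟨h, e1, e2⟩)⟩
    have h4 : Tendsto (fun p : L.grp.Obj × Y.Obj => (L.F.obj p.1, p.2)) (𝓝 a ×ˢ 𝓝 x)
        (𝓝 (L.F.obj a, x)) := by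
      rw [nhds_prod_eq]
      exact ((L.etale.continuous.tendsto a).comp tendsto_fst).prodMk tendsto_snd
    have h5 : ∀ᶠ p : L.grp.Obj × Y.Obj in 𝓝 a ×ˢ 𝓝 x, ∀ g, p.1 ∈ A g :=
      (eventually_all.mpr fun g => hA g : ∀ᶠ b in 𝓝 a, ∀ g, b ∈ A g).prod_inl _
    filter_upwards [h4.eventually h3, h5] with p hp1 hp2 h e1 e2
    obtain ⟨g, hg⟩ := mem_iUnion.mp (hp1 h e1 e2)
    have := hAG g p.1 (hp2 g) h (interior_subset hg) e1
    rw [e2] at this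
    exact ⟨g, this⟩

end Layer

end Resolution

end BranchedResolution

namespace BranchedResolution

open SseGroupoid

/-! ### From local branching structures to frames -/

section Resolution

variable {n : ℕ} {H : Type} [TopologicalSpace H]
  {I : ModelWithCorners ℝ (EuclideanSpace ℝ (Fin n)) H}

namespace Layer

variable {Y : SseGroupoid.{u} I} {L : Layer Y} [T2Space Y.Orbit]

/-- The branches of the local branching structures at the points over `x` extend to sections over
a neighbourhood of `x`. -/
theorem exists_frame (hY : Y.IsProper) (hp : IsProperMap L.base) {Λ : L.grp.HOrbit → ℝ}
    (hB : ∀ p, ∃ (N : Set L.grp.HOrbit) (ℓ : ℕ) (U : Fin ℓ → Set L.grp.Obj) (m : Fin ℓ → ℝ),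
      p ∈ N ∧ IsLocalBranching L.grp Λ N U m) {κ : Y.Orbit → ℝ} (hκ : ∀ p, 0 < κ p)
    (hκ' : IsLocallyConstant κ) (x : Y.Obj) :
    ∃ (T : L.Frame x) (w : T.S → ℝ), (∀ s, 0 < w s) ∧
      (∀ s, InjOn (fun y => L.grp.projH (T.pt s y)) T.P) ∧
      (∀ y ∈ T.P, ∀ a g, Y.src g = L.F.obj a → Y.tgt g = y →
        (∀ b, L.grp.projH a = L.grp.projH b → L.grp.proj a = L.grp.proj b) →
        ∑ s, {s | L.Germ a g (T.pt s y) (T.mor s y)}.indicator w s =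
          Λ (L.grp.projH a) / κ (Y.proj y)) ∧
      ∀ q, L.base q = Y.proj x → Λ q = κ (Y.proj x) / Y.order x *
        ∑ s, {s | L.grp.projH (T.pt s x) = q}.indicator w s := by
  classical
  have hK := finite_fibre hY hp hB (Y.proj x)
  let K : Type u := {q // L.base q = Y.proj x}
  have : Fintype K := hK.fintype
  obtain ⟨D, hD, hDd⟩ := hK.t2_separation
  choose N ℓ U m hqN hbr using hB
  -- One index for each point `q` over `x` and each branch of the structure chosen at `q` that
  -- contains `q`. A section is then given by such an index and a morphism from the chosen object on
  -- the branch to `x`; there are `|G_x|` of these.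
  let J : Type u := Σ q : K, {i : Fin (ℓ q.1) // q.1 ∈ L.grp.projH '' U q.1 i}
  have ha : ∀ j : J, ∃ a ∈ U j.1.1 j.2.1, L.grp.projH a = j.1.1 := fun j => j.2.2
  choose a haU haq using ha
  have hax : ∀ j, Y.proj (L.F.obj (a j)) = Y.proj x := fun j => by
    rw [← base_projH, haq, j.1.2]
  choose σ γ V hV hxV hσ hγ hσx hγx hV' hev using fun j => exists_sections hY L (a j) x
  have hev' : ∀ j, ∃ B ∈ 𝓝 (a j), ∃ V' ∈ 𝓝 x, ∀ b ∈ B, ∀ y ∈ V', ∀ h, Y.src h = L.F.obj b →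
      Y.tgt h = y → ∃ g, b = σ j g y ∧ h = γ j g y := by
    intro j
    obtain ⟨B, hB, V', hV', h⟩ := mem_prod_iff.mp (hev j)
    exact ⟨B, hB, V', hV', fun b hb y hy k => @h (b, y) ⟨hb, hy⟩ k⟩
  choose B hBn V' hV'n hBV using hev'
  let G : J → Type u := fun j => {g : Y.Mor | Y.src g = L.F.obj (a j) ∧ Y.tgt g = x}
  have hGfin : ∀ j, Finite (G j) := fun j => Y.finite_hom _ _
  have : ∀ j, Fintype (G j) := fun j => Fintype.ofFinite _
  have hGcard : ∀ j, Fintype.card (G j) = Y.order x := by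
    intro j
    obtain ⟨δ, h1, h2⟩ := Y.proj_eq_iff.mp (hax j)
    have := ncard_hom δ h1 h2
    rw [order_congr (hax j)] at this
    rw [← this, ← Nat.card_coe_set_eq, ← Nat.card_eq_fintype_card]
  -- neighbourhoods of the points over `x`
  let E : K → Set L.grp.HOrbit := fun q => {q' | q' ∈ N q.1 ∧ q' ∈ D q.1 ∧
    (∀ i, q.1 ∉ L.grp.projH '' U q.1 i → q' ∉ L.grp.projH '' U q.1 i) ∧
    ∀ i, ∀ hi : q.1 ∈ L.grp.projH '' U q.1 i, ∀ b ∈ U q.1 i, L.grp.projH b = q' → b ∈ B ⟨q, i, hi⟩}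
  have hE : ∀ q : K, E q ∈ 𝓝 q.1 := by
    intro q
    refine inter_mem ((hbr q.1).isOpen_nhd.mem_nhds (hqN q.1))
      (inter_mem ((hD q.1).2.mem_nhds (hD q.1).1) (inter_mem ?_ ?_))
    · refine eventually_all.mpr fun i => ?_
      by_cases hi : q.1 ∈ L.grp.projH '' U q.1 i
      · exact Eventually.of_forall fun _ h => absurd hi h
      · exact ((hbr q.1).eventually_notMem (hqN q.1) hi).mono fun _ h _ => h
    · refine eventually_all.mpr fun i => ?_
      by_cases hi : q.1 ∈ L.grp.projH '' U q.1 i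
      · have := (hbr q.1).eventually_mem (haU ⟨q, i, hi⟩) (hBn ⟨q, i, hi⟩)
        rw [haq ⟨q, i, hi⟩] at this
        exact this.mono fun _ h _ => h
      · exact Eventually.of_forall fun _ h => absurd h hi
  -- Tube lemma: the base map is closed, so fibres near that of `x` lie in the union of the
  -- neighbourhoods `E q`.
  have hcov : ∀ᶠ p in 𝓝 (Y.proj x), ∀ q', L.base q' = p → ∃ q : K, q' ∈ interior (E q) := by
    have h1 : IsClosed (L.base '' (⋃ q : K, interior (E q))ᶜ) :=
      hp.isClosedMap _ (isOpen_iUnion fun q => isOpen_interior).isClosed_compl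
    have h2 : Y.proj x ∉ L.base '' (⋃ q : K, interior (E q))ᶜ := by
      rintro ⟨q, hq, hqx⟩
      exact hq (mem_iUnion.mpr ⟨⟨q, hqx⟩, mem_interior_iff_mem_nhds.mpr (hE ⟨q, hqx⟩)⟩)
    filter_upwards [h1.isOpen_compl.mem_nhds h2] with p hp' q' hq'
    by_contra h
    exact hp' ⟨q', fun hh => h (mem_iUnion.mp hh), hq'⟩
  have tσ : ∀ j (g : G j), Tendsto (σ j g) (𝓝 x) (𝓝 (a j)) := fun j g => by
    have := (hσ j g).continuousAt ((hV j).mem_nhds (hxV j))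
    rwa [ContinuousAt, hσx] at this
  have tγ : ∀ j (g : G j), Tendsto (γ j g) (𝓝 x) (𝓝 g.1) := fun j g => by
    have := (hγ j g).continuousAt ((hV j).mem_nhds (hxV j))
    rwa [ContinuousAt, hγx] at this
  have e1 : ∀ᶠ y in 𝓝 x, ∀ j, y ∈ V j ∧ y ∈ V' j :=
    eventually_all.mpr fun j => ((hV j).eventually_mem (hxV j)).and (hV'n j)
  have e2 : ∀ᶠ y in 𝓝 x, ∀ j (g : G j), σ j g y ∈ U j.1.1 j.2.1 ∧
      L.grp.projH (σ j g y) ∈ interior (E j.1) := by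
    refine eventually_all.mpr fun j => eventually_all.mpr fun g => ?_
    refine ((tσ j g).eventually (((hbr j.1.1).isOpen_branch _).mem_nhds (haU j))).and
      (((L.grp.continuous_projH.tendsto _).comp (tσ j g)).eventually ?_)
    rw [haq]
    exact isOpen_interior.mem_nhds (mem_interior_iff_mem_nhds.mpr (hE j.1))
  have e3 : ∀ᶠ y in 𝓝 x, ∀ q', L.base q' = Y.proj y → ∃ q : K, q' ∈ interior (E q) :=
    (Y.continuous_proj.tendsto x).eventually hcov
  have e4 : ∀ᶠ y in 𝓝 x, ∀ j (g g' : G j), g ≠ g' → γ j g y ≠ γ j g' y := by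
    refine eventually_all.mpr fun j => eventually_all.mpr fun g => eventually_all.mpr fun g' => ?_
    by_cases h : g = g'
    · exact Eventually.of_forall fun _ h' => absurd h h'
    · exact (((tγ j g).prodMk_nhds (tγ j g')).eventually (isClosed_diagonal.isOpen_compl.mem_nhds
        (show (g.1, g'.1) ∉ diagonal _ from fun h' => h (Subtype.ext h')))).mono fun _ h' _ => h'
  have e5 : ∀ᶠ y in 𝓝 x, κ (Y.proj y) = κ (Y.proj x) :=
    (Y.continuous_proj.tendsto x).eventually (hκ'.eventually_eq (Y.proj x))
  -- Local inverses of the source recover the morphism of a section from the source, and so from its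
  -- object; this gives injectivity of the sections.
  have e6 : ∃ e : Y.Mor → Y.Obj → Y.Mor, ∀ᶠ y in 𝓝 x, ∀ j (g : G j),
      e g.1 (Y.src (γ j g y)) = γ j g y := by
    choose e _ _ _ _ _ _ he using fun g : Y.Mor => exists_section Y.src_localDiffeo.isLocalHomeomorph g
    exact ⟨e, eventually_all.mpr fun j => eventually_all.mpr fun g => (tγ j g).eventually (he g.1)⟩
  obtain ⟨e, e6⟩ := e6
  obtain ⟨P, hP, hPo, hxP⟩ := eventually_nhds_iff.mp
    (e1.and (e2.and (e3.and (e4.and (e5.and e6)))))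
  have hsrc : ∀ j (g : G j), ∀ y ∈ P, Y.src (γ j g y) = L.F.obj (σ j g y) := fun j g y hy =>
    (hV' j g y ((hP y hy).1 j).1).1
  have htgt : ∀ j (g : G j), ∀ y ∈ P, Y.tgt (γ j g y) = y := fun j g y hy =>
    (hV' j g y ((hP y hy).1 j).1).2
  -- If the orbit of `b` meets a branch through `q` close to `q`, then it does so near the chosen
  -- object, where all pairs lie on the sections constructed above.
  have key : ∀ y ∈ P, ∀ b b' h, Y.src h = L.F.obj b → Y.tgt h = y → L.grp.proj b' = L.grp.proj b →
      ∀ j : J, b' ∈ U j.1.1 j.2.1 → L.grp.projH b ∈ interior (E j.1) →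
      ∃ g : G j, L.Germ b h (σ j g y) (γ j g y) := by
    intro y hy b b' h h1 h2 hbb j hj hbE
    obtain ⟨α, hα1, hα2⟩ := L.grp.proj_eq_iff.mp hbb
    have h3 : Y.src h = Y.tgt (L.F.mor α) := by rw [h1, L.F.tgt_mor, hα2]
    have hb'B : b' ∈ B j := (interior_subset hbE).2.2.2 j.2.1 j.2.2 b' hj (congrArg T2Quotient.mk hbb)
    obtain ⟨g, hg1, hg2⟩ := hBV j b' hb'B y ((hP y hy).1 j).2 (Y.mul h (L.F.mor α))
      (by rw [src_mul, L.F.src_mor, hα1]) (by rw [tgt_mul h3, h2])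
    refine ⟨g, ?_⟩
    rw [← hg1, ← hg2]
    exact (Germ.of_mor hα1 hα2 h1).symm
  let T : L.Frame x :=
    { P := P
      isOpen := hPo
      mem := hxP
      S := Σ j, G j
      pt := fun s => σ s.1 s.2
      mor := fun s => γ s.1 s.2
      cont_pt := fun s => (hσ s.1 s.2).mono fun y hy => ((hP y hy).1 s.1).1
      cont_mor := fun s => (hγ s.1 s.2).mono fun y hy => ((hP y hy).1 s.1).1
      src_mor := fun s => hsrc s.1 s.2
      tgt_mor := fun s => htgt s.1 s.2
      cover := by
        intro y hy b h h1 h2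
        obtain ⟨q, hq⟩ := (hP y hy).2.2.1 (L.grp.projH b) (by rw [base_projH, ← h1, Y.proj_src_eq, h2])
        have hq' := interior_subset hq
        obtain ⟨i, b', hb', hbb⟩ := (hbr q.1).exists_proj_eq hq'.1
        have hi : q.1 ∈ L.grp.projH '' U q.1 i := by
          by_contra hi
          exact hq'.2.2.1 i hi ⟨b', hb', congrArg T2Quotient.mk hbb⟩
        obtain ⟨g, hg⟩ := key y hy b b' h h1 h2 hbb ⟨q, i, hi⟩ hb' hq
        exact ⟨⟨_, g⟩, hg⟩ }
  -- the weights of the branches at points near a point over `x`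
  have hsum : ∀ (q : K) (q' : L.grp.HOrbit), q' ∈ interior (E q) → ∀ c : ℝ,
      ∑ j : J, (if q' ∈ interior (E j.1) ∧ q' ∈ L.grp.projH '' U j.1.1 j.2.1 then
        c * m j.1.1 j.2.1 else 0) = c * Λ q' := by
    intro q q' hq' c
    have hq'' := interior_subset hq'
    rw [Fintype.sum_sigma, Finset.sum_eq_single q, (hbr q.1).weighting q' hq''.1, Finset.mul_sum,
      ← Fintype.sum_subtype_add_sum_subtype (fun i => q.1 ∈ L.grp.projH '' U q.1 i)]
    · rw [Finset.sum_eq_zero (s := (Finset.univ : Finset {i // ¬ q.1 ∈ L.grp.projH '' U q.1 i}))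
        fun i _ => by rw [indicator_of_notMem (hq''.2.2.1 i.1 i.2), mul_zero], add_zero]
      refine Finset.sum_congr rfl fun i _ => ?_
      by_cases hi : q' ∈ L.grp.projH '' U q.1 i
      · rw [if_pos ⟨hq', hi⟩, indicator_of_mem hi]
      · rw [if_neg fun h => hi h.2, indicator_of_notMem hi, mul_zero]
    · intro q₁ _ hne
      refine Finset.sum_eq_zero fun i _ => if_neg ?_
      rintro ⟨h1, -⟩
      exact Set.disjoint_left.mp (hDd q₁.2 q.2 fun h => hne (Subtype.ext h))
        (interior_subset h1).2.1 hq''.2.1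
    · exact fun h => absurd (Finset.mem_univ _) h
  refine ⟨T, fun s => m s.1.1.1 s.1.2.1 / κ (Y.proj x), fun s => div_pos ((hbr _).weight_pos _) (hκ _),
    ?_, ?_, ?_⟩
  · rintro ⟨j, g⟩ y hy z hz hyz
    have h1 : σ j g y = σ j g z := (hbr j.1.1).injOn j.2.1 ((hP y hy).2.1 j g).1
      ((hP z hz).2.1 j g).1 hyz
    have h2 : γ j g y = γ j g z := by
      rw [← (hP y hy).2.2.2.2.2 j g, ← (hP z hz).2.2.2.2.2 j g, hsrc j g y hy, hsrc j g z hz, h1]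
    rw [← htgt j g y hy, h2, htgt j g z hz]
  -- For every branch met by `b` exactly one of its sections passes through the germ of `(b, h)`, so
  -- the weights add up to `Λ / κ`. The branches are known only in the Hausdorff quotient; `hsep`
  -- turns this into equality of orbits.
  · intro y hy b h h1 h2 hsep
    obtain ⟨q, hq⟩ := (hP y hy).2.2.1 (L.grp.projH b) (by rw [base_projH, ← h1, Y.proj_src_eq, h2])
    rw [(hP y hy).2.2.2.2.1, div_eq_inv_mul, ← hsum q _ hq, Fintype.sum_sigma]
    refine Finset.sum_congr rfl fun j _ => ?_
    split_ifs with hj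
    · obtain ⟨hj, b', hb', hbb⟩ := hj
      obtain ⟨g, hg⟩ := key y hy b b' h h1 h2 (hsep b' hbb.symm).symm j hb' hj
      rw [Finset.sum_eq_single g, indicator_of_mem (by exact hg), div_eq_inv_mul]
      · intro g' _ hne
        refine indicator_of_notMem (fun hg' => (hP y hy).2.2.2.1 j g' g hne ?_) _
        have h3 := (Germ.symm hg').trans hg
        have h4 : σ j g' y = σ j g y := (hbr j.1.1).injOn j.2.1 ((hP y hy).2.1 j g').1
          ((hP y hy).2.1 j g).1 (congrArg T2Quotient.mk h3.proj_eq)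
        change L.Germ (σ j g' y) (γ j g' y) (σ j g y) (γ j g y) at h3
        rw [h4] at h3
        exact h3.eq_of_self
      · exact fun h => absurd (Finset.mem_univ _) h
    · refine Finset.sum_eq_zero fun g _ => indicator_of_notMem (fun hg => hj ?_) _
      have h3 : L.grp.projH b = L.grp.projH (σ j g y) := congrArg T2Quotient.mk (Germ.proj_eq hg)
      rw [h3]
      exact ⟨((hP y hy).2.1 j g).2, mem_image_of_mem _ ((hP y hy).2.1 j g).1⟩
  · intro q hq
    have hk : Y.order x ≠ 0 := (order_pos x).ne'
    rw [Fintype.sum_sigma]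
    -- Over `x` itself all `|G_x|` sections of a branch pass through the same point, whence the
    -- factor `order x`.
    have h1 : ∀ j : J, ∑ g : G j, {s : Σ j, G j | L.grp.projH (T.pt s x) = q}.indicator
        (fun s => m s.1.1.1 s.1.2.1 / κ (Y.proj x)) ⟨j, g⟩ = 
        if q ∈ interior (E j.1) ∧ q ∈ L.grp.projH '' U j.1.1 j.2.1 then
          (Y.order x / κ (Y.proj x)) * m j.1.1 j.2.1 else 0 := by
      intro j
      have h2 : ∀ g : G j, L.grp.projH (T.pt ⟨j, g⟩ x) = j.1.1 := fun g => by
        rw [← haq j, ← hσx j g]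
      have h3 : (q ∈ interior (E j.1) ∧ q ∈ L.grp.projH '' U j.1.1 j.2.1) ↔ j.1.1 = q := by
        constructor
        · rintro ⟨h, -⟩
          by_contra hne
          exact Set.disjoint_left.mp (hDd j.1.2 hq hne) (interior_subset h).2.1 (hD q).1
        · rintro rfl
          exact ⟨mem_interior_iff_mem_nhds.mpr (hE j.1), j.2.2⟩
      rw [if_congr h3 rfl rfl]
      split_ifs with h
      · rw [Finset.sum_congr rfl fun g _ => indicator_of_mem (by exact (h2 g).trans h) _]
        refine (Finset.sum_const (m j.1.1 j.2.1 / κ (Y.proj x))).trans ?_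
        rw [Finset.card_univ, hGcard, nsmul_eq_mul]
        ring
      · exact Finset.sum_eq_zero fun g _ => indicator_of_notMem
          (show (⟨j, g⟩ : Σ j, G j) ∉ {s : Σ j, G j | L.grp.projH (T.pt s x) = q} from
            fun h' => h ((h2 g).symm.trans h')) _
    rw [Finset.sum_congr rfl fun j _ => h1 j,
      hsum ⟨q, hq⟩ q (mem_interior_iff_mem_nhds.mpr (hE ⟨q, hq⟩))]
    have h2 := (hκ (Y.proj x)).ne'
    have h3 : (Y.order x : ℝ) ≠ 0 := Nat.cast_ne_zero.mpr hk
    field_simp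

end Layer

end Resolution

end BranchedResolution

namespace BranchedResolution

open SseGroupoid

/-! ### The weights of a resolution are induced by sheets -/

section Resolution

variable {n : ℕ} {H : Type} [TopologicalSpace H]
  {I : ModelWithCorners ℝ (EuclideanSpace ℝ (Fin n)) H}

namespace Layer

variable {Y : SseGroupoid.{u} I} {L : Layer Y} [T2Space Y.Orbit]

theorem Frame.hasSum {x : Y.Obj} (T : L.Frame x) {w : T.S → ℝ} {Λ : L.grp.HOrbit → ℝ} {c : ℝ}
    (h : ∀ q, L.base q = Y.proj x →
      Λ q = c * ∑ s, {s | L.grp.projH (T.pt s x) = q}.indicator w s) :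
    HasSum (fun q : {q // L.base q = Y.proj x} => Λ q.1) (c * ∑ s, w s) := by
  classical
  have h1 : ∀ q : {q // L.base q = Y.proj x}, Λ q.1 = c *
      ∑ s, if q = ⟨L.grp.projH (T.pt s x), T.base_pt s T.mem⟩ then w s else 0 := by
    intro q
    rw [h q.1 q.2]
    congr 1
    refine Finset.sum_congr rfl fun s _ => ?_
    by_cases hs : L.grp.projH (T.pt s x) = q.1
    · rw [indicator_of_mem (by exact hs), if_pos (Subtype.ext hs.symm)]
    · rw [indicator_of_notMem (by exact hs), if_neg fun h => hs (congrArg Subtype.val h).symm]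
  have h2 : HasSum (fun q : {q // L.base q = Y.proj x} => ∑ s,
      if q = ⟨L.grp.projH (T.pt s x), T.base_pt s T.mem⟩ then w s else 0) (∑ s, w s) :=
    hasSum_sum fun s _ => hasSum_ite_eq _ _
  exact (funext h1 : (fun q : {q // L.base q = Y.proj x} => Λ q.1) = _) ▸ h2.mul_left c

/-- The weighting function of a resolution is induced by a weight with sheets. -/
theorem exists_weight (hY : Y.IsProper) (hp : IsProperMap L.base) {Λ : L.grp.HOrbit → ℝ}
    (hB : ∀ p, ∃ (N : Set L.grp.HOrbit) (ℓ : ℕ) (U : Fin ℓ → Set L.grp.Obj) (m : Fin ℓ → ℝ),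
      p ∈ N ∧ IsLocalBranching L.grp Λ N U m) (hΛ : ∀ p, 0 < Λ p)
    (hker : IsLocallyConstant (kerOrbit : Y.Orbit → ℝ))
    (hsum : ∀ p : Y.Orbit, Y.IsSmoothPoint p →
      HasSum (fun q : {q // L.base q = p} => Λ q.1) 1) :
    ∃ W : L.Weight, (∀ x, Nonempty (Sheets W x)) ∧ IsInduced W kerOrbit Λ := by
  choose T w hw hinj hwt hΛw using exists_frame hY hp hB kerOrbit_pos hker
  let W : L.Weight :=
    -- Generic points are those near which the Hausdorff quotient makes no identifications; there
    -- the sections through a germ have total weight `Λ / κ`.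
    { gen := interior L.separated
      isOpen_gen := isOpen_interior
      dense_gen := dense_interior_separated hY fun x => ⟨T x⟩
      wt := fun a => Λ (L.grp.projH a) / kerOrbit (Y.proj (L.F.obj a))
      wt_pos := fun a => div_pos (hΛ _) (kerOrbit_pos _)
      wt_src := fun α => by
        have h1 := L.grp.proj_src_eq α
        have h2 : L.grp.projH (L.grp.src α) = L.grp.projH (L.grp.tgt α) := congrArg T2Quotient.mk h1
        rw [h2, ← base_projH, ← base_projH, h2] }
  have hW : ∀ x, (T x).IsWeight W (w x) := fun x => ⟨hw x, fun y hy hgen a g h1 h2 => by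
    have h3 : Y.proj (L.F.obj a) = Y.proj y := by rw [← h1, Y.proj_src_eq, h2]
    rw [hwt x y hy a g h1 h2 fun b hb => interior_subset hgen a b h3 hb, ← h3]⟩
  -- At a smooth point `κ` is the order of the stabilizer, so the normalization of the fibre sum
  -- gives total weight one.
  have h1 : ∀ x, Y.IsSmoothPoint (Y.proj x) → ∑ s, w x s = 1 := by
    intro x hx
    have h2 := ((T x).hasSum (hΛw x)).unique (hsum _ hx)
    have h3 : (Y.order x : ℝ) ≠ 0 := Nat.cast_ne_zero.mpr (order_pos x).ne'
    rwa [kerOrbit_proj, kerOrder_eq_order_of_isSmoothPoint hx, div_self h3, _root_.one_mul] at h2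
  have h2 : ∀ x, ∑ s, w x s = 1 := by
    intro x
    obtain ⟨y₀, hy₀, hgen₀⟩ := W.frequently_gen (T x).eventually_mem
    -- The total weight of a frame can be compared at any generic point of its domain, and the open
    -- set of generic points there contains a smooth one.
    obtain ⟨y, ⟨hy, hgen⟩, hs⟩ := hY.exists_isSmoothPoint
      ((T x).isOpen.inter (W.isOpen_gen.preimage Y.continuous_proj)) ⟨y₀, hy₀, hgen₀⟩
    have h3 := sum_comparison (hW x) (hW y) (η := Y.one y) (by rwa [Y.src_one])
      (by rw [Y.tgt_one]; exact (T y).mem) (by rwa [Y.src_one]) (φ := fun _ => 1) (φ' := fun _ => 1)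
      fun _ _ _ => rfl
    simp only [_root_.mul_one] at h3
    rw [h3, h1 y hs]
  let R : ∀ x, Sheets W x := fun x =>
    { T x with
      w := w x
      isWeight := hW x
      sum_w := h2 x
      inj := hinj x }
  refine ⟨W, fun x => ⟨R x⟩, isInduced_of_exists fun p => ?_⟩
  obtain ⟨x, rfl⟩ := Y.isOpenQuotientMap_proj.surjective p
  exact ⟨x, rfl, R x, hΛw x⟩

end Layer

end Resolution

end BranchedResolution

namespace BranchedResolution

open SseGroupoid

/-- The marginal of a product of weights of total one is the corresponding factor. This is why
projections of a gluing preserve weights. -/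
theorem sum_mul_prod_eq {ι : Type*} [Fintype ι] [DecidableEq ι] {S : ι → Type*}
    [∀ i, Fintype (S i)] (w : ∀ i, S i → ℝ) (hw : ∀ i, ∑ s, w i s = 1) (i : ι) (f : S i → ℝ) :
    ∑ τ : ∀ j, S j, f (τ i) * ∏ j, w j (τ j) = ∑ s, f s * w i s := by
  rw [← (Equiv.piSplitAt i S).symm.sum_comp, Fintype.sum_prod_type]
  refine Finset.sum_congr rfl fun s _ => ?_
  have h1 : ∀ t : (∀ j : {j // j ≠ i}, S j), f ((Equiv.piSplitAt i S).symm (s, t) i) *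
      ∏ j, w j ((Equiv.piSplitAt i S).symm (s, t) j) =
      f s * w i s * ∏ j : {j // j ≠ i}, w j (t j) := by
    intro t
    have h2 : (Equiv.piSplitAt i S).symm (s, t) i = s := by simp [Equiv.piSplitAt]
    have h3 : ∀ j : {j // j ≠ i}, (Equiv.piSplitAt i S).symm (s, t) j = t j := fun j => by
      simp [Equiv.piSplitAt, j.2]
    rw [Fintype.prod_eq_mul_prod_subtype_ne _ i, h2, _root_.mul_assoc]
    congr 2
    exact Finset.prod_congr rfl fun j _ => by rw [h3]
  have h4 : ∑ t : (∀ j : {j // j ≠ i}, S j), ∏ j : {j // j ≠ i}, w j (t j) = 1 := by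
    rw [← Fintype.piFinset_univ, ← Finset.prod_univ_sum]
    exact Finset.prod_eq_one fun j _ => hw j
  rw [Finset.sum_congr rfl fun t _ => h1 t, ← Finset.mul_sum, h4, _root_.mul_one]

/-! ### Components of a gluing as layered coverings; commensurability -/

section Covering

variable {n : ℕ} {H : Type} [TopologicalSpace H]
  {I : ModelWithCorners ℝ (EuclideanSpace ℝ (Fin n)) H}

@[simp] theorem SmoothFunctor.hOrbitMap_projH {n' : ℕ} {H' : Type} [TopologicalSpace H']
    {J : ModelWithCorners ℝ (EuclideanSpace ℝ (Fin n')) H'} {X : SseGroupoid.{u} I}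
    {Y : SseGroupoid.{u} J} (F : SmoothFunctor X Y) (a : X.Obj) :
    F.hOrbitMap (X.projH a) = Y.projH (F.obj a) :=
  T2Quotient.lift_mk ((T2Quotient.continuous_mk Y.Orbit).comp F.continuous_orbitMap) (X.proj a)

theorem SmoothFunctor.continuous_hOrbitMap {n' : ℕ} {H' : Type} [TopologicalSpace H']
    {J : ModelWithCorners ℝ (EuclideanSpace ℝ (Fin n')) H'} {X : SseGroupoid.{u} I}
    {Y : SseGroupoid.{u} J} (F : SmoothFunctor X Y) : Continuous F.hOrbitMap :=
  T2Quotient.continuous_lift _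

namespace Gluing

variable {Y : SseGroupoid.{u} I} {G : Gluing Y} {i : G.ι}
  {P : SmoothFunctor G.layer.grp (G.L i).grp} {ψ : G.M → Y.Mor}

theorem projH_component [T2Space Y.Orbit] (hc : ∀ m : G.M, G.c i m (P.obj m) (ψ m)) {m : G.M}
    {n : (G.L i).grp.Obj} {g : Y.Mor} (h : G.c i m n g) :
    (G.L i).grp.proj (P.obj m) = (G.L i).grp.proj n :=
  (G.unique (hc m) h).proj_eq

theorem base_component [T2Space Y.Orbit] (hc : ∀ m : G.M, G.c i m (P.obj m) (ψ m))
    (q : G.layer.grp.HOrbit) : (G.L i).base (P.hOrbitMap q) = G.layer.base q := by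
  obtain ⟨m, rfl⟩ := G.layer.grp.projH_surjective q
  have h1 : Y.proj (Y.src (ψ m)) = Y.proj (Y.tgt (ψ m)) := Y.proj_src_eq _
  have h2 := G.src_eq (hc m)
  have h3 := G.tgt_eq (hc m)
  rw [P.hOrbitMap_projH, Layer.base_projH, Layer.base_projH, ← h2, h1, h3]
  rfl

theorem surjective_component [T2Space Y.Orbit] (hC : ∀ p, p ∈ G.C i)
    (hc : ∀ m : G.M, G.c i m (P.obj m) (ψ m)) : Function.Surjective P.orbitMap := by
  classical
  intro q
  obtain ⟨n, rfl⟩ := (G.L i).grp.isOpenQuotientMap_proj.surjective q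
  have T : ∀ j : {j // Y.proj ((G.L i).F.obj n) ∈ G.C j},
      Layer.Sheets (G.W j) ((G.L i).F.obj n) := fun j => (G.sheets j _ j.2).some
  obtain ⟨R, e, -, hR⟩ := exists_sheets _ T
  obtain ⟨s, hs⟩ := (T ⟨i, hC _⟩).cover _ (T ⟨i, hC _⟩).mem n (Y.one _) (Y.src_one _) (Y.tgt_one _)
  have hne : ∀ j, Nonempty (T j).S := fun j => by
    by_contra hem
    have := (T j).sum_w
    rw [not_nonempty_iff] at hem
    simp at this
  -- The tuple with `i`-th entry `s`, a section through the given object, and arbitrary other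
  -- entries.
  have h1 := hR (e.symm (Function.update (fun j => (hne j).some) ⟨i, hC _⟩ s)) ⟨i, hC _⟩
  rw [e.apply_symm_apply, Function.update_self] at h1
  exact ⟨G.layer.grp.proj (R.pt _ _), (projH_component hc h1).trans hs.proj_eq.symm⟩

/-- The points over `q` are hit exactly by the tuples whose `i`-th section passes through `q`. Both
weighting functions carry the same factor `κ / |G_x|`, and summing out the other entries leaves the
weights of the `i`-th sections. -/
theorem hasSum_component [T2Space Y.Orbit] (hC : ∀ p, p ∈ G.C i)
    (hc : ∀ m : G.M, G.c i m (P.obj m) (ψ m)) {κ : Y.Orbit → ℝ} {Λ : G.layer.grp.HOrbit → ℝ}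
    (hΛ : Layer.IsInduced G.weight κ Λ) {Λ' : (G.L i).grp.HOrbit → ℝ}
    (hΛ' : Layer.IsInduced (G.W i) κ Λ') (q : (G.L i).grp.HOrbit) :
    HasSum (fun q' : {q' // P.hOrbitMap q' = q} => Λ q'.1) (Λ' q) := by
  classical
  obtain ⟨x, hx⟩ := Y.isOpenQuotientMap_proj.surjective ((G.L i).base q)
  have T : ∀ j : {j // Y.proj x ∈ G.C j}, Layer.Sheets (G.W j) x := fun j => (G.sheets j _ j.2).some
  obtain ⟨R, e, hw, hR⟩ := exists_sheets _ T
  have hP : ∀ σ, P.hOrbitMap (G.layer.grp.projH (R.pt σ x)) =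
      (G.L i).grp.projH ((T ⟨i, hC _⟩).pt (e σ ⟨i, hC _⟩) x) := fun σ => by
    rw [P.hOrbitMap_projH]
    exact congrArg T2Quotient.mk (projH_component hc (hR σ ⟨i, hC _⟩))
  have h1 : ∀ q' : {q' // P.hOrbitMap q' = q}, Λ q'.1 = κ (Y.proj x) / Y.order x *
      ∑ σ, if h : P.hOrbitMap (G.layer.grp.projH (R.pt σ x)) = q then
        (if q' = ⟨_, h⟩ then R.w σ else 0) else 0 := by
    intro q'
    rw [hΛ x R q'.1 (by rw [← base_component hc, q'.2, hx])]
    congr 1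
    refine Finset.sum_congr rfl fun σ _ => ?_
    by_cases hs : G.layer.grp.projH (R.pt σ x) = q'.1
    · rw [indicator_of_mem (by exact hs), dif_pos (by rw [hs, q'.2]), if_pos (Subtype.ext hs.symm)]
    · rw [indicator_of_notMem (by exact hs)]
      split_ifs with h2 h3
      · exact absurd (congrArg Subtype.val h3).symm hs
      · rfl
      · rfl
  have h2 : HasSum (fun q' : {q' // P.hOrbitMap q' = q} => ∑ σ,
      if h : P.hOrbitMap (G.layer.grp.projH (R.pt σ x)) = q then
        (if q' = ⟨_, h⟩ then R.w σ else 0) else 0)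
      (∑ σ, {s | (G.L i).grp.projH ((T ⟨i, hC _⟩).pt s x) = q}.indicator (fun _ => (1 : ℝ))
        (e σ ⟨i, hC _⟩) * ∏ j, (T j).w (e σ j)) := by
    refine hasSum_sum fun σ _ => ?_
    by_cases h : P.hOrbitMap (G.layer.grp.projH (R.pt σ x)) = q
    · rw [indicator_of_mem (show e σ ⟨i, hC _⟩ ∈ {s | (G.L i).grp.projH ((T ⟨i, hC _⟩).pt s x) = q} from
        (hP σ).symm.trans h), _root_.one_mul, ← hw]
      simp only [dif_pos h]
      exact hasSum_ite_eq _ _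
    · rw [indicator_of_notMem (show e σ ⟨i, hC _⟩ ∉ {s | (G.L i).grp.projH ((T ⟨i, hC _⟩).pt s x) = q} from
        fun h' => h ((hP σ).trans h')), zero_mul]
      simp only [dif_neg h]
      exact hasSum_zero
  have h3 := e.sum_comp fun τ => {s | (G.L i).grp.projH ((T ⟨i, hC _⟩).pt s x) = q}.indicator
    (fun _ => (1 : ℝ)) (τ ⟨i, hC _⟩) * ∏ j, (T j).w (τ j)
  rw [h3, sum_mul_prod_eq (fun j => (T j).w) (fun j => (T j).sum_w) ⟨i, hC _⟩
    ({s | (G.L i).grp.projH ((T ⟨i, hC _⟩).pt s x) = q}.indicator (fun _ => (1 : ℝ)))] at h2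
  have h4 : Λ' q = κ (Y.proj x) / Y.order x * ∑ s,
      {s | (G.L i).grp.projH ((T ⟨i, hC _⟩).pt s x) = q}.indicator (fun _ => (1 : ℝ)) s *
        (T ⟨i, hC _⟩).w s := by
    rw [hΛ' x (T ⟨i, hC _⟩) q hx.symm]
    congr 1
    refine Finset.sum_congr rfl fun s _ => ?_
    by_cases hs : s ∈ {s | (G.L i).grp.projH ((T ⟨i, hC _⟩).pt s x) = q}
    · rw [indicator_of_mem hs, indicator_of_mem hs, _root_.one_mul]
    · rw [indicator_of_notMem hs, indicator_of_notMem hs, zero_mul]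
  rw [h4]
  exact (funext h1 : (fun q' : {q' // P.hOrbitMap q' = q} => Λ q'.1) = _) ▸ h2.mul_left _

/-- The base map of the gluing is proper and factors through this map. -/
theorem isProperMap_component [T2Space Y.Orbit] (hY : Y.IsProper)
    (hc : ∀ m : G.M, G.c i m (P.obj m) (ψ m)) : IsProperMap P.hOrbitMap := by
  refine isProperMap_of_comp_of_t2 (g := (G.L i).base) P.continuous_hOrbitMap Layer.continuous_base ?_
  rw [show (G.L i).base ∘ P.hOrbitMap = G.layer.base from funext (base_component hc)]
  exact Layer.isProperMap_base hY fun x => ⟨(G.nonempty_sheets x).some.toFrame⟩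

end Gluing

theorem LayerFamily.exists_component {Y : SseGroupoid.{u} I} (F : LayerFamily Y) (i : F.ι)
    (hC : ∀ p, p ∈ F.C i) : ∃ P : SmoothFunctor F.universal.layer.grp (F.L i).grp,
      IsOrientedLocalDiffeo F.universal.layer.grp.Obj (F.L i).grp.Obj P.obj ∧
      ∃ ψ : F.universal.M → Y.Mor, ∀ m : F.universal.M, F.universal.c i m (P.obj m) (ψ m) := by
  let φ : F.Univ → (F.L i).grp.Obj := fun m =>
    (F.sheet m.1.1 ⟨i, hC _⟩).pt (m.1.2 ⟨i, hC _⟩) m.2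
  let ψ : F.Univ → Y.Mor := fun m => (F.sheet m.1.1 ⟨i, hC _⟩).mor (m.1.2 ⟨i, hC _⟩) m.2
  have hφ : Continuous φ :=
    continuous_sigma fun j => ((F.sheet j.1 ⟨i, hC _⟩).cont_pt (j.2 ⟨i, hC _⟩)).comp_continuous
      continuous_subtype_val fun y => F.nhd_subset y.2 _
  have hψ : Continuous ψ :=
    continuous_sigma fun j => ((F.sheet j.1 ⟨i, hC _⟩).cont_mor (j.2 ⟨i, hC _⟩)).comp_continuous
      continuous_subtype_val fun y => F.nhd_subset y.2 _
  have hc : ∀ m : F.universal.M, F.universal.c i m (φ m) (ψ m) := fun m : F.Univ =>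
    ⟨hC _, .refl ((F.sheet m.1.1 ⟨i, hC _⟩).src_mor (m.1.2 ⟨i, hC _⟩) _ (F.nhd_subset m.2.2 _))⟩
  obtain ⟨P, hP, hP'⟩ := F.universal.exists_component i hφ hψ hc hC
  refine ⟨P, hP', ψ, fun m => ?_⟩
  rw [hP]
  exact hc m

/-- The layer defined by a wnb groupoid that is étale over `Y`. -/
def WnbGroupoid.layer (A : WnbGroupoid.{u} I) {Y : SseGroupoid.{u} I}
    (F : SmoothFunctor A.toSseGroupoid Y) (hF : IsOrientedLocalDiffeo A.Obj Y.Obj F.obj) :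
    Layer Y where
  grp := A.toSseGroupoid
  nonsingular := A.nonsingular
  F := F
  etale := hF

/-- Weighted nonsingular branched groupoids over `Y` whose weights are induced are commensurate. -/
theorem commensurate_of_isInduced {Y : SseGroupoid.{u} I} [T2Space Y.Orbit] (hY : Y.IsProper)
    {κ : Y.Orbit → ℝ} (hκ : ∀ p, 0 < κ p) (hκ' : IsLocallyConstant κ)
    {A C : WnbGroupoid.{u} I} {F : SmoothFunctor A.toSseGroupoid Y}
    {hF : IsOrientedLocalDiffeo A.Obj Y.Obj F.obj} {G : SmoothFunctor C.toSseGroupoid Y}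
    {hG : IsOrientedLocalDiffeo C.Obj Y.Obj G.obj} {V : (A.layer F hF).Weight}
    (hV : ∀ x, Nonempty (Layer.Sheets V x)) (hA : Layer.IsInduced V κ A.Λ)
    {W : (C.layer G hG).Weight}
    (hW : ∀ x, Nonempty (Layer.Sheets W x)) (hC : Layer.IsInduced W κ C.Λ) :
    Commensurate A C := by
  -- Both layers are active everywhere, so the gluing is a weighted fibre product of the two
  -- groupoids over `Y`.
  let E : LayerFamily Y :=
    { ι := ULift Bool
      L := fun i => match i with
        | ⟨false⟩ => A.layer F hF
        | ⟨true⟩ => C.layer G hG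
      W := fun i => match i with
        | ⟨false⟩ => V
        | ⟨true⟩ => W
      C := fun _ => univ
      isClosed := fun _ => isClosed_univ
      locallyFinite := locallyFinite_of_finite _
      exists_interior := fun p => ⟨⟨false⟩, by simp⟩
      sheets := fun i x _ => match i with
        | ⟨false⟩ => hV x
        | ⟨true⟩ => hW x }
  obtain ⟨Λ, hΛ⟩ := Layer.exists_isInduced E.universal.weight E.universal.nonempty_sheets κ
  obtain ⟨P, hP, ψ, hψ⟩ := E.exists_component ⟨false⟩ fun p => mem_univ p
  obtain ⟨Q, hQ, χ, hχ⟩ := E.exists_component ⟨true⟩ fun p => mem_univ p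
  exact ⟨E.universal.layer.wnb hY E.universal.nonempty_sheets hκ hκ' hΛ, P, Q,
    ⟨hP, Gluing.surjective_component (G := E.universal) (fun p => mem_univ p) hψ,
      Gluing.isProperMap_component (G := E.universal) hY hψ,
      Gluing.hasSum_component (G := E.universal) (fun p => mem_univ p) hψ hΛ hA⟩,
    ⟨hQ, Gluing.surjective_component (G := E.universal) (fun p => mem_univ p) hχ,
      Gluing.isProperMap_component (G := E.universal) hY hχ,
      Gluing.hasSum_component (G := E.universal) (fun p => mem_univ p) hχ hΛ hC⟩⟩

end Covering

end BranchedResolution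

namespace BranchedResolution

open SseGroupoid

/-! ### Slices as layers; existence of resolutions -/

section Existence

variable {n : ℕ} {H : Type} [TopologicalSpace H]
  {I : ModelWithCorners ℝ (EuclideanSpace ℝ (Fin n)) H}

/-- For `y` near `x` the value of a section determines the source of its morphism, hence the
morphism, hence its target `y`. -/
theorem Layer.Frame.exists_injOn {Y : SseGroupoid.{u} I} {L : Layer Y} {x : Y.Obj}
    (T : L.Frame x) : ∃ P, IsOpen P ∧ x ∈ P ∧ P ⊆ T.P ∧ ∀ s, InjOn (T.pt s) P := by
  choose e _ _ _ _ _ _ he using fun g : Y.Mor => exists_section Y.src_localDiffeo.isLocalHomeomorph g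
  have e1 : ∀ᶠ y in 𝓝 x, ∀ s, e (T.mor s x) (Y.src (T.mor s y)) = T.mor s y :=
    eventually_all.mpr fun s => (T.tendsto_mor s T.mem).eventually (he _)
  obtain ⟨P, hP, hPo, hxP⟩ := eventually_nhds_iff.mp (e1.and T.eventually_mem)
  refine ⟨P, hPo, hxP, fun y hy => (hP y hy).2, fun s y hy z hz hyz => ?_⟩
  have h : T.mor s y = T.mor s z := by
    rw [← (hP y hy).1, ← (hP z hz).1, T.src_mor s y (hP y hy).2, T.src_mor s z (hP z hz).2, hyz]
  rw [← T.tgt_mor s y (hP y hy).2, h, T.tgt_mor s z (hP z hz).2]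

namespace SseGroupoid

variable {Y : SseGroupoid.{u} I}

theorem eventually_eq_one (x : Y.Obj) : ∀ᶠ γ in 𝓝 (Y.one x), γ = Y.one (Y.src γ) := by
  obtain ⟨s, U, hU, hxU, hs, hsU, hsx, hs'⟩ :=
    exists_section Y.one_localDiffeo.isLocalHomeomorph x
  filter_upwards [hU.mem_nhds hxU] with γ hγ
  rw [← hsU γ hγ, Y.src_one]

namespace Slice

variable {x : Y.Obj} (S : Y.Slice x)

/-- A slice, without its nontrivial morphisms. -/
noncomputable def etaleRel : EtaleRel Y where
  N := S.P
  pr := Subtype.val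
  etale := S.isOpen.isOpenEmbedding_subtypeVal.isLocalHomeomorph
  rel a g b := a = b ∧ g = Y.one a
  src_eq := by
    rintro a g b ⟨-, rfl⟩
    exact Y.src_one _
  tgt_eq := by
    rintro a g b ⟨rfl, rfl⟩
    exact Y.tgt_one _
  refl a := ⟨rfl, rfl⟩
  symm := by
    rintro a g b ⟨rfl, rfl⟩
    exact ⟨rfl, inv_one _⟩
  trans := by
    rintro a g b h c ⟨rfl, rfl⟩ ⟨rfl, rfl⟩
    exact ⟨rfl, SseGroupoid.mul_one (Y.src_one _)⟩
  isOpen := by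
    rintro a g b ⟨rfl, rfl⟩
    have : Tendsto (fun t : S.P × Y.Mor × S.P => t.2.1) (𝓝 (a, Y.one a, a)) (𝓝 (Y.one a)) :=
      (continuous_fst.comp continuous_snd).tendsto _
    filter_upwards [this.eventually (eventually_eq_one a.1)] with t ht h1 h2
    rw [h1] at ht
    refine ⟨Subtype.ext ?_, ht⟩
    rw [← h2, ht, Y.tgt_one]

instance : T2Space S.etaleRel.N := inferInstanceAs (T2Space S.P)
instance : SecondCountableTopology S.etaleRel.N := inferInstanceAs (SecondCountableTopology S.P)

/-- The layer formed by a slice. -/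
noncomputable def layer : Layer Y where
  grp := S.etaleRel.toSse
  nonsingular := by
    intro (γ : S.etaleRel.RelMor) (h : γ.1.1 = γ.1.2.2)
    obtain ⟨⟨a, g, b⟩, hr⟩ := γ
    obtain rfl : a = b := h
    exact Subtype.ext (Prod.ext rfl (Prod.ext hr.2 rfl))
  F := S.etaleRel.toBase
  etale := S.etaleRel.toBase_localDiffeo

/-- All morphisms of this layer are identities, so its orbit space is the Hausdorff space `P`
itself. -/
theorem layer_projH_injective : Function.Injective S.layer.grp.projH := by
  have h1 : ∀ α : S.layer.grp.Mor, S.layer.grp.src α = S.layer.grp.tgt α := by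
    intro (α : S.etaleRel.RelMor)
    exact α.2.1
  let f : S.layer.grp.Orbit → S.layer.grp.Obj := Quotient.lift id (by
    rintro a b ⟨α, rfl, rfl⟩
    exact h1 α)
  have hf : Continuous f := continuous_quot_lift _ continuous_id
  intro a b h
  have := congrArg (T2Quotient.lift hf) h
  simpa [projH, f, proj] using this

theorem layer_germ_iff {a b : S.P} {g h : Y.Mor} (hs : Y.src g = a) :
    S.layer.Germ a g b h ↔ a = b ∧ g = h := by
  constructor
  · rintro ⟨h1, ⟨⟨a', k, b'⟩, hr⟩, rfl, rfl, rfl⟩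
    obtain ⟨h2, h3⟩ := hr
    obtain rfl : a' = b' := h2
    refine ⟨rfl, ?_⟩
    exact (congrArg (Y.mul h) h3).trans (SseGroupoid.mul_one h1)
  · rintro ⟨rfl, rfl⟩
    exact .refl hs

/-- The uniform weight on a slice. -/
noncomputable def weight : S.layer.Weight where
  gen := univ
  isOpen_gen := isOpen_univ
  dense_gen := dense_univ
  wt _ := 1 / Y.order x
  wt_pos _ := div_pos one_pos (Nat.cast_pos.mpr (order_pos x))
  wt_src _ := rfl

/-- Move `y` into the slice along a local family `e` of morphisms. Every morphism from a point of
the slice to `y` is then `e y` after the inverse of a unique stabilizer element acting on the source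
of `e y`. So there are `|G_x|` sections, and each germ lies on exactly one of them. -/
theorem nonempty_sheets {y : Y.Obj} (hy : Y.proj y ∈ Y.proj '' S.P) :
    Nonempty (Layer.Sheets S.weight y) := by
  classical
  obtain ⟨z, hz, hzy⟩ := hy
  obtain ⟨δ, rfl, rfl⟩ := Y.proj_eq_iff.mp hzy
  clear hzy
  obtain ⟨e, U, hU, hδU, he, heU, heδ, -⟩ :=
    exists_section Y.tgt_localDiffeo.isLocalHomeomorph δ
  have hV := (Y.continuous_src.comp_continuousOn he).isOpen_inter_preimage hU S.isOpen
  set V := U ∩ (Y.src ∘ e) ⁻¹' S.P with hVdef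
  have hδV : Y.tgt δ ∈ V := ⟨hδU, by simpa [heδ] using hz⟩
  have hfin : Finite (Y.stab x) := Y.stable x
  have : Fintype (Y.stab x) := Fintype.ofFinite _
  have hcard : Fintype.card (Y.stab x) = Y.order x := by
    rw [← Nat.card_eq_fintype_card, Nat.card_coe_set_eq]
    rfl
  have hsrc : ∀ y ∈ V, ∀ g : Y.stab x, Y.src (S.sec g (Y.src (e y))) = Y.src (e y) :=
    fun y hy g => S.src_sec g g.2 _ hy.2
  have hsec : ∀ g : Y.stab x, ContinuousOn (fun y => S.sec g (Y.src (e y))) V := fun g =>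
    (S.cont g g.2).comp (Y.continuous_src.comp_continuousOn (he.mono inter_subset_left))
      fun y hy => hy.2
  -- The value is the translate of the source of `e y`; the point `x` is a default value off the
  -- domain `V`.
  let pt : Y.stab x → Y.Obj → S.P := fun g y =>
    if h : Y.tgt (S.sec g (Y.src (e y))) ∈ S.P then ⟨_, h⟩ else ⟨x, S.mem⟩
  have hpt : ∀ g, ∀ y ∈ V, (pt g y : Y.Obj) = Y.tgt (S.sec g (Y.src (e y))) := fun g y hy => by
    exact congrArg Subtype.val (dif_pos (S.tgt_mem g g.2 (Y.src (e y)) hy.2))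
  let T : S.layer.Frame (Y.tgt δ) :=
    { P := V
      isOpen := hV
      mem := hδV
      S := Y.stab x
      pt := pt
      mor := fun g y => Y.mul (e y) (Y.inv (S.sec g (Y.src (e y))))
      cont_pt := fun g => by
        have : ContinuousOn (fun y => (pt g y : Y.Obj)) V :=
          (Y.continuous_tgt.comp_continuousOn (hsec g)).congr (hpt g)
        exact Topology.IsInducing.subtypeVal.continuousOn_iff.mpr this
      cont_mor := fun g y hy => by
        have h1 : Tendsto e (𝓝[V] y) (𝓝 (e y)) := (he.mono inter_subset_left) y hy
        have h2 := (Y.continuous_inv.tendsto _).comp (hsec g y hy)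
        refine tendsto_mul h1 h2 ?_ ?_
        · rw [Y.tgt_inv, hsrc y hy]
        · filter_upwards [self_mem_nhdsWithin] with w hw
          exact ((Y.tgt_inv _).trans (hsrc w hw g)).symm
      src_mor := fun g y hy => by
        rw [src_mul, Y.src_inv]
        exact (hpt g y hy).symm
      tgt_mor := fun g y hy => by
        rw [tgt_mul (by rw [Y.tgt_inv, hsrc y hy]), heU y hy.1]
      cover := by
        intro y hy (a : S.P) g (h1 : Y.src g = a) h2
        have h3 : Y.src (Y.inv (e y)) = Y.tgt g := by rw [Y.src_inv, heU y hy.1, h2]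
        obtain ⟨k, hk, hk'⟩ := S.exists_sec (Y.inv (Y.mul (Y.inv (e y)) g))
          (by rw [Y.src_inv, tgt_mul h3, Y.tgt_inv]; exact hy.2)
          (by rw [Y.tgt_inv, src_mul, h1]; exact a.2)
        rw [Y.src_inv, tgt_mul h3, Y.tgt_inv] at hk'
        refine ⟨⟨k, hk⟩, (S.layer_germ_iff h1).mpr ⟨Subtype.ext ?_, ?_⟩⟩
        · rw [hpt _ y hy]
          change (a : Y.Obj) = Y.tgt (S.sec k (Y.src (e y)))
          rw [← hk', Y.tgt_inv, src_mul, h1]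
        · change g = Y.mul (e y) (Y.inv (S.sec k (Y.src (e y))))
          rw [← hk', SseGroupoid.inv_inv, mul_inv_cancel_left (by rw [heU y hy.1, h2])] }
  obtain ⟨P, hP, hyP, hPT, hinj⟩ := T.exists_injOn
  refine ⟨{ T.restrict hP hPT hyP with
    w := fun _ => 1 / Y.order x
    isWeight := ⟨fun _ => div_pos one_pos (Nat.cast_pos.mpr (order_pos x)), ?_⟩
    sum_w := ?_
    inj := fun s y hy z hz hyz => hinj s hy hz (S.layer_projH_injective hyz) }⟩
  · intro y hy _ (a : S.P) g h1 h2
    obtain ⟨k, hk⟩ := T.cover y (hPT hy) a g h1 h2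
    refine (Finset.sum_eq_single k ?_ ?_).trans ?_
    rotate_left 2
    · exact indicator_of_mem (s := {s | S.layer.Germ a g (T.pt s y) (T.mor s y)}) hk
        fun _ => (1 / Y.order x : ℝ)
    · intro k' _ hne
      refine indicator_of_notMem (s := {s | S.layer.Germ a g (T.pt s y) (T.mor s y)})
        (fun hk' => hne ?_) fun _ => (1 / Y.order x : ℝ)
      have e1 := ((S.layer_germ_iff h1).mp hk).2
      have e2 := ((S.layer_germ_iff h1).mp hk').2
      have e3 : Y.inv (S.sec k' (Y.src (e y))) = Y.inv (S.sec k (Y.src (e y))) :=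
        mul_left_cancel (by rw [Y.tgt_inv, hsrc y (hPT hy)])
          (by rw [Y.tgt_inv, hsrc y (hPT hy)]) (e2.symm.trans e1)
      have e4 := congrArg Y.inv e3
      rw [SseGroupoid.inv_inv, SseGroupoid.inv_inv] at e4
      exact Subtype.ext (S.sec_inj _ k'.2 _ k.2 _ (hPT hy).2 e4)
    · exact fun h => absurd (Finset.mem_univ _) h
  · refine (Finset.sum_const (1 / (Y.order x : ℝ))).trans ?_
    rw [Finset.card_univ, nsmul_eq_mul]
    change (Fintype.card (Y.stab x) : ℝ) * _ = 1
    rw [hcard]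
    exact mul_one_div_cancel (Nat.cast_ne_zero.mpr (order_pos x).ne')

end Slice

end SseGroupoid

/-- Slices, over a shrinking of the cover of the orbit space by their images. -/
theorem SseGroupoid.IsProper.exists_layerFamily {Y : SseGroupoid.{u} I} [LocallyCompactSpace Y.Obj]
    (hY : Y.IsProper) : Nonempty (LayerFamily Y) := by
  have : T2Space Y.Orbit := hY.t2Space
  have : LocallyCompactSpace Y.Orbit := Y.isOpenQuotientMap_proj.locallyCompactSpace
  have : SecondCountableTopology Y.Orbit :=
    Y.isOpenQuotientMap_proj.isQuotientMap.secondCountableTopology Y.isOpenQuotientMap_proj.isOpenMap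
  choose S _ using fun x : Y.Obj => hY.exists_slice (univ_mem : univ ∈ 𝓝 x)
  obtain ⟨v, hv, hvU, hvf, hvS⟩ := precise_refinement (fun x => Y.proj '' (S x).P)
    (fun x => (S x).isOpen_proj_image) (eq_univ_of_forall fun p => by
      obtain ⟨x, rfl⟩ := Y.isOpenQuotientMap_proj.surjective p
      exact mem_iUnion.mpr ⟨x, x, (S x).mem, rfl⟩)
  obtain ⟨C, hCU, hC, hCv⟩ := exists_iUnion_eq_closure_subset hv hvf.point_finite hvU
  exact ⟨{
    ι := Y.Obj
    L := fun x => (S x).layer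
    W := fun x => (S x).weight
    C := fun x => closure (C x)
    isClosed := fun _ => isClosed_closure
    locallyFinite := hvf.subset hCv
    exists_interior := fun p => by
      obtain ⟨x, hx⟩ := mem_iUnion.mp (hCU.symm ▸ mem_univ p : p ∈ ⋃ x, C x)
      exact ⟨x, (hC x).subset_interior_iff.mpr subset_closure hx⟩
    sheets := fun x y hy => (S x).nonempty_sheets (hvS x (hCv x hy)) }⟩

/-- Glue slices and take `kerOrbit` as `κ`. The fibre sum is `κ / |G_x|`, which is one where the
whole stabilizer acts trivially. -/
theorem exists_isResolution {d : ℕ} (X : EpGroupoid.{u} d) :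
    ∃ (B : WnbGroupoid.{u} (𝓡 d)) (F : SmoothFunctor B.toSseGroupoid X.toSseGroupoid),
      IsResolution B X F := by
  have hX : X.toSseGroupoid.IsProper := X.proper
  have : LocallyCompactSpace X.Obj := Manifold.locallyCompact_of_finiteDimensional (𝓡 d)
  obtain ⟨E⟩ := hX.exists_layerFamily
  obtain ⟨Λ, hΛ⟩ := Layer.exists_isInduced E.universal.weight E.universal.nonempty_sheets kerOrbit
  refine ⟨E.universal.layer.wnb hX E.universal.nonempty_sheets kerOrbit_pos
    hX.isLocallyConstant_kerOrbit hΛ, E.universal.layer.F, E.universal.layer.etale,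
    Layer.isProperMap_base hX fun x => ⟨(E.universal.nonempty_sheets x).some.toFrame⟩, fun p hp => ?_⟩
  obtain ⟨x, rfl⟩ := X.isOpenQuotientMap_proj.surjective p
  have h1 := hΛ.hasSum E.universal.nonempty_sheets x
  rwa [kerOrbit_proj, kerOrder_eq_order_of_isSmoothPoint hp,
    div_self (Nat.cast_ne_zero.mpr (order_pos x).ne')] at h1

theorem IsResolution.exists_weight {d : ℕ} {X : EpGroupoid.{u} d} {A : WnbGroupoid.{u} (𝓡 d)}
    {F : SmoothFunctor A.toSseGroupoid X.toSseGroupoid} (h : IsResolution A X F) :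
    ∃ W : (A.layer F h.localDiffeo).Weight, (∀ x, Nonempty (Layer.Sheets W x)) ∧
      Layer.IsInduced W kerOrbit A.Λ :=
  Layer.exists_weight (L := A.layer F h.localDiffeo) X.proper h.proper A.branching A.Λ_pos
    (IsProper.isLocallyConstant_kerOrbit X.proper) h.weighting

theorem IsResolution.commensurate {d : ℕ} {X : EpGroupoid.{u} d} {A C : WnbGroupoid.{u} (𝓡 d)}
    {F : SmoothFunctor A.toSseGroupoid X.toSseGroupoid} (hF : IsResolution A X F)
    {G : SmoothFunctor C.toSseGroupoid X.toSseGroupoid} (hG : IsResolution C X G) :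
    Commensurate A C := by
  obtain ⟨V, hV, hA⟩ := hF.exists_weight
  obtain ⟨W, hW, hC⟩ := hG.exists_weight
  exact commensurate_of_isInduced X.proper kerOrbit_pos
    (IsProper.isLocallyConstant_kerOrbit X.proper) hV hA hW hC

end Existence

end BranchedResolution

namespace BranchedResolution

/-! ### Orientations of Euclidean space as signs -/

section Sign

variable {n : ℕ}

/-- The standard basis of `ℝⁿ`. -/
noncomputable abbrev stdBasis (n : ℕ) : Module.Basis (Fin n) ℝ (EuclideanSpace ℝ (Fin n)) :=
  (EuclideanSpace.basisFun (Fin n) ℝ).toBasis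

open Classical in
/-- The sign of an orientation of `ℝⁿ`. -/
noncomputable def orientationSign (o : Orientation ℝ (EuclideanSpace ℝ (Fin n)) (Fin n)) : ℝ :=
  if o = (stdBasis n).orientation then 1 else -1

theorem orientationSign_mul_self (o : Orientation ℝ (EuclideanSpace ℝ (Fin n)) (Fin n)) :
    orientationSign o * orientationSign o = 1 := by
  unfold orientationSign
  split_ifs <;> norm_num

theorem orientationSign_neg (o : Orientation ℝ (EuclideanSpace ℝ (Fin n)) (Fin n)) :
    orientationSign (-o) = -orientationSign o := by
  have hne : (stdBasis n).orientation ≠ -(stdBasis n).orientation :=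
    Module.Ray.ne_neg_self _
  unfold orientationSign
  rcases (stdBasis n).orientation_eq_or_eq_neg o with rfl | rfl
  · rw [if_neg hne.symm, if_pos rfl]
  · have h : - -(stdBasis n).orientation = (stdBasis n).orientation :=
      by convert neg_neg (show Module.Ray ℝ _ from (stdBasis n).orientation)
    rw [if_pos h, if_neg hne.symm, neg_neg]

/-- Orientations are turned into signs and positivity into an inequality between numbers, so later
comparisons are determinant computations. For `n = 0` the determinant of the empty family is one and
the sign alone decides. -/
theorem isPositive_iff {o : Orientation ℝ (EuclideanSpace ℝ (Fin n)) (Fin n)}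
    {v : Fin n → EuclideanSpace ℝ (Fin n)} :
    IsPositive o v ↔ 0 < orientationSign o * (stdBasis n).det v := by
  have key : ∀ b : Module.Basis (Fin n) ℝ (EuclideanSpace ℝ (Fin n)), b.orientation = o ↔
      0 < orientationSign o * (stdBasis n).det b := by
    intro b
    have h1 := (stdBasis n).orientation_eq_iff_det_pos b
    have h2 : (stdBasis n).det b ≠ 0 := ((stdBasis n).isUnit_det b).ne_zero
    unfold orientationSign
    split_ifs with ho
    · rw [ho, one_mul, ← h1, eq_comm]
    · rw [neg_one_mul, neg_pos, ← not_le, h2.symm.le_iff_lt, ← h1]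
      have h3 := (stdBasis n).orientation_eq_or_eq_neg o
      have h4 := (stdBasis n).orientation_eq_or_eq_neg b.orientation
      constructor
      · rintro rfl h5
        exact ho h5.symm
      · intro h5
        rw [h3.resolve_left ho, h4.resolve_left fun h => h5 h.symm]
  constructor
  · rintro ⟨b, rfl, hb⟩
    exact (key b).mp hb
  · intro h
    have h1 : IsUnit ((stdBasis n).det v) := isUnit_iff_ne_zero.mpr fun h0 => by
      rw [h0, mul_zero] at h
      exact lt_irrefl _ h
    obtain ⟨h2, h3⟩ := (Module.Basis.is_basis_iff_det (stdBasis n)).mpr h1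
    have h4 : ⇑(Module.Basis.mk h2 h3.ge) = v := Module.Basis.coe_mk _ _
    refine ⟨_, h4, (key _).mpr ?_⟩
    rwa [h4]

theorem exists_orientationSign_eq {c : ℝ} (hc : c * c = 1) :
    ∃ o : Orientation ℝ (EuclideanSpace ℝ (Fin n)) (Fin n), orientationSign o = c := by
  have h : orientationSign (stdBasis n).orientation = 1 := if_pos rfl
  rcases mul_self_eq_one_iff.mp hc with rfl | rfl
  · exact ⟨_, h⟩
  · exact ⟨-(stdBasis n).orientation, by rw [orientationSign_neg, h]⟩

theorem isPositive_iff_isPositive_map {o o' : Orientation ℝ (EuclideanSpace ℝ (Fin n)) (Fin n)}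
    {L : EuclideanSpace ℝ (Fin n) →ₗ[ℝ] EuclideanSpace ℝ (Fin n)} (hL : LinearMap.det L ≠ 0) :
    (∀ v, IsPositive o v ↔ IsPositive o' fun i => L (v i)) ↔
      0 < orientationSign o * orientationSign o' * LinearMap.det L := by
  have h1 : ∀ v, IsPositive o' (fun i => L (v i)) ↔
      0 < orientationSign o' * (LinearMap.det L * (stdBasis n).det v) := fun v => by
    rw [isPositive_iff, ← Module.Basis.det_comp]
    rfl
  have ho := orientationSign_mul_self o
  simp only [h1, isPositive_iff]
  constructor
  · intro h
    have h2 := h (stdBasis n)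
    rw [(stdBasis n).det_self, mul_one, mul_one] at h2
    have h3 : orientationSign o' * LinearMap.det L ≠ 0 :=
      mul_ne_zero (fun h0 => by have := orientationSign_mul_self o'; simp [h0] at this) hL
    rw [mul_assoc]
    rcases mul_self_eq_one_iff.mp ho with h4 | h4 <;> rw [h4] at h2 ⊢
    · rw [one_mul]
      exact h2.mp one_pos
    · have h5 : ¬ 0 < orientationSign o' * LinearMap.det L := fun h6 => by
        have := h2.mpr h6
        norm_num at this
      rw [neg_one_mul, neg_pos]
      exact lt_of_le_of_ne (not_lt.mp h5) h3
  · intro h v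
    have h2 : orientationSign o' * (LinearMap.det L * (stdBasis n).det v) =
        (orientationSign o * orientationSign o' * LinearMap.det L) *
          (orientationSign o * (stdBasis n).det v) := by
      linear_combination (-(orientationSign o' * LinearMap.det L * (stdBasis n).det v)) * ho
    rw [h2, mul_pos_iff_of_pos_left h]

end Sign

/-! ### Splitting off the coordinate of index zero -/

section Cone

variable {d : ℕ}

/-- `ℝᵈ × ℝ ≃ ℝᵈ⁺¹`, the last factor corresponding to the coordinate of index `0`. -/
noncomputable def coneEquiv (d : ℕ) :
    (EuclideanSpace ℝ (Fin d) × EuclideanSpace ℝ (Fin 1)) ≃L[ℝ] EuclideanSpace ℝ (Fin (d + 1)) :=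
  LinearEquiv.toContinuousLinearEquiv
    { toFun := fun p => WithLp.toLp 2 (Fin.cons (p.2 0) fun i => p.1 i)
      invFun := fun v => (WithLp.toLp 2 fun i => v i.succ, WithLp.toLp 2 fun _ => v 0)
      map_add' := fun p q => by
        ext i
        refine Fin.cases ?_ (fun i => ?_) i <;> simp
      map_smul' := fun c p => by
        ext i
        refine Fin.cases ?_ (fun i => ?_) i <;> simp
      left_inv := fun p => by
        refine Prod.ext ?_ ?_
        · ext i
          simp
        · ext i
          rw [Subsingleton.elim i 0]
          simp
      right_inv := fun v => by
        ext i
        refine Fin.cases ?_ (fun i => ?_) i <;> simp }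

/-- The coordinate of index `0`. -/
noncomputable def headL (d : ℕ) : EuclideanSpace ℝ (Fin (d + 1)) →L[ℝ] ℝ :=
  EuclideanSpace.proj (0 : Fin (d + 1))

/-- The other coordinates. -/
noncomputable def tailL (d : ℕ) :
    EuclideanSpace ℝ (Fin (d + 1)) →L[ℝ] EuclideanSpace ℝ (Fin d) :=
  (ContinuousLinearMap.fst ℝ _ _).comp (coneEquiv d).symm.toContinuousLinearMap

@[simp] theorem headL_apply (v : EuclideanSpace ℝ (Fin (d + 1))) : headL d v = v 0 := rfl
@[simp] theorem tailL_apply (v : EuclideanSpace ℝ (Fin (d + 1))) (i : Fin d) :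
    tailL d v i = v i.succ := rfl

/-- Laplace expansion along the row of the coordinate of index zero, whose only possibly nonzero
entry is that of `ν`. -/
theorem det_cons (ν : EuclideanSpace ℝ (Fin (d + 1))) {w : Fin d → EuclideanSpace ℝ (Fin (d + 1))}
    (hw : ∀ i, w i 0 = 0) : (stdBasis (d + 1)).det (Fin.cons ν w : Fin (d + 1) → _) =
      ν 0 * (stdBasis d).det fun i => tailL d (w i) := by
  rw [Module.Basis.det_apply, Module.Basis.det_apply, Matrix.det_succ_row_zero, Fin.sum_univ_succ,
    Finset.sum_eq_zero, add_zero]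
  · have h : (Matrix.submatrix ((stdBasis (d + 1)).toMatrix (Fin.cons ν w : Fin (d + 1) → _))
        Fin.succ (Fin.succAbove 0)) = (stdBasis d).toMatrix fun i => tailL d (w i) := by
      ext i j
      simp [Module.Basis.toMatrix_apply]
    rw [h]
    simp [Module.Basis.toMatrix_apply]
  · intro j _
    simp [Module.Basis.toMatrix_apply, hw]

theorem det_block {L : EuclideanSpace ℝ (Fin (d + 1)) →ₗ[ℝ] EuclideanSpace ℝ (Fin (d + 1))}
    {A : EuclideanSpace ℝ (Fin d) →ₗ[ℝ] EuclideanSpace ℝ (Fin d)} {c : ℝ}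
    (h0 : ∀ v, L v 0 = c * v 0) (hA : ∀ v, tailL d (L v) = A (tailL d v)) :
    LinearMap.det L = c * LinearMap.det A := by
  have h1 := Module.Basis.det_comp (stdBasis (d + 1)) L (stdBasis (d + 1))
  have h2 := Module.Basis.det_comp (stdBasis d) A (stdBasis d)
  rw [(stdBasis _).det_self, mul_one] at h1 h2
  rw [← h1, ← h2]
  have h3 : (L ∘ stdBasis (d + 1)) = Fin.cons (L (stdBasis (d + 1) 0))
      fun i => L (stdBasis (d + 1) i.succ) := by
    ext1 i
    refine Fin.cases ?_ (fun i => ?_) i <;> rfl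
  rw [h3, det_cons _ (fun i => by rw [h0]; simp), h0]
  have h4 : ∀ i, tailL d (L (stdBasis (d + 1) i.succ)) = (A ∘ stdBasis d) i := by
    intro i
    rw [hA, Function.comp]
    congr 1
    ext j
    simp
  rw [funext h4]
  simp

end Cone

end BranchedResolution

namespace BranchedResolution

/-! ### Changing the model of a manifold -/

section Transfer

variable {E H E' H' M : Type*} [NormedAddCommGroup E] [NormedSpace ℝ E] [NormedAddCommGroup E']
  [NormedSpace ℝ E'] [TopologicalSpace H] [TopologicalSpace H'] [TopologicalSpace M]
  [ChartedSpace H M] {J : ModelWithCorners ℝ E H} {J' : ModelWithCorners ℝ E' H'}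

/-- The charted space structure obtained by composing all charts with a homeomorphism. -/
@[reducible] def transferChartedSpace (M : Type*) [TopologicalSpace M] [ChartedSpace H M]
    (h : H ≃ₜ H') : ChartedSpace H' M where
  atlas := (fun c : OpenPartialHomeomorph M H => c.transHomeomorph h) '' atlas H M
  chartAt x := (chartAt H x).transHomeomorph h
  mem_chart_source x := by simp
  chart_mem_atlas x := ⟨_, chart_mem_atlas H x, rfl⟩

variable (h : H ≃ₜ H') (e : E ≃L[ℝ] E') (hh : ∀ z, J' (h z) = e (J z))

theorem isManifold_transfer [IsManifold J ∞ M] (hh : ∀ z, J' (h z) = e (J z)) :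
    letI := transferChartedSpace M h
    IsManifold J' ∞ M := by
  let _ := transferChartedSpace M h
  refine isManifold_of_contDiffOn J' ∞ M ?_
  rintro _ _ ⟨c, hc, rfl⟩ ⟨c', hc', rfl⟩
  have h1 : c.symm ≫ₕ c' ∈ contDiffGroupoid ∞ J := HasGroupoid.compatible hc hc'
  rw [contDiffGroupoid, mem_groupoid_of_pregroupoid] at h1
  have h2 : ContDiffOn ℝ ∞ (J ∘ (c.symm ≫ₕ c') ∘ J.symm)
    (J.symm ⁻¹' (c.symm ≫ₕ c').source ∩ range J) := h1.1
  have h3 := e.contDiff.comp_contDiffOn (h2.comp e.symm.contDiff.contDiffOn.{0}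
    (s := J'.symm ⁻¹' ((c.transHomeomorph h).symm ≫ₕ (c'.transHomeomorph h)).source ∩ range J') ?_)
  · refine h3.congr ?_
    rintro _ ⟨-, z, rfl⟩
    obtain ⟨z, rfl⟩ := h.surjective z
    simp [hh]
    rw [← hh, J'.left_inv]
    simp
  · rintro _ ⟨hz, z, rfl⟩
    obtain ⟨z, rfl⟩ := h.surjective z
    rw [mem_preimage, J'.left_inv] at hz
    rw [hh, e.symm_apply_apply]
    refine ⟨?_, mem_range_self _⟩
    rw [mem_preimage, J.left_inv]
    simpa using hz

theorem contMDiff_id_transfer [IsManifold J ∞ M] (hh : ∀ z, J' (h z) = e (J z)) :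
    letI := transferChartedSpace M h
    ContMDiff J J' ∞ (id : M → M) := by
  let _ := transferChartedSpace M h
  intro x
  refine contMDiffAt_iff_target.mpr ⟨continuousAt_id, ?_⟩
  refine (e.contDiff.contMDiff.contMDiffAt.comp x
    (contMDiffAt_extChartAt (I := J))).congr_of_eventuallyEq (Eventually.of_forall fun y => ?_)
  exact hh _

theorem contMDiff_transfer_id [IsManifold J ∞ M] (hh : ∀ z, J' (h z) = e (J z)) :
    letI := transferChartedSpace M h
    ContMDiff J' J ∞ (id : M → M) := by
  let _ := transferChartedSpace M h
  have := isManifold_transfer (M := M) h e hh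
  intro x
  refine contMDiffAt_iff_target.mpr ⟨continuousAt_id, ?_⟩
  refine (e.symm.contDiff.contMDiff.contMDiffAt.comp x
    (contMDiffAt_extChartAt (I := J'))).congr_of_eventuallyEq (Eventually.of_forall fun y => ?_)
  exact (e.symm_apply_apply _).symm.trans (congrArg e.symm (hh _).symm)

/-- The identity, as a diffeomorphism between the original and the transferred structure. -/
def transferDiffeomorph (M : Type*) [TopologicalSpace M] [ChartedSpace H M] [IsManifold J ∞ M]
    (hh : ∀ z, J' (h z) = e (J z)) :
    letI := transferChartedSpace M h
    M ≃ₘ^∞⟮J, J'⟯ M :=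
  letI := transferChartedSpace M h
  { Equiv.refl M with
    contMDiff_toFun := contMDiff_id_transfer h e hh
    contMDiff_invFun := contMDiff_transfer_id h e hh }

end Transfer

section Cone

/-- The product of `ℝᵈ` with the half line is the half space. -/
noncomputable def coneHomeo (d : ℕ) :
    ModelProd (EuclideanSpace ℝ (Fin d)) (EuclideanHalfSpace 1) ≃ₜ EuclideanHalfSpace (d + 1) where
  toFun p := ⟨coneEquiv d (p.1, p.2.1), p.2.2⟩
  invFun v := (((coneEquiv d).symm v.1).1, ⟨((coneEquiv d).symm v.1).2, v.2⟩)
  left_inv p := by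
    have h := Prod.ext_iff.mp ((coneEquiv d).symm_apply_apply (p.1, p.2.1))
    exact Prod.ext h.1 (Subtype.ext h.2)
  right_inv v := Subtype.ext ((coneEquiv d).apply_symm_apply v.1)
  continuous_toFun := ((coneEquiv d).continuous.comp
    (continuous_fst.prodMk (continuous_subtype_val.comp continuous_snd))).subtype_mk _
  continuous_invFun := (continuous_fst.comp ((coneEquiv d).symm.continuous.comp
    continuous_subtype_val)).prodMk ((continuous_snd.comp ((coneEquiv d).symm.continuous.comp
    continuous_subtype_val)).subtype_mk _)

theorem coneHomeo_spec (d : ℕ) (p : ModelProd (EuclideanSpace ℝ (Fin d)) (EuclideanHalfSpace 1)) :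
    (𝓡∂ (d + 1)) (coneHomeo d p) = coneEquiv d (((𝓡 d).prod (𝓡∂ 1)) p) := rfl

end Cone

end BranchedResolution

namespace BranchedResolution

/-! ### The manifold structure of a cylinder and derivatives in its charts -/

section Cylinder

variable {d : ℕ} {M N : Type*} [TopologicalSpace M] [ChartedSpace (EuclideanSpace ℝ (Fin d)) M]
  [TopologicalSpace N] [ChartedSpace (EuclideanSpace ℝ (Fin d)) N]

/-- The charts of the cylinder on a manifold. -/
noncomputable instance cylinderChartedSpace :
    ChartedSpace (EuclideanHalfSpace (d + 1)) (M × Icc (0 : ℝ) 1) :=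
  transferChartedSpace (H := ModelProd (EuclideanSpace ℝ (Fin d)) (EuclideanHalfSpace 1))
    (M × Icc (0 : ℝ) 1) (coneHomeo d)

instance isManifold_cylinder [IsManifold (𝓡 d) ∞ M] :
    IsManifold (𝓡∂ (d + 1)) ∞ (M × Icc (0 : ℝ) 1) :=
  isManifold_transfer (J := (𝓡 d).prod (𝓡∂ 1)) (coneHomeo d) (coneEquiv d) (coneHomeo_spec d)

/-- The product of a manifold with the interval is diffeomorphic to the cylinder. -/
noncomputable def cylinderDiffeomorph (M : Type*) [TopologicalSpace M]
    [ChartedSpace (EuclideanSpace ℝ (Fin d)) M] [IsManifold (𝓡 d) ∞ M] :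
    (M × Icc (0 : ℝ) 1) ≃ₘ^∞⟮(𝓡 d).prod (𝓡∂ 1), 𝓡∂ (d + 1)⟯ (M × Icc (0 : ℝ) 1) :=
  transferDiffeomorph (J := (𝓡 d).prod (𝓡∂ 1)) (coneHomeo d) (coneEquiv d)
    (M × Icc (0 : ℝ) 1) (coneHomeo_spec d)

theorem contMDiff_cylinder_fst [IsManifold (𝓡 d) ∞ M] :
    ContMDiff (𝓡∂ (d + 1)) (𝓡 d) ∞ (Prod.fst : M × Icc (0 : ℝ) 1 → M) :=
  (contMDiff_fst (I := 𝓡 d) (J := 𝓡∂ 1)).comp (cylinderDiffeomorph M).symm.contMDiff_toFun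

theorem contMDiff_cylinder_snd [IsManifold (𝓡 d) ∞ M] :
    ContMDiff (𝓡∂ (d + 1)) (𝓡∂ 1) ∞ (Prod.snd : M × Icc (0 : ℝ) 1 → Icc (0 : ℝ) 1) :=
  (contMDiff_snd (I := 𝓡 d) (J := 𝓡∂ 1)).comp (cylinderDiffeomorph M).symm.contMDiff_toFun

theorem contMDiffOn_cylinder {E H L : Type*} [NormedAddCommGroup E] [NormedSpace ℝ E]
    [TopologicalSpace H] {J : ModelWithCorners ℝ E H} [TopologicalSpace L] [ChartedSpace H L]
    [IsManifold (𝓡 d) ∞ M] {f : L → M × Icc (0 : ℝ) 1} {s : Set L}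
    (h1 : ContMDiffOn J (𝓡 d) ∞ (fun x => (f x).1) s)
    (h2 : ContMDiffOn J (𝓡∂ 1) ∞ (fun x => (f x).2) s) : ContMDiffOn J (𝓡∂ (d + 1)) ∞ f s :=
  (cylinderDiffeomorph M).contMDiff_toFun.comp_contMDiffOn (h1.prodMk h2)

theorem boundary_cylinder [IsManifold (𝓡 d) ∞ M] (k : M × Icc (0 : ℝ) 1) :
    k ∈ (𝓡∂ (d + 1)).boundary (M × Icc (0 : ℝ) 1) ↔ k.2 = 0 ∨ k.2 = 1 := by
  have h1 := (cylinderDiffeomorph (d := d) M).preimage_boundary (by simp)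
  rw [ModelWithCorners.boundary_of_boundaryless_left, boundary_Icc] at h1
  have h2 : k ∈ ⇑(cylinderDiffeomorph (d := d) M) ⁻¹' (𝓡∂ (d + 1)).boundary (M × Icc (0 : ℝ) 1) ↔ _ :=
    Set.ext_iff.mp h1 k
  exact h2.trans ⟨fun h => h.2, fun h => ⟨trivial, h⟩⟩

/-- The derivative of the time in the chart at `t`. -/
noncomputable def timeSign (t : Icc (0 : ℝ) 1) : ℝ :=
  if (t : ℝ) < 1 then 1 else -1

theorem timeSign_mul_self (t : Icc (0 : ℝ) 1) : timeSign t * timeSign t = 1 := by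
  unfold timeSign
  split_ifs <;> norm_num

/-- The charts of the interval are `t` and `1 - t`. The second is used at `t = 1` only, and there
the time is reversed; `timeSign` records this. -/
theorem headL_extChartAt (k : M × Icc (0 : ℝ) 1) : ∃ c : ℝ, ∀ k' : M × Icc (0 : ℝ) 1,
    headL d (extChartAt (𝓡∂ (d + 1)) k k') = timeSign k.2 * (k'.2 : ℝ) + c := by
  have h1 : ∀ k', headL d (extChartAt (𝓡∂ (d + 1)) k k') = (chartAt (EuclideanHalfSpace 1) k.2 k'.2).1 0 :=
    fun k' => rfl
  by_cases hk : (k.2 : ℝ) < 1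
  · refine ⟨0, fun k' => ?_⟩
    rw [h1, Icc_chartedSpaceChartAt_of_le_top hk, timeSign, if_pos hk, IccLeftChart]
    simp
  · refine ⟨1, fun k' => ?_⟩
    rw [h1, Icc_chartedSpaceChartAt_of_top_le (not_lt.mp hk), timeSign, if_neg hk, IccRightChart]
    simp
    ring

variable {E H L : Type*} [NormedAddCommGroup E] [NormedSpace ℝ E]
    [TopologicalSpace H] {J : ModelWithCorners ℝ E H} [TopologicalSpace L] [ChartedSpace H L]

theorem hasMFDerivAt_tailL {f : L → M × Icc (0 : ℝ) 1} {x : L} {k : M × Icc (0 : ℝ) 1}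
    {D : E →L[ℝ] EuclideanSpace ℝ (Fin (d + 1))}
    (hf : HasMFDerivAt J 𝓘(ℝ, EuclideanSpace ℝ (Fin (d + 1)))
      (fun x => extChartAt (𝓡∂ (d + 1)) k (f x)) x D) :
    HasMFDerivAt J 𝓘(ℝ, EuclideanSpace ℝ (Fin d)) (fun x => extChartAt (𝓡 d) k.1 (f x).1) x
      ((tailL d).comp D) :=
  (tailL d).hasMFDerivAt.comp x hf

theorem hasMFDerivAt_headL {f : L → M × Icc (0 : ℝ) 1} {x : L} {k : M × Icc (0 : ℝ) 1}
    {D : E →L[ℝ] EuclideanSpace ℝ (Fin (d + 1))}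
    (hf : HasMFDerivAt J 𝓘(ℝ, EuclideanSpace ℝ (Fin (d + 1)))
      (fun x => extChartAt (𝓡∂ (d + 1)) k (f x)) x D) :
    HasMFDerivAt J 𝓘(ℝ, ℝ) (fun x => ((f x).2 : ℝ)) x (timeSign k.2 • (headL d).comp D) := by
  obtain ⟨c, hc⟩ := headL_extChartAt (d := d) k
  have h1 : HasFDerivAt (fun v => timeSign k.2 • (headL d v - c)) (timeSign k.2 • headL d)
      (extChartAt (𝓡∂ (d + 1)) k (f x)) :=
    ((headL d).hasFDerivAt.sub_const c).fun_const_smul _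
  refine (h1.hasMFDerivAt.comp x hf).congr_of_eventuallyEq (Eventually.of_forall fun y => ?_)
  change _ = timeSign k.2 * (headL d (extChartAt (𝓡∂ (d + 1)) k (f y)) - c)
  rw [hc, add_sub_cancel_right, ← mul_assoc, timeSign_mul_self, one_mul]

variable [IsManifold (𝓡 d) ∞ M]

omit [ChartedSpace (EuclideanSpace ℝ (Fin d)) M] [IsManifold (𝓡 d) ∞ M] in
theorem hasMFDerivAt_extChartAt_comp {n : ℕ} {H₀ N : Type*} [TopologicalSpace H₀]
    {I : ModelWithCorners ℝ (EuclideanSpace ℝ (Fin n)) H₀} [TopologicalSpace N] [ChartedSpace H₀ N]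
    [IsManifold I ∞ N] {f : L → N} {x : L} (hf : MDifferentiableAt J I f x) :
    HasMFDerivAt J 𝓘(ℝ, EuclideanSpace ℝ (Fin n)) (fun y => extChartAt I (f x) (f y)) x
      (mfderiv J I f x : E →L[ℝ] EuclideanSpace ℝ (Fin n)) := by
  have : IsManifold I 1 N := IsManifold.of_le (n := ∞) (by simp)
  have h1 : HasMFDerivAt I 𝓘(ℝ, EuclideanSpace ℝ (Fin n)) (extChartAt I (f x)) (f x)
      (mfderiv I 𝓘(ℝ, EuclideanSpace ℝ (Fin n)) (extChartAt I (f x)) (f x)) :=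
    (mdifferentiableAt_extChartAt (mem_chart_source H₀ (f x))).hasMFDerivAt
  rw [mfderiv_extChartAt_self] at h1
  exact h1.comp x hf.hasMFDerivAt

theorem hasMFDerivAt_eq {n : ℕ} {x : L} {f : L → EuclideanSpace ℝ (Fin n)}
    {D D' : E →L[ℝ] EuclideanSpace ℝ (Fin n)}
    (h : HasMFDerivAt J 𝓘(ℝ, EuclideanSpace ℝ (Fin n)) f x D)
    (h' : HasMFDerivAt J 𝓘(ℝ, EuclideanSpace ℝ (Fin n)) f x D') : D = D' :=
  hasMFDerivAt_unique h h'

theorem tailL_mfderiv {f : L → M × Icc (0 : ℝ) 1} {g : L → M} {x : L}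
    (hg : ∀ y, (f y).1 = g y) (hf : MDifferentiableAt J (𝓡∂ (d + 1)) f x) :
    (tailL d).comp (mfderiv J (𝓡∂ (d + 1)) f x : E →L[ℝ] EuclideanSpace ℝ (Fin (d + 1))) =
      (mfderiv J (𝓡 d) g x : E →L[ℝ] EuclideanSpace ℝ (Fin d)) := by
  have h1 := hasMFDerivAt_tailL (hasMFDerivAt_extChartAt_comp hf)
  have h2 : MDifferentiableAt J (𝓡 d) (fun y => (f y).1) x :=
    (contMDiff_cylinder_fst.mdifferentiableAt (by simp)).comp x hf
  rw [show (fun y => (f y).1) = g from funext hg] at h2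
  have h3 := hasMFDerivAt_extChartAt_comp (I := 𝓡 d) (f := g) h2
  rw [show (fun y => extChartAt (𝓡 d) (g x) (g y)) = fun y => extChartAt (𝓡 d) (f x).1 (f y).1 by
    simp only [hg]] at h3
  exact hasMFDerivAt_eq (E := E) h1 h3

theorem headL_mfderiv {f : L → M × Icc (0 : ℝ) 1} {x : L}
    (hf : MDifferentiableAt J (𝓡∂ (d + 1)) f x) :
    (mfderiv J 𝓘(ℝ, ℝ) (fun y => ((f y).2 : ℝ)) x : E →L[ℝ] ℝ) = timeSign (f x).2 •
      (headL d).comp (mfderiv J (𝓡∂ (d + 1)) f x : E →L[ℝ] EuclideanSpace ℝ (Fin (d + 1))) :=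
  (hasMFDerivAt_headL (hasMFDerivAt_extChartAt_comp hf)).mfderiv

section

variable {k k' : M × Icc (0 : ℝ) 1}

omit [IsManifold (𝓡 d) ∞ M] in
theorem fst_mem_extChartAt_source (hk : k' ∈ (chartAt (EuclideanHalfSpace (d + 1)) k).source) :
    k'.1 ∈ (chartAt (EuclideanSpace ℝ (Fin d)) k.1).source :=
  hk.1

/-- With `headL_mfderiv_extChartAt` this gives the block form of the derivative of a cylinder chart:
the chart of `M` on the tail and a sign on the head. -/
theorem tailL_mfderiv_extChartAt
    (hk : k' ∈ (chartAt (EuclideanHalfSpace (d + 1)) k).source) :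
    (tailL d).comp (mfderiv (𝓡∂ (d + 1)) 𝓘(ℝ, EuclideanSpace ℝ (Fin (d + 1)))
      (extChartAt (𝓡∂ (d + 1)) k) k' :
        EuclideanSpace ℝ (Fin (d + 1)) →L[ℝ] EuclideanSpace ℝ (Fin (d + 1))) =
    (mfderiv (𝓡 d) 𝓘(ℝ, EuclideanSpace ℝ (Fin d)) (extChartAt (𝓡 d) k.1) k'.1 :
      EuclideanSpace ℝ (Fin d) →L[ℝ] EuclideanSpace ℝ (Fin d)).comp (tailL d) := by
  have : IsManifold (𝓡 d) 1 M := IsManifold.of_le (n := ∞) (by simp)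
  have : IsManifold (𝓡∂ (d + 1)) 1 (M × Icc (0 : ℝ) 1) := IsManifold.of_le (n := ∞) (by simp)
  have h1 : MDifferentiableAt (𝓡∂ (d + 1)) 𝓘(ℝ, EuclideanSpace ℝ (Fin (d + 1)))
      (extChartAt (𝓡∂ (d + 1)) k) k' := mdifferentiableAt_extChartAt hk
  have h2 : MDifferentiableAt (𝓡 d) 𝓘(ℝ, EuclideanSpace ℝ (Fin d)) (extChartAt (𝓡 d) k.1) k'.1 :=
    mdifferentiableAt_extChartAt (fst_mem_extChartAt_source hk)
  have h3 : MDifferentiableAt (𝓡∂ (d + 1)) (𝓡 d) (Prod.fst : M × Icc (0 : ℝ) 1 → M) k' :=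
    contMDiff_cylinder_fst.mdifferentiableAt (by simp)
  have h4 := hasMFDerivAt_tailL (f := id) h1.hasMFDerivAt
  have h5 := h2.hasMFDerivAt.comp k' h3.hasMFDerivAt
  have h6 := hasMFDerivAt_tailL (hasMFDerivAt_extChartAt_comp
    (mdifferentiableAt_id (I := 𝓡∂ (d + 1)) (x := k')))
  have h7 := hasMFDerivAt_eq h6 (hasMFDerivAt_extChartAt_comp h3)
  have h8 := hasMFDerivAt_eq h4 h5
  rw [mfderiv_id] at h7
  refine h8.trans ?_
  exact congrArg (ContinuousLinearMap.comp _) (h7.symm.trans (ContinuousLinearMap.comp_id _))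

theorem headL_mfderiv_extChartAt
    (hk : k' ∈ (chartAt (EuclideanHalfSpace (d + 1)) k).source) :
    timeSign k.2 • (headL d).comp (mfderiv (𝓡∂ (d + 1)) 𝓘(ℝ, EuclideanSpace ℝ (Fin (d + 1)))
      (extChartAt (𝓡∂ (d + 1)) k) k' :
        EuclideanSpace ℝ (Fin (d + 1)) →L[ℝ] EuclideanSpace ℝ (Fin (d + 1))) =
    timeSign k'.2 • headL d := by
  have : IsManifold (𝓡∂ (d + 1)) 1 (M × Icc (0 : ℝ) 1) := IsManifold.of_le (n := ∞) (by simp)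
  have h1 : MDifferentiableAt (𝓡∂ (d + 1)) 𝓘(ℝ, EuclideanSpace ℝ (Fin (d + 1)))
      (extChartAt (𝓡∂ (d + 1)) k) k' := mdifferentiableAt_extChartAt hk
  have h4 := hasMFDerivAt_headL (f := id) h1.hasMFDerivAt
  have h6 := hasMFDerivAt_headL (hasMFDerivAt_extChartAt_comp
    (mdifferentiableAt_id (I := 𝓡∂ (d + 1)) (x := k')))
  rw [mfderiv_id] at h6
  exact (hasMFDerivAt_unique h4 h6).trans
    (congrArg (timeSign k'.2 • ·) (ContinuousLinearMap.comp_id (headL d)))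

end

end Cylinder

end BranchedResolution

namespace BranchedResolution

/-! ### Orientation of the cylinder -/

section Cylinder

variable {d : ℕ}

/-- The determinant of `L` is `a' * a` times that of `A`. The same two signs enter the orientations
of source and target, so they cancel, and orientation questions on the cylinder reduce to those on
`M`. -/
theorem isPositive_block {o o' : Orientation ℝ (EuclideanSpace ℝ (Fin d)) (Fin d)}
    {p p' : Orientation ℝ (EuclideanSpace ℝ (Fin (d + 1))) (Fin (d + 1))} {a a' : ℝ}
    (hp : orientationSign p = orientationSign o * a)
    (hp' : orientationSign p' = orientationSign o' * a')
    {A : EuclideanSpace ℝ (Fin d) →L[ℝ] EuclideanSpace ℝ (Fin d)}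
    {L : EuclideanSpace ℝ (Fin (d + 1)) →L[ℝ] EuclideanSpace ℝ (Fin (d + 1))}
    (ha : a * a = 1) (ha' : a' * a' = 1) (h0 : a' • (headL d).comp L = a • headL d)
    (h1 : (tailL d).comp L = A.comp (tailL d)) (hA : A.IsInvertible)
    (h : ∀ v, IsPositive o v ↔ IsPositive o' fun i => A (v i)) :
    ∀ v, IsPositive p v ↔ IsPositive p' fun i => L (v i) := by
  have hdA : LinearMap.det (A : EuclideanSpace ℝ (Fin d) →ₗ[ℝ] EuclideanSpace ℝ (Fin d)) ≠ 0 := by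
    obtain ⟨e, rfl⟩ := hA
    exact (LinearEquiv.isUnit_det' e.toLinearEquiv).ne_zero
  have hdL := det_block (L := (L : EuclideanSpace ℝ (Fin (d + 1)) →ₗ[ℝ] EuclideanSpace ℝ (Fin (d + 1))))
    (A := (A : EuclideanSpace ℝ (Fin d) →ₗ[ℝ] EuclideanSpace ℝ (Fin d))) (c := a' * a) (fun v => by
    have h2 : a' * (L v 0) = a * v 0 := DFunLike.congr_fun h0 v
    change L v 0 = a' * a * v 0
    calc L v 0 = (a' * a') * L v 0 := by rw [ha', one_mul]
      _ = a' * a * v 0 := by rw [mul_assoc, h2, mul_assoc])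
    fun v => DFunLike.congr_fun h1 v
  have hpos := (isPositive_iff_isPositive_map 
    (L := (A : EuclideanSpace ℝ (Fin d) →ₗ[ℝ] EuclideanSpace ℝ (Fin d))) hdA).mp h
  have hne : a' * a ≠ 0 := fun h0 => by
    have : (a' * a) * (a' * a) = 1 := by linear_combination a * a * ha' + ha
    simp [h0] at this
  refine (isPositive_iff_isPositive_map 
    (L := (L : EuclideanSpace ℝ (Fin (d + 1)) →ₗ[ℝ] EuclideanSpace ℝ (Fin (d + 1))))
    (by rw [hdL]; exact mul_ne_zero hne hdA)).mpr ?_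
  rw [hdL, hp, hp']
  convert hpos using 1
  linear_combination (orientationSign o * orientationSign o' *
    LinearMap.det (A : EuclideanSpace ℝ (Fin d) →ₗ[ℝ] EuclideanSpace ℝ (Fin d))) *
      (a * a * ha' + ha)

namespace OrientedManifold

variable (M N : OrientedManifold.{u} (𝓡 d))

theorem sign_mul_timeSign (k : M × Icc (0 : ℝ) 1) :
    orientationSign (M.orient k.1) * timeSign k.2 *
      (orientationSign (M.orient k.1) * timeSign k.2) = 1 := by
  linear_combination timeSign k.2 * timeSign k.2 * orientationSign_mul_self (M.orient k.1) +
    timeSign_mul_self k.2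

/-- The orientation of the cylinder. -/
noncomputable def cylinderOrient (k : M × Icc (0 : ℝ) 1) :
    Orientation ℝ (EuclideanSpace ℝ (Fin (d + 1))) (Fin (d + 1)) :=
  Classical.choose (exists_orientationSign_eq (M.sign_mul_timeSign k))

theorem orientationSign_cylinderOrient (k : M × Icc (0 : ℝ) 1) :
    orientationSign (M.cylinderOrient k) = orientationSign (M.orient k.1) * timeSign k.2 :=
  Classical.choose_spec (exists_orientationSign_eq (M.sign_mul_timeSign k))

/-- The cylinder `M × [0, 1]`, a manifold with boundary. -/
noncomputable def cylinder : OrientedManifold.{u} (𝓡∂ (d + 1)) where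
  carrier := M × Icc (0 : ℝ) 1
  orient := M.cylinderOrient
  orient_locallyConstant k₀ := by
    have : IsManifold (𝓡 d) 1 M := IsManifold.of_le (n := ∞) (by simp)
    obtain ⟨o, ho⟩ := M.orient_locallyConstant k₀.1
    obtain ⟨p, hp⟩ := exists_orientationSign_eq (n := d + 1)
      (c := orientationSign o * timeSign k₀.2)
      (by linear_combination timeSign k₀.2 * timeSign k₀.2 * orientationSign_mul_self o +
          timeSign_mul_self k₀.2)
    refine ⟨p, ?_⟩
    filter_upwards [continuous_fst.continuousAt.eventually ho,
      (chartAt (EuclideanHalfSpace (d + 1)) k₀).open_source.mem_nhds (mem_chart_source _ k₀)]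
      with k hk hs
    exact isPositive_block (M.orientationSign_cylinderOrient k) hp (timeSign_mul_self _)
      (timeSign_mul_self _) (headL_mfderiv_extChartAt hs) (tailL_mfderiv_extChartAt hs)
      (isInvertible_mfderiv_extChartAt (by
        rw [extChartAt_source]; exact fst_mem_extChartAt_source hs)) hk

variable {M N}

theorem isLocalDiffeomorph_cylinderMap {f : M → N} (hf : IsLocalDiffeomorph (𝓡 d) (𝓡 d) ∞ f) :
    IsLocalDiffeomorph (𝓡∂ (d + 1)) (𝓡∂ (d + 1)) ∞
      (fun k => (f k.1, k.2) : M × Icc (0 : ℝ) 1 → N × Icc (0 : ℝ) 1) := by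
  intro k
  obtain ⟨Φ, hk, hΦ⟩ := hf k.1
  refine ⟨{ toPartialEquiv := Φ.toPartialEquiv.prod (PartialEquiv.refl _)
            open_source := Φ.open_source.prod isOpen_univ
            open_target := Φ.open_target.prod isOpen_univ
            contMDiffOn_toFun := contMDiffOn_cylinder
              (Φ.contMDiffOn_toFun.comp contMDiff_cylinder_fst.contMDiffOn fun x hx => hx.1)
              contMDiff_cylinder_snd.contMDiffOn
            contMDiffOn_invFun := contMDiffOn_cylinder
              (Φ.contMDiffOn_invFun.comp contMDiff_cylinder_fst.contMDiffOn fun x hx => hx.1)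
              contMDiff_cylinder_snd.contMDiffOn }, ⟨hk, trivial⟩, fun x hx => ?_⟩
  exact Prod.ext (hΦ hx.1) rfl

theorem _root_.BranchedResolution.IsOrientedLocalDiffeo.cylinder {f : M → N}
    (hf : IsOrientedLocalDiffeo M N f) :
    IsOrientedLocalDiffeo M.cylinder N.cylinder (fun k => (f k.1, k.2)) where
  isLocalDiffeomorph := isLocalDiffeomorph_cylinderMap hf.isLocalDiffeomorph
  preserves := by
    intro (k : M × Icc (0 : ℝ) 1)
    have hd : MDifferentiableAt (𝓡∂ (d + 1)) (𝓡∂ (d + 1))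
        (fun k => (f k.1, k.2) : M × Icc (0 : ℝ) 1 → N × Icc (0 : ℝ) 1) k :=
      (isLocalDiffeomorph_cylinderMap hf.isLocalDiffeomorph).mdifferentiable (by simp) k
    have h3 : MDifferentiableAt (𝓡∂ (d + 1)) (𝓡 d) (Prod.fst : M × Icc (0 : ℝ) 1 → M) k :=
      contMDiff_cylinder_fst.mdifferentiableAt (by simp)
    have hi : MDifferentiableAt (𝓡∂ (d + 1)) (𝓡∂ (d + 1)) (id : M × Icc (0 : ℝ) 1 → _) k :=
      mdifferentiableAt_id
    have ht := (headL_mfderiv hd).symm.trans (headL_mfderiv (f := id) hi)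
    have h4 := tailL_mfderiv (f := id) (g := Prod.fst) (fun _ => rfl) hi
    rw [mfderiv_id] at ht h4
    have h5 := tailL_mfderiv (g := f ∘ Prod.fst) (fun _ => rfl) hd
    rw [mfderiv_comp k (hf.mdifferentiableAt k.1) h3] at h5
    refine isPositive_block (M.orientationSign_cylinderOrient k)
      (N.orientationSign_cylinderOrient (f k.1, k.2)) (timeSign_mul_self _) (timeSign_mul_self _)
      ht (A := mfderiv (𝓡 d) (𝓡 d) f k.1) ?_ ?_ (hf.preserves k.1)
    · exact h5.trans (congrArg (ContinuousLinearMap.comp _) (h4.symm.trans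
        (ContinuousLinearMap.comp_id _)))
    · exact ⟨(hf.isLocalDiffeomorph k.1).mfderivToContinuousLinearEquiv (by simp),
        (hf.isLocalDiffeomorph k.1).mfderivToContinuousLinearEquiv_coe (by simp)⟩

end OrientedManifold

end Cylinder

end BranchedResolution

namespace BranchedResolution

/-! ### Oriented boundary of a manifold étale over a cylinder -/

section Boundary

variable {d : ℕ} {M P : OrientedManifold.{u} (𝓡 d)} {E : Type u} [TopologicalSpace E] [T2Space E]
  [SecondCountableTopology E] {q : E → P × Icc (0 : ℝ) 1} {hq : IsLocalHomeomorph q}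
  {f : M → P.cylinder.pullback q hq} {F : M → P} {e : Icc (0 : ℝ) 1}

theorem contMDiff_const_time (hF : ContMDiff (𝓡 d) (𝓡 d) ∞ F) (e : Icc (0 : ℝ) 1) :
    ContMDiff (𝓡 d) (𝓡∂ (d + 1)) ∞ (fun x => (F x, e) : M → P × Icc (0 : ℝ) 1) :=
  contMDiffOn_univ.mp (contMDiffOn_cylinder hF.contMDiffOn contMDiffOn_const)

theorem contMDiff_cylinder_end (hF : ContMDiff (𝓡 d) (𝓡 d) ∞ F) (hf : Continuous f)
    (h : ∀ x, q (f x) = (F x, e)) : ContMDiff (𝓡 d) (𝓡∂ (d + 1)) ∞ f := fun x =>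
  contMDiffAt_of_comp_isLocalDiffeomorph (P.cylinder.isOrientedLocalDiffeo_pullback q hq).1
    hf.continuousAt (((funext h : q ∘ f = fun x => (F x, e)) ▸ contMDiff_const_time hF e) x)

/-- The derivative of the étale map `q` is the identity on model spaces, so `f` has the derivative
of `x ↦ (F x, e)`: constant in time, and `F` on the tail. -/
theorem mfderiv_cylinder_end (hF : IsOrientedLocalDiffeo M P F) (hf : Continuous f)
    (h : ∀ x, q (f x) = (F x, e)) (x : M) (v : EuclideanSpace ℝ (Fin d)) :
    (headL d (mfderiv (𝓡 d) (𝓡∂ (d + 1)) f x v) = 0) ∧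
    (tailL d (mfderiv (𝓡 d) (𝓡∂ (d + 1)) f x v) =
      (mfderiv (𝓡 d) (𝓡 d) F x : EuclideanSpace ℝ (Fin d) →L[ℝ] EuclideanSpace ℝ (Fin d)) v) := by
  have hq' := P.cylinder.isOrientedLocalDiffeo_pullback q hq
  have hd : MDifferentiableAt (𝓡 d) (𝓡∂ (d + 1)) f x :=
    (contMDiff_cylinder_end hF.contMDiff hf h).mdifferentiableAt (by simp)
  have hd' : MDifferentiableAt (𝓡 d) (𝓡∂ (d + 1)) (fun x => (F x, e) : M → P × Icc (0 : ℝ) 1) x :=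
    (contMDiff_const_time hF.contMDiff e).mdifferentiableAt (by simp)
  have h1 : mfderiv (𝓡 d) (𝓡∂ (d + 1)) (fun x => (F x, e) : M → P × Icc (0 : ℝ) 1) x v =
      mfderiv (𝓡 d) (𝓡∂ (d + 1)) f x v := by
    have h2 := mfderiv_comp x (hq'.mdifferentiableAt (f x)) hd
    have key : ∀ φ ψ : M → P.cylinder, φ = ψ →
        (mfderiv (𝓡 d) (𝓡∂ (d + 1)) φ x : EuclideanSpace ℝ (Fin d) →L[ℝ]
          EuclideanSpace ℝ (Fin (d + 1))) = mfderiv (𝓡 d) (𝓡∂ (d + 1)) ψ x := by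
      rintro φ _ rfl
      rfl
    have h3 := key _ _ (funext h).symm
    exact (DFunLike.congr_fun (h3.trans h2) v).trans
      (mfderiv_pullback (I := 𝓡∂ (d + 1)) hq (f x) _)
  have h4 := DFunLike.congr_fun (headL_mfderiv hd') v
  have h5 := DFunLike.congr_fun (tailL_mfderiv (g := F) (fun _ => rfl) hd') v
  constructor
  · refine (congrArg (headL d) h1).symm.trans ?_
    have h6 : mfderiv (𝓡 d) 𝓘(ℝ, ℝ) (fun _ : M => (e : ℝ)) x = 0 := mfderiv_const
    have h7 : (0 : ℝ) = timeSign e * headL d (mfderiv (𝓡 d) (𝓡∂ (d + 1))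
      (fun x => (F x, e) : M → P × Icc (0 : ℝ) 1) x v) :=
      (DFunLike.congr_fun h6 v).symm.trans h4
    rcases mul_eq_zero.mp h7.symm with h8 | h8
    · have := timeSign_mul_self e
      simp [h8] at this
    · exact h8
  · exact (congrArg (tailL d) h1).symm.trans h5

theorem injective_mfderiv_cylinder_end (hF : IsOrientedLocalDiffeo M P F) (hf : Continuous f)
    (h : ∀ x, q (f x) = (F x, e)) (x : M) : Function.Injective
      (mfderiv (𝓡 d) (𝓡∂ (d + 1)) f x) := by
  intro (v : EuclideanSpace ℝ (Fin d)) (w : EuclideanSpace ℝ (Fin d)) hvw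
  refine ((hF.isLocalDiffeomorph x).mfderivToContinuousLinearEquiv (by simp)).injective ?_
  rw [← ContinuousLinearEquiv.coe_coe, IsLocalDiffeomorphAt.mfderivToContinuousLinearEquiv_coe]
  exact (mfderiv_cylinder_end hF hf h x v).2.symm.trans
    ((congrArg (tailL d) hvw).trans (mfderiv_cylinder_end hF hf h x w).2)

/-- An outward vector has negative coordinate of index zero, so putting it in front changes the sign
of the determinant. The sign in `hp` compensates. -/
theorem isPositive_cylinder_end (hF : IsOrientedLocalDiffeo M P F) (hf : Continuous f)
    (h : ∀ x, q (f x) = (F x, e)) (x : M)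
    {p : Orientation ℝ (EuclideanSpace ℝ (Fin (d + 1))) (Fin (d + 1))}
    (hp : orientationSign p = -orientationSign (P.orient (F x)))
    (ν : TangentSpace (𝓡∂ (d + 1)) (f x))
    (hν : IsOutward (P.cylinder.pullback q hq) (f x) ν) (v : Fin d → TangentSpace (𝓡 d) x) :
    IsPositive (M.orient x) v ↔ IsPositive p (Fin.cons ν fun i =>
      mfderiv (𝓡 d) (𝓡∂ (d + 1)) f x (v i)) := by
  have : IsManifold (𝓡∂ (d + 1)) 1 (P.cylinder.pullback q hq) :=
    IsManifold.of_le (n := ∞) (by simp)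
  have hν' : headL d ν < 0 := by
    unfold IsOutward at hν
    rw [mfderiv_extChartAt_self] at hν
    exact hν
  rw [hF.preserves x v]
  refine isPositive_iff.trans (Iff.trans ?_ isPositive_iff.symm)
  have h1 := det_cons (d := d) ν (w := fun i =>
    mfderiv (𝓡 d) (𝓡∂ (d + 1)) f x (v i))
    (fun i => (mfderiv_cylinder_end hF hf h x (v i)).1)
  have h2 := fun i => (mfderiv_cylinder_end hF hf h x (v i)).2
  rw [hp]
  have h3 : (fun i => tailL d (mfderiv (𝓡 d) (𝓡∂ (d + 1))
      f x (v i))) = fun i => mfderiv (𝓡 d) (𝓡 d) F x (v i) :=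
    funext h2
  rw [h3] at h1
  refine Iff.trans ?_ (iff_of_eq (congrArg (fun r => 0 < -orientationSign (P.orient (F x)) * r)
    h1.symm))
  have h4 : ∀ a b c : ℝ, b < 0 → (0 < a * c ↔ 0 < -a * (b * c)) := fun a b c hb => by
    rw [show -a * (b * c) = -b * (a * c) by ring, mul_pos_iff_of_pos_left (neg_pos.mpr hb)]
  exact h4 _ _ _ hν'

/-- Boundary points are those at times `0` and `1`, since `q` is a local diffeomorphism. The
cylinder has the sign of `P` at time `0` and the opposite sign at time `1`, where the chart reverses
time; hence one end occurs with reversed orientation. -/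
theorem isOrientedBoundary_cylinder {N : OrientedManifold.{u} (𝓡 d)} {g : N → P.cylinder.pullback q hq} {G : N → P}
    (hF : IsOrientedLocalDiffeo M P F) (hf : Topology.IsEmbedding f)
    (hqf : ∀ x, q (f x) = (F x, 0)) (hfr : ∀ y, (q y).2 = 0 → y ∈ range f)
    (hG : IsOrientedLocalDiffeo N P G) (hg : Topology.IsEmbedding g)
    (hqg : ∀ x, q (g x) = (G x, 1)) (hgr : ∀ y, (q y).2 = 1 → y ∈ range g) :
    IsOrientedBoundary M N (P.cylinder.pullback q hq) f g where
  contMDiff_left := contMDiff_cylinder_end hF.contMDiff hf.continuous hqf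
  contMDiff_right := contMDiff_cylinder_end hG.contMDiff hg.continuous hqg
  immersion_left := injective_mfderiv_cylinder_end hF hf.continuous hqf
  immersion_right := injective_mfderiv_cylinder_end hG hg.continuous hqg
  embedding := by
    have hc : Continuous fun y => ((q y).2 : ℝ) :=
      continuous_subtype_val.comp (continuous_snd.comp hq.continuous)
    refine Topology.IsEmbedding.sumElim_of_separatedNhds hf hg
      ⟨_, _, isOpen_Iio.preimage hc, isOpen_Ioi.preimage hc, ?_, ?_,
        (disjoint_left.mpr fun a (h1 : a < 1 / 2) (h2 : 1 / 2 < a) => lt_asymm h1 h2).preimage _⟩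
    · rintro _ ⟨x, rfl⟩
      change ((q (f x)).2 : ℝ) < 1 / 2
      rw [hqf]
      norm_num
    · rintro _ ⟨x, rfl⟩
      change 1 / 2 < ((q (g x)).2 : ℝ)
      rw [hqg]
      norm_num
  range_eq := by
    have h1 := (P.cylinder.isOrientedLocalDiffeo_pullback q hq).1.preimage_boundary (by simp)
    rw [← h1]
    ext y
    refine Iff.trans ?_ (boundary_cylinder (q y)).symm
    constructor
    · rintro ⟨x | x, rfl⟩
      · exact Or.inl (congrArg Prod.snd (hqf x))
      · exact Or.inr (congrArg Prod.snd (hqg x))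
    · rintro (h | h)
      · obtain ⟨x, rfl⟩ := hfr y h
        exact ⟨Sum.inl x, rfl⟩
      · obtain ⟨x, rfl⟩ := hgr y h
        exact ⟨Sum.inr x, rfl⟩
  orient_left x ν hν v := by
    refine isPositive_cylinder_end hF hf.continuous hqf x ?_ ν hν v
    refine (orientationSign_neg _).trans (congrArg Neg.neg ?_)
    refine (P.orientationSign_cylinderOrient (q (f x))).trans ?_
    rw [hqf]
    simp [timeSign]
  orient_right x ν hν v := by
    refine isPositive_cylinder_end hG hg.continuous hqg x ?_ ν hν v
    refine (P.orientationSign_cylinderOrient (q (g x))).trans ?_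
    rw [hqg]
    simp [timeSign]

end Boundary

end BranchedResolution

namespace BranchedResolution

open SseGroupoid

/-! ### Products of groupoids with the interval -/

section CylinderGroupoid

variable {d : ℕ}

/-- The product of a groupoid with the interval. -/
noncomputable def SseGroupoid.cylinder (X : SseGroupoid.{u} (𝓡 d)) :
    SseGroupoid.{u} (𝓡∂ (d + 1)) where
  Obj := X.Obj.cylinder
  Mor := X.Mor.cylinder
  src := fun k : X.Mor × Icc (0 : ℝ) 1 => ((X.src k.1, k.2) : X.Obj × Icc (0 : ℝ) 1)
  tgt := fun k : X.Mor × Icc (0 : ℝ) 1 => ((X.tgt k.1, k.2) : X.Obj × Icc (0 : ℝ) 1)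
  one := fun k : X.Obj × Icc (0 : ℝ) 1 => ((X.one k.1, k.2) : X.Mor × Icc (0 : ℝ) 1)
  inv := fun k : X.Mor × Icc (0 : ℝ) 1 => ((X.inv k.1, k.2) : X.Mor × Icc (0 : ℝ) 1)
  comp := fun (δ γ : X.Mor × Icc (0 : ℝ) 1) h =>
    ((X.comp δ.1 γ.1 (congrArg Prod.fst h), γ.2) : X.Mor × Icc (0 : ℝ) 1)
  src_one k := Prod.ext (X.src_one _) rfl
  tgt_one k := Prod.ext (X.tgt_one _) rfl
  src_inv k := Prod.ext (X.src_inv _) rfl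
  tgt_inv k := Prod.ext (X.tgt_inv _) rfl
  src_comp δ γ h := Prod.ext (X.src_comp _ _ _) rfl
  tgt_comp δ γ h := Prod.ext (X.tgt_comp _ _ _) (congrArg Prod.snd h).symm
  one_comp k := Prod.ext (X.one_comp _) rfl
  comp_one k := Prod.ext (X.comp_one _) rfl
  inv_comp k := Prod.ext (X.inv_comp _) rfl
  comp_inv k := Prod.ext (X.comp_inv _) rfl
  assoc ε δ γ h₁ h₂ := Prod.ext (X.assoc _ _ _ _ _) rfl
  src_localDiffeo := X.src_localDiffeo.cylinder
  tgt_localDiffeo := X.tgt_localDiffeo.cylinder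
  one_localDiffeo := X.one_localDiffeo.cylinder
  inv_localDiffeo := X.inv_localDiffeo.cylinder
  continuous_comp := by
    have h1 : Continuous fun p : {p : (X.Mor × Icc (0 : ℝ) 1) × (X.Mor × Icc (0 : ℝ) 1) //
        ((X.src p.1.1, p.1.2) : X.Obj × Icc (0 : ℝ) 1) = (X.tgt p.2.1, p.2.2)} =>
        (⟨(p.1.1.1, p.1.2.1), congrArg Prod.fst p.2⟩ :
          {p : X.Mor × X.Mor // X.src p.1 = X.tgt p.2}) :=
      ((continuous_fst.comp (continuous_fst.comp continuous_subtype_val)).prodMk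
        (continuous_fst.comp (continuous_snd.comp continuous_subtype_val))).subtype_mk _
    exact (X.continuous_comp.comp h1).prodMk
      (continuous_snd.comp (continuous_snd.comp continuous_subtype_val))
  stable := fun x : X.Obj × Icc (0 : ℝ) 1 => by
    refine ((X.stable x.1).prod (finite_singleton x.2)).subset ?_
    rintro ⟨γ, t⟩ ⟨h1, h2⟩
    exact ⟨⟨congrArg Prod.fst h1, congrArg Prod.fst h2⟩, congrArg Prod.snd h1⟩

namespace SseGroupoid

variable {X Y : SseGroupoid.{u} (𝓡 d)}

theorem cylinder_mul {δ γ : X.Mor} {t : Icc (0 : ℝ) 1} (h : X.src δ = X.tgt γ) :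
    X.cylinder.mul (δ, t) (γ, t) = (X.mul δ γ, t) := by
  have h' : X.cylinder.src (δ, t) = X.cylinder.tgt (γ, t) := Prod.ext h rfl
  refine (mul_eq h').trans ?_
  rw [mul_eq h]
  rfl

theorem IsNonsingular.cylinder (hX : X.IsNonsingular) : X.cylinder.IsNonsingular :=
  fun (γ : X.Mor × Icc (0 : ℝ) 1) h => Prod.ext (hX γ.1 (congrArg Prod.fst h)) rfl

theorem IsProper.cylinder (hX : X.IsProper) : X.cylinder.IsProper := by
  have h1 : IsProperMap (fun t : Icc (0 : ℝ) 1 => (t, t)) := by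
    refine Topology.IsClosedEmbedding.isProperMap ?_
    exact (continuous_id.prodMk continuous_id).isClosedEmbedding fun a b h => congrArg Prod.fst h
  have h2 := (Homeomorph.prodProdProdComm X.Obj X.Obj (Icc (0 : ℝ) 1) (Icc (0 : ℝ) 1)).isProperMap.comp
    (IsProperMap.prodMap (show IsProperMap fun γ : X.Mor => (X.src γ, X.tgt γ) from hX) h1)
  exact h2

theorem order_cylinder (x : X.Obj) (t : Icc (0 : ℝ) 1) :
    X.cylinder.order (x, t) = X.order x := by
  have : {γ : X.cylinder.Mor | X.cylinder.src γ = (x, t) ∧ X.cylinder.tgt γ = (x, t)} =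
      (fun γ : X.Mor => ((γ, t) : X.Mor × Icc (0 : ℝ) 1)) ''
        {γ : X.Mor | X.src γ = x ∧ X.tgt γ = x} := by
    ext (γ : X.Mor × Icc (0 : ℝ) 1)
    constructor
    · rintro ⟨h1, h2⟩
      exact ⟨γ.1, ⟨congrArg Prod.fst h1, congrArg Prod.fst h2⟩,
        Prod.ext rfl (congrArg Prod.snd h1).symm⟩
    · rintro ⟨γ, ⟨h1, h2⟩, rfl⟩
      exact ⟨Prod.ext h1 rfl, Prod.ext h2 rfl⟩
  exact (congrArg Set.ncard this).trans
    (Set.ncard_image_of_injective _ fun a b h => congrArg Prod.fst h)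

variable (X) in
/-- The projection of the cylinder. -/
noncomputable def cylinderFst : SmoothFunctor X.cylinder X where
  obj := Prod.fst
  mor := Prod.fst
  contMDiff_obj := contMDiff_cylinder_fst
  contMDiff_mor := contMDiff_cylinder_fst
  src_mor _ := rfl
  tgt_mor _ := rfl
  mor_one _ := rfl
  mor_comp _ _ _ := rfl

/-- The product of a functor with the interval. -/
noncomputable def _root_.BranchedResolution.SmoothFunctor.cylinder (F : SmoothFunctor X Y) :
    SmoothFunctor X.cylinder Y.cylinder where
  obj := fun k : X.Obj × Icc (0 : ℝ) 1 => ((F.obj k.1, k.2) : Y.Obj × Icc (0 : ℝ) 1)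
  mor := fun k : X.Mor × Icc (0 : ℝ) 1 => ((F.mor k.1, k.2) : Y.Mor × Icc (0 : ℝ) 1)
  contMDiff_obj := contMDiffOn_univ.mp (contMDiffOn_cylinder
    (F.contMDiff_obj.comp contMDiff_cylinder_fst).contMDiffOn contMDiff_cylinder_snd.contMDiffOn)
  contMDiff_mor := contMDiffOn_univ.mp (contMDiffOn_cylinder
    (F.contMDiff_mor.comp contMDiff_cylinder_fst).contMDiffOn contMDiff_cylinder_snd.contMDiffOn)
  src_mor _ := Prod.ext (F.src_mor _) rfl
  tgt_mor _ := Prod.ext (F.tgt_mor _) rfl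
  mor_one _ := Prod.ext (F.mor_one _) rfl
  mor_comp _ _ _ := Prod.ext (F.mor_comp _ _ _) rfl

variable (X) in
/-- The time, on the orbit space of the cylinder. -/
noncomputable def time : X.cylinder.Orbit → Icc (0 : ℝ) 1 :=
  Quotient.lift (fun k : X.Obj × Icc (0 : ℝ) 1 => k.2) (by
    rintro a b ⟨γ, rfl, rfl⟩
    rfl)

theorem continuous_time : Continuous X.time :=
  continuous_quot_lift _ continuous_snd

theorem isOpenMap_cylinderFst : IsOpenMap X.cylinderFst.orbitMap := by
  intro U hU
  have : X.cylinderFst.orbitMap '' U =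
      X.proj '' (Prod.fst '' ((X.cylinder.proj ⁻¹' U : Set (X.Obj × Icc (0 : ℝ) 1)))) := by
    ext p
    constructor
    · rintro ⟨q, hq, rfl⟩
      obtain ⟨⟨x, t⟩, rfl⟩ := X.cylinder.isOpenQuotientMap_proj.surjective q
      exact ⟨x, ⟨(x, t), hq, rfl⟩, rfl⟩
    · rintro ⟨_, ⟨⟨x, t⟩, hq, rfl⟩, rfl⟩
      exact ⟨_, hq, rfl⟩
  rw [this]
  exact X.isOpenQuotientMap_proj.isOpenMap _
    (isOpenMap_fst _ (hU.preimage X.cylinder.continuous_proj))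

/-- The product of `|X|` with the interval maps onto the orbit space of the cylinder. The map is
continuous because the product of an open quotient map with the identity is again a quotient map. -/
theorem compactSpace_cylinder_orbit [CompactSpace X.Orbit] : CompactSpace X.cylinder.Orbit := by
  let f : X.Orbit × Icc (0 : ℝ) 1 → X.cylinder.Orbit := fun p =>
    Quotient.lift (fun x : X.Obj => X.cylinder.proj (x, p.2)) (by
      rintro a b ⟨γ, rfl, rfl⟩
      exact X.cylinder.proj_src_eq (γ, p.2)) p.1
  have hf : Continuous f := by
    have h1 : IsOpenQuotientMap (Prod.map X.proj (id : Icc (0 : ℝ) 1 → Icc (0 : ℝ) 1)) :=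
      X.isOpenQuotientMap_proj.prodMap IsOpenQuotientMap.id
    rw [h1.isQuotientMap.continuous_iff]
    exact X.cylinder.continuous_proj
  have hs : Function.Surjective f := by
    intro q
    obtain ⟨⟨x, t⟩, rfl⟩ := X.cylinder.isOpenQuotientMap_proj.surjective q
    exact ⟨(X.proj x, t), rfl⟩
  exact hs.compactSpace hf

end SseGroupoid

end CylinderGroupoid

end BranchedResolution

namespace BranchedResolution

open SseGroupoid

/-! ### Products of layers, frames and sheets with the interval -/

section CylinderLayer

variable {d : ℕ} {Y : SseGroupoid.{u} (𝓡 d)}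

namespace Layer

/-- The product of a layer with the interval. -/
noncomputable def cylinder (L : Layer Y) : Layer Y.cylinder where
  grp := L.grp.cylinder
  nonsingular := L.nonsingular.cylinder
  F := L.F.cylinder
  etale := L.etale.cylinder

variable {L : Layer Y}

theorem germ_cylinder_iff {a b : L.grp.Obj} {g h : Y.Mor} {t : Icc (0 : ℝ) 1} :
    L.cylinder.Germ (a, t) (g, t) (b, t) (h, t) ↔ L.Germ a g b h := by
  constructor
  · rintro ⟨h1, ⟨α, s⟩, h2, h3, h4⟩
    have h1' : Y.src h = L.F.obj b := congrArg Prod.fst h1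
    have h3' : L.grp.tgt α = b := congrArg Prod.fst h3
    obtain rfl : s = t := congrArg Prod.snd h2
    refine ⟨h1', α, congrArg Prod.fst h2, h3', ?_⟩
    have h5 := Y.cylinder_mul (t := s) (h1'.trans (by rw [L.F.tgt_mor, h3']) :
      Y.src h = Y.tgt (L.F.mor α))
    exact congrArg Prod.fst (h4.trans h5)
  · rintro ⟨h1, α, rfl, rfl, rfl⟩
    refine ⟨Prod.ext h1 rfl, ((α, t) : L.grp.Mor × Icc (0 : ℝ) 1), rfl, rfl, ?_⟩
    exact (Y.cylinder_mul (t := t) (h1.trans (L.F.tgt_mor α).symm)).symm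

/-- The product of a frame with the interval. -/
noncomputable def Frame.cylinder {x : Y.Obj} (T : L.Frame x) (t : Icc (0 : ℝ) 1) :
    L.cylinder.Frame ((x, t) : Y.Obj × Icc (0 : ℝ) 1) where
  P := (Prod.fst ⁻¹' T.P : Set (Y.Obj × Icc (0 : ℝ) 1))
  isOpen := T.isOpen.preimage continuous_fst
  mem := T.mem
  S := T.S
  pt s := fun y : Y.Obj × Icc (0 : ℝ) 1 => ((T.pt s y.1, y.2) : L.grp.Obj × Icc (0 : ℝ) 1)
  mor s := fun y : Y.Obj × Icc (0 : ℝ) 1 => ((T.mor s y.1, y.2) : Y.Mor × Icc (0 : ℝ) 1)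
  cont_pt s := ((T.cont_pt s).comp continuousOn_fst fun y hy => hy).prodMk continuousOn_snd
  cont_mor s := ((T.cont_mor s).comp continuousOn_fst fun y hy => hy).prodMk continuousOn_snd
  src_mor s y hy := Prod.ext (T.src_mor s _ hy) rfl
  tgt_mor s y hy := Prod.ext (T.tgt_mor s _ hy) rfl
  cover := by
    rintro ⟨y, r⟩ hy ⟨a, r'⟩ ⟨g, r''⟩ h1 h2
    obtain rfl : r'' = r' := congrArg Prod.snd h1
    obtain rfl : r'' = r := congrArg Prod.snd h2
    obtain ⟨s, hs⟩ := T.cover y hy a g (congrArg Prod.fst h1) (congrArg Prod.fst h2)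
    exact ⟨s, germ_cylinder_iff.mpr hs⟩

/-- The weight on the product with the interval. -/
noncomputable def Weight.cylinder (W : L.Weight) : L.cylinder.Weight where
  gen := Y.cylinderFst.orbitMap ⁻¹' W.gen
  isOpen_gen := W.isOpen_gen.preimage Y.cylinderFst.continuous_orbitMap
  dense_gen := W.dense_gen.preimage Y.isOpenMap_cylinderFst
  wt := fun a : L.grp.Obj × Icc (0 : ℝ) 1 => W.wt a.1
  wt_pos _ := W.wt_pos _
  wt_src _ := W.wt_src _

theorem hOrbitMap_cylinderFst_projH (a : L.grp.Obj) (t : Icc (0 : ℝ) 1) :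
    L.grp.cylinderFst.hOrbitMap (L.cylinder.grp.projH (a, t)) = L.grp.projH a :=
  SmoothFunctor.hOrbitMap_projH _ _

/-- The product of sheets with the interval. -/
noncomputable def Sheets.cylinder {W : L.Weight} {x : Y.Obj} [T2Space Y.cylinder.Orbit]
    (T : Sheets W x) (t : Icc (0 : ℝ) 1) :
    Sheets W.cylinder ((x, t) : Y.Obj × Icc (0 : ℝ) 1) where
  toFrame := T.toFrame.cylinder t
  w := T.w
  isWeight := by
    refine ⟨T.isWeight.pos, ?_⟩
    rintro ⟨y, r⟩ hy hgen ⟨a, r'⟩ ⟨g, r''⟩ h1 h2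
    obtain rfl : r'' = r' := congrArg Prod.snd h1
    obtain rfl : r'' = r := congrArg Prod.snd h2
    refine Eq.trans ?_ (T.isWeight.wt_eq y hy hgen a g (congrArg Prod.fst h1)
      (congrArg Prod.fst h2))
    refine Finset.sum_congr rfl fun s _ => ?_
    congr 1
    ext s
    exact germ_cylinder_iff
  sum_w := T.sum_w
  inj s := by
    rintro ⟨y, r⟩ hy ⟨z, r'⟩ hz h
    have h1 := congrArg L.grp.cylinderFst.hOrbitMap h
    -- The time is recovered from the Hausdorff orbit space through the base, the point of `Y`
    -- through the projection to the original layer.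
    have h2 := congrArg (fun q => Y.time (L.cylinder.base q)) h
    refine Prod.ext (T.inj s hy hz ?_) ?_
    · exact (hOrbitMap_cylinderFst_projH _ _).symm.trans
        (h1.trans (hOrbitMap_cylinderFst_projH _ _))
    · exact (congrArg Y.time (base_projH _)).symm.trans
        (h2.trans (congrArg Y.time (base_projH _)))

end Layer

end CylinderLayer

end BranchedResolution

namespace BranchedResolution

open SseGroupoid

/-! ### Gluings that agree with single layers over invariant open sets -/

section Collar

variable {n : ℕ} {H : Type} [TopologicalSpace H]
  {I : ModelWithCorners ℝ (EuclideanSpace ℝ (Fin n)) H}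

theorem _root_.Topology.IsOpenEmbedding.exists_eq_of_comp {A M B : Type*} [TopologicalSpace A]
    [TopologicalSpace M] [TopologicalSpace B] {e : A → M} (he : Topology.IsOpenEmbedding e)
    {f : M → B} (hf : IsLocalHomeomorph (f ∘ e)) (a : A) :
    ∃ φ : OpenPartialHomeomorph M B, e a ∈ φ.source ∧ f = φ :=
  (hf.isLocalHomeomorphOn.of_comp_right he.isLocalHomeomorph.isLocalHomeomorphOn) (e a)
    ⟨a, mem_univ a, rfl⟩

theorem _root_.Topology.IsOpenEmbedding.eventually_nhds_prod {A M B : Type*} [TopologicalSpace A]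
    [TopologicalSpace M] [TopologicalSpace B] {e : A → M} (he : Topology.IsOpenEmbedding e)
    {a : A} {b : B} {p : M × B → Prop} (h : ∀ᶠ t : A × B in 𝓝 (a, b), p (e t.1, t.2)) :
    ∀ᶠ t in 𝓝 (e a, b), p t := by
  have h1 := (he.prodMap (.id (X := B))).map_nhds_eq (a, b)
  simp only [Prod.map, id] at h1
  rw [← h1]
  exact h

/-- Invariant open subsets `V` and `O i` that cover the objects, such that the layer of index `i`
is the only one over `O i`. -/
structure Collar {Y : SseGroupoid.{u} I} (F : LayerFamily Y) where
  V : Set Y.Obj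
  isOpen_V : IsOpen V
  inv_V : ∀ γ, Y.tgt γ ∈ V → Y.src γ ∈ V
  O : F.ι → Set Y.Obj
  isOpen_O : ∀ i, IsOpen (O i)
  inv_O : ∀ i γ, Y.tgt γ ∈ O i → Y.src γ ∈ O i
  covers : ∀ x, x ∈ V ∨ ∃ i, x ∈ O i
  active : ∀ i, ∀ x ∈ O i, Y.proj x ∈ F.C i
  eq_of_active : ∀ i, ∀ x ∈ O i, ∀ j, Y.proj x ∈ F.C j → j = i

namespace Collar

variable {Y : SseGroupoid.{u} I} {F : LayerFamily Y} (K : Collar F)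

/-- The universal gluing over `V`, and the single layers over the sets `O i`. -/
abbrev Total : Type u :=
  {m : F.Univ // (m.2 : Y.Obj) ∈ K.V} ⊕ Σ i, {a : (F.L i).grp.Obj // (F.L i).F.obj a ∈ K.O i}

/-- The projection. -/
def pr : K.Total → Y.Obj :=
  Sum.elim (fun m => m.1.2) fun a => (F.L a.1).F.obj a.2.1

/-- The components. -/
def comp (j : F.ι) (m : K.Total) (b : (F.L j).grp.Obj) (g : Y.Mor) : Prop :=
  Sum.elim (fun m => F.universal.c j m.1 b g)
    (fun a => ∃ h : a.1 = j, (F.L j).Germ b g (h ▸ a.2.1) (Y.one ((F.L a.1).F.obj a.2.1))) m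

theorem isLocalHomeomorph_pr : IsLocalHomeomorph K.pr := by
  have hV : IsOpen {m : F.Univ | (m.2 : Y.Obj) ∈ K.V} :=
    K.isOpen_V.preimage F.universal.etale.continuous
  rintro (m | ⟨i, a⟩)
  · exact Topology.IsOpenEmbedding.inl.exists_eq_of_comp (f := K.pr)
      (F.universal.etale.comp hV.isOpenEmbedding_subtypeVal.isLocalHomeomorph) m
  · have hO : IsOpen {a | (F.L i).F.obj a ∈ K.O i} :=
      (K.isOpen_O i).preimage (F.L i).etale.continuous
    exact (Topology.IsOpenEmbedding.inr.comp Topology.IsOpenEmbedding.sigmaMk).exists_eq_of_comp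
      (f := K.pr) ((F.L i).etale.isLocalHomeomorph.comp
        hO.isOpenEmbedding_subtypeVal.isLocalHomeomorph) a

instance [Countable F.ι] : SecondCountableTopology K.Total := by
  have : SecondCountableTopology {m : F.Univ // (m.2 : Y.Obj) ∈ K.V} :=
    inferInstanceAs (SecondCountableTopology {m : F.Univ | (m.2 : Y.Obj) ∈ K.V})
  have (i : F.ι) : SecondCountableTopology {a : (F.L i).grp.Obj // (F.L i).F.obj a ∈ K.O i} :=
    inferInstanceAs (SecondCountableTopology {a : (F.L i).grp.Obj | (F.L i).F.obj a ∈ K.O i})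
  infer_instance

/-- The gluing with collars. -/
noncomputable def gluing [Countable F.ι] : Gluing Y where
  toLayerFamily := F
  M := K.Total
  pr := K.pr
  etale := K.isLocalHomeomorph_pr
  c := K.comp
  src_eq := by
    rintro i (m | ⟨i, a⟩) b g h
    · exact F.universal.src_eq h
    · obtain ⟨rfl, h⟩ := h
      exact h.src_left
  tgt_eq := by
    rintro i (m | ⟨i, a⟩) b g h
    · exact F.universal.tgt_eq (m := m.1) h
    · obtain ⟨rfl, h⟩ := h
      exact h.tgt_eq.trans (Y.tgt_one _)
  isOpen := by
    rintro i (m | ⟨i, a⟩) b g h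
    · refine Topology.IsOpenEmbedding.inl.eventually_nhds_prod (p := fun t : K.Total × (F.L i).grp.Obj × Y.Mor => Y.src t.2.2 =
        (F.L i).F.obj t.2.1 → Y.tgt t.2.2 = K.pr t.1 → K.comp i t.1 t.2.1 t.2.2) ?_
      have h1 : Tendsto (fun t : {m : F.Univ // (m.2 : Y.Obj) ∈ K.V} × (F.L i).grp.Obj × Y.Mor =>
          ((t.1 : F.Univ), t.2)) (𝓝 (m, b, g)) (𝓝 ((m : F.Univ), b, g)) :=
        ((continuous_subtype_val.comp continuous_fst).prodMk continuous_snd).tendsto _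
      exact h1.eventually (F.universal.isOpen (m := m.1) h)
    · obtain ⟨rfl, h⟩ := h
      refine (Topology.IsOpenEmbedding.inr.comp
        (Topology.IsOpenEmbedding.sigmaMk (i := i))).eventually_nhds_prod
        (p := fun t : K.Total × (F.L i).grp.Obj × Y.Mor => Y.src t.2.2 =
        (F.L i).F.obj t.2.1 → Y.tgt t.2.2 = K.pr t.1 → K.comp i t.1 t.2.1 t.2.2) ?_
      set l := 𝓝 (a, b, g) ⊓ 𝓟 {t : {a : (F.L i).grp.Obj // (F.L i).F.obj a ∈ K.O i} × (F.L i).grp.Obj × Y.Mor |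
        Y.src t.2.2 = (F.L i).F.obj t.2.1 ∧ Y.tgt t.2.2 = (F.L i).F.obj t.1}
      have hl : ∀ᶠ t in l, Y.src t.2.2 = (F.L i).F.obj t.2.1 ∧ Y.tgt t.2.2 = (F.L i).F.obj t.1 :=
        mem_inf_of_right (mem_principal_self _)
      have t1 : Tendsto (fun t : {a : (F.L i).grp.Obj // (F.L i).F.obj a ∈ K.O i} × (F.L i).grp.Obj × Y.Mor => (t.1 : (F.L i).grp.Obj)) l
          (𝓝 a) :=
        ((continuous_subtype_val.comp continuous_fst).tendsto (a, b, g)).mono_left inf_le_left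
      have t2 : Tendsto (fun t : {a : (F.L i).grp.Obj // (F.L i).F.obj a ∈ K.O i} × (F.L i).grp.Obj × Y.Mor => t.2.1) l (𝓝 b) :=
        ((continuous_fst.comp continuous_snd).tendsto (a, b, g)).mono_left inf_le_left
      have t3 : Tendsto (fun t : {a : (F.L i).grp.Obj // (F.L i).F.obj a ∈ K.O i} × (F.L i).grp.Obj × Y.Mor => t.2.2) l (𝓝 g) :=
        ((continuous_snd.comp continuous_snd).tendsto (a, b, g)).mono_left inf_le_left
      have t4 : Tendsto (fun t : {a : (F.L i).grp.Obj // (F.L i).F.obj a ∈ K.O i} × (F.L i).grp.Obj × Y.Mor => Y.one ((F.L i).F.obj t.1)) l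
          (𝓝 (Y.one ((F.L i).F.obj a))) := (Y.continuous_one.tendsto _).comp (((F.L i).etale.continuous.tendsto _).comp t1)
      have := Layer.Germ.eventually (a := b) (g := g) (b := a.1)
        (h := Y.one ((F.L i).F.obj a)) h t2 t3 t1 t4
        (hl.mono fun t ht => ht.1) (Eventually.of_forall fun t => Y.src_one _)
        (hl.mono fun t ht => ht.2.trans (Y.tgt_one _).symm)
      filter_upwards [eventually_inf_principal.mp this] with t ht h1 h2
      exact ⟨rfl, ht ⟨h1, h2⟩⟩
  germ := by
    rintro i (m | ⟨i, a⟩) b g b' g' h h'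
    · exact F.universal.germ (m := m.1) h h'
    · obtain ⟨rfl, h⟩ := h
      exact ⟨rfl, h'.trans h⟩
  unique := by
    rintro i (m | ⟨i, a⟩) b g b' g' h h'
    · exact F.universal.unique (m := m.1) h h'
    · obtain ⟨rfl, h⟩ := h
      obtain ⟨_, h'⟩ := h'
      exact h.trans h'.symm
  exists_comp := by
    rintro i (m | ⟨j, a⟩) h
    · exact F.universal.exists_comp (m := m.1) h
    · obtain rfl := K.eq_of_active j _ a.2 i h
      exact ⟨a.1, _, rfl, .refl (Y.src_one _)⟩
  surj := by
    intro x b g hs ht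
    rcases K.covers x with hx | ⟨i, hx⟩
    · obtain ⟨m, η, h1, h2, h3⟩ := F.universal.surj x b g hs ht
      exact ⟨Sum.inl ⟨m, (congrArg (· ∈ K.V) h1).mp (K.inv_V η (h2.symm ▸ hx))⟩, η, h1, h2, h3⟩
    · have hi := K.active i x hx
      -- Over `O i` the only component is the one of index `i`; it serves as the object, and its own
      -- morphism as `η`.
      refine ⟨Sum.inr ⟨i, b ⟨i, hi⟩, ?_⟩, g ⟨i, hi⟩, hs _, ht _, ?_⟩
      · rw [← hs ⟨i, hi⟩]
        exact K.inv_O i _ ((ht ⟨i, hi⟩).symm ▸ hx)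
      · rintro ⟨j, hj⟩
        obtain rfl := K.eq_of_active i x hx j hj
        refine ⟨rfl, ?_⟩
        have h : Y.mul (Y.inv (g ⟨j, hj⟩)) (g ⟨j, hj⟩) = Y.one ((F.L j).F.obj (b ⟨j, hj⟩)) := by
          rw [inv_mul, hs ⟨j, hj⟩]
        exact h.symm ▸ .refl (Y.src_one _)

variable [Countable F.ι]

/-- The inclusion of the collar. -/
def incl (i : F.ι) (a : {a : (F.L i).grp.Obj // (F.L i).F.obj a ∈ K.O i}) : K.gluing.M :=
  (Sum.inr ⟨i, a⟩ : K.Total)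

theorem isOpenEmbedding_incl (i : F.ι) : Topology.IsOpenEmbedding (K.incl i) :=
  Topology.IsOpenEmbedding.inr.comp Topology.IsOpenEmbedding.sigmaMk

theorem comp_incl_iff {i : F.ι} {a : {a : (F.L i).grp.Obj // (F.L i).F.obj a ∈ K.O i}}
    {b : (F.L i).grp.Obj} {g : Y.Mor} : K.gluing.c i (K.incl i a) b g ↔
      (F.L i).Germ b g a (Y.one ((F.L i).F.obj a)) :=
  ⟨fun ⟨_, h⟩ => h, fun h => ⟨rfl, h⟩⟩

theorem exists_incl_eq {m : K.Total} (hV : K.pr m ∉ K.V) {i : F.ι}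
    (hi : K.pr m ∈ K.O i) : ∃ a, K.incl i a = m := by
  obtain m | ⟨j, a⟩ := m
  · exact absurd m.2 hV
  · obtain rfl := K.eq_of_active j _ a.2 i (K.active i _ hi)
    exact ⟨a, rfl⟩

/-- Only the layer `i` is active over `O i`, so relations between collar objects are exactly the
germs of that layer. -/
theorem rel_incl_iff {i : F.ι} {a b : {a : (F.L i).grp.Obj // (F.L i).F.obj a ∈ K.O i}}
    {η : Y.Mor} : K.gluing.etaleRel.rel (K.incl i a) η (K.incl i b) ↔
      (F.L i).Germ a η b (Y.one ((F.L i).F.obj b)) := by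
  constructor
  · rintro ⟨h1, h2, h3⟩
    obtain ⟨c, g, hc, hc'⟩ := h3 i (K.active i _ a.2)
    have e1 := K.comp_incl_iff.mp hc
    have h1' : Y.src η = (F.L i).F.obj a := h1
    have e2 := e1.mul_left (k := η) (by rw [e1.tgt_eq, Y.tgt_one, h1'])
    rw [SseGroupoid.mul_one h1'] at e2
    exact e2.symm.trans (K.comp_incl_iff.mp hc')
  · intro h
    refine ⟨h.src_left, h.tgt_eq.trans (Y.tgt_one _), fun j hj => ?_⟩
    obtain rfl := K.eq_of_active i _ a.2 j hj
    refine ⟨a.1, _, K.comp_incl_iff.mpr (.refl (Y.src_one _)), K.comp_incl_iff.mpr ?_⟩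
    rwa [SseGroupoid.mul_one h.src_left]

end Collar

end Collar

end BranchedResolution

namespace BranchedResolution

open SseGroupoid

/-! ### Morphisms of a layer as an embedded space -/

section LayerEmbedding

variable {n : ℕ} {H : Type} [TopologicalSpace H]
  {I : ModelWithCorners ℝ (EuclideanSpace ℝ (Fin n)) H} {Y : SseGroupoid.{u} I}

theorem Layer.etale_mor (L : Layer Y) : IsOrientedLocalDiffeo L.grp.Mor Y.Mor L.F.mor :=
  Y.src_localDiffeo.of_comp L.F.contMDiff_mor.continuous
    ((L.etale.comp L.grp.src_localDiffeo).congr fun α => (L.F.src_mor α).symm)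

/-- A morphism of a layer is determined by its ends, also topologically, once its image is known. -/
theorem Layer.isEmbedding_mor (L : Layer Y) :
    Topology.IsEmbedding fun α : L.grp.Mor => (L.grp.src α, L.F.mor α, L.grp.tgt α) := by
  have hc : Continuous fun α : L.grp.Mor => (L.grp.src α, L.F.mor α, L.grp.tgt α) :=
    L.grp.continuous_src.prodMk (L.F.contMDiff_mor.continuous.prodMk L.grp.continuous_tgt)
  refine ⟨Topology.isInducing_iff_nhds.mpr fun α => le_antisymm (hc.tendsto α).le_comap ?_,
    fun α β h => L.nonsingular.hom_unique (congrArg Prod.fst h)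
      (congrArg (fun t => t.2.2) h)⟩
  set l := comap (fun α : L.grp.Mor => (L.grp.src α, L.F.mor α, L.grp.tgt α))
    (𝓝 (L.grp.src α, L.F.mor α, L.grp.tgt α))
  have t0 : Tendsto (fun α : L.grp.Mor => (L.grp.src α, L.F.mor α, L.grp.tgt α)) l
    (𝓝 (L.grp.src α, L.F.mor α, L.grp.tgt α)) := tendsto_comap
  have t1 : Tendsto L.grp.src l (𝓝 (L.grp.src α)) := (continuous_fst.tendsto _).comp t0
  have t2 : Tendsto L.F.mor l (𝓝 (L.F.mor α)) :=
    ((continuous_fst.comp continuous_snd).tendsto (L.grp.src α, L.F.mor α, L.grp.tgt α)).comp t0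
  have t3 : Tendsto L.grp.tgt l (𝓝 (L.grp.tgt α)) :=
    ((continuous_snd.comp continuous_snd).tendsto (L.grp.src α, L.F.mor α, L.grp.tgt α)).comp t0
  obtain ⟨s, U, hU, hαU, hs, hsU, hsα, -⟩ :=
    exists_section L.grp.src_localDiffeo.isLocalHomeomorph α
  have t4 : Tendsto (fun β => s (L.grp.src β)) l (𝓝 α) := by
    have := (hs.continuousAt (hU.mem_nhds hαU)).tendsto
    rw [hsα] at this
    exact this.comp t1
  have e1 : ∀ᶠ β in l, L.grp.src (s (L.grp.src β)) = L.grp.src β :=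
    (t1.eventually (hU.mem_nhds hαU)).mono fun β hβ => hsU _ hβ
  have e2 : ∀ᶠ β in l, L.F.mor (s (L.grp.src β)) = L.F.mor β :=
    eventually_eq_of_isLocalHomeomorph Y.src_localDiffeo.isLocalHomeomorph
      ((L.F.contMDiff_mor.continuous.tendsto _).comp t4) t2 (e1.mono fun β hβ => by
        rw [L.F.src_mor, L.F.src_mor, hβ])
  have e3 : ∀ᶠ β in l, L.grp.tgt (s (L.grp.src β)) = L.grp.tgt β :=
    eventually_eq_of_isLocalHomeomorph L.etale.isLocalHomeomorph
      ((L.grp.continuous_tgt.tendsto _).comp t4) t3 (e2.mono fun β hβ => by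
        rw [← L.F.tgt_mor, ← L.F.tgt_mor, hβ])
  refine Tendsto.congr' (f₁ := fun β => s (L.grp.src β)) (f₂ := id) ?_ t4
  filter_upwards [e1, e3] with β h1 h2 using L.nonsingular.hom_unique h1 h2

end LayerEmbedding

/-! ### The ends of a collar on a cylinder -/

section CylinderEnds

variable {d : ℕ}

/-- Layers of `Y`, each of them to be used over some part of the product with the interval. -/
structure CylinderFamily (Y : SseGroupoid.{u} (𝓡 d)) where
  ι : Type u
  L : ι → Layer Y
  W : ∀ i, (L i).Weight
  C : ι → Set Y.cylinder.Orbit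
  isClosed : ∀ i, IsClosed (C i)
  locallyFinite : LocallyFinite C
  exists_interior : ∀ p, ∃ i, p ∈ interior (C i)
  sheets : ∀ i x, Nonempty (Layer.Sheets (W i) x)

variable {Y : SseGroupoid.{u} (𝓡 d)} [T2Space Y.cylinder.Orbit]

/-- The family of layers of the product with the interval. -/
noncomputable abbrev CylinderFamily.toLayerFamily (E : CylinderFamily Y) :
    LayerFamily Y.cylinder where
  ι := E.ι
  L i := (E.L i).cylinder
  W i := (E.W i).cylinder
  C := E.C
  isClosed := E.isClosed
  locallyFinite := E.locallyFinite
  exists_interior := E.exists_interior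
  sheets i := fun (x : Y.Obj × Icc (0 : ℝ) 1) _ => (E.sheets i x.1).map fun T => T.cylinder x.2

theorem isEmbedding_slice {A : Type*} [TopologicalSpace A] (e : Icc (0 : ℝ) 1) :
    Topology.IsEmbedding fun a : A => (a, e) :=
  Topology.IsEmbedding.of_leftInverse (f := Prod.fst) (fun _ => rfl) continuous_fst
    (continuous_id.prodMk continuous_const)

namespace Collar

variable {E : CylinderFamily Y} (K : Collar E.toLayerFamily) [Countable E.ι] {i : E.ι}
  {e : Icc (0 : ℝ) 1}

/-- The end at time `e` of the collar. -/
noncomputable def endObj (he : ∀ x : Y.Obj, ((x, e) : Y.Obj × Icc (0 : ℝ) 1) ∈ K.O i) (a : (E.L i).grp.Obj) :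
    K.gluing.M :=
  K.incl i ⟨((a, e) : (E.L i).grp.Obj × Icc (0 : ℝ) 1), he ((E.L i).F.obj a)⟩

variable (he : ∀ x : Y.Obj, ((x, e) : Y.Obj × Icc (0 : ℝ) 1) ∈ K.O i)

theorem isEmbedding_endObj : Topology.IsEmbedding (K.endObj he) :=
  (K.isOpenEmbedding_incl i).isEmbedding.comp
    (Topology.IsEmbedding.subtypeVal.of_comp_iff.mp (isEmbedding_slice (A := (E.L i).grp.Obj) e))

theorem rel_endObj_iff {a b : (E.L i).grp.Obj} {g : Y.Mor} :
    K.gluing.etaleRel.rel (K.endObj he a) ((g, e) : Y.Mor × Icc (0 : ℝ) 1) (K.endObj he b) ↔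
      (E.L i).Germ a g b (Y.one ((E.L i).F.obj b)) :=
  K.rel_incl_iff.trans Layer.germ_cylinder_iff

/-- The morphisms of the end at time `e` of the collar. -/
noncomputable def endMor (α : (E.L i).grp.Mor) : K.gluing.etaleRel.RelMor :=
  ⟨(K.endObj he ((E.L i).grp.src α), ((E.L i).F.mor α, e), K.endObj he ((E.L i).grp.tgt α)),
    (K.rel_endObj_iff he).mpr ⟨Y.src_one _, α, rfl, rfl,
      (SseGroupoid.one_mul ((E.L i).F.tgt_mor α)).symm⟩⟩

theorem isEmbedding_endMor : Topology.IsEmbedding (K.endMor he) := by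
  refine (Topology.IsEmbedding.subtypeVal.of_comp_iff).mp ?_
  exact ((K.isEmbedding_endObj he).prodMap ((isEmbedding_slice (A := Y.Mor) e).prodMap
    (K.isEmbedding_endObj he))).comp (E.L i).isEmbedding_mor

/-- The inclusion of the end at time `e` of the collar. -/
noncomputable def endFunctor : SmoothFunctor (E.L i).grp K.gluing.layer.grp where
  obj := K.endObj he
  mor := K.endMor he
  contMDiff_obj := contMDiff_cylinder_end (P := Y.Obj) (q := K.gluing.pr) (hq := K.gluing.etale)
    (E.L i).etale.contMDiff (K.isEmbedding_endObj he).continuous fun _ => rfl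
  contMDiff_mor := contMDiff_cylinder_end (P := Y.Mor)
    (hq := K.gluing.etaleRel.isLocalHomeomorph_relMor)
    (E.L i).etale_mor.contMDiff (K.isEmbedding_endMor he).continuous fun _ => rfl
  src_mor _ := rfl
  tgt_mor _ := rfl
  mor_one a := K.gluing.layer.nonsingular.hom_unique
    (congrArg (K.endObj he) ((E.L i).grp.src_one a))
    (congrArg (K.endObj he) ((E.L i).grp.tgt_one a))
  mor_comp δ γ h := K.gluing.layer.nonsingular.hom_unique
    (congrArg (K.endObj he) ((E.L i).grp.src_comp δ γ h))
    (congrArg (K.endObj he) ((E.L i).grp.tgt_comp δ γ h))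

/-- At time `e` there are no objects of the universal gluing, because this time avoids `V`. Collar
objects are determined by their `i`-component. -/
theorem mem_range_endObj (hV : ∀ x : Y.Obj, ((x, e) : Y.Obj × Icc (0 : ℝ) 1) ∉ K.V)
    {m : K.gluing.M} (hm : (K.gluing.pr m : Y.Obj × Icc (0 : ℝ) 1).2 = e) :
    m ∈ range (K.endObj he) := by
  have h1 : K.pr m = ((K.pr m : Y.Obj × Icc (0 : ℝ) 1).1, e) := Prod.ext rfl hm
  obtain ⟨⟨a, ha⟩, rfl⟩ := K.exists_incl_eq (m := m) (i := i) (h1 ▸ hV _) (h1 ▸ he _)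
  exact ⟨(a : (E.L i).grp.Obj × Icc (0 : ℝ) 1).1,
    congrArg (K.incl i) (Subtype.ext (Prod.ext rfl hm.symm))⟩

theorem mem_range_endMor (hV : ∀ x : Y.Obj, ((x, e) : Y.Obj × Icc (0 : ℝ) 1) ∉ K.V)
    {γ : K.gluing.etaleRel.RelMor} (hγ : (γ.1.2.1 : Y.Mor × Icc (0 : ℝ) 1).2 = e) :
    γ ∈ range (K.endMor he) := by
  obtain ⟨⟨m, ⟨g, t⟩, m'⟩, hr⟩ := γ
  obtain rfl : t = e := hγ
  obtain ⟨a, rfl⟩ := K.mem_range_endObj he hV (m := m)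
    (congrArg Prod.snd (K.gluing.etaleRel.src_eq hr)).symm
  obtain ⟨b, rfl⟩ := K.mem_range_endObj he hV (m := m')
    (congrArg Prod.snd (K.gluing.etaleRel.tgt_eq hr)).symm
  obtain ⟨h1, α, h2, h3, h4⟩ := (K.rel_endObj_iff he).mp hr
  exact ⟨α, K.gluing.layer.nonsingular.hom_unique (congrArg (K.endObj he) h2)
    (congrArg (K.endObj he) h3)⟩

theorem comp_endObj (a : (E.L i).grp.Obj) :
    K.gluing.c i (K.endObj he a) ((a, e) : (E.L i).grp.Obj × Icc (0 : ℝ) 1)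
      ((Y.one ((E.L i).F.obj a), e) : Y.Mor × Icc (0 : ℝ) 1) :=
  K.comp_incl_iff.mpr (Layer.germ_cylinder_iff.mpr (.refl (Y.src_one _)))

/-- The component map goes back from the glued Hausdorff orbit space to that of the layer times the
interval near time `e`; projecting away the time recovers the orbit of `a`. Hence the end is
embedded injectively. -/
theorem projH_eq_of_comp
    (hC : ∀ x : Y.Obj, Y.cylinder.proj (x, e) ∈ interior (E.C i)) {m : K.gluing.M}
    {a b : (E.L i).grp.Obj} {g : Y.cylinder.Mor} (hm : K.gluing.c i m
      ((b, e) : (E.L i).grp.Obj × Icc (0 : ℝ) 1) g)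
    (h : K.gluing.layer.grp.projH (K.endObj he a) = K.gluing.layer.grp.projH m) :
    (E.L i).grp.projH a = (E.L i).grp.projH b := by
  have := Gluing.projH_comp_eq (G := K.gluing) (i := i) (m := K.endObj he a)
    (hC ((E.L i).F.obj a)) h (K.comp_endObj he a) hm
  exact (Layer.hOrbitMap_cylinderFst_projH _ _).symm.trans
    ((congrArg (E.L i).grp.cylinderFst.hOrbitMap this).trans (Layer.hOrbitMap_cylinderFst_projH _ _))

theorem injective_hOrbitMap_end
    (hC : ∀ x : Y.Obj, Y.cylinder.proj (x, e) ∈ interior (E.C i)) :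
    Function.Injective (K.endFunctor he).hOrbitMap := by
  intro p q h
  obtain ⟨a, rfl⟩ := (E.L i).grp.projH_surjective p
  obtain ⟨b, rfl⟩ := (E.L i).grp.projH_surjective q
  rw [SmoothFunctor.hOrbitMap_projH, SmoothFunctor.hOrbitMap_projH] at h
  exact K.projH_eq_of_comp he hC (K.comp_endObj he b) h

theorem time_hOrbitMap_end (q : (E.L i).grp.HOrbit) :
    Y.time (K.gluing.layer.base ((K.endFunctor he).hOrbitMap q)) = e := by
  obtain ⟨a, rfl⟩ := (E.L i).grp.projH_surjective q
  rw [SmoothFunctor.hOrbitMap_projH]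
  exact congrArg Y.time (Layer.base_projH (L := K.gluing.layer) (K.endObj he a))

end Collar

end CylinderEnds

end BranchedResolution

namespace BranchedResolution

open SseGroupoid

/-! ### Weights at the ends and the cobordism -/

section Cobordism

variable {d : ℕ} {Y : SseGroupoid.{u} (𝓡 d)}

namespace Collar

variable [T2Space Y.cylinder.Orbit] {E : CylinderFamily Y} (K : Collar E.toLayerFamily)
  [Countable E.ι] {i : E.ι} {e : Icc (0 : ℝ) 1}
  (he : ∀ x : Y.Obj, ((x, e) : Y.Obj × Icc (0 : ℝ) 1) ∈ K.O i)

/-- Only the index `i` is active at time `e`, so an object and the collar object with the same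
`i`-component have the same germ. -/
theorem proj_eq_endObj {x : Y.Obj} {m : K.gluing.M} {η : Y.cylinder.Mor}
    (h1 : Y.cylinder.src η = K.gluing.pr m)
    (h2 : Y.cylinder.tgt η = ((x, e) : Y.Obj × Icc (0 : ℝ) 1)) {b : (E.L i).grp.Obj} {g : Y.Mor}
    (h3 : Y.src g = (E.L i).F.obj b) (h4 : Y.tgt g = x)
    (hc : K.gluing.c i m ((b, e) : (E.L i).grp.Obj × Icc (0 : ℝ) 1)
      (Y.cylinder.mul (Y.cylinder.inv η) ((g, e) : Y.Mor × Icc (0 : ℝ) 1))) :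
    K.gluing.layer.grp.proj m = K.gluing.layer.grp.proj (K.endObj he b) := by
  have h5 : Y.cylinder.tgt ((g, e) : Y.Mor × Icc (0 : ℝ) 1) = Y.cylinder.tgt η :=
    (Prod.ext h4 rfl : ((Y.tgt g, e) : Y.Obj × Icc (0 : ℝ) 1) = (x, e)).trans h2.symm
  refine (Gluing.germ_of_forall (G := K.gluing) (m' := K.endObj he b)
    (η' := ((g, e) : Y.Mor × Icc (0 : ℝ) 1)) h1 (Prod.ext h3 rfl) h5.symm fun j hj => ?_).proj_eq
  have h6 : Y.cylinder.proj (K.gluing.pr m) = Y.cylinder.proj ((x, e) : Y.Obj × Icc (0 : ℝ) 1) := by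
    rw [← h1, ← h2, Y.cylinder.proj_src_eq]
  obtain rfl : j = i := K.eq_of_active i _ (he x) j
    (show Y.cylinder.proj ((x, e) : Y.Obj × Icc (0 : ℝ) 1) ∈ E.C j from h6 ▸ hj)
  refine ⟨_, _, h5, hc, ?_⟩
  have h7 : Y.cylinder.mul (Y.cylinder.inv ((g, e) : Y.Mor × Icc (0 : ℝ) 1))
      ((g, e) : Y.Mor × Icc (0 : ℝ) 1) = ((Y.one ((E.L j).F.obj b), e) : Y.Mor × Icc (0 : ℝ) 1) :=
    (SseGroupoid.inv_mul _).trans (Prod.ext (congrArg Y.one h3) rfl)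
  exact h7.symm ▸ K.comp_endObj he b

/-- The weight of the glued layer restricts to the weights of the ends of the collars. -/
theorem weight_hOrbitMap_end (hC : ∀ x : Y.Obj, Y.cylinder.proj (x, e) ∈ interior (E.C i))
    [T2Space Y.Orbit] {κ : Y.Orbit → ℝ} {Λ : K.gluing.layer.grp.HOrbit → ℝ}
    (hΛ : Layer.IsInduced K.gluing.weight (κ ∘ Y.cylinderFst.orbitMap) Λ)
    {Λ' : (E.L i).grp.HOrbit → ℝ} (hΛ' : Layer.IsInduced (E.W i) κ Λ') (q : (E.L i).grp.HOrbit) :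
    Λ ((K.endFunctor he).hOrbitMap q) = Λ' q := by
  classical
  obtain ⟨a, rfl⟩ := (E.L i).grp.projH_surjective q
  rw [SmoothFunctor.hOrbitMap_projH]
  set x := (E.L i).F.obj a
  let x' : Y.cylinder.Obj := ((x, e) : Y.Obj × Icc (0 : ℝ) 1)
  have hi : Y.cylinder.proj x' ∈ E.C i := interior_subset (hC x)
  let T := fun j : E.ι => (E.sheets j x).some
  obtain ⟨R, ε, hw, hR⟩ := Gluing.exists_sheets (G := K.gluing) x' fun j => (T j.1).cylinder e
  -- A tuple of sheets passes through the image of `a` exactly if its `i`-th sheet passes through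
  -- `a`. The weights of such tuples then add up to those of the `i`-th sheets.
  have key : ∀ σ, K.gluing.layer.grp.projH (R.pt σ x') = K.gluing.layer.grp.projH (K.endObj he a) ↔
      (E.L i).grp.projH ((T i).pt (ε σ ⟨i, hi⟩) x) = (E.L i).grp.projH a := by
    intro σ
    constructor
    · exact fun h => (K.projH_eq_of_comp he hC (hR σ ⟨i, hi⟩) h.symm).symm
    · intro h
      have h1 : K.gluing.layer.grp.projH (R.pt σ x') =
          K.gluing.layer.grp.projH (K.endObj he ((T i).pt (ε σ ⟨i, hi⟩) x)) :=
        congrArg T2Quotient.mk (K.proj_eq_endObj he (R.src_mor σ x' R.mem) (R.tgt_mor σ x' R.mem)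
          ((T i).src_mor _ x (T i).mem) ((T i).tgt_mor _ x (T i).mem) (hR σ ⟨i, hi⟩))
      refine h1.trans ?_
      have h2 := congrArg (K.endFunctor he).hOrbitMap h
      rwa [SmoothFunctor.hOrbitMap_projH, SmoothFunctor.hOrbitMap_projH] at h2
  have h1 := hΛ x' R (K.gluing.layer.grp.projH (K.endObj he a))
    (Layer.base_projH (L := K.gluing.layer) (K.endObj he a))
  have h2 := hΛ' x (T i) ((E.L i).grp.projH a) (Layer.base_projH a)
  refine h1.trans (Eq.trans ?_ h2.symm)
  have h3 : (Y.cylinder.order x' : ℝ) = Y.order x := congrArg _ (order_cylinder x e)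
  rw [h3]
  change κ (Y.proj x) / _ * _ = _
  congr 1
  let f : (T i).S → ℝ :=
    {s | (E.L i).grp.projH ((T i).pt s x) = (E.L i).grp.projH a}.indicator fun _ => 1
  have h4 : ∀ σ, {s | K.gluing.layer.grp.projH (R.pt s x') =
      K.gluing.layer.grp.projH (K.endObj he a)}.indicator R.w σ =
      f (ε σ ⟨i, hi⟩) * ∏ j : {j // Y.cylinder.proj x' ∈ K.gluing.C j}, (T j.1).w (ε σ j) := by
    intro σ
    by_cases h : K.gluing.layer.grp.projH (R.pt σ x') = K.gluing.layer.grp.projH (K.endObj he a)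
    · rw [indicator_of_mem (by exact h), show f (ε σ ⟨i, hi⟩) = 1 from
        indicator_of_mem (by exact (key σ).mp h) _, _root_.one_mul]
      exact hw σ
    · rw [indicator_of_notMem (by exact h), show f (ε σ ⟨i, hi⟩) = 0 from
        indicator_of_notMem (s := {s | (E.L i).grp.projH ((T i).pt s x) = (E.L i).grp.projH a})
          (fun h' => h ((key σ).mpr h')) _, zero_mul]
  refine (Finset.sum_congr rfl fun σ _ => h4 σ).trans ?_
  refine (ε.sum_comp fun τ => f (τ ⟨i, hi⟩) *
    ∏ j : {j // Y.cylinder.proj x' ∈ K.gluing.C j}, (T j.1).w (τ j)).trans ?_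
  refine (sum_mul_prod_eq (fun j : {j // Y.cylinder.proj x' ∈ K.gluing.C j} => (T j.1).w)
    (fun j => (T j.1).sum_w) ⟨i, hi⟩ f).trans (Finset.sum_congr rfl fun s _ => ?_)
  by_cases hs : s ∈ {s | (E.L i).grp.projH ((T i).pt s x) = (E.L i).grp.projH a}
  · rw [show f s = 1 from indicator_of_mem hs _, indicator_of_mem hs, _root_.one_mul]
  · rw [show f s = 0 from indicator_of_notMem hs _, indicator_of_notMem hs, zero_mul]

end Collar

/-- Weighted nonsingular branched groupoids over a compact `Y` whose weights are induced are
cobordant. -/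
theorem cobordant_of_isInduced [T2Space Y.Orbit] (hY : Y.IsProper) [CompactSpace Y.Orbit] {κ : Y.Orbit → ℝ}
    (hκ : ∀ p, 0 < κ p) (hκ' : IsLocallyConstant κ)
    {A C : WnbGroupoid.{u} (𝓡 d)} {F : SmoothFunctor A.toSseGroupoid Y}
    {hF : IsOrientedLocalDiffeo A.Obj Y.Obj F.obj} {G : SmoothFunctor C.toSseGroupoid Y}
    {hG : IsOrientedLocalDiffeo C.Obj Y.Obj G.obj} {V : (A.layer F hF).Weight}
    (hV : ∀ x, Nonempty (Layer.Sheets V x)) (hA : Layer.IsInduced V κ A.Λ)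
    {W : (C.layer G hG).Weight}
    (hW : ∀ x, Nonempty (Layer.Sheets W x)) (hC : Layer.IsInduced W κ C.Λ) :
    Cobordant A C := by
  have : T2Space Y.cylinder.Orbit := hY.cylinder.t2Space
  have : CompactSpace Y.cylinder.Orbit := compactSpace_cylinder_orbit
  have cA : CompactSpace A.HOrbit :=
    ⟨(Layer.isProperMap_base (L := A.layer F hF) hY
      fun x => ⟨(hV x).some.toFrame⟩).isCompact_preimage isCompact_univ⟩
  have cC : CompactSpace C.HOrbit :=
    ⟨(Layer.isProperMap_base (L := C.layer G hG) hY
      fun x => ⟨(hW x).some.toFrame⟩).isCompact_preimage isCompact_univ⟩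
  have ht : Continuous fun p => (Y.time p : ℝ) := continuous_subtype_val.comp continuous_time
  have hs : Continuous fun k : Y.Obj × Icc (0 : ℝ) 1 => (k.2 : ℝ) :=
    continuous_subtype_val.comp continuous_snd
  -- Both layers are active on the middle third, where the gluing is a fibre product. The interiors
  -- of the two sets still cover all times, and a single layer remains on each outer third.
  let D : ULift.{u} Bool → Set Y.cylinder.Orbit := fun i => match i with
    | ⟨false⟩ => {p | (Y.time p : ℝ) ≤ 2 / 3}
    | ⟨true⟩ => {p | 1 / 3 ≤ (Y.time p : ℝ)}
  have i0 : ∀ p, (Y.time p : ℝ) < 2 / 3 → p ∈ interior (D ⟨false⟩) := fun p hp =>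
    interior_maximal (fun q (hq : (Y.time q : ℝ) < 2 / 3) => hq.le) (isOpen_Iio.preimage ht) hp
  have i1 : ∀ p, 1 / 3 < (Y.time p : ℝ) → p ∈ interior (D ⟨true⟩) := fun p hp =>
    interior_maximal (fun q (hq : 1 / 3 < (Y.time q : ℝ)) => hq.le) (isOpen_Ioi.preimage ht) hp
  let E : CylinderFamily Y :=
    { ι := ULift Bool
      L := fun i => match i with
        | ⟨false⟩ => A.layer F hF
        | ⟨true⟩ => C.layer G hG
      W := fun i => match i with
        | ⟨false⟩ => V
        | ⟨true⟩ => W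
      C := D
      isClosed := fun i => match i with
        | ⟨false⟩ => isClosed_Iic.preimage ht
        | ⟨true⟩ => isClosed_Ici.preimage ht
      locallyFinite := locallyFinite_of_finite _
      exists_interior := fun p => by
        rcases lt_or_ge (Y.time p : ℝ) (2 / 3) with h | h
        · exact ⟨⟨false⟩, i0 p h⟩
        · exact ⟨⟨true⟩, i1 p (by linarith)⟩
      sheets := fun i x => match i with
        | ⟨false⟩ => hV x
        | ⟨true⟩ => hW x }
  have : Countable E.ι := inferInstanceAs (Countable (ULift Bool))
  -- The universal gluing is used over the open interval only. The times `0` and `1` are thus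
  -- covered by the collars alone, and the boundary consists of the given groupoids rather than of
  -- copies of their sheets.
  let K : Collar E.toLayerFamily :=
    { V := {k : Y.Obj × Icc (0 : ℝ) 1 | 0 < (k.2 : ℝ) ∧ (k.2 : ℝ) < 1}
      isOpen_V := (isOpen_Ioo (a := (0 : ℝ)) (b := 1)).preimage hs
      inv_V := fun _ h => h
      O := fun i => match i with
        | ⟨false⟩ => {k : Y.Obj × Icc (0 : ℝ) 1 | (k.2 : ℝ) < 1 / 3}
        | ⟨true⟩ => {k : Y.Obj × Icc (0 : ℝ) 1 | 2 / 3 < (k.2 : ℝ)}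
      isOpen_O := fun i => match i with
        | ⟨false⟩ => isOpen_Iio.preimage hs
        | ⟨true⟩ => isOpen_Ioi.preimage hs
      inv_O := fun i => match i with
        | ⟨false⟩ => fun _ h => h
        | ⟨true⟩ => fun _ h => h
      covers := fun (k : Y.Obj × Icc (0 : ℝ) 1) => by
        by_cases h : 0 < (k.2 : ℝ) ∧ (k.2 : ℝ) < 1
        · exact .inl h
        rcases lt_or_ge (k.2 : ℝ) (1 / 3) with h0 | h0
        · exact .inr ⟨⟨false⟩, h0⟩
        · refine .inr ⟨⟨true⟩, show 2 / 3 < (k.2 : ℝ) from ?_⟩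
          by_contra h1
          exact h ⟨by linarith, by linarith⟩
      active := fun i => match i with
        | ⟨false⟩ => fun (k : Y.Obj × Icc (0 : ℝ) 1) (h : (k.2 : ℝ) < 1 / 3) =>
          show (k.2 : ℝ) ≤ 2 / 3 by linarith
        | ⟨true⟩ => fun (k : Y.Obj × Icc (0 : ℝ) 1) (h : 2 / 3 < (k.2 : ℝ)) =>
          show 1 / 3 ≤ (k.2 : ℝ) by linarith
      eq_of_active := fun i => match i with
        | ⟨false⟩ => fun (k : Y.Obj × Icc (0 : ℝ) 1) (h : (k.2 : ℝ) < 1 / 3) j => match j with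
          | ⟨false⟩ => fun _ => rfl
          | ⟨true⟩ => fun (h' : 1 / 3 ≤ (k.2 : ℝ)) => absurd h (not_lt.mpr h')
        | ⟨true⟩ => fun (k : Y.Obj × Icc (0 : ℝ) 1) (h : 2 / 3 < (k.2 : ℝ)) j => match j with
          | ⟨false⟩ => fun (h' : (k.2 : ℝ) ≤ 2 / 3) => absurd h (not_lt.mpr h')
          | ⟨true⟩ => fun _ => rfl }
  have he0 : ∀ x : Y.Obj, ((x, 0) : Y.Obj × Icc (0 : ℝ) 1) ∈ K.O ⟨false⟩ := fun _ =>
    show ((0 : Icc (0 : ℝ) 1) : ℝ) < 1 / 3 by norm_num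
  have he1 : ∀ x : Y.Obj, ((x, 1) : Y.Obj × Icc (0 : ℝ) 1) ∈ K.O ⟨true⟩ := fun _ =>
    show 2 / 3 < ((1 : Icc (0 : ℝ) 1) : ℝ) by norm_num
  have hV0 : ∀ x : Y.Obj, ((x, 0) : Y.Obj × Icc (0 : ℝ) 1) ∉ K.V := fun _ h =>
    lt_irrefl (0 : ℝ) h.1
  have hV1 : ∀ x : Y.Obj, ((x, 1) : Y.Obj × Icc (0 : ℝ) 1) ∉ K.V := fun _ h =>
    lt_irrefl (1 : ℝ) h.2
  have hC0 : ∀ x : Y.Obj, Y.cylinder.proj ((x, 0) : Y.Obj × Icc (0 : ℝ) 1) ∈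
      interior (E.C ⟨false⟩) := fun x =>
    i0 _ (show ((0 : Icc (0 : ℝ) 1) : ℝ) < 2 / 3 by norm_num)
  have hC1 : ∀ x : Y.Obj, Y.cylinder.proj ((x, 1) : Y.Obj × Icc (0 : ℝ) 1) ∈
      interior (E.C ⟨true⟩) := fun x =>
    i1 _ (show 1 / 3 < ((1 : Icc (0 : ℝ) 1) : ℝ) by norm_num)
  obtain ⟨Λ, hΛ⟩ := Layer.exists_isInduced K.gluing.weight K.gluing.nonempty_sheets
    (κ ∘ Y.cylinderFst.orbitMap)
  let j : SmoothFunctor A.toSseGroupoid K.gluing.layer.grp := K.endFunctor (i := ⟨false⟩) he0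
  let k : SmoothFunctor C.toSseGroupoid K.gluing.layer.grp := K.endFunctor (i := ⟨true⟩) he1
  refine ⟨cA, cC, K.gluing.layer.wnb hY.cylinder K.gluing.nonempty_sheets (fun p => hκ _)
    (hκ'.comp_continuous Y.cylinderFst.continuous_orbitMap) hΛ, j, k, ?_, ?_, ?_, ?_, ?_, ?_⟩
  · exact ⟨(Layer.isProperMap_base hY.cylinder
      fun x => ⟨(K.gluing.nonempty_sheets x).some.toFrame⟩).isCompact_preimage isCompact_univ⟩
  · exact isOrientedBoundary_cylinder (P := Y.Obj) (q := K.gluing.pr) (hq := K.gluing.etale)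
      hF (K.isEmbedding_endObj (i := ⟨false⟩) he0) (fun _ => rfl)
      (fun m => K.mem_range_endObj (i := ⟨false⟩) he0 hV0)
      hG (K.isEmbedding_endObj (i := ⟨true⟩) he1) (fun _ => rfl)
      (fun m => K.mem_range_endObj (i := ⟨true⟩) he1 hV1)
  · exact isOrientedBoundary_cylinder (P := Y.Mor) (hq := K.gluing.etaleRel.isLocalHomeomorph_relMor)
      (A.layer F hF).etale_mor (K.isEmbedding_endMor (i := ⟨false⟩) he0) (fun _ => rfl)
      (fun m => K.mem_range_endMor (i := ⟨false⟩) he0 hV0)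
      (C.layer G hG).etale_mor (K.isEmbedding_endMor (i := ⟨true⟩) he1) (fun _ => rfl)
      (fun m => K.mem_range_endMor (i := ⟨true⟩) he1 hV1)
  -- The source is compact and the target Hausdorff, so injectivity suffices. Each end is injective
  -- by its component map, and the two ends are told apart by the time.
  · refine Topology.IsClosedEmbedding.isEmbedding (Continuous.isClosedEmbedding
      (j.continuous_hOrbitMap.sumElim k.continuous_hOrbitMap) ?_)
    refine Function.Injective.sumElim (K.injective_hOrbitMap_end (i := ⟨false⟩) he0 hC0)
      (K.injective_hOrbitMap_end (i := ⟨true⟩) he1 hC1) fun p q h => ?_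
    have h1 := (K.time_hOrbitMap_end (i := ⟨false⟩) he0 p).symm.trans
      ((congrArg (fun r => Y.time (K.gluing.layer.base r)) h).trans
        (K.time_hOrbitMap_end (i := ⟨true⟩) he1 q))
    exact zero_ne_one h1
  · exact K.weight_hOrbitMap_end (i := ⟨false⟩) he0 hC0 hΛ hA
  · exact K.weight_hOrbitMap_end (i := ⟨true⟩) he1 hC1 hΛ hC

theorem IsResolution.cobordant {X : EpGroupoid.{u} d} {A C : WnbGroupoid.{u} (𝓡 d)}
    {F : SmoothFunctor A.toSseGroupoid X.toSseGroupoid} (hF : IsResolution A X F)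
    {G : SmoothFunctor C.toSseGroupoid X.toSseGroupoid} (hG : IsResolution C X G)
    (hX : CompactSpace X.Orbit) : Cobordant A C := by
  obtain ⟨V, hV, hA⟩ := hF.exists_weight
  obtain ⟨W, hW, hC⟩ := hG.exists_weight
  have : T2Space X.Orbit := IsProper.t2Space X.proper
  exact cobordant_of_isInduced X.proper kerOrbit_pos
    (IsProper.isLocallyConstant_kerOrbit X.proper) hV hA hW hC

end Cobordism

end BranchedResolution

end

open BranchedResolution in
theorem proposition3p18 (d : ℕ) (X : EpGroupoid.{u} d) :
    (∃ (B : WnbGroupoid.{u} (𝓡 d)) (F : SmoothFunctor B.toSseGroupoid X.toSseGroupoid),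
      IsResolution B X F) ∧
    (∀ (A C : WnbGroupoid.{u} (𝓡 d))
      (F : SmoothFunctor A.toSseGroupoid X.toSseGroupoid)
      (G : SmoothFunctor C.toSseGroupoid X.toSseGroupoid),
      IsResolution A X F → IsResolution C X G →
        Commensurate A C ∧ (CompactSpace X.Orbit → Cobordant A C)) := by
  exact ⟨exists_isResolution X, fun A C F G hF hG =>
    ⟨hF.commensurate hG, hF.cobordant hG⟩⟩
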